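/- **Setting.** Let $\Omega\subset\mathbb C$ be a bounded open set, $\Omega_0$ a measurable set with $\overline{\Omega_0}\subset\Omega$, $z_0\in\partial\Omega$ and $n\ge 1$. For real-valued $\mu\in L^\infty(\Omega_0)$ (extended by $0$) and $k\in\mathbb C$ put $e_k(z)=e^{i(kz+\bar k\bar z)}$, $\nu=e_{-k}\mu$, $\alpha=-i\bar k e_{-k}\mu$, $\rho f=\bar f$, $$Pf(z)=-\frac1\pi\int_{\mathbb C}\frac{f(w)}{w-z}\,d^2w,\qquad Sf(z)=-\frac1\pi\,\mathrm{p.v.}\!\int_{\mathbb C}\frac{f(w)}{(w-z)^2}\,d^2w,\qquad A=-\bar\alpha P-\bar\nu S .$$ Let $U_k(\mu)=u\in L^2(\Omega)$ be the unique solution of $(I+A\rho)u=-\bar\alpha$ in $\Omega$ ($u$ extended by $0$ outside $\Omega$), and define the $n$-th Born term by $$\omega_n(z,k)=-P\rho\Big(\tfrac1{n!}D^nU_k|_{0}(\mu,\dots,\mu)\Big)(z).$$ Write $\mathbb S^1=\mathbb R/2\pi\mathbb Z$ with angle $\varphi$ (distributions, wave front sets and submanifolds on $\mathbb R\times\mathbb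 S^1\times\mathbb C^n$ are described on the cover $\mathbb R\times\mathbb R\times\mathbb C^n$, $2\pi$-periodically in $\varphi$), and $\Psi(\varphi,z)=2\,\mathrm{Re}\big(e^{i\varphi}\sum_{j=1}^n(-1)^jz_j\big)$. For $A\subset\{1,\dots,n-1\}$ let $p_A=n-|A|$, $\epsilon_j=1$ if $j\in A$ and $\epsilon_j=0$ otherwise, $d_j=z_{j+1}-z_j$ for $j$ even, $d_j=\overline{z_{j+1}-z_j}$ for $j$ odd. Let $$K_n^{z_0}(t,e^{i\varphi};z)=2\pi\Big(-\frac1\pi\Big)^n\sum_{A}\ \prod_{j\in\{1,\dots,n\}\setminus A}(-1)^je^{i(-1)^j\varphi}\cdot\frac{(-1)^{p_A}\,\delta^{(p_A)}\big(t-\Psi(\varphi,z)\big)}{(z_1-z_0)\prod_{j=1}^{n-1}d_j^{\,1+\epsilon_j}},$$ understood as a principal value: the limit as $\delta\to0^+$ of its restrictions to $\{|z_j-z_{j+1}|>\delta,\ 1\le j\le n-1\}$. **Theorem.** 1. For each $k$, the equation $(I+A\rho)u=-\bar\alpha$ has exactly one solution in $L^2(\Omega)$ for all $\mu$ near $0$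 in $L^\infty(\Omega_0)$, $U_k$ is $C^\infty$ at $\mu=0$, and $\frac1{n!}D^nU_k|_0(\mu,\dots,\mu)=u_n$, where $u_1=-\bar\alpha$ and $u_{j+1}=-A\overline{u_j}$. The function $k\mapsto\omega_n(z_0,k)$ is continuous and $O((1+|k|)^n)$. 2. There is an $n$-linear operator $T_n^{z_0}$ on $L^\infty(\Omega_0;\mathbb C)^n$ with values in $\mathcal D'(\mathbb R\times\mathbb S^1)$, $$T_n^{z_0}(\mu_1\otimes\cdots\otimes\mu_n)(t,e^{i\varphi})=\int_{\mathbb C^n}K_n^{z_0}(t,e^{i\varphi};z_1,\dots,z_n)\,\mu_1(z_1)\cdots\mu_n(z_n)\,d^2z_1\cdots d^2z_n$$ (again as the limit of the truncated integrals), and for all real $\mu\in L^\infty(\Omega_0)$ the partial Fourier transform $\int e^{-it\tau}\,\omega_n(z_0,\tau e^{i\varphi})\,d\tau$, in the sense of distributions in $(t,e^{i\varphi})$, equals $T_n^{z_0}(\mu\otimes\cdots\otimes\mu)$. 3. $K_n^{z_0}$ is a well-defined distribution on $\mathbb R\times\mathbb S^1\times\mathbb C^n$, and over $\{z_1\ne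 z_0\}$ (which contains all $z\in\Omega^n$) its wave front set is contained in $\bigcup_JN^*L_n^J$, where $J$ runs over the subsets of $\{1,\dots,n-1\}$ and $$L_n^J=\Big\{t-2\,\mathrm{Re}\Big(e^{i\varphi}\sum_{j=1}^n(-1)^jz_j\Big)=0\Big\}\cap\bigcap_{j\in J}\{z_j=z_{j+1}\}.$$ 4. Each $L_n^J$ is a smooth submanifold of codimension $1+2|J|$; the $N^*L_n^J$ (conormal bundles without zero section) are $2^{n-1}$ distinct Lagrangian manifolds, and they intersect pairwise cleanly. -/

import Mathlib

open MeasureTheory Filter Topology TopologicalSpace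
open scoped ContDiff Distributions ComplexConjugate

noncomputable section

/-! ### Distributions, wave front sets, conormal bundles -/

section Microlocal

variable {E : Type*} [NormedAddCommGroup E] [NormedSpace ℝ E]

/-- Complex distributions on a (finite-dimensional) real vector space `E`: continuous linear
functionals on the space of smooth compactly supported functions with its LF topology. -/
abbrev ComplexDistribution (E : Type*) [NormedAddCommGroup E] [NormedSpace ℝ E] : Type _ :=
  𝓓((⊤ : Opens E), ℂ) →L[ℂ] ℂ

/-- The test function `y ↦ χ(y) exp(-i η(y))`, for a covector `η`. -/
def modulate (χ : 𝓓((⊤ : Opens E), ℂ)) (η : E →L[ℝ] ℝ) : 𝓓((⊤ : Opens E), ℂ) where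
  toFun y := χ y * Complex.exp (-Complex.I * (η y : ℂ))
  contDiff' := by
    have h : ContDiff ℝ ∞ (fun y : E => Complex.exp (-Complex.I * (η y : ℂ))) :=
      (contDiff_const.mul (Complex.ofRealCLM.contDiff.comp η.contDiff)).cexp
    exact χ.contDiff.mul h
  hasCompactSupport' := χ.hasCompactSupport.mul_right
  tsupport_subset' := fun _ _ => trivial

/-- The test function `y ↦ ψ(y + h)`. -/
def shiftTest [FiniteDimensional ℝ E] (h : E) (ψ : 𝓓((⊤ : Opens E), ℂ)) :
    𝓓((⊤ : Opens E), ℂ) where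
  toFun y := ψ (y + h)
  contDiff' := ψ.contDiff.comp (contDiff_id.add contDiff_const)
  hasCompactSupport' := ψ.hasCompactSupport.comp_homeomorph (Homeomorph.addRight h)
  tsupport_subset' := fun _ _ => trivial

/-- Invariance of a distribution under the translation by `h`. -/
def IsPeriodicDistribution [FiniteDimensional ℝ E] (u : ComplexDistribution E) (h : E) : Prop :=
  ∀ ψ : 𝓓((⊤ : Opens E), ℂ), u (shiftTest h ψ) = u ψ

/-- `u` is microlocally smooth at `(x, ξ)`: for some cut-off `χ` with `χ(x) ≠ 0`, the Fourier
transform of `χ u` is rapidly decreasing in an open cone around `ξ`. -/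
def MicrolocallySmoothAt (u : ComplexDistribution E) (x : E) (ξ : E →L[ℝ] ℝ) : Prop :=
  ∃ χ : 𝓓((⊤ : Opens E), ℂ), χ x ≠ 0 ∧ ∃ V ∈ 𝓝 ξ, ∀ N : ℕ, ∃ C : ℝ,
    ∀ η ∈ V, ∀ s : ℝ, 1 ≤ s → ‖u (modulate χ (s • η))‖ ≤ C * s⁻¹ ^ N

/-- The wave front set, a subset of the cotangent bundle `T^*E = E × E^*` minus its zero
section. -/
def waveFrontSet (u : ComplexDistribution E) : Set (E × (E →L[ℝ] ℝ)) :=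
  {p | p.2 ≠ 0 ∧ ¬ MicrolocallySmoothAt u p.1 p.2}

/-- Embedded smooth submanifolds of codimension `c`: near each of its points, `S` is
straightened to a linear subspace of codimension `c` by a smooth diffeomorphism between open
sets. -/
def IsSmoothSubmanifold (S : Set E) (c : ℕ) : Prop :=
  ∀ p ∈ S, ∃ e : OpenPartialHomeomorph E E, p ∈ e.source ∧
    ContDiffOn ℝ ∞ e e.source ∧ ContDiffOn ℝ ∞ e.symm e.target ∧
    ∃ V : Submodule ℝ E, Module.finrank ℝ V + c = Module.finrank ℝ E ∧
      ∀ y ∈ e.source, y ∈ S ↔ e y ∈ V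

/-- Tangent vectors to `S` at `p`: velocities at `p` of smooth curves in `S`. -/
def tangentSet (S : Set E) (p : E) : Set E :=
  {v | ∃ γ : ℝ → E, ContDiff ℝ ∞ γ ∧ γ 0 = p ∧ (∀ᶠ s in 𝓝 0, γ s ∈ S) ∧ HasDerivAt γ v 0}

/-- The conormal bundle `N^*L`, without its zero section. -/
def conormalBundle (L : Set E) : Set (E × (E →L[ℝ] ℝ)) :=
  {p | p.1 ∈ L ∧ p.2 ≠ 0 ∧ ∀ v ∈ tangentSet L p.1, p.2 v = 0}

/-- Lagrangian submanifolds of `T^*E = E × E^*`: submanifolds of dimension `dim E` on which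
the canonical symplectic form vanishes. -/
def IsLagrangian (Λ : Set (E × (E →L[ℝ] ℝ))) : Prop :=
  IsSmoothSubmanifold Λ (Module.finrank ℝ E) ∧
    ∀ p ∈ Λ, ∀ v ∈ tangentSet Λ p, ∀ w ∈ tangentSet Λ p, w.2 v.1 - v.2 w.1 = 0

/-- Clean intersection: `A ∩ B` is a smooth submanifold, with tangent space the intersection
of the tangent spaces of `A` and `B`. -/
def IntersectCleanly (A B : Set E) : Prop :=
  (∃ c : ℕ, IsSmoothSubmanifold (A ∩ B) c) ∧
    ∀ p ∈ A ∩ B, tangentSet (A ∩ B) p = tangentSet A p ∩ tangentSet B p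

end Microlocal

/-! ### The Beltrami equation and its Born terms -/

/-- The Cauchy transform. -/
def cauchyP (f : ℂ → ℂ) (z : ℂ) : ℂ :=
  -(1 / (Real.pi : ℂ)) * ∫ w, f w / (w - z)

/-- The Beurling transform, a principal value. -/
def beurlingS (f : ℂ → ℂ) (z : ℂ) : ℂ :=
  limUnder (𝓝[>] (0 : ℝ)) fun δ =>
    -(1 / (Real.pi : ℂ)) * ∫ w in {w : ℂ | δ < ‖w - z‖}, f w / (w - z) ^ 2

/-- `e_k(z) = exp(i(kz + conj(kz)))`. -/
def eK (k z : ℂ) : ℂ := Complex.exp (Complex.I * (k * z + conj k * conj z))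

/-- `ν = e_{-k} μ`. -/
def nuCoeff (μ : ℂ → ℝ) (k z : ℂ) : ℂ := eK (-k) z * (μ z : ℂ)

/-- `α = -i conj(k) e_{-k} μ`. -/
def alphaCoeff (μ : ℂ → ℝ) (k z : ℂ) : ℂ := -Complex.I * conj k * eK (-k) z * (μ z : ℂ)

/-- `A = -conj(α) P - conj(ν) S`. -/
def opA (μ : ℂ → ℝ) (k : ℂ) (f : ℂ → ℂ) (z : ℂ) : ℂ :=
  -conj (alphaCoeff μ k z) * cauchyP f z - conj (nuCoeff μ k z) * beurlingS f z

/-- The terms of the Neumann series: `neumannU μ k j` is `u_{j+1}`, where `u_1 = -conj(α)` and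
`u_{n+1} = -A (conj u_n)`. -/
def neumannU (μ : ℂ → ℝ) (k : ℂ) : ℕ → ℂ → ℂ
  | 0 => fun z => -conj (alphaCoeff μ k z)
  | j + 1 => fun z => -opA μ k (fun w => conj (neumannU μ k j w)) z

/-- The real Banach space of bounded coefficients `μ` that vanish outside `Ω₀`. -/
abbrev Coefficients (Ω₀ : Set ℂ) : Type := Lp ℝ ⊤ (volume.restrict Ω₀)

/-- Extension of a coefficient by zero. -/
def extendCoeff {Ω₀ : Set ℂ} (μ : Coefficients Ω₀) : ℂ → ℝ := Ω₀.indicator μ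

/-- `u ∈ L²(Ω)` solves `(I + Aρ) u = -conj(α)` in `Ω`, where `ρ` is complex conjugation; `P`
and `S` act on functions on `Ω` extended by zero. -/
def IsBeltramiSolution (Ω : Set ℂ) (μ : ℂ → ℝ) (k : ℂ) (u : Lp ℂ 2 (volume.restrict Ω)) : Prop :=
  ∀ᵐ z ∂(volume.restrict Ω),
    u z + opA μ k (fun w => conj (Ω.indicator u w)) z = -conj (alphaCoeff μ k z)

open Classical in
/-- `U_k`: the map sending `μ` to the unique solution `u ∈ L²(Ω)`. -/
def solutionMap (Ω Ω₀ : Set ℂ) (k : ℂ) (μ : Coefficients Ω₀) : Lp ℂ 2 (volume.restrict Ω) :=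
  if h : ∃! u, IsBeltramiSolution Ω (extendCoeff μ) k u then h.exists.choose else 0

/-- `(1 / n!) Dⁿ U_k |_0 (μ, …, μ)`, with Fréchet derivatives on `L^∞(Ω₀)`. -/
def frechetTerm (Ω Ω₀ : Set ℂ) (n : ℕ) (k : ℂ) (μ : Coefficients Ω₀) :
    Lp ℂ 2 (volume.restrict Ω) :=
  ((n.factorial : ℝ)⁻¹) • iteratedFDeriv ℝ n (solutionMap Ω Ω₀ k) 0 (fun _ => μ)

/-- The `n`-th Born term `ω_n(z, k) = -P ρ ((1 / n!) Dⁿ U_k |_0 (μ, …, μ))(z)`. -/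
def bornTerm (Ω Ω₀ : Set ℂ) (n : ℕ) (μ : Coefficients Ω₀) (z k : ℂ) : ℂ :=
  -cauchyP (fun w => conj (Ω.indicator (frechetTerm Ω Ω₀ n k μ) w)) z

/-! ### The kernel

The number of factors is `n = m + 1`, and `z_1, …, z_n` are `z 0, …, z m`.  The circle is
`ℝ / 2πℤ` with angle `φ`; objects on `ℝ × S¹ × ℂⁿ` are written as `2π`-periodic objects on the
covering space `ℝ × ℝ × ℂⁿ`, with points `(t, φ, z)`. -/

/-- The covering space of `ℝ × S¹ × ℂⁿ`, `n = m + 1`. -/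
abbrev KernelSpace (m : ℕ) : Type := ℝ × ℝ × (Fin (m + 1) → ℂ)

/-- `2 Re (e^{iφ} ∑_{j=1}^{n} (-1)^j z_j)`. -/
def phase (m : ℕ) (φ : ℝ) (z : Fin (m + 1) → ℂ) : ℝ :=
  2 * (Complex.exp (Complex.I * φ) * ∑ i : Fin (m + 1), (-1) ^ ((i : ℕ) + 1) * z i).re

/-- `(-1)^j e^{i (-1)^j φ}`, with `j = i + 1`. -/
def angularFactor (i : ℕ) (φ : ℝ) : ℂ :=
  (-1) ^ (i + 1) * Complex.exp (Complex.I * ((-1) ^ (i + 1) * φ))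

/-- The difference `z_{j+1} - z_j`, `j = i + 1`, conjugated when `j` is odd. -/
def linkDifference {m : ℕ} (z : Fin (m + 1) → ℂ) (i : Fin m) : ℂ :=
  if Even (i : ℕ) then conj (z i.succ - z i.castSucc) else z i.succ - z i.castSucc

/-- The coefficient of `(-1)^p δ^{(p)}(t - phase)`, `p = n - |A|`, in the kernel `K_n^{z₀}`; the
set `A` of links carries the factors with exponent `2` (coming from `S`), the others have
exponent `1` (coming from `P`). -/
def kernelCoeff (m : ℕ) (z₀ : ℂ) (A : Finset (Fin m)) (φ : ℝ) (z : Fin (m + 1) → ℂ) : ℂ :=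
  2 * (Real.pi : ℂ) * (-(1 / (Real.pi : ℂ))) ^ (m + 1) *
    (angularFactor m φ * ∏ i ∈ Aᶜ, angularFactor (i : ℕ) φ) /
    ((z 0 - z₀) * ∏ i : Fin m, linkDifference z i ^ (if i ∈ A then 2 else 1))

/-- The kernel
`K_n^{z₀} = ∑_A kernelCoeff_A · (-1)^p δ^{(p)}(t - phase)`, `p = n - |A|`, truncated to the region
where `|z_j - z_{j+1}| > δ` for all `j`, and paired in all the variables with
`g(t, φ, z)`; the derivatives of the delta function are moved to `g`. -/
def truncatedPairing (m : ℕ) (z₀ : ℂ) (g : ℝ → ℝ → (Fin (m + 1) → ℂ) → ℂ) (δ : ℝ) : ℂ :=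
  ∫ φ : ℝ, ∫ z in {z : Fin (m + 1) → ℂ | ∀ i : Fin m, δ < ‖z i.castSucc - z i.succ‖},
    ∑ A : Finset (Fin m), kernelCoeff m z₀ A φ z *
      iteratedDeriv (m + 1 - A.card) (fun t => g t φ z) (phase m φ z)

/-- `K` is the distribution `K_n^{z₀}` on `ℝ × S¹ × ℂⁿ`: the principal value of the kernel. -/
def IsBornKernel (m : ℕ) (z₀ : ℂ) (K : ComplexDistribution (KernelSpace m)) : Prop :=
  ∀ ψ : 𝓓((⊤ : Opens (KernelSpace m)), ℂ),
    Tendsto (truncatedPairing m z₀ fun t φ z => ψ (t, φ, z)) (𝓝[>] 0) (𝓝 (K ψ))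

/-- `T` is the operator `T_n^{z₀}` with kernel `K_n^{z₀}`:
`T(μ_1 ⊗ ⋯ ⊗ μ_n)(t, φ) = ∫ K_n^{z₀}(t, φ; z) μ_1(z_1) ⋯ μ_n(z_n) dz` as distributions on `ℝ × S¹`. -/
def IsBornOperator (m : ℕ) (z₀ : ℂ) (Ω₀ : Set ℂ)
    (T : (Fin (m + 1) → Lp ℂ ⊤ (volume.restrict Ω₀)) → ComplexDistribution (ℝ × ℝ)) : Prop :=
  ∀ (μ : Fin (m + 1) → Lp ℂ ⊤ (volume.restrict Ω₀)) (ψ : 𝓓((⊤ : Opens (ℝ × ℝ)), ℂ)),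
    Tendsto (truncatedPairing m z₀ fun t φ z => ψ (t, φ) * ∏ i, Ω₀.indicator (μ i) (z i))
      (𝓝[>] 0) (𝓝 (T μ ψ))

/-- `L_n^J = {t - 2 Re (e^{iφ} ∑ (-1)^j z_j) = 0} ∩ {z_j = z_{j+1} for j ∈ J}`. -/
def LJ (m : ℕ) (J : Finset (Fin m)) : Set (KernelSpace m) :=
  {p | p.1 - phase m p.2.1 p.2.2 = 0 ∧ ∀ i ∈ J, p.2.2 i.castSucc - p.2.2 i.succ = 0}

end

noncomputable section

set_option linter.unusedSectionVars false

/-! ### Submanifolds straightened by a global diffeomorphism -/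

section Straightening

variable {E : Type*} [NormedAddCommGroup E] [NormedSpace ℝ E]

/-! Born terms. Both α and ν are multiples of μ, so Aρu = μ Q u with Q a bounded real-linear
operator on L²(Ω), and -ᾱ = μ c. The equation becomes u + M(μ)Qu = M(μ)c, where M(μ) is
multiplication by μ. Near μ = 0 the operator 1 + M(μ)Q is invertible and the solution is analytic in
μ; comparing the two power series on each line s ↦ sμ identifies Taylor terms with Neumann terms
(`iteratedFDeriv_neumannSol`). The operator S is built on L² as the isometry ∂̄φ ↦ ∂φ (`norm_dzL`,
`denseRange_dbarL`). The function `regInv δ` is Lipschitz, with ∂ equal almost everywhere to minus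
the truncated kernel w⁻² and ∂̄ equal to a multiple of the indicator of a disc. Hence the truncated
Beurling transform of f is exactly the disc average of Sf (`truncated_beurling_eq`), and Lebesgue
differentiation gives the principal value.

The operator T. The n-th Born term at z₀ is a bounded functional, the Cauchy kernel at a point away
from Ω₀, applied to a multilinear chain of multiplications, conjugations and operators ikP + S. For
truncated operators the chain is an absolutely convergent integral with kernel e^{iτΨ} times a
product of factors iτ·c/d + 1/d² (`integral_chainKernel`). Expanding the product over the set A of
links carrying 1/d² gives powers (iτ)^p e^{iτΨ}, and Fourier inversion in τ turns them into 2π times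
p-th t-derivatives of the test function at t = Ψ (`truncatedPairing_eq_fourierPairing`). As δ → 0
the truncated P converges in norm and the truncated S strongly with bounded norms, which suffices
for chains (`tendsto_chain`).

The kernel. In the coordinates z₁ - z₀, z_{j+1} - z_j the singular factors separate. Each factor w⁻²
is integrated by parts through `regInv`, without boundary term, leaving weights dominated by ∏
|w_j|⁻¹ uniformly in δ (`exists_integral_weight_eq`); so the principal value exists and is a
distribution.

The wave front set. The kernel vanishes off the graph t = Ψ. At a point of the graph let J be the
set of links that vanish there. If ξ is not conormal to L^J, some direction tangent to L^J has
nonzero pairing with ξ. Moving along it leaves the singular factors (links in J) unchanged, and the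
other factors are smooth nearby, so one may integrate by parts arbitrarily often; each time gains a
power of the frequency, uniformly in δ and in the covector
(`IsAdmissible.exists_norm_oscillatory_le`).

The geometry. L^J is the graph of Ψ over a linear subspace. The shear t ↦ t - Ψ, lifted to the
cotangent bundle, straightens all the conormal bundles simultaneously to pieces of linear subspaces,
so the Lagrangian property and clean intersection reduce to linear algebra. -/

/-- The open set `U` is there to cut the zero section out of a conormal bundle that `Φ` straightens
to a linear subspace. -/
lemma isSmoothSubmanifold_of_equiv (Φ : E ≃ E) (hΦ : ContDiff ℝ ∞ Φ)
    (hΦs : ContDiff ℝ ∞ Φ.symm) {U S : Set E} (hU : IsOpen U) (hSU : S ⊆ U)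
    (W : Submodule ℝ E) (hS : ∀ y ∈ U, y ∈ S ↔ Φ y ∈ W) {c : ℕ}
    (hc : Module.finrank ℝ W + c = Module.finrank ℝ E) : IsSmoothSubmanifold S c := by
  intro p hp
  let h : E ≃ₜ E := ⟨Φ, hΦ.continuous, hΦs.continuous⟩
  refine ⟨h.toOpenPartialHomeomorph.restrOpen U hU, ?_, hΦ.contDiffOn, hΦs.contDiffOn, W, hc, ?_⟩
  · simpa using hSU hp
  · intro y hy
    exact hS y (by simpa using hy)

/-- A curve in `S` is mapped by `Φ` into the closed subspace `W`, so its difference quotients and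
their limit stay in `W`. Conversely, the straight line through `Φ p` with velocity `Φ' v`, pulled
back by `Φ.symm`, has velocity `v`. -/
lemma tangentSet_of_equiv [FiniteDimensional ℝ E] (Φ : E ≃ E)
    (hΦs : ContDiff ℝ ∞ Φ.symm) {U S : Set E} (hU : IsOpen U) (hSU : S ⊆ U)
    (W : Submodule ℝ E) (hS : ∀ y ∈ U, y ∈ S ↔ Φ y ∈ W) {p : E} (hp : p ∈ S)
    {Φ' : E →L[ℝ] E} (hΦ' : HasFDerivAt Φ Φ' p) :
    tangentSet S p = {v | Φ' v ∈ W} := by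
  have hWc : IsClosed (W : Set E) := W.closed_of_finiteDimensional
  have hpW : Φ p ∈ W := (hS p (hSU hp)).1 hp
  ext v
  constructor
  · rintro ⟨γ, hγ, rfl, hev, hv⟩
    have h1 : HasDerivAt (fun s => Φ (γ s)) (Φ' v) 0 := hΦ'.comp_hasDerivAt 0 hv
    have h2 : Tendsto (fun s : ℝ => s⁻¹ • (Φ (γ (0 + s)) - Φ (γ 0))) (𝓝[≠] 0) (𝓝 (Φ' v)) :=
      h1.tendsto_slope_zero
    refine hWc.mem_of_tendsto h2 ?_
    filter_upwards [hev.filter_mono nhdsWithin_le_nhds] with s hs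
    exact W.smul_mem _ (W.sub_mem (by simpa using (hS _ (hSU hs)).1 hs) hpW)
  · intro hv
    have hc : ContDiff ℝ ∞ fun s : ℝ => Φ.symm (Φ p + s • Φ' v) :=
      hΦs.comp (contDiff_const.add (contDiff_id.smul contDiff_const))
    refine ⟨_, hc, by simp, ?_, ?_⟩
    · have h0 : ∀ᶠ s in 𝓝 (0 : ℝ), Φ.symm (Φ p + s • Φ' v) ∈ U :=
        hc.continuous.continuousAt.eventually_mem (hU.mem_nhds (by simpa using hSU hp))
      filter_upwards [h0] with s hs
      rw [hS _ hs]
      simpa using W.add_mem hpW (W.smul_mem s hv)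
    · have hd : DifferentiableAt ℝ Φ.symm (Φ p) := (hΦs.differentiable (by simp)) _
      have h1 : HasFDerivAt (fun x => Φ.symm (Φ x)) ((fderiv ℝ Φ.symm (Φ p)).comp Φ') p :=
        hd.hasFDerivAt.comp p hΦ'
      simp only [Equiv.symm_apply_apply] at h1
      -- Differentiating `Φ.symm ∘ Φ = id` shows that the derivative of `Φ.symm` sends `Φ' v` back
      -- to `v`.
      have h2 := congrArg (fun L : E →L[ℝ] E => L v) (h1.unique (hasFDerivAt_id p))
      have h3 : HasDerivAt (fun s : ℝ => Φ p + s • Φ' v) (Φ' v) 0 := by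
        simpa using ((hasDerivAt_id (0 : ℝ)).smul_const (Φ' v)).const_add (Φ p)
      have h4 : HasFDerivAt Φ.symm (fderiv ℝ Φ.symm (Φ p)) ((fun s : ℝ => Φ p + s • Φ' v) 0) := by
        simpa using hd.hasFDerivAt
      have h5 := h4.comp_hasDerivAt 0 h3
      exact h5.congr_deriv h2

/-! ### Annihilators and dimension counts. -/

/-- The continuous linear forms that vanish on a subspace. -/
def annihilator (W : Submodule ℝ E) : Submodule ℝ (E →L[ℝ] ℝ) where
  carrier := {η | ∀ v ∈ W, η v = 0}
  add_mem' ha hb v hv := by simp [ha v hv, hb v hv]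
  zero_mem' := by simp
  smul_mem' c a ha v hv := by simp [ha v hv]

lemma mem_annihilator {W : Submodule ℝ E} {η : E →L[ℝ] ℝ} :
    η ∈ annihilator W ↔ ∀ v ∈ W, η v = 0 := Iff.rfl

lemma finrank_continuousDual [FiniteDimensional ℝ E] :
    Module.finrank ℝ (E →L[ℝ] ℝ) = Module.finrank ℝ E := by
  rw [← (LinearMap.toContinuousLinearMap (𝕜 := ℝ) (E := E) (F' := ℝ)).finrank_eq]
  exact Subspace.dual_finrank_eq

lemma finrank_add_finrank_annihilator [FiniteDimensional ℝ E] (W : Submodule ℝ E) :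
    Module.finrank ℝ W + Module.finrank ℝ (annihilator W) = Module.finrank ℝ E := by
  rw [← Subspace.finrank_add_finrank_dualAnnihilator_eq W]
  congr 1
  let e := (LinearMap.toContinuousLinearMap (𝕜 := ℝ) (E := E) (F' := ℝ))
  have : annihilator W = W.dualAnnihilator.map e.toLinearMap := by
    ext η
    simp only [Submodule.mem_map, Submodule.mem_dualAnnihilator, mem_annihilator]
    constructor
    · intro h
      exact ⟨e.symm η, fun w hw => h w hw, by simp⟩
    · rintro ⟨f, hf, rfl⟩ v hv
      exact hf v hv
  rw [this]
  exact LinearEquiv.finrank_map_eq e _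

lemma finrank_submodule_prod {E' : Type*} [NormedAddCommGroup E'] [NormedSpace ℝ E']
    [FiniteDimensional ℝ E] [FiniteDimensional ℝ E'] (p : Submodule ℝ E) (q : Submodule ℝ E') :
    Module.finrank ℝ (p.prod q) = Module.finrank ℝ p + Module.finrank ℝ q := by
  have h : Module.finrank ℝ (p.prod q) = Module.finrank ℝ (p × q) :=
    LinearEquiv.finrank_eq
      { toFun := fun x => (⟨x.1.1, x.2.1⟩, ⟨x.1.2, x.2.2⟩)
        invFun := fun x => ⟨(x.1, x.2), x.1.2, x.2.2⟩
        map_add' := fun _ _ => rfl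
        map_smul' := fun _ _ => rfl
        left_inv := fun _ => rfl
        right_inv := fun _ => rfl }
  rw [h, Module.finrank_prod]

end Straightening

/-! ### Graphs over subspaces and their conormal bundles -/

section Graph

variable {F : Type*} [NormedAddCommGroup F] [NormedSpace ℝ F]

/-- The graph of `r` over the subspace `V`. -/
def graphOver (r : F → ℝ) (V : Submodule ℝ F) : Set (ℝ × F) :=
  {p | p.1 - r p.2 = 0 ∧ p.2 ∈ V}

/-- The shear that straightens the graph of `r`. -/
def shear (r : F → ℝ) : ℝ × F ≃ ℝ × F where
  toFun p := (p.1 - r p.2, p.2)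
  invFun p := (p.1 + r p.2, p.2)
  left_inv p := by simp
  right_inv p := by simp

/-- The symplectic lift of the shear to the cotangent bundle. -/
def cotangentShear (r : F → ℝ) :
    (ℝ × F) × (ℝ × F →L[ℝ] ℝ) ≃ (ℝ × F) × (ℝ × F →L[ℝ] ℝ) where
  toFun p := ((p.1.1 - r p.1.2, p.1.2),
    p.2 + p.2 (1, 0) • (fderiv ℝ r p.1.2).comp (ContinuousLinearMap.snd ℝ ℝ F))
  invFun p := ((p.1.1 + r p.1.2, p.1.2),
    p.2 - p.2 (1, 0) • (fderiv ℝ r p.1.2).comp (ContinuousLinearMap.snd ℝ ℝ F))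
  left_inv p := by simp
  right_inv p := by simp

variable {r : F → ℝ}

lemma contDiff_shear (hr : ContDiff ℝ ∞ r) :
    ContDiff ℝ ∞ (shear r) ∧ ContDiff ℝ ∞ (shear r).symm := by
  constructor
  · exact (contDiff_fst.sub (hr.comp contDiff_snd)).prodMk contDiff_snd
  · exact (contDiff_fst.add (hr.comp contDiff_snd)).prodMk contDiff_snd

lemma contDiff_cotangentShear (hr : ContDiff ℝ ∞ r) :
    ContDiff ℝ ∞ (cotangentShear r) ∧ ContDiff ℝ ∞ (cotangentShear r).symm := by
  have hr' : ContDiff ℝ ∞ (fderiv ℝ r) := hr.fderiv_right (by simp)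
  have h2 : ContDiff ℝ ∞ fun p : (ℝ × F) × (ℝ × F →L[ℝ] ℝ) => p.1.2 :=
    contDiff_snd.comp contDiff_fst
  have h3 : ContDiff ℝ ∞ fun p : (ℝ × F) × (ℝ × F →L[ℝ] ℝ) =>
      p.2 (1, 0) • (fderiv ℝ r p.1.2).comp (ContinuousLinearMap.snd ℝ ℝ F) :=
    (contDiff_snd.clm_apply contDiff_const).smul ((hr'.comp h2).clm_comp contDiff_const)
  have h1 : ContDiff ℝ ∞ fun p : (ℝ × F) × (ℝ × F →L[ℝ] ℝ) => p.1.1 :=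
    contDiff_fst.comp contDiff_fst
  constructor
  · exact ((h1.sub (hr.comp h2)).prodMk h2).prodMk (contDiff_snd.add h3)
  · exact ((h1.add (hr.comp h2)).prodMk h2).prodMk (contDiff_snd.sub h3)

/-- The tangent space of the straightened graph. -/
def straightGraph (V : Submodule ℝ F) : Submodule ℝ (ℝ × F) := (⊥ : Submodule ℝ ℝ).prod V

/-- The straightened conormal bundle, with its zero section. -/
def straightConormal (V : Submodule ℝ F) : Submodule ℝ ((ℝ × F) × (ℝ × F →L[ℝ] ℝ)) :=
  (straightGraph V).prod (annihilator (straightGraph V))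

lemma mem_graphOver_iff (V : Submodule ℝ F) (p : ℝ × F) :
    p ∈ graphOver r V ↔ shear r p ∈ straightGraph V := by
  simp [graphOver, shear, straightGraph]

lemma mem_annihilator_straightGraph {V : Submodule ℝ F} {η : ℝ × F →L[ℝ] ℝ} :
    η ∈ annihilator (straightGraph V) ↔ ∀ y ∈ V, η (0, y) = 0 := by
  simp only [mem_annihilator, straightGraph, Submodule.mem_prod, Submodule.mem_bot, Prod.forall]
  exact ⟨fun h y hy => h 0 y ⟨rfl, hy⟩, fun h a y hy => by rw [hy.1]; exact h y hy.2⟩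

lemma isOpen_snd_ne_zero : IsOpen {p : (ℝ × F) × (ℝ × F →L[ℝ] ℝ) | p.2 ≠ 0} :=
  isOpen_ne_fun continuous_snd continuous_const

/-- Differentiability is already known, so the value of the derivative at `v` can be computed along
the line `p + s • v`, one component at a time. -/
lemma hasFDerivAt_cotangentShear (hr : ContDiff ℝ ∞ r) (p : (ℝ × F) × (ℝ × F →L[ℝ] ℝ)) :
    ∃ D : ((ℝ × F) × (ℝ × F →L[ℝ] ℝ)) →L[ℝ] ((ℝ × F) × (ℝ × F →L[ℝ] ℝ)),
      HasFDerivAt (cotangentShear r) D p ∧ ∀ v, D v =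
      ((v.1.1 - fderiv ℝ r p.1.2 v.1.2, v.1.2),
        v.2 + (v.2 (1, 0) • (fderiv ℝ r p.1.2).comp (ContinuousLinearMap.snd ℝ ℝ F) +
          p.2 (1, 0) • (fderiv ℝ (fderiv ℝ r) p.1.2 v.1.2).comp
            (ContinuousLinearMap.snd ℝ ℝ F))) := by
  refine ⟨fderiv ℝ (cotangentShear r) p,
    ((contDiff_cotangentShear hr).1.differentiable (by simp) p).hasFDerivAt, fun v => ?_⟩
  have hD := ((contDiff_cotangentShear hr).1.differentiable (by simp) p).hasFDerivAt
  have hline : HasDerivAt (fun s : ℝ => p + s • v) v 0 := by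
    simpa using ((hasDerivAt_id (0 : ℝ)).smul_const v).const_add p
  have h1 := HasFDerivAt.comp_hasDerivAt (0 : ℝ) (by simpa using hD) hline
  refine h1.unique ?_
  have hl : HasDerivAt (fun s : ℝ => p.1.2 + s • v.1.2) v.1.2 0 := by
    simpa using ((hasDerivAt_id (0 : ℝ)).smul_const v.1.2).const_add p.1.2
  have hl1 : HasDerivAt (fun s : ℝ => p.1.1 + s • v.1.1) v.1.1 0 := by
    simpa using ((hasDerivAt_id (0 : ℝ)).smul_const v.1.1).const_add p.1.1
  have hl2 : HasDerivAt (fun s : ℝ => p.2 + s • v.2) v.2 0 := by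
    simpa using ((hasDerivAt_id (0 : ℝ)).smul_const v.2).const_add p.2
  have hl3 : HasDerivAt (fun s : ℝ => (p.2 + s • v.2) (1, 0)) (v.2 (1, 0)) 0 := by
    simpa using ((hasDerivAt_id (0 : ℝ)).mul_const (v.2 (1, 0))).const_add (p.2 (1, 0))
  have hr0 : HasDerivAt (fun s : ℝ => r (p.1.2 + s • v.1.2)) (fderiv ℝ r p.1.2 v.1.2) 0 := by
    have h : HasFDerivAt r (fderiv ℝ r p.1.2) (p.1.2 + (0 : ℝ) • v.1.2) := by
      simpa using (hr.differentiable (by simp) p.1.2).hasFDerivAt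
    exact h.comp_hasDerivAt (0 : ℝ) hl
  have hr1 : HasDerivAt (fun s : ℝ => fderiv ℝ r (p.1.2 + s • v.1.2))
      (fderiv ℝ (fderiv ℝ r) p.1.2 v.1.2) 0 := by
    have h : HasFDerivAt (fderiv ℝ r) (fderiv ℝ (fderiv ℝ r) p.1.2) (p.1.2 + (0 : ℝ) • v.1.2) := by
      simpa using ((hr.fderiv_right (m := ∞) (by simp)).differentiable (by simp)
        p.1.2).hasFDerivAt
    exact h.comp_hasDerivAt (0 : ℝ) hl
  have hr2 : HasDerivAt (fun s : ℝ => (fderiv ℝ r (p.1.2 + s • v.1.2)).comp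
      (ContinuousLinearMap.snd ℝ ℝ F)) ((fderiv ℝ (fderiv ℝ r) p.1.2 v.1.2).comp
      (ContinuousLinearMap.snd ℝ ℝ F)) 0 := by
    simpa using hr1.clm_comp (hasDerivAt_const (0 : ℝ) (ContinuousLinearMap.snd ℝ ℝ F))
  have h6 := ((hl1.sub hr0).prodMk hl).prodMk (hl2.add (hl3.smul hr2))
  refine h6.congr_deriv ?_
  simp [add_comm]

variable [FiniteDimensional ℝ F]

lemma finrank_straightGraph (V : Submodule ℝ F) :
    Module.finrank ℝ (straightGraph V) = Module.finrank ℝ V := by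
  rw [straightGraph, finrank_submodule_prod]
  simp

lemma isSmoothSubmanifold_graphOver (hr : ContDiff ℝ ∞ r) (V : Submodule ℝ F) {c : ℕ}
    (hc : Module.finrank ℝ V + c = Module.finrank ℝ F) :
    IsSmoothSubmanifold (graphOver r V) (1 + c) := by
  refine isSmoothSubmanifold_of_equiv (shear r) (contDiff_shear hr).1 (contDiff_shear hr).2
    isOpen_univ (Set.subset_univ _) (straightGraph V) (fun y _ => mem_graphOver_iff V y) ?_
  rw [finrank_straightGraph, Module.finrank_prod, Module.finrank_self]
  omega

lemma tangentSet_graphOver (hr : ContDiff ℝ ∞ r) (V : Submodule ℝ F) {p : ℝ × F}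
    (hp : p ∈ graphOver r V) :
    tangentSet (graphOver r V) p = {v | v.1 = fderiv ℝ r p.2 v.2 ∧ v.2 ∈ V} := by
  have hd : HasFDerivAt r (fderiv ℝ r p.2) p.2 := (hr.differentiable (by simp) _).hasFDerivAt
  have h : HasFDerivAt (shear r) ((ContinuousLinearMap.fst ℝ ℝ F -
      (fderiv ℝ r p.2).comp (ContinuousLinearMap.snd ℝ ℝ F)).prod
      (ContinuousLinearMap.snd ℝ ℝ F)) p :=
    (hasFDerivAt_fst.sub (hd.comp p hasFDerivAt_snd)).prodMk hasFDerivAt_snd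
  rw [tangentSet_of_equiv (shear r) (contDiff_shear hr).2
    isOpen_univ (Set.subset_univ _) (straightGraph V) (fun y _ => mem_graphOver_iff V y) hp h]
  ext v
  simp [straightGraph, sub_eq_zero]

/-- The lifted covector acts on (0, y) as ξ acts on the graph tangent (dr y, y). The straightening
map does not depend on `V`, which is what allows several conormal bundles to be compared. -/
lemma conormalBundle_graphOver (hr : ContDiff ℝ ∞ r) (V : Submodule ℝ F) :
    conormalBundle (graphOver r V) =
      {p | p.2 ≠ 0 ∧ cotangentShear r p ∈ straightConormal V} := by
  ext ⟨x, ξ⟩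
  have key : ∀ y, (ξ + ξ (1, 0) • (fderiv ℝ r x.2).comp (ContinuousLinearMap.snd ℝ ℝ F)) (0, y)
      = ξ (fderiv ℝ r x.2 y, y) := by
    intro y
    have : ((fderiv ℝ r x.2 y, y) : ℝ × F) = fderiv ℝ r x.2 y • (1, 0) + (0, y) := by simp
    rw [this, map_add, map_smul]
    simp
    ring
  have hW : cotangentShear r (x, ξ) ∈ straightConormal V ↔ x ∈ graphOver r V ∧
      ∀ y ∈ V, ξ (fderiv ℝ r x.2 y, y) = 0 := by
    rw [straightConormal, Submodule.mem_prod, mem_annihilator_straightGraph, mem_graphOver_iff]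
    refine and_congr Iff.rfl (forall₂_congr fun y _ => ?_)
    rw [← key y]
    rfl
  simp only [conormalBundle, Set.mem_ofPred_eq, hW]
  constructor
  · rintro ⟨h1, h2, h3⟩
    refine ⟨h2, h1, fun y hy => h3 _ ?_⟩
    rw [tangentSet_graphOver hr V h1]
    exact ⟨rfl, hy⟩
  · rintro ⟨h2, h1, h3⟩
    refine ⟨h1, h2, fun v hv => ?_⟩
    rw [tangentSet_graphOver hr V h1] at hv
    have := h3 v.2 hv.2
    rwa [← hv.1] at this

/-- An arbitrary subspace `W` is allowed so that the lemma covers both a single conormal bundle and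
the intersection of two. -/
lemma isSmoothSubmanifold_conormal_inter (hr : ContDiff ℝ ∞ r)
    (W : Submodule ℝ ((ℝ × F) × (ℝ × F →L[ℝ] ℝ))) :
    ∃ c, Module.finrank ℝ W + c = 2 * Module.finrank ℝ (ℝ × F) ∧
      IsSmoothSubmanifold {p | p.2 ≠ 0 ∧ cotangentShear r p ∈ W} c := by
  have hdim : Module.finrank ℝ ((ℝ × F) × (ℝ × F →L[ℝ] ℝ)) = 2 * Module.finrank ℝ (ℝ × F) := by
    rw [Module.finrank_prod, finrank_continuousDual]
    ring
  have hle : Module.finrank ℝ W ≤ 2 * Module.finrank ℝ (ℝ × F) := hdim ▸ Submodule.finrank_le W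
  refine ⟨2 * Module.finrank ℝ (ℝ × F) - Module.finrank ℝ W, by omega, ?_⟩
  refine isSmoothSubmanifold_of_equiv (cotangentShear r) (contDiff_cotangentShear hr).1
    (contDiff_cotangentShear hr).2 isOpen_snd_ne_zero (fun p hp => And.left hp) W
    (fun y hy => ⟨fun h => And.right h, fun h => And.intro hy h⟩) ?_
  rw [hdim]
  omega

lemma tangentSet_conormal_inter (hr : ContDiff ℝ ∞ r)
    (W : Submodule ℝ ((ℝ × F) × (ℝ × F →L[ℝ] ℝ))) {p : (ℝ × F) × (ℝ × F →L[ℝ] ℝ)}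
    (hp : p.2 ≠ 0 ∧ cotangentShear r p ∈ W) :
    tangentSet {p : (ℝ × F) × (ℝ × F →L[ℝ] ℝ) | p.2 ≠ 0 ∧ cotangentShear r p ∈ W} p =
      {v | fderiv ℝ (cotangentShear r) p v ∈ W} :=
  tangentSet_of_equiv (cotangentShear r)
    (contDiff_cotangentShear hr).2 isOpen_snd_ne_zero (fun p hp => And.left hp) W
    (fun y hy => ⟨fun h => And.right h, fun h => And.intro hy h⟩) hp
    ((contDiff_cotangentShear hr).1.differentiable (by simp) p).hasFDerivAt

/-- The straightened bundle is a subspace times its annihilator, hence of half dimension. In the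
symplectic form the only contribution not cancelled linearly is the second derivative of `r`, which
is symmetric. -/
lemma isLagrangian_conormalBundle_graphOver (hr : ContDiff ℝ ∞ r) (V : Submodule ℝ F) :
    IsLagrangian (conormalBundle (graphOver r V)) := by
  rw [conormalBundle_graphOver hr]
  constructor
  · obtain ⟨c, hc, h⟩ := isSmoothSubmanifold_conormal_inter hr (straightConormal V)
    rw [straightConormal, finrank_submodule_prod, finrank_add_finrank_annihilator] at hc
    obtain rfl : c = Module.finrank ℝ (ℝ × F) := by omega
    exact h
  · intro p hp v hv w hw
    rw [tangentSet_conormal_inter hr _ hp] at hv hw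
    obtain ⟨D, hD, hDv⟩ := hasFDerivAt_cotangentShear hr p
    rw [Set.mem_ofPred_eq, hD.fderiv, hDv, straightConormal, Submodule.mem_prod,
      mem_annihilator_straightGraph] at hv hw
    simp only [straightGraph, Submodule.mem_prod, Submodule.mem_bot, sub_eq_zero] at hv hw
    obtain ⟨⟨hv1, hv2⟩, hv3⟩ := hv
    obtain ⟨⟨hw1, hw2⟩, hw3⟩ := hw
    have a := hv3 _ hw2
    have b := hw3 _ hv2
    have hsymm : fderiv ℝ (fderiv ℝ r) p.1.2 v.1.2 w.1.2
        = fderiv ℝ (fderiv ℝ r) p.1.2 w.1.2 v.1.2 :=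
      (hr.contDiffAt.isSymmSndFDerivAt (by
        rw [minSmoothness_of_isRCLikeNormedField]
        exact (WithTop.coe_le_coe (α := ℕ∞)).2 (le_top : (2 : ℕ∞) ≤ ⊤))) _ _
    have e1 : ∀ (ζ : ℝ × F →L[ℝ] ℝ) (u : ℝ × F), ζ u = u.1 * ζ (1, 0) + ζ (0, u.2) := by
      intro ζ u
      have : u = u.1 • ((1, 0) : ℝ × F) + (0, u.2) := by ext <;> simp
      conv_lhs => rw [this, map_add, map_smul, smul_eq_mul]
    rw [e1 w.2 v.1, e1 v.2 w.1, hv1, hw1]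
    simp at a b
    rw [hsymm] at a
    linear_combination b - a

/-- One diffeomorphism straightens both bundles, and linear subspaces always intersect cleanly. -/
lemma intersectCleanly_conormalBundle_graphOver (hr : ContDiff ℝ ∞ r) (V V' : Submodule ℝ F) :
    IntersectCleanly (conormalBundle (graphOver r V)) (conormalBundle (graphOver r V')) := by
  have hinter : conormalBundle (graphOver r V) ∩ conormalBundle (graphOver r V') =
      {p | p.2 ≠ 0 ∧ cotangentShear r p ∈ straightConormal V ⊓ straightConormal V'} := by
    rw [conormalBundle_graphOver hr, conormalBundle_graphOver hr]
    ext p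
    simp only [Set.mem_inter_iff, Set.mem_ofPred_eq, Submodule.mem_inf]
    tauto
  constructor
  · obtain ⟨c, -, h⟩ :=
      isSmoothSubmanifold_conormal_inter hr (straightConormal V ⊓ straightConormal V')
    exact ⟨c, hinter ▸ h⟩
  · intro p hp
    have hp' := hp
    rw [hinter] at hp'
    rw [hinter, tangentSet_conormal_inter hr _ hp', conormalBundle_graphOver hr,
      conormalBundle_graphOver hr, tangentSet_conormal_inter hr _ ⟨hp'.1, hp'.2.1⟩,
      tangentSet_conormal_inter hr _ ⟨hp'.1, hp'.2.2⟩]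
    ext v
    simp

end Graph

/-! ### The submanifolds `L_n^J` -/

section Geometry

variable {m : ℕ}

/-- The phase as a function on `ℝ × ℂⁿ`. -/
def phaseFn (m : ℕ) (y : ℝ × (Fin (m + 1) → ℂ)) : ℝ := phase m y.1 y.2

lemma contDiff_phaseFn : ContDiff ℝ ∞ (phaseFn m) := by
  have h1 : ContDiff ℝ ∞ fun y : ℝ × (Fin (m + 1) → ℂ) => Complex.exp (Complex.I * (y.1 : ℂ)) :=
    (contDiff_const.mul (Complex.ofRealCLM.contDiff.comp contDiff_fst)).cexp
  have h2 : ContDiff ℝ ∞ fun y : ℝ × (Fin (m + 1) → ℂ) =>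
      ∑ i : Fin (m + 1), (-1 : ℂ) ^ ((i : ℕ) + 1) * y.2 i :=
    ContDiff.sum fun i _ => contDiff_const.mul ((contDiff_apply ℝ ℂ i).comp contDiff_snd)
  exact contDiff_const.mul (Complex.reCLM.contDiff.comp (h1.mul h2))

/-- The subspace `z_j = z_{j+1}`, `j ∈ J`, of `ℝ × ℂⁿ`. -/
def coincidenceSpace (J : Finset (Fin m)) : Submodule ℝ (ℝ × (Fin (m + 1) → ℂ)) where
  carrier := {y | ∀ i ∈ J, y.2 i.castSucc - y.2 i.succ = 0}
  add_mem' {a b} ha hb i hi := by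
    have := congrArg₂ (· + ·) (ha i hi) (hb i hi)
    simp only [add_zero] at this
    rw [← this, Prod.snd_add, Pi.add_apply, Pi.add_apply]
    ring
  zero_mem' := by simp
  smul_mem' c a ha i hi := by
    simp only [Prod.smul_snd, Pi.smul_apply, ← smul_sub, ha i hi, smul_zero]

lemma mem_coincidenceSpace {J : Finset (Fin m)} {y : ℝ × (Fin (m + 1) → ℂ)} :
    y ∈ coincidenceSpace J ↔ ∀ i ∈ J, y.2 i.castSucc - y.2 i.succ = 0 := Iff.rfl

lemma LJ_eq_graphOver (J : Finset (Fin m)) :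
    LJ m J = graphOver (phaseFn m) (coincidenceSpace J) := rfl

/-- The point of `ℂⁿ` with prescribed consecutive differences. -/
def pointOfLinks (w : Fin m → ℂ) (k : Fin (m + 1)) : ℂ :=
  ∑ i : Fin m, if (i : ℕ) < k then w i else 0

lemma pointOfLinks_sub (w : Fin m → ℂ) (i : Fin m) :
    pointOfLinks w i.succ - pointOfLinks w i.castSucc = w i := by
  rw [pointOfLinks, pointOfLinks, ← Finset.sum_sub_distrib, Finset.sum_eq_single i]
  · simp
  · intro j _ hj
    have : (j : ℕ) ≠ i := fun h => hj (Fin.ext h)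
    by_cases h : (j : ℕ) < i
    · simp [h, Nat.lt_succ_of_lt h]
    · have : ¬ (j : ℕ) < i + 1 := by omega
      simp [h, this]
  · simp

/-- The differences at the links in `J` are independent, since `pointOfLinks` realises arbitrary
values; each costs two real dimensions. -/
lemma finrank_coincidenceSpace (J : Finset (Fin m)) :
    Module.finrank ℝ (coincidenceSpace J) + 2 * J.card =
      Module.finrank ℝ (ℝ × (Fin (m + 1) → ℂ)) := by
  let f : (ℝ × (Fin (m + 1) → ℂ)) →ₗ[ℝ] (J → ℂ) :=
    { toFun := fun y i => y.2 i.1.castSucc - y.2 i.1.succ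
      map_add' := fun a b => by
        ext i
        simp only [Prod.snd_add, Pi.add_apply]
        ring
      map_smul' := fun c a => by
        ext i
        simp only [Prod.smul_snd, Pi.smul_apply, ← smul_sub, RingHom.id_apply] }
  have hker : coincidenceSpace J = LinearMap.ker f := by
    ext y
    simp only [mem_coincidenceSpace, LinearMap.mem_ker, funext_iff, Subtype.forall]
    rfl
  have hsurj : LinearMap.range f = ⊤ := by
    rw [LinearMap.range_eq_top]
    intro w
    refine ⟨(0, pointOfLinks fun i => if h : i ∈ J then -w ⟨i, h⟩ else 0), ?_⟩
    ext i
    change pointOfLinks _ _ - pointOfLinks _ _ = _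
    rw [← neg_sub, pointOfLinks_sub]
    simp
  have h := LinearMap.finrank_range_add_finrank_ker f
  rw [hsurj, finrank_top, ← hker] at h
  have h2 : Module.finrank ℝ (J → ℂ) = 2 * J.card := by
    rw [Module.finrank_pi_fintype]
    simp [mul_comm]
  omega

lemma isSmoothSubmanifold_LJ (J : Finset (Fin m)) :
    IsSmoothSubmanifold (LJ m J) (1 + 2 * J.card) :=
  isSmoothSubmanifold_graphOver contDiff_phaseFn _ (finrank_coincidenceSpace J)

lemma isLagrangian_conormalBundle_LJ (J : Finset (Fin m)) :
    IsLagrangian (conormalBundle (LJ m J)) := by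
  rw [LJ_eq_graphOver]
  exact isLagrangian_conormalBundle_graphOver contDiff_phaseFn _

lemma intersectCleanly_conormalBundle_LJ (J J' : Finset (Fin m)) :
    IntersectCleanly (conormalBundle (LJ m J)) (conormalBundle (LJ m J')) := by
  rw [LJ_eq_graphOver, LJ_eq_graphOver]
  exact intersectCleanly_conormalBundle_graphOver contDiff_phaseFn _ _

/-- The curves in the definition of the conormal bundle are eliminated here: tangent vectors of the
graph are (dΨ y, y). The wave front estimate uses this form. -/
lemma mem_conormalBundle_LJ {J : Finset (Fin m)} {x : KernelSpace m}
    {ξ : KernelSpace m →L[ℝ] ℝ} :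
    (x, ξ) ∈ conormalBundle (LJ m J) ↔ x ∈ LJ m J ∧ ξ ≠ 0 ∧
      ∀ y ∈ coincidenceSpace J, ξ (fderiv ℝ (phaseFn m) x.2 y, y) = 0 := by
  have h : ∀ hx : x ∈ LJ m J, ((∀ v ∈ tangentSet (LJ m J) x, ξ v = 0) ↔
      ∀ y ∈ coincidenceSpace J, ξ (fderiv ℝ (phaseFn m) x.2 y, y) = 0) := by
    intro hx
    rw [LJ_eq_graphOver] at hx ⊢
    rw [tangentSet_graphOver contDiff_phaseFn _ hx]
    exact ⟨fun h y hy => h _ ⟨rfl, hy⟩, fun h v hv => by simpa [← hv.1] using h v.2 hv.2⟩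
  exact ⟨fun hx => ⟨hx.1, hx.2.1, (h hx.1).1 hx.2.2⟩, fun hx => ⟨hx.1, hx.2.1, (h hx.1).2 hx.2.2⟩⟩

/-- The conormal bundle remembers its base, and `L_n^J` contains points at which the links in `J`
are the only ones that vanish. -/
lemma conormalBundle_LJ_injective :
    Function.Injective fun J : Finset (Fin m) => conormalBundle (LJ m J) := by
  have key : ∀ J J' : Finset (Fin m), conormalBundle (LJ m J) ⊆ conormalBundle (LJ m J') →
      J' ⊆ J := by
    intro J J' h i hi
    let z : Fin (m + 1) → ℂ := pointOfLinks fun i => if i ∈ J then 0 else 1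
    -- The covector dt - dΨ vanishes on the tangent space of the whole graph, so it is conormal to
    -- every `L_n^J` through the point.
    let ξ : KernelSpace m →L[ℝ] ℝ := ContinuousLinearMap.fst ℝ ℝ _ -
      (fderiv ℝ (phaseFn m) (0, z)).comp (ContinuousLinearMap.snd ℝ ℝ _)
    have hz : ∀ i, z i.castSucc - z i.succ = -(if i ∈ J then 0 else 1) := fun i => by
      rw [← neg_sub, pointOfLinks_sub]
    have hξ : ξ ≠ 0 := fun h0 => by
      have := congrArg (fun L : KernelSpace m →L[ℝ] ℝ => L (1, 0)) h0
      simp [ξ] at this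
    have h1 : ((phase m 0 z, 0, z), ξ) ∈ conormalBundle (LJ m J) :=
      mem_conormalBundle_LJ.2 ⟨⟨sub_self _, fun i hi => by simp [hz, hi]⟩, hξ,
        fun y _ => by simp [ξ]⟩
    have h2 := (h h1).1.2 i hi
    simp only [hz] at h2
    by_contra hiJ
    simp [hiJ] at h2
  intro J J' h
  exact (key _ _ h.symm.subset).antisymm (key _ _ h.subset)

lemma ncard_range_conormalBundle_LJ :
    (Set.range fun J : Finset (Fin m) => conormalBundle (LJ m J)).ncard = 2 ^ m := by
  rw [← Set.image_univ, Set.ncard_image_of_injective _ conormalBundle_LJ_injective,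
    Set.ncard_univ, Nat.card_eq_fintype_card, Fintype.card_finset, Fintype.card_fin]

end Geometry

/-! ### Integration by parts along a direction -/

section IntegrationByParts

variable {E : Type*} [NormedAddCommGroup E] [NormedSpace ℝ E] [FiniteDimensional ℝ E]
  [MeasurableSpace E] [BorelSpace E] {μ : Measure E} [μ.IsAddHaarMeasure]

/-- The integral of a derivative along `v`, against a weight invariant along `v`, vanishes. -/
lemma integral_invariant_mul_lineDeriv_eq_zero {G h h' : E → ℂ} {v : E} {C : ℝ}
    (hG : LocallyIntegrable G μ) (hGv : ∀ x (s : ℝ), G (x + s • v) = G x)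
    (hh : HasCompactSupport h) (hc : Continuous h)
    (hlip : ∀ x (s : ℝ), ‖h (x + s • v) - h x‖ ≤ C * |s|)
    (hd : ∀ᵐ x ∂μ, HasLineDerivAt ℝ h (h' x) x v) : ∫ x, G x * h' x ∂μ = 0 := by
  have hGh : Integrable (fun x => G x * h x) μ := by
    simpa [mul_comm] using hG.integrable_smul_left_of_hasCompactSupport hc hh
  -- `G` is constant along `v`, so the two terms are translates of one another; the claim is the
  -- limit of this identity divided by s.
  have hzero : ∀ s : ℝ, ∫ x, G x * (h (x + s • v) - h x) ∂μ = 0 := by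
    intro s
    have h1 : ∀ x, G x * (h (x + s • v) - h x) = G (x + s • v) * h (x + s • v) - G x * h x := by
      intro x
      rw [hGv]
      ring
    simp_rw [h1]
    rw [integral_sub (hGh.comp_add_right (s • v)) hGh,
      integral_add_right_eq_self (fun x => G x * h x), sub_self]
  -- This compact set contains the supports of all difference quotients with 0 ≤ s ≤ 1, so one
  -- dominating function serves for all of them.
  set K : Set E := (fun p : E × ℝ => p.1 - p.2 • v) '' (tsupport h ×ˢ Set.Icc 0 1) with hK
  have hKc : IsCompact K :=
    (hh.isCompact.prod isCompact_Icc).image (by fun_prop)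
  have hKm : MeasurableSet K := hKc.measurableSet
  let s : ℕ → ℝ := fun n => 1 / ((n : ℝ) + 1)
  have hs : ∀ n, 0 < s n := fun n => Nat.one_div_pos_of_nat
  have hs1 : ∀ n, s n ≤ 1 := fun n => by
    have : (0 : ℝ) ≤ n := Nat.cast_nonneg n
    exact (div_le_one (by positivity)).2 (by linarith)
  have hlim : Tendsto (fun n => ∫ x, G x * ((s n)⁻¹ • (h (x + s n • v) - h x)) ∂μ) atTop
      (𝓝 (∫ x, G x * h' x ∂μ)) := by
    refine tendsto_integral_of_dominated_convergence (K.indicator fun x => ‖G x‖ * C) ?_ ?_ ?_ ?_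
    · intro n
      exact hG.aestronglyMeasurable.mul (Continuous.aestronglyMeasurable (by fun_prop))
    · rw [integrable_indicator_iff hKm]
      exact ((hG.integrableOn_isCompact hKc).norm).mul_const C
    · intro n
      refine Eventually.of_forall fun x => ?_
      by_cases hx : x ∈ K
      · rw [Set.indicator_of_mem hx, norm_mul, norm_smul, norm_inv, Real.norm_of_nonneg (hs n).le]
        refine mul_le_mul_of_nonneg_left ?_ (norm_nonneg _)
        rw [inv_mul_le_iff₀ (hs n), mul_comm]
        simpa [abs_of_pos (hs n)] using hlip x (s n)
      · have h1 : h x = 0 := by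
          refine image_eq_zero_of_notMem_tsupport fun h2 => hx ⟨(x, 0), ⟨h2, by simp⟩, by simp⟩
        have h3 : h (x + s n • v) = 0 := by
          refine image_eq_zero_of_notMem_tsupport fun h2 =>
            hx ⟨(x + s n • v, s n), ⟨h2, (hs n).le, hs1 n⟩, by simp⟩
        simp [h1, h3, Set.indicator_of_notMem hx]
    · filter_upwards [hd] with x hx
      refine tendsto_const_nhds.mul ?_
      have hs0 : Tendsto s atTop (𝓝[≠] 0) :=
        tendsto_nhdsWithin_iff.2 ⟨tendsto_one_div_add_atTop_nhds_zero_nat,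
          Eventually.of_forall fun n => (hs n).ne'⟩
      exact hx.tendsto_slope_zero.comp hs0
  refine tendsto_nhds_unique hlim ?_
  have : ∀ n, ∫ x, G x * ((s n)⁻¹ • (h (x + s n • v) - h x)) ∂μ = 0 := by
    intro n
    have h1 : ∀ x, G x * ((s n)⁻¹ • (h (x + s n • v) - h x)) =
        (s n)⁻¹ • (G x * (h (x + s n • v) - h x)) := fun x => mul_smul_comm _ _ _
    simp_rw [h1]
    rw [integral_smul, hzero, smul_zero]
  simp_rw [this]
  exact tendsto_const_nhds

lemma LipschitzWith.norm_sub_line_le {f : E → ℂ} {C : NNReal} (hf : LipschitzWith C f) (x v : E)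
    (s : ℝ) : ‖f (x + s • v) - f x‖ ≤ C * ‖v‖ * |s| := by
  have := hf.dist_le_mul (x + s • v) x
  rw [dist_eq_norm, dist_eq_norm, add_sub_cancel_left, norm_smul, Real.norm_eq_abs] at this
  linarith

lemma LipschitzWith.ae_hasLineDerivAt {f : E → ℂ} {C : NNReal} (hf : LipschitzWith C f) (v : E) :
    ∀ᵐ x ∂μ, HasLineDerivAt ℝ f (fderiv ℝ f x v) x v := by
  filter_upwards [hf.ae_differentiableAt (μ := μ)] with x hx
  exact hx.hasFDerivAt.hasLineDerivAt v

lemma LipschitzWith.norm_fderiv_apply_le {f : E → ℂ} {C : NNReal} (hf : LipschitzWith C f)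
    (x v : E) : ‖fderiv ℝ f x v‖ ≤ C * ‖v‖ :=
  ((fderiv ℝ f x).le_opNorm v).trans
    (mul_le_mul_of_nonneg_right (norm_fderiv_le_of_lipschitz ℝ hf) (norm_nonneg v))

lemma LipschitzWith.locallyIntegrable_fderiv_apply {f : E → ℂ} {C : NNReal}
    (hf : LipschitzWith C f) (v : E) : LocallyIntegrable (fun x => fderiv ℝ f x v) μ := by
  refine (locallyIntegrable_const ((C : ℝ) * ‖v‖)).mono
    (measurable_fderiv_apply_const ℝ f v).aestronglyMeasurable (Eventually.of_forall fun x => ?_)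
  rw [Real.norm_of_nonneg (by positivity)]
  exact hf.norm_fderiv_apply_le x v

/-- Integration by parts for Lipschitz functions, both ways. -/
lemma integral_fderiv_mul_fderiv_comm {f g : E → ℂ} {C D : NNReal} (hf : LipschitzWith C f)
    (hg : LipschitzWith D g) (hgc : HasCompactSupport g) (u v : E) :
    ∫ x, fderiv ℝ f x u * fderiv ℝ g x v ∂μ = ∫ x, fderiv ℝ f x v * fderiv ℝ g x u ∂μ := by
  have hfv := hf.locallyIntegrable_fderiv_apply (μ := μ) v
  have hgvi : Integrable (fun x => fderiv ℝ g x v) μ := by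
    refine (integrableOn_iff_integrable_of_support_subset (s := tsupport g) ?_).1
      ((hg.locallyIntegrable_fderiv_apply (μ := μ) v).integrableOn_isCompact hgc.isCompact)
    intro x hx
    by_contra h
    exact hx (by simp [fderiv_of_notMem_tsupport (𝕜 := ℝ) h])
  obtain ⟨M, hM⟩ := hgc.exists_bound_of_continuous hg.continuous
  have hgi : Integrable g μ := hg.continuous.integrable_of_hasCompactSupport hgc
  -- Second derivatives need not exist. So the derivative in `u` is replaced by a finite difference,
  -- only the derivative in `v` is integrated by parts, and the difference is moved to `g` by
  -- translation; then s → 0.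
  have key : ∀ s : ℝ, ∫ x, (f (x + s • u) - f x) * fderiv ℝ g x v ∂μ =
      ∫ x, fderiv ℝ f x v * (g x - g (x + s • (-u))) ∂μ := by
    intro s
    have hfs : LipschitzWith C fun x => f (x + s • u) :=
      LipschitzWith.of_dist_le_mul fun x y => by
        simpa using hf.dist_le_mul (x + s • u) (y + s • u)
    have hbd : ∀ x, ‖f (x + s • u) - f x‖ ≤ C * ‖u‖ * |s| := fun x => hf.norm_sub_line_le x u s
    have h0 : ∫ x, (1 : ℂ) * ((fderiv ℝ (fun x => f (x + s • u)) x v - fderiv ℝ f x v) * g x +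
        (f (x + s • u) - f x) * fderiv ℝ g x v) ∂μ = 0 := by
      refine integral_invariant_mul_lineDeriv_eq_zero (G := fun _ => 1) (v := v)
        (h := fun x => (f (x + s • u) - f x) * g x)
        -- Lipschitz constant along `v` of the product: the two copies of `f` times the bound of
        -- `g`, plus the bound of the difference times the Lipschitz bound of `g`.
        (C := 2 * (C * ‖v‖) * M + C * ‖u‖ * |s| * (D * ‖v‖)) (locallyIntegrable_const 1)
        (fun _ _ => rfl) hgc.mul_left ?_ ?_ ?_
      · exact (hfs.continuous.sub hf.continuous).mul hg.continuous
      · intro x t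
        have e : (f (x + t • v + s • u) - f (x + t • v)) * g (x + t • v) -
            (f (x + s • u) - f x) * g x =
            ((f (x + t • v + s • u) - f (x + s • u)) - (f (x + t • v) - f x)) * g (x + t • v) +
            (f (x + s • u) - f x) * (g (x + t • v) - g x) := by ring
        rw [e]
        refine (norm_add_le _ _).trans ?_
        rw [norm_mul, norm_mul]
        have a1 := hfs.norm_sub_line_le x v t
        have a2 := hf.norm_sub_line_le x v t
        have a3 := hg.norm_sub_line_le x v t
        have a4 : ‖(f (x + t • v + s • u) - f (x + s • u)) - (f (x + t • v) - f x)‖ ≤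
            2 * (C * ‖v‖) * |t| := (norm_sub_le _ _).trans (by linarith)
        have a5 := mul_le_mul a4 (hM (x + t • v)) (norm_nonneg _) (by positivity)
        have a6 := mul_le_mul (hbd x) a3 (norm_nonneg _) (by positivity)
        linarith
      · filter_upwards [hfs.ae_differentiableAt (μ := μ), hf.ae_differentiableAt (μ := μ),
          hg.ae_differentiableAt (μ := μ)] with x h1 h2 h3
        have := ((h1.hasFDerivAt.sub h2.hasFDerivAt).mul h3.hasFDerivAt).hasLineDerivAt v
        refine HasDerivAt.congr_deriv this ?_
        simp
        ring
    have hsh : ∀ x, fderiv ℝ (fun x => f (x + s • u)) x v = fderiv ℝ f (x + s • u) v := fun x => by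
      rw [fderiv_comp_add_right]
    simp only [one_mul, hsh] at h0
    have i1 : Integrable (fun x => fderiv ℝ f x v * g x) μ := by
      simpa [mul_comm] using hfv.integrable_smul_left_of_hasCompactSupport hg.continuous hgc
    have hg' : HasCompactSupport fun x => g (x + s • (-u)) :=
      hgc.comp_homeomorph (Homeomorph.addRight (s • (-u)))
    have i2 : Integrable (fun x => fderiv ℝ f x v * g (x + s • (-u))) μ := by
      simpa [mul_comm] using hfv.integrable_smul_left_of_hasCompactSupport
        (hg.continuous.comp (by fun_prop)) hg'
    have e2 : ∀ x, fderiv ℝ f (x + s • u) v * g x =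
        (fun y => fderiv ℝ f y v * g (y + s • (-u))) (x + s • u) := fun x => by simp
    have i3 : Integrable (fun x => fderiv ℝ f (x + s • u) v * g x) μ := by
      simp_rw [e2]
      exact i2.comp_add_right _
    have i4 : Integrable (fun x => (f (x + s • u) - f x) * fderiv ℝ g x v) μ :=
      hgvi.bdd_mul (hfs.continuous.sub hf.continuous).aestronglyMeasurable
        (Eventually.of_forall hbd)
    have e3 : ∫ x, fderiv ℝ f (x + s • u) v * g x ∂μ =
        ∫ x, fderiv ℝ f x v * g (x + s • (-u)) ∂μ := by
      simp_rw [e2]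
      exact integral_add_right_eq_self (fun y => fderiv ℝ f y v * g (y + s • (-u))) _
    have e4 : ∫ x, ((fderiv ℝ f (x + s • u) v - fderiv ℝ f x v) * g x +
        (f (x + s • u) - f x) * fderiv ℝ g x v) ∂μ =
        (∫ x, fderiv ℝ f (x + s • u) v * g x ∂μ - ∫ x, fderiv ℝ f x v * g x ∂μ) +
          ∫ x, (f (x + s • u) - f x) * fderiv ℝ g x v ∂μ := by
      have i5 : Integrable (fun x => fderiv ℝ f (x + s • u) v * g x - fderiv ℝ f x v * g x) μ :=
        i3.sub i1
      rw [← integral_sub i3 i1, ← integral_add i5 i4]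
      refine integral_congr_ae (Eventually.of_forall fun x => ?_)
      ring
    rw [e4, e3] at h0
    simp_rw [mul_sub]
    rw [integral_sub i1 i2]
    linear_combination h0
  let s : ℕ → ℝ := fun n => 1 / ((n : ℝ) + 1)
  have hs : ∀ n, 0 < s n := fun n => Nat.one_div_pos_of_nat
  have hs1 : ∀ n, s n ≤ 1 := fun n => by
    have : (0 : ℝ) ≤ n := Nat.cast_nonneg n
    exact (div_le_one (by positivity)).2 (by linarith)
  have hs0 : Tendsto s atTop (𝓝[≠] 0) :=
    tendsto_nhdsWithin_iff.2 ⟨tendsto_one_div_add_atTop_nhds_zero_nat,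
      Eventually.of_forall fun n => (hs n).ne'⟩
  have l1 : Tendsto (fun n => ∫ x, ((s n)⁻¹ • (f (x + s n • u) - f x)) * fderiv ℝ g x v ∂μ) atTop
      (𝓝 (∫ x, fderiv ℝ f x u * fderiv ℝ g x v ∂μ)) := by
    refine tendsto_integral_of_dominated_convergence
      (fun x => (C * ‖u‖) * ‖fderiv ℝ g x v‖) ?_ (hgvi.norm.const_mul _) ?_ ?_
    · intro n
      have hfc := hf.continuous
      exact (Continuous.aestronglyMeasurable (by fun_prop)).mul hgvi.aestronglyMeasurable
    · intro n
      refine Eventually.of_forall fun x => ?_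
      rw [norm_mul, norm_smul, norm_inv, Real.norm_of_nonneg (hs n).le]
      refine mul_le_mul_of_nonneg_right ?_ (norm_nonneg _)
      rw [inv_mul_le_iff₀ (hs n), mul_comm]
      simpa [abs_of_pos (hs n)] using hf.norm_sub_line_le x u (s n)
    · filter_upwards [hf.ae_hasLineDerivAt (μ := μ) u] with x hx
      exact (hx.tendsto_slope_zero.comp hs0).mul tendsto_const_nhds
  set K : Set E := (fun p : E × ℝ => p.1 + p.2 • u) '' (tsupport g ×ˢ Set.Icc 0 1) with hK
  have hKc : IsCompact K := (hgc.isCompact.prod isCompact_Icc).image (by fun_prop)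
  have l2 : Tendsto (fun n => ∫ x, fderiv ℝ f x v * ((s n)⁻¹ • (g x - g (x + s n • (-u)))) ∂μ)
      atTop (𝓝 (∫ x, fderiv ℝ f x v * fderiv ℝ g x u ∂μ)) := by
    refine tendsto_integral_of_dominated_convergence
      (K.indicator fun x => ‖fderiv ℝ f x v‖ * (D * ‖u‖)) ?_ ?_ ?_ ?_
    · intro n
      have hgc := hg.continuous
      exact hfv.aestronglyMeasurable.mul (Continuous.aestronglyMeasurable (by fun_prop))
    · rw [integrable_indicator_iff hKc.measurableSet]
      exact ((hfv.integrableOn_isCompact hKc).norm).mul_const _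
    · intro n
      refine Eventually.of_forall fun x => ?_
      by_cases hx : x ∈ K
      · rw [Set.indicator_of_mem hx, norm_mul, norm_smul, norm_inv, Real.norm_of_nonneg (hs n).le]
        refine mul_le_mul_of_nonneg_left ?_ (norm_nonneg _)
        rw [inv_mul_le_iff₀ (hs n), mul_comm, norm_sub_rev]
        simpa [abs_of_pos (hs n)] using hg.norm_sub_line_le x (-u) (s n)
      · have h1 : g x = 0 := by
          refine image_eq_zero_of_notMem_tsupport fun h2 => hx ⟨(x, 0), ⟨h2, by simp⟩, by simp⟩
        have h3 : g (x + s n • (-u)) = 0 := by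
          refine image_eq_zero_of_notMem_tsupport fun h2 =>
            hx ⟨(x + s n • (-u), s n), ⟨h2, (hs n).le, hs1 n⟩, by simp⟩
        rw [h1, h3, Set.indicator_of_notMem hx]
        simp
    · filter_upwards [hg.ae_differentiableAt (μ := μ)] with x hx
      refine tendsto_const_nhds.mul ?_
      have h1 := ((hx.hasFDerivAt.hasLineDerivAt (-u)).tendsto_slope_zero.comp hs0).neg
      simp only [map_neg, neg_neg] at h1
      refine h1.congr fun n => ?_
      simp only [Function.comp_apply, ← smul_neg, neg_sub]
  refine tendsto_nhds_unique l1 (l2.congr fun n => ?_)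
  have e1 : ∀ x, fderiv ℝ f x v * ((s n)⁻¹ • (g x - g (x + s n • (-u)))) =
      (s n)⁻¹ • (fderiv ℝ f x v * (g x - g (x + s n • (-u)))) := fun x => mul_smul_comm _ _ _
  have e2 : ∀ x, ((s n)⁻¹ • (f (x + s n • u) - f x)) * fderiv ℝ g x v =
      (s n)⁻¹ • ((f (x + s n • u) - f x) * fderiv ℝ g x v) := fun x => smul_mul_assoc _ _ _
  simp_rw [e1, e2]
  rw [integral_smul, integral_smul, key]

end IntegrationByParts

/-! ### The regularised Cauchy kernel -/

section Reflection

/-- The Lipschitz function equal to `1 / w` for `|w| ≥ δ` and to `conj w / δ²` for `|w| ≤ δ`. -/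
def regInv (δ : ℝ) (w : ℂ) : ℂ := conj w / ((max ‖w‖ δ ^ 2 : ℝ) : ℂ)

lemma regInv_of_le {δ : ℝ} {w : ℂ} (h : ‖w‖ ≤ δ) : regInv δ w = conj w / ((δ ^ 2 : ℝ) : ℂ) := by
  rw [regInv, max_eq_right h]

lemma regInv_of_ge {δ : ℝ} {w : ℂ} (h : δ ≤ ‖w‖) : regInv δ w = w⁻¹ := by
  rw [regInv, max_eq_left h, Complex.inv_def, Complex.normSq_eq_norm_sq]
  push_cast
  rw [div_eq_mul_inv]

/-- This bound is uniform in δ and locally integrable; it is what permits δ → 0 under the integral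
sign. -/
lemma norm_regInv_le {δ : ℝ} (hδ : 0 < δ) (w : ℂ) : ‖regInv δ w‖ ≤ ‖w‖⁻¹ := by
  rcases le_total ‖w‖ δ with h | h
  · rw [regInv_of_le h, norm_div, Complex.norm_real, Real.norm_of_nonneg (by positivity),
      RCLike.norm_conj]
    rcases eq_or_ne w 0 with rfl | hw
    · simp
    · have hw' : 0 < ‖w‖ := norm_pos_iff.2 hw
      rw [div_le_iff₀ (by positivity), inv_mul_eq_div, le_div_iff₀ hw']
      nlinarith
  · rw [regInv_of_ge h, norm_inv]

lemma norm_regInv_le_inv {δ : ℝ} (hδ : 0 < δ) (w : ℂ) : ‖regInv δ w‖ ≤ δ⁻¹ := by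
  rcases le_total ‖w‖ δ with h | h
  · rw [regInv_of_le h, norm_div, Complex.norm_real, Real.norm_of_nonneg (by positivity),
      RCLike.norm_conj, div_le_iff₀ (by positivity)]
    have : δ⁻¹ * δ ^ 2 = δ := by field_simp
    rwa [this]
  · exact (norm_regInv_le hδ w).trans (inv_anti₀ hδ h)

lemma tendsto_regInv (w : ℂ) : Tendsto (fun δ => regInv δ w) (𝓝[>] 0) (𝓝 w⁻¹) := by
  rcases eq_or_ne w 0 with rfl | hw
  · simp [regInv]
  · refine tendsto_const_nhds.congr' ?_
    have : ∀ᶠ δ in 𝓝[>] (0 : ℝ), δ < ‖w‖ :=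
      (eventually_lt_nhds (norm_pos_iff.2 hw)).filter_mono nhdsWithin_le_nhds
    filter_upwards [this] with δ hδ
    exact (regInv_of_ge hδ.le).symm

/-- Up to conjugation the map is the identity inside the unit disc and inversion in the circle
outside, so the plane is folded onto the disc without increasing distances. -/
lemma normSq_regInv_sub_le {a b : ℂ} :
    ‖regInv 1 a - regInv 1 b‖ ≤ ‖a - b‖ := by
  -- After multiplication by |b|², the difference of the squared distances factors as (|b|² -
  -- 1)(|b|² + 1 - 2 Re(a b̄)), and both factors are nonnegative since Re(a b̄) ≤ |b|.
  have mixed : ∀ a b : ℂ, ‖a‖ ≤ 1 → 1 ≤ ‖b‖ → ‖conj a - b⁻¹‖ ≤ ‖a - b‖ := by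
    intro a b ha hb
    have hb0 : b ≠ 0 := norm_pos_iff.1 (by linarith)
    rw [← abs_of_nonneg (norm_nonneg (conj a - _)), ← abs_of_nonneg (norm_nonneg (a - b)),
      ← sq_le_sq]
    have hr2 : (1 : ℝ) ≤ ‖b‖ ^ 2 := by nlinarith
    have e1 : ‖conj a - b⁻¹‖ ^ 2 * ‖b‖ ^ 2 = ‖a‖ ^ 2 * ‖b‖ ^ 2 + 1 - 2 * (a * conj b).re := by
      have : conj a - b⁻¹ = (conj a * b - 1) / b := by field_simp
      rw [this, norm_div, div_pow, div_mul_cancel₀ _ (by positivity)]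
      simp only [← Complex.normSq_eq_norm_sq, Complex.normSq_apply]
      simp
      ring
    have e2 : ‖a - b‖ ^ 2 = ‖a‖ ^ 2 + ‖b‖ ^ 2 - 2 * (a * conj b).re := by
      simp only [← Complex.normSq_eq_norm_sq, Complex.normSq_sub]
    have e3 : (a * conj b).re ≤ ‖b‖ := by
      refine (Complex.re_le_norm _).trans ?_
      rw [norm_mul, RCLike.norm_conj]
      nlinarith [norm_nonneg b]
    have e4 : ‖conj a - b⁻¹‖ ^ 2 * ‖b‖ ^ 2 ≤ ‖a - b‖ ^ 2 * ‖b‖ ^ 2 := by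
      rw [e1, e2]
      have : (‖a‖ ^ 2 + ‖b‖ ^ 2 - 2 * (a * conj b).re) * ‖b‖ ^ 2 -
          (‖a‖ ^ 2 * ‖b‖ ^ 2 + 1 - 2 * (a * conj b).re) =
          (‖b‖ ^ 2 - 1) * (‖b‖ ^ 2 + 1 - 2 * (a * conj b).re) := by ring
      nlinarith [mul_nonneg (sub_nonneg.2 hr2) (show 0 ≤ ‖b‖ ^ 2 + 1 - 2 * (a * conj b).re by
        nlinarith [sq_nonneg (‖b‖ - 1)])]
    exact le_of_mul_le_mul_right e4 (by positivity)
  rcases le_total ‖a‖ 1 with ha | ha <;> rcases le_total ‖b‖ 1 with hb | hb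
  · rw [regInv_of_le ha, regInv_of_le hb]
    simp only [one_pow, Complex.ofReal_one, div_one]
    rw [← map_sub, RCLike.norm_conj]
  · rw [regInv_of_le ha, regInv_of_ge hb]
    simpa using mixed a b ha hb
  · rw [regInv_of_ge ha, regInv_of_le hb, norm_sub_rev, norm_sub_rev a]
    simpa using mixed b a hb ha
  · rw [regInv_of_ge ha, regInv_of_ge hb]
    have ha0 : a ≠ 0 := norm_pos_iff.1 (by linarith)
    have hb0 : b ≠ 0 := norm_pos_iff.1 (by linarith)
    rw [inv_sub_inv ha0 hb0, norm_div, norm_mul, norm_sub_rev]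
    exact div_le_self (norm_nonneg _) (by nlinarith)

/-- Rescaling by δ⁻¹ reduces to radius one; the prefactor and the argument contribute one factor δ⁻¹
each. -/
lemma lipschitzWith_regInv {δ : ℝ} (hδ : 0 < δ) :
    LipschitzWith (Real.toNNReal (δ ^ 2)⁻¹) (regInv δ) := by
  refine LipschitzWith.of_dist_le_mul fun a b => ?_
  have hsc : ∀ w, regInv δ w = (δ : ℂ)⁻¹ * regInv 1 ((δ : ℂ)⁻¹ * w) := by
    intro w
    have h1 : ‖(δ : ℂ)⁻¹ * w‖ = δ⁻¹ * ‖w‖ := by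
      rw [norm_mul, norm_inv, Complex.norm_real, Real.norm_of_nonneg hδ.le]
    have hδ' : (δ : ℂ) ≠ 0 := Complex.ofReal_ne_zero.2 hδ.ne'
    rcases le_total ‖w‖ δ with h | h
    · rw [regInv_of_le h, regInv_of_le (by rw [h1, inv_mul_le_iff₀ hδ]; simpa using h)]
      simp
      field_simp
    · rw [regInv_of_ge h, regInv_of_ge (by rw [h1, le_inv_mul_iff₀ hδ]; simpa using h)]
      rw [mul_inv, inv_inv, ← mul_assoc, inv_mul_cancel₀ hδ', one_mul]
  rw [dist_eq_norm, dist_eq_norm, hsc a, hsc b, ← mul_sub, norm_mul, Real.coe_toNNReal _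
    (by positivity)]
  have h1 := normSq_regInv_sub_le (a := (δ : ℂ)⁻¹ * a) (b := (δ : ℂ)⁻¹ * b)
  rw [← mul_sub, norm_mul] at h1
  rw [norm_inv, Complex.norm_real, Real.norm_of_nonneg hδ.le] at *
  calc _ ≤ δ⁻¹ * (δ⁻¹ * ‖a - b‖) := mul_le_mul_of_nonneg_left h1 (by positivity)
    _ = _ := by rw [← mul_assoc]; congr 1; field_simp

/-! ### The derivatives of the regularised kernel. -/

/-- The conjugate differential operators `∂` and `∂̄`. -/
def dz (φ : ℂ → ℂ) (z : ℂ) : ℂ := (fderiv ℝ φ z 1 - Complex.I * fderiv ℝ φ z Complex.I) / 2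

/-- The Cauchy–Riemann operator. -/
def dbar (φ : ℂ → ℂ) (z : ℂ) : ℂ := (fderiv ℝ φ z 1 + Complex.I * fderiv ℝ φ z Complex.I) / 2

lemma hasFDerivAt_regInv_of_lt {δ : ℝ} {w : ℂ} (h : ‖w‖ < δ) :
    HasFDerivAt (regInv δ) (((δ ^ 2 : ℝ) : ℂ)⁻¹ • (Complex.conjCLE : ℂ →L[ℝ] ℂ)) w := by
  refine (((δ ^ 2 : ℝ) : ℂ)⁻¹ • (Complex.conjCLE : ℂ →L[ℝ] ℂ)).hasFDerivAt.congr_of_eventuallyEq ?_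
  filter_upwards [(isOpen_lt continuous_norm continuous_const).mem_nhds h] with v hv
  rw [regInv_of_le (le_of_lt hv), div_eq_inv_mul]
  rfl

lemma hasFDerivAt_regInv_of_gt {δ : ℝ} (hδ : 0 < δ) {w : ℂ} (h : δ < ‖w‖) :
    HasFDerivAt (regInv δ) ((-(w ^ 2)⁻¹ : ℂ) • (ContinuousLinearMap.id ℝ ℂ)) w := by
  have hw : w ≠ 0 := norm_pos_iff.1 (hδ.trans h)
  have h1 := (hasDerivAt_inv hw).complexToReal_fderiv
  refine (h1.congr_of_eventuallyEq ?_)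
  filter_upwards [(isOpen_lt continuous_const continuous_norm).mem_nhds h] with v hv
  rw [regInv_of_ge (le_of_lt hv)]

/-- The regularised kernel is antiholomorphic inside the disc and holomorphic outside. So ∂ produces
exactly the truncated kernel -w⁻², and ∂̄ a constant on the disc; being Lipschitz, it has no
singular part on the circle. -/
lemma dz_regInv_of_lt {δ : ℝ} {w : ℂ} (h : ‖w‖ < δ) : dz (regInv δ) w = 0 := by
  rw [dz, (hasFDerivAt_regInv_of_lt h).fderiv]
  simp
  ring_nf
  simp

lemma dbar_regInv_of_lt {δ : ℝ} {w : ℂ} (h : ‖w‖ < δ) :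
    dbar (regInv δ) w = ((δ ^ 2 : ℝ) : ℂ)⁻¹ := by
  rw [dbar, (hasFDerivAt_regInv_of_lt h).fderiv]
  simp
  ring_nf
  simp
  ring

lemma dz_regInv_of_gt {δ : ℝ} (hδ : 0 < δ) {w : ℂ} (h : δ < ‖w‖) :
    dz (regInv δ) w = -(w ^ 2)⁻¹ := by
  rw [dz, (hasFDerivAt_regInv_of_gt hδ h).fderiv]
  simp
  ring_nf
  simp
  ring

lemma dbar_regInv_of_gt {δ : ℝ} (hδ : 0 < δ) {w : ℂ} (h : δ < ‖w‖) :
    dbar (regInv δ) w = 0 := by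
  rw [dbar, (hasFDerivAt_regInv_of_gt hδ h).fderiv]
  simp
  ring_nf
  simp

lemma ae_norm_sub_ne (z : ℂ) (δ : ℝ) : ∀ᵐ w : ℂ, ‖w - z‖ ≠ δ := by
  rw [ae_iff]
  rcases eq_or_ne δ 0 with rfl | hδ
  · have : {a : ℂ | ¬ ‖a - z‖ ≠ 0} = {z} := by ext; simp [sub_eq_zero]
    rw [this, measure_singleton]
  · have : {a : ℂ | ¬ ‖a - z‖ ≠ δ} = Metric.sphere z δ := by
      ext
      simp
    rw [this, Measure.addHaar_sphere_of_ne_zero _ _ hδ]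

end Reflection

/-! ### The Beurling transform on `L²(ℂ)` -/

section Beurling

/-- The square integrable functions on the plane. -/
abbrev L2C : Type := Lp ℂ 2 (volume : Measure ℂ)

/-- Compactly supported Lipschitz functions. -/
def lipschitzCompact : Submodule ℂ (ℂ → ℂ) where
  carrier := {φ | (∃ C, LipschitzWith C φ) ∧ HasCompactSupport φ}
  add_mem' := fun ⟨⟨C, hC⟩, h⟩ ⟨⟨D, hD⟩, h'⟩ => ⟨⟨C + D, hC.add hD⟩, h.add h'⟩
  zero_mem' := ⟨⟨0, LipschitzWith.const 0⟩, HasCompactSupport.zero⟩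
  smul_mem' := fun c _ ⟨⟨C, hC⟩, h⟩ => ⟨⟨‖c‖₊ * C, (lipschitzWith_smul c).comp hC⟩, h.smul_left⟩

lemma memLp_fderiv_apply {φ : ℂ → ℂ} (h : φ ∈ lipschitzCompact) (v : ℂ) :
    MemLp (fun z => fderiv ℝ φ z v) 2 volume := by
  obtain ⟨⟨C, hC⟩, hc⟩ := h
  have h1 : MemLp (fun z => fderiv ℝ φ z v) ⊤ (volume : Measure ℂ) :=
    memLp_top_of_bound (measurable_fderiv_apply_const ℝ φ v).aestronglyMeasurable (C * ‖v‖)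
      (Eventually.of_forall fun x => hC.norm_fderiv_apply_le x v)
  refine h1.mono_exponent_of_measure_support_ne_top (s := tsupport φ) ?_
    hc.isCompact.measure_ne_top le_top
  intro x hx
  simp [fderiv_of_notMem_tsupport (𝕜 := ℝ) hx]

lemma memLp_dz {φ : ℂ → ℂ} (h : φ ∈ lipschitzCompact) : MemLp (dz φ) 2 volume := by
  have := ((memLp_fderiv_apply h 1).sub ((memLp_fderiv_apply h Complex.I).const_mul
    Complex.I)).const_mul (1 / 2)
  refine this.ae_eq (Eventually.of_forall fun z => ?_)
  simp only [dz, Pi.sub_apply]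
  ring

lemma memLp_dbar {φ : ℂ → ℂ} (h : φ ∈ lipschitzCompact) : MemLp (dbar φ) 2 volume := by
  have := ((memLp_fderiv_apply h 1).add ((memLp_fderiv_apply h Complex.I).const_mul
    Complex.I)).const_mul (1 / 2)
  refine this.ae_eq (Eventually.of_forall fun z => ?_)
  simp only [dbar, Pi.add_apply]
  ring

lemma ae_differentiableAt_of_mem {φ : ℂ → ℂ} (h : φ ∈ lipschitzCompact) :
    ∀ᵐ z, DifferentiableAt ℝ φ z := h.1.choose_spec.ae_differentiableAt

/-- `∂` as an operator from compactly supported Lipschitz functions to `L²`. -/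
def dzL : lipschitzCompact →ₗ[ℂ] L2C where
  toFun φ := (memLp_dz φ.2).toLp
  map_add' φ ψ := by
    rw [← MemLp.toLp_add]
    refine MemLp.toLp_congr _ _ ?_
    filter_upwards [ae_differentiableAt_of_mem φ.2, ae_differentiableAt_of_mem ψ.2] with z h1 h2
    simp only [dz, Submodule.coe_add, fderiv_add h1 h2, Pi.add_apply,
      _root_.add_apply]
    ring
  map_smul' c φ := by
    rw [RingHom.id_apply, ← MemLp.toLp_const_smul]
    refine MemLp.toLp_congr _ _ ?_
    filter_upwards [ae_differentiableAt_of_mem φ.2] with z h1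
    simp only [dz, Submodule.coe_smul, fderiv_const_smul h1, Pi.smul_apply,
      _root_.smul_apply, smul_eq_mul]
    ring

/-- `∂̄` as an operator from compactly supported Lipschitz functions to `L²`. -/
def dbarL : lipschitzCompact →ₗ[ℂ] L2C where
  toFun φ := (memLp_dbar φ.2).toLp
  map_add' φ ψ := by
    rw [← MemLp.toLp_add]
    refine MemLp.toLp_congr _ _ ?_
    filter_upwards [ae_differentiableAt_of_mem φ.2, ae_differentiableAt_of_mem ψ.2] with z h1 h2
    simp only [dbar, Submodule.coe_add, fderiv_add h1 h2, Pi.add_apply,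
      _root_.add_apply]
    ring
  map_smul' c φ := by
    rw [RingHom.id_apply, ← MemLp.toLp_const_smul]
    refine MemLp.toLp_congr _ _ ?_
    filter_upwards [ae_differentiableAt_of_mem φ.2] with z h1
    simp only [dbar, Submodule.coe_smul, fderiv_const_smul h1, Pi.smul_apply,
      _root_.smul_apply, smul_eq_mul]
    ring

lemma L2C.inner_toLp {f g : ℂ → ℂ} (hf : MemLp f 2 volume) (hg : MemLp g 2 volume) :
    inner ℂ (hf.toLp) (hg.toLp) = ∫ z, conj (f z) * g z := by
  rw [L2.inner_def]
  refine integral_congr_ae ?_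
  filter_upwards [hf.coeFn_toLp, hg.coeFn_toLp] with z h1 h2
  rw [h1, h2, RCLike.inner_apply, mul_comm]

lemma fderiv_conj (φ : ℂ → ℂ) (z v : ℂ) :
    fderiv ℝ (fun w => conj (φ w)) z v = conj (fderiv ℝ φ z v) := by
  have := Complex.conjCLE.comp_fderiv (f := φ) (x := z)
  exact congrArg (fun L : ℂ →L[ℝ] ℂ => L v) this

/-- The difference |∂φ|² - |∂̄φ|² is a multiple of ∂₁φ̄ ∂₂φ - ∂₂φ̄ ∂₁φ, whose integral vanishes by
integration by parts. This isometry is the L² boundedness of S. -/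
lemma norm_dzL (φ : lipschitzCompact) : ‖dzL φ‖ = ‖dbarL φ‖ := by
  obtain ⟨φ, hφ⟩ := φ
  have h1 : inner ℂ (dzL ⟨φ, hφ⟩) (dzL ⟨φ, hφ⟩) = inner ℂ (dbarL ⟨φ, hφ⟩) (dbarL ⟨φ, hφ⟩) := by
    change inner ℂ (memLp_dz hφ).toLp (memLp_dz hφ).toLp =
      inner ℂ (memLp_dbar hφ).toLp (memLp_dbar hφ).toLp
    rw [L2C.inner_toLp, L2C.inner_toLp, ← sub_eq_zero]
    have ha := memLp_fderiv_apply hφ 1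
    have hb := memLp_fderiv_apply hφ Complex.I
    have iz : Integrable (fun z => conj (dz φ z) * dz φ z) :=
      (memLp_dz hφ).star.integrable_mul (memLp_dz hφ)
    have ib : Integrable (fun z => conj (dbar φ z) * dbar φ z) :=
      (memLp_dbar hφ).star.integrable_mul (memLp_dbar hφ)
    rw [← integral_sub iz ib]
    obtain ⟨⟨C, hC⟩, hc⟩ := hφ
    have hCs : LipschitzWith C fun w => conj (φ w) := by
      simpa [Function.comp_def] using Complex.isometry_conj.lipschitz.comp hC
    have key := integral_fderiv_mul_fderiv_comm (μ := (volume : Measure ℂ)) hCs hC hc 1 Complex.I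
    simp only [fderiv_conj] at key
    have i1 : Integrable (fun z => conj (fderiv ℝ φ z 1) * fderiv ℝ φ z Complex.I) :=
      ha.star.integrable_mul hb
    have i2 : Integrable (fun z => conj (fderiv ℝ φ z Complex.I) * fderiv ℝ φ z 1) :=
      hb.star.integrable_mul ha
    have e : ∀ z, conj (dz φ z) * dz φ z - conj (dbar φ z) * dbar φ z =
        -(Complex.I / 2) * (conj (fderiv ℝ φ z 1) * fderiv ℝ φ z Complex.I -
          conj (fderiv ℝ φ z Complex.I) * fderiv ℝ φ z 1) := by
      intro z
      simp only [dz, dbar, map_div₀, map_sub, map_add, map_mul, Complex.conj_I, map_ofNat]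
      ring
    simp_rw [e]
    rw [integral_const_mul, integral_sub i1 i2, key, sub_self, mul_zero]
  have h2 := congrArg Complex.re h1
  simp only [inner_self_eq_norm_sq_to_K] at h2
  have h3 : ‖dzL ⟨φ, hφ⟩‖ ^ 2 = ‖dbarL ⟨φ, hφ⟩‖ ^ 2 := by exact_mod_cast h2
  exact (sq_eq_sq₀ (norm_nonneg _) (norm_nonneg _)).1 h3

/-- The regularised Cauchy kernel based at `z`. -/
lemma lipschitzWith_regInv_sub {δ : ℝ} (hδ : 0 < δ) (z : ℂ) :
    LipschitzWith (Real.toNNReal (δ ^ 2)⁻¹) fun w => regInv δ (w - z) :=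
  LipschitzWith.of_dist_le_mul fun a b => by
    simpa using (lipschitzWith_regInv hδ).dist_le_mul (a - z) (b - z)

lemma dz_comp_sub (f : ℂ → ℂ) (z w : ℂ) : dz (fun w => f (w - z)) w = dz f (w - z) := by
  simp only [dz, sub_eq_add_neg, fderiv_comp_add_right]

lemma dbar_comp_sub (f : ℂ → ℂ) (z w : ℂ) : dbar (fun w => f (w - z)) w = dbar f (w - z) := by
  simp only [dbar, sub_eq_add_neg, fderiv_comp_add_right]

lemma ae_dz_regInv {δ : ℝ} (hδ : 0 < δ) (z : ℂ) : ∀ᵐ w, dz (fun w => regInv δ (w - z)) w =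
    {w | δ < ‖w - z‖}.indicator (fun w => -((w - z) ^ 2)⁻¹) w := by
  filter_upwards [ae_norm_sub_ne z δ] with w hw
  rw [dz_comp_sub]
  rcases lt_or_gt_of_ne hw with h | h
  · rw [dz_regInv_of_lt h, Set.indicator_of_notMem (by simpa using h.le)]
  · rw [dz_regInv_of_gt hδ h, Set.indicator_of_mem (by simpa using h)]

lemma ae_dbar_regInv {δ : ℝ} (hδ : 0 < δ) (z : ℂ) : ∀ᵐ w, dbar (fun w => regInv δ (w - z)) w =
    (Metric.closedBall z δ).indicator (fun _ => ((δ ^ 2 : ℝ) : ℂ)⁻¹) w := by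
  filter_upwards [ae_norm_sub_ne z δ] with w hw
  rw [dbar_comp_sub]
  rcases lt_or_gt_of_ne hw with h | h
  · rw [dbar_regInv_of_lt h, Set.indicator_of_mem (by simpa [dist_eq_norm] using h.le)]
  · rw [dbar_regInv_of_gt hδ h, Set.indicator_of_notMem (by simpa [dist_eq_norm] using h)]

/-- The average over a disc, times `π`. -/
def discFun (z : ℂ) (δ : ℝ) : ℂ → ℂ :=
  (Metric.closedBall z δ).indicator fun _ => ((δ ^ 2 : ℝ) : ℂ)⁻¹

/-- The truncated kernel of the Beurling transform. -/
def cutKernel (z : ℂ) (δ : ℝ) : ℂ → ℂ :=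
  {w | δ < ‖w - z‖}.indicator fun w => -((w - z) ^ 2)⁻¹

lemma memLp_discFun (z : ℂ) (δ : ℝ) : MemLp (discFun z δ) 2 volume :=
  memLp_indicator_const _ Metric.isClosed_closedBall.measurableSet _
    (Or.inr measure_closedBall_lt_top.ne)

lemma measurable_cutKernel (z : ℂ) (δ : ℝ) : Measurable (cutKernel z δ) :=
  Measurable.indicator (by fun_prop) (measurableSet_lt measurable_const (by fun_prop))

lemma memLp_cutKernel (z : ℂ) {δ : ℝ} (hδ : 0 < δ) : MemLp (cutKernel z δ) 2 volume := by
  rw [memLp_two_iff_integrable_sq_norm (measurable_cutKernel z δ).aestronglyMeasurable]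
  -- If δ < |x| then 1 + |x| ≤ (1 + δ⁻¹)|x|, so |x|⁻⁴ is at most (1 + δ⁻¹)⁴ (1 + |x|)⁻⁴.
  have h := ((integrable_one_add_norm (E := ℂ) (μ := volume) (r := 4)
    (by simp; norm_num)).comp_sub_right z).const_mul ((1 + δ⁻¹) ^ 4)
  refine h.mono' ((measurable_cutKernel z δ).norm.pow_const 2).aestronglyMeasurable
    (Eventually.of_forall fun w => ?_)
  by_cases hw : δ < ‖w - z‖
  · have hp : 0 < ‖w - z‖ := hδ.trans hw
    rw [cutKernel, Set.indicator_of_mem (by simpa using hw)]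
    rw [Real.norm_of_nonneg (by positivity), norm_neg, norm_inv, norm_pow, ← inv_pow, ← pow_mul]
    have e : (1 + ‖w - z‖) ^ (-4 : ℝ) = ((1 + ‖w - z‖)⁻¹) ^ 4 := by
      rw [Real.rpow_neg (by positivity), inv_pow]
      norm_cast
    rw [e, ← mul_pow]
    refine pow_le_pow_left₀ (by positivity) ?_ 4
    rw [← div_eq_mul_inv, le_div_iff₀ (by positivity), inv_mul_le_iff₀ hp]
    have : 1 ≤ δ⁻¹ * ‖w - z‖ := by
      rw [le_inv_mul_iff₀ hδ]
      simpa using hw.le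
    nlinarith
  · rw [cutKernel, Set.indicator_of_notMem (by simpa using hw)]
    simp only [norm_zero, ne_eq, OfNat.ofNat_ne_zero, not_false_eq_true, zero_pow]
    positivity

/-- The truncated Beurling transform of `∂̄φ` is the disc average of `∂φ`. -/
lemma integral_cutKernel_mul_dbar {φ : ℂ → ℂ} (h : φ ∈ lipschitzCompact) (z : ℂ) {δ : ℝ}
    (hδ : 0 < δ) : ∫ w, cutKernel z δ w * dbar φ w = ∫ w, discFun z δ w * dz φ w := by
  have hL := lipschitzWith_regInv_sub hδ z
  obtain ⟨⟨C, hC⟩, hc⟩ := id h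
  have key := integral_fderiv_mul_fderiv_comm (μ := (volume : Measure ℂ)) hL hC hc 1 Complex.I
  have e1 : ∫ w, cutKernel z δ w * dbar φ w =
      ∫ w, dz (fun w => regInv δ (w - z)) w * dbar φ w := by
    refine integral_congr_ae ?_
    filter_upwards [ae_dz_regInv hδ z] with w hw
    rw [hw, cutKernel]
  have e2 : ∫ w, discFun z δ w * dz φ w =
      ∫ w, dbar (fun w => regInv δ (w - z)) w * dz φ w := by
    refine integral_congr_ae ?_
    filter_upwards [ae_dbar_regInv hδ z] with w hw
    rw [hw, discFun]
  have iz : Integrable (fun w => dz (fun w => regInv δ (w - z)) w * dbar φ w) :=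
    ((memLp_cutKernel z hδ).integrable_mul (memLp_dbar h)).congr (by
      filter_upwards [ae_dz_regInv hδ z] with w hw
      rw [hw, Pi.mul_apply, cutKernel])
  have ib : Integrable (fun w => dbar (fun w => regInv δ (w - z)) w * dz φ w) :=
    ((memLp_discFun z δ).integrable_mul (memLp_dz h)).congr (by
      filter_upwards [ae_dbar_regInv hδ z] with w hw
      rw [hw, Pi.mul_apply, discFun])
  have hbb : ∀ v u, Integrable fun w =>
      fderiv ℝ (fun w => regInv δ (w - z)) w v * fderiv ℝ φ w u := by
    intro v u
    refine Integrable.bdd_mul (c := Real.toNNReal (δ ^ 2)⁻¹ * ‖v‖) ?_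
      (measurable_fderiv_apply_const ℝ _ v).aestronglyMeasurable
      (Eventually.of_forall fun x => hL.norm_fderiv_apply_le x v)
    refine (integrableOn_iff_integrable_of_support_subset (s := tsupport φ) ?_).1
      ((hC.locallyIntegrable_fderiv_apply (μ := volume) u).integrableOn_isCompact hc.isCompact)
    intro x hx
    by_contra h'
    exact hx (by simp [fderiv_of_notMem_tsupport (𝕜 := ℝ) h'])
  rw [e1, e2, ← sub_eq_zero, ← integral_sub iz ib]
  have e : ∀ w, dz (fun w => regInv δ (w - z)) w * dbar φ w -
      dbar (fun w => regInv δ (w - z)) w * dz φ w =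
      (Complex.I / 2) * (fderiv ℝ (fun w => regInv δ (w - z)) w 1 * fderiv ℝ φ w Complex.I -
        fderiv ℝ (fun w => regInv δ (w - z)) w Complex.I * fderiv ℝ φ w 1) := by
    intro w
    simp only [dz, dbar]
    ring
  simp_rw [e]
  rw [integral_const_mul, integral_sub (hbb _ _) (hbb _ _), key, sub_self, mul_zero]

/-! ### Density of the range of ∂̄. -/

/-- A function whose averages over discs vanish is zero. -/
lemma L2C.eq_zero_of_setIntegral_closedBall {g : L2C}
    (h : ∀ z : ℂ, ∀ δ > 0, ∫ w in Metric.closedBall z δ, g w = 0) : g = 0 := by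
  rw [Lp.eq_zero_iff_ae_eq_zero]
  have hg : LocallyIntegrable g volume := (Lp.memLp g).locallyIntegrable (by norm_num)
  filter_upwards [IsUnifLocDoublingMeasure.ae_tendsto_average volume hg 1] with z hz
  have h1 := hz (l := 𝓝[>] (0 : ℝ)) (fun _ => z) id tendsto_id (by
    filter_upwards [self_mem_nhdsWithin] with δ hδ
    simpa using (le_of_lt hδ : (0 : ℝ) ≤ δ))
  refine tendsto_nhds_unique h1 (tendsto_const_nhds.congr' ?_)
  filter_upwards [self_mem_nhdsWithin] with δ hδ
  rw [setAverage_eq, id, h z δ hδ, smul_zero]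
  rfl

/-- Far from `z` both terms equal 1/(w - z) and cancel. These differences are the test functions for
the density of the range of ∂̄. -/
lemma regInv_sub_mem_lipschitzCompact (z : ℂ) {δ R : ℝ} (hδ : 0 < δ) (hR : 0 < R) :
    ((fun w => regInv δ (w - z)) - fun w => regInv R (w - z)) ∈ lipschitzCompact := by
  refine ⟨⟨_, (lipschitzWith_regInv_sub hδ z).sub (lipschitzWith_regInv_sub hR z)⟩, ?_⟩
  refine HasCompactSupport.intro (isCompact_closedBall z (max δ R)) fun w hw => ?_
  rw [Metric.mem_closedBall, dist_eq_norm, not_le, max_lt_iff] at hw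
  rw [Pi.sub_apply, regInv_of_ge hw.1.le, regInv_of_ge hw.2.le, sub_self]

lemma dbar_regInv_sub_ae (z : ℂ) {δ R : ℝ} (hδ : 0 < δ) (hR : 0 < R) :
    dbar ((fun w => regInv δ (w - z)) - fun w => regInv R (w - z)) =ᵐ[volume]
      fun w => discFun z δ w - discFun z R w := by
  filter_upwards [ae_dbar_regInv hδ z, ae_dbar_regInv hR z,
    (lipschitzWith_regInv_sub hδ z).ae_differentiableAt (μ := volume),
    (lipschitzWith_regInv_sub hR z).ae_differentiableAt (μ := volume)] with w h1 h2 h3 h4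
  rw [discFun, discFun, ← h1, ← h2]
  simp only [dbar]
  rw [fderiv_sub h3 h4]
  simp only [_root_.sub_apply]
  ring

lemma L2C.norm_toLp_discFun (z : ℂ) {R : ℝ} (hR : 0 < R) :
    ‖(memLp_discFun z R).toLp‖ ≤ 2 * R⁻¹ := by
  have h : ‖(memLp_discFun z R).toLp‖ ^ 2 = Real.pi * R⁻¹ ^ 2 := by
    have := inner_self_eq_norm_sq_to_K (𝕜 := ℂ) (memLp_discFun z R).toLp
    rw [L2C.inner_toLp] at this
    generalize ‖(memLp_discFun z R).toLp‖ = N at this ⊢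
    have e : ∀ w, conj (discFun z R w) * discFun z R w =
        (Metric.closedBall z R).indicator (fun _ => (((R ^ 2)⁻¹ ^ 2 : ℝ) : ℂ)) w := by
      intro w
      by_cases hw : w ∈ Metric.closedBall z R
      · simp only [discFun, Set.indicator_of_mem hw, ← Complex.ofReal_inv, Complex.conj_ofReal]
        push_cast
        ring
      · simp only [discFun, Set.indicator_of_notMem hw, mul_zero]
    simp_rw [e] at this
    rw [integral_indicator Metric.isClosed_closedBall.measurableSet, setIntegral_const,
      measureReal_def, Complex.volume_closedBall] at this
    simp only [ENNReal.toReal_mul, ENNReal.toReal_pow, ENNReal.toReal_ofReal hR.le] at this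
    simp at this
    have h3 : (R ^ 2 * Real.pi * ((R ^ 2) ^ 2)⁻¹ : ℝ) = N ^ 2 := by
      exact_mod_cast this
    rw [← h3]
    field_simp
  -- The exact norm is √π R⁻¹, and π ≤ 4 gives the constant 2; only the decay as R grows matters.
  have h2 : ‖(memLp_discFun z R).toLp‖ ^ 2 ≤ (2 * R⁻¹) ^ 2 := by
    rw [h, mul_pow]
    have := Real.pi_le_four
    gcongr
    linarith
  exact (sq_le_sq₀ (norm_nonneg _) (by positivity)).1 h2

lemma L2C.inner_discFun (z : ℂ) (δ : ℝ) (g : L2C) :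
    inner ℂ (memLp_discFun z δ).toLp g =
      ((δ ^ 2 : ℝ) : ℂ)⁻¹ * ∫ w in Metric.closedBall z δ, g w := by
  conv_lhs => rw [← Lp.toLp_coeFn g (Lp.memLp g), L2C.inner_toLp]
  rw [← integral_const_mul, ← integral_indicator Metric.isClosed_closedBall.measurableSet]
  refine integral_congr_ae (Eventually.of_forall fun w => ?_)
  by_cases hw : w ∈ Metric.closedBall z δ
  · simp only [discFun, Set.indicator_of_mem hw, ← Complex.ofReal_inv, Complex.conj_ofReal]
  · simp only [discFun, Set.indicator_of_notMem hw, map_zero, zero_mul]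

/-- A function orthogonal to the range has the same pairing with the disc functions of all radii,
because their differences are in the range. The norm of the disc function of radius R is O(1/R), so
the common value is zero and all integrals over discs vanish. -/
lemma denseRange_dbarL : DenseRange dbarL := by
  rw [DenseRange, ← LinearMap.coe_range, Submodule.dense_iff_topologicalClosure_eq_top, Submodule.topologicalClosure_eq_top_iff,
    Submodule.eq_bot_iff]
  intro g hg
  refine L2C.eq_zero_of_setIntegral_closedBall fun z δ hδ => ?_
  have hconst : ∀ R > 0, inner ℂ (memLp_discFun z δ).toLp g = inner ℂ (memLp_discFun z R).toLp g := by
    intro R hR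
    have h0 := (Submodule.mem_orthogonal _ _).1 hg
      (dbarL ⟨_, regInv_sub_mem_lipschitzCompact z hδ hR⟩) ⟨_, rfl⟩
    have h1 : dbarL ⟨_, regInv_sub_mem_lipschitzCompact z hδ hR⟩ =
        (memLp_discFun z δ).toLp - (memLp_discFun z R).toLp := by
      rw [← MemLp.toLp_sub]
      exact MemLp.toLp_congr (memLp_dbar (regInv_sub_mem_lipschitzCompact z hδ hR)) _
        (dbar_regInv_sub_ae z hδ hR)
    rw [h1, inner_sub_left, sub_eq_zero] at h0
    exact h0
  have hzero : inner ℂ (memLp_discFun z δ).toLp g = 0 := by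
    have hlim : Tendsto (fun R : ℝ => 2 * R⁻¹ * ‖g‖) atTop (𝓝 0) := by
      simpa using (tendsto_inv_atTop_zero.const_mul (2 : ℝ)).mul_const ‖g‖
    have hle : ∀ᶠ R : ℝ in atTop, ‖inner ℂ (memLp_discFun z δ).toLp g‖ ≤ 2 * R⁻¹ * ‖g‖ := by
      filter_upwards [eventually_gt_atTop 0] with R hR
      rw [hconst R hR]
      exact (norm_inner_le_norm _ _).trans
        (mul_le_mul_of_nonneg_right (L2C.norm_toLp_discFun z hR) (norm_nonneg _))
    exact norm_le_zero_iff.1 (ge_of_tendsto hlim hle)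
  rw [L2C.inner_discFun] at hzero
  have hne : ((δ ^ 2 : ℝ) : ℂ)⁻¹ ≠ 0 := by
    have : δ ≠ 0 := ne_of_gt hδ
    simp [this]
  exact (mul_eq_zero.1 hzero).resolve_left hne

/-! ### The Beurling transform and its principal values. -/

/-- The Beurling transform on `L²`. -/
def beurlingL : L2C →L[ℂ] L2C := dzL.extendOfNorm dbarL

lemma beurlingL_dbarL (φ : lipschitzCompact) : beurlingL (dbarL φ) = dzL φ :=
  LinearMap.extendOfNorm_eq denseRange_dbarL ⟨1, fun φ => by rw [one_mul, norm_dzL]⟩ φ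

lemma MeasureTheory.MemLp.conj {f : ℂ → ℂ} (hf : MemLp f 2 volume) :
    MemLp (fun z => conj (f z)) 2 volume := hf.star

/-- The truncated Beurling transform is the disc average of the Beurling transform. -/
lemma integral_cutKernel_mul (f : L2C) (z : ℂ) {δ : ℝ} (hδ : 0 < δ) :
    ∫ w, cutKernel z δ w * f w = ((δ ^ 2 : ℝ) : ℂ)⁻¹ * ∫ w in Metric.closedBall z δ, beurlingL f w := by
  have hk := memLp_cutKernel z hδ
  have key : inner ℂ hk.conj.toLp f =
      inner ℂ (memLp_discFun z δ).toLp (beurlingL f) := by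
    -- Both sides are continuous in `f`, so it suffices to take f = ∂̄φ, where the identity is
    -- integration by parts against the regularised kernel.
    refine denseRange_dbarL.induction_on (p := fun f : L2C => inner ℂ hk.conj.toLp f =
      inner ℂ (memLp_discFun z δ).toLp (beurlingL f)) f ?_ ?_
    · exact isClosed_eq (by fun_prop) (by fun_prop)
    · intro φ
      rw [beurlingL_dbarL]
      change inner ℂ hk.conj.toLp (memLp_dbar φ.2).toLp =
        inner ℂ (memLp_discFun z δ).toLp (memLp_dz φ.2).toLp
      rw [L2C.inner_toLp, L2C.inner_toLp]
      simp only [RingHomCompTriple.comp_apply, RingHom.id_apply]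
      rw [integral_cutKernel_mul_dbar φ.2 z hδ]
      refine integral_congr_ae (Eventually.of_forall fun w => ?_)
      by_cases hw : w ∈ Metric.closedBall z δ
      · simp only [discFun, Set.indicator_of_mem hw, ← Complex.ofReal_inv, Complex.conj_ofReal]
      · simp only [discFun, Set.indicator_of_notMem hw, map_zero]
  have h := key
  rw [L2C.inner_discFun] at h
  rw [← h]
  conv_rhs => rw [← Lp.toLp_coeFn f (Lp.memLp f), L2C.inner_toLp]
  simp

/-- The truncated principal value. -/
lemma truncated_beurling_eq (f : L2C) (z : ℂ) {δ : ℝ} (hδ : 0 < δ) :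
    -(1 / (Real.pi : ℂ)) * ∫ w in {w : ℂ | δ < ‖w - z‖}, f w / (w - z) ^ 2 =
      ⨍ w in Metric.closedBall z δ, beurlingL f w := by
  have hm : MeasurableSet {w : ℂ | δ < ‖w - z‖} := measurableSet_lt measurable_const (by fun_prop)
  have h := integral_cutKernel_mul f z hδ
  have e : ∀ w, cutKernel z δ w * f w =
      -({w : ℂ | δ < ‖w - z‖}.indicator (fun w => f w / (w - z) ^ 2) w) := by
    intro w
    by_cases hw : w ∈ {w : ℂ | δ < ‖w - z‖}
    · simp only [cutKernel, Set.indicator_of_mem hw]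
      ring
    · simp only [cutKernel, Set.indicator_of_notMem hw]
      ring
  simp_rw [e] at h
  rw [integral_neg, integral_indicator hm] at h
  rw [setAverage_eq, measureReal_def, Complex.volume_closedBall]
  simp only [ENNReal.toReal_mul, ENNReal.toReal_pow, ENNReal.toReal_ofReal hδ.le]
  rw [neg_mul, ← mul_neg, h]
  simp [NNReal.coe_real_pi]
  ring

/-- Since truncations are exact disc averages of the transform, Lebesgue's differentiation theorem
suffices and no maximal singular integral is needed. -/
lemma ae_tendsto_truncated_beurling (f : L2C) : ∀ᵐ z, Tendsto (fun δ : ℝ =>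
    -(1 / (Real.pi : ℂ)) * ∫ w in {w : ℂ | δ < ‖w - z‖}, f w / (w - z) ^ 2) (𝓝[>] 0)
    (𝓝 (beurlingL f z)) := by
  have hg : LocallyIntegrable (beurlingL f) volume :=
    (Lp.memLp (beurlingL f)).locallyIntegrable (by norm_num)
  filter_upwards [IsUnifLocDoublingMeasure.ae_tendsto_average volume hg 1] with z hz
  have h1 := hz (l := 𝓝[>] (0 : ℝ)) (fun _ => z) id tendsto_id (by
    filter_upwards [self_mem_nhdsWithin] with δ hδ
    simpa using (le_of_lt hδ : (0 : ℝ) ≤ δ))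
  refine h1.congr' ?_
  filter_upwards [self_mem_nhdsWithin] with δ hδ
  exact (truncated_beurling_eq f z hδ).symm

/-- The principal value integral computes the Beurling transform on `L²`. -/
lemma beurlingS_ae_eq {f : ℂ → ℂ} (F : L2C) (hf : f =ᵐ[volume] F) :
    beurlingS f =ᵐ[volume] beurlingL F := by
  filter_upwards [ae_tendsto_truncated_beurling F] with z hz
  rw [beurlingS]
  refine Tendsto.limUnder_eq (hz.congr fun δ => ?_)
  congr 1
  refine integral_congr_ae (ae_restrict_of_ae ?_)
  filter_upwards [hf] with w hw
  rw [hw]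

end Beurling

/-! ### Convolution of `L²` functions with integrable kernels -/

section Convolution

open scoped ENNReal

/-- Cauchy–Schwarz for k = √k · √k, with one square root attached to `g`. -/
lemma ENNReal.sq_lintegral_mul_le {α : Type*} [MeasurableSpace α] {μ : Measure α}
    {k g : α → ℝ≥0∞} (hk : AEMeasurable k μ) (hg : AEMeasurable g μ) :
    (∫⁻ w, k w * g w ∂μ) ^ 2 ≤ (∫⁻ w, k w ∂μ) * ∫⁻ w, k w * g w ^ 2 ∂μ := by
  have h := ENNReal.lintegral_mul_le_Lp_mul_Lq μ Real.HolderConjugate.two_two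
    (hk.pow_const (1 / 2 : ℝ)) ((hk.pow_const (1 / 2 : ℝ)).mul hg)
  have e0 : ∀ x : ℝ≥0∞, x ^ (1 / 2 : ℝ) * x ^ (1 / 2 : ℝ) = x := fun x => by
    rw [← ENNReal.rpow_add_of_nonneg _ _ (by norm_num) (by norm_num)]
    norm_num
  have e1 : ∀ w, ((fun w => k w ^ (1 / 2 : ℝ)) * ((fun w => k w ^ (1 / 2 : ℝ)) * g)) w =
      k w * g w := fun w => by
    simp only [Pi.mul_apply]
    rw [← mul_assoc, e0]
  have e2 : ∀ w, (k w ^ (1 / 2 : ℝ)) ^ (2 : ℝ) = k w := fun w => by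
    rw [← ENNReal.rpow_mul]
    norm_num
  have e3 : ∀ w, (((fun w => k w ^ (1 / 2 : ℝ)) * g) w) ^ (2 : ℝ) = k w * g w ^ 2 := fun w => by
    rw [Pi.mul_apply, ENNReal.mul_rpow_of_nonneg _ _ (by norm_num), e2, ENNReal.rpow_two]
  simp only [e1, e2, e3] at h
  calc _ ≤ ((∫⁻ w, k w ∂μ) ^ (1 / 2 : ℝ) * (∫⁻ w, k w * g w ^ 2 ∂μ) ^ (1 / 2 : ℝ)) ^ 2 := by
        gcongr
    _ = _ := by
      rw [mul_pow, sq, sq, e0, e0]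

/-- Young's inequality `L¹ * L² ⊂ L²` for nonnegative functions. -/
lemma lintegral_sq_conv_le {k g : ℂ → ℝ≥0∞} (hk : Measurable k) (hg : Measurable g) :
    ∫⁻ z : ℂ, (∫⁻ w, k (w - z) * g w) ^ 2 ≤ (∫⁻ w, k w) ^ 2 * ∫⁻ w, g w ^ 2 := by
  have hm : Measurable fun p : ℂ × ℂ => k (p.2 - p.1) * g p.2 ^ 2 :=
    (hk.comp (measurable_snd.sub measurable_fst)).mul ((hg.comp measurable_snd).pow_const 2)
  calc ∫⁻ z : ℂ, (∫⁻ w, k (w - z) * g w) ^ 2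
      ≤ ∫⁻ z : ℂ, (∫⁻ w, k w) * ∫⁻ w, k (w - z) * g w ^ 2 := by
        refine lintegral_mono fun z => ?_
        have h := ENNReal.sq_lintegral_mul_le (μ := (volume : Measure ℂ))
          (hk.comp (measurable_id.sub_const z)).aemeasurable hg.aemeasurable
        have e : ∫⁻ w, k (w - z) = ∫⁻ w, k w := lintegral_sub_right_eq_self k z
        simp only [Function.comp_apply, id] at h
        rwa [e] at h
    _ = (∫⁻ w, k w) * ∫⁻ w, ∫⁻ z : ℂ, k (w - z) * g w ^ 2 := by
        rw [lintegral_const_mul _ hm.lintegral_prod_right', lintegral_lintegral_swap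
          hm.aemeasurable]
    _ = (∫⁻ w, k w) * ∫⁻ w, (∫⁻ z, k z) * g w ^ 2 := by
        congr 1
        refine lintegral_congr fun w => ?_
        rw [lintegral_mul_const _ (show Measurable fun z => k (w - z) from
          hk.comp (measurable_const.sub measurable_id)),
          lintegral_sub_left_eq_self k w]
    _ = _ := by
        rw [lintegral_const_mul _ (hg.pow_const 2), sq, mul_assoc]

lemma eLpNorm_two_sq {f : ℂ → ℂ} : eLpNorm f 2 volume ^ 2 = ∫⁻ w, ‖f w‖ₑ ^ 2 := by
  have := eLpNorm_nnreal_pow_eq_lintegral (f := f) (μ := volume) (p := 2) (by norm_num)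
  simpa using this

variable {κ : ℂ → ℂ}

/-- Young's inequality for absolute values gives the bound, and its finiteness gives absolute
convergence for almost every z. The kernel is evaluated at w - z, as in the definitions of P and S.
-/
lemma conv_core (hκ : Measurable κ) (hκi : Integrable κ) {f : ℂ → ℂ} (hf : Measurable f)
    (hf2 : MemLp f 2 volume) :
    (∀ᵐ z, Integrable fun w => κ (w - z) * f w) ∧
    MemLp (fun z => ∫ w, κ (w - z) * f w) 2 volume ∧
    eLpNorm (fun z => ∫ w, κ (w - z) * f w) 2 volume ≤
      ENNReal.ofReal (∫ w, ‖κ w‖) * eLpNorm f 2 volume := by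
  have hm : Measurable fun p : ℂ × ℂ => κ (p.2 - p.1) * f p.2 :=
    (hκ.comp (measurable_snd.sub measurable_fst)).mul (hf.comp measurable_snd)
  have h1 := lintegral_sq_conv_le hκ.enorm hf.enorm
  have hN : ∫⁻ w, ‖κ w‖ₑ = ENNReal.ofReal (∫ w, ‖κ w‖) :=
    (ofReal_integral_norm_eq_lintegral_enorm hκi).symm
  rw [← eLpNorm_two_sq, hN, ← mul_pow] at h1
  have hfin : (ENNReal.ofReal (∫ w, ‖κ w‖) * eLpNorm f 2 volume) ^ 2 < ⊤ :=
    ENNReal.pow_lt_top (ENNReal.mul_lt_top ENNReal.ofReal_lt_top hf2.eLpNorm_lt_top)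
  have hm2 : Measurable fun z : ℂ => ∫⁻ w, ‖κ (w - z)‖ₑ * ‖f w‖ₑ := by
    have : Measurable fun p : ℂ × ℂ => ‖κ (p.2 - p.1)‖ₑ * ‖f p.2‖ₑ :=
      (hκ.comp (measurable_snd.sub measurable_fst)).enorm.mul (hf.comp measurable_snd).enorm
    exact this.lintegral_prod_right'
  have hae := ae_lt_top (hm2.pow_const 2) (h1.trans_lt hfin).ne
  have hbound : eLpNorm (fun z => ∫ w, κ (w - z) * f w) 2 volume ≤
      ENNReal.ofReal (∫ w, ‖κ w‖) * eLpNorm f 2 volume := by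
    rw [← ENNReal.pow_le_pow_left_iff two_ne_zero, eLpNorm_two_sq]
    refine (lintegral_mono fun z => ?_).trans h1
    gcongr
    refine (enorm_integral_le_lintegral_enorm _).trans_eq ?_
    simp only [enorm_mul]
  refine ⟨?_, ⟨?_, ?_⟩, hbound⟩
  · filter_upwards [hae] with z hz
    refine ⟨(hm.comp measurable_prodMk_left).aestronglyMeasurable, ?_⟩
    rw [HasFiniteIntegral]
    simp only [enorm_mul]
    exact (ENNReal.pow_lt_top_iff.1 hz).resolve_right (by norm_num)
  · exact hm.stronglyMeasurable.integral_prod_right'.aestronglyMeasurable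
  · exact hbound.trans_lt (ENNReal.mul_lt_top ENNReal.ofReal_lt_top hf2.eLpNorm_lt_top)

lemma conv_core_Lp (hκ : Measurable κ) (hκi : Integrable κ) (F : L2C) :
    (∀ᵐ z, Integrable fun w => κ (w - z) * F w) ∧
    MemLp (fun z => ∫ w, κ (w - z) * F w) 2 volume ∧
    eLpNorm (fun z => ∫ w, κ (w - z) * F w) 2 volume ≤
      ENNReal.ofReal (∫ w, ‖κ w‖) * eLpNorm F 2 volume :=
  conv_core hκ hκi (Lp.stronglyMeasurable F).measurable (Lp.memLp F)

/-- The operator `f ↦ ∫ κ(w - z) f(w) dw` on `L²`. -/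
def convL (κ : ℂ → ℂ) (hκ : Measurable κ) (hκi : Integrable κ) : L2C →L[ℂ] L2C :=
  LinearMap.mkContinuous
    { toFun := fun F => (conv_core_Lp hκ hκi F).2.1.toLp
      map_add' := fun F G => by
        rw [← MemLp.toLp_add]
        refine MemLp.toLp_congr _ _ ?_
        filter_upwards [(conv_core_Lp hκ hκi F).1, (conv_core_Lp hκ hκi G).1] with z h1 h2
        rw [Pi.add_apply, ← integral_add h1 h2]
        refine integral_congr_ae ?_
        filter_upwards [Lp.coeFn_add F G] with w hw
        rw [hw, Pi.add_apply, mul_add]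
      map_smul' := fun c F => by
        rw [RingHom.id_apply, ← MemLp.toLp_const_smul]
        refine MemLp.toLp_congr _ _ (Eventually.of_forall fun z => ?_)
        simp only [Pi.smul_apply]
        rw [smul_eq_mul, ← integral_const_mul]
        refine integral_congr_ae ?_
        filter_upwards [Lp.coeFn_smul c F] with w hw
        rw [hw, Pi.smul_apply, smul_eq_mul]
        ring }
    (∫ w, ‖κ w‖) fun F => by
      change ‖(conv_core_Lp hκ hκi F).2.1.toLp‖ ≤ _
      rw [Lp.norm_toLp, Lp.norm_def, ← ENNReal.toReal_ofReal
        (integral_nonneg fun w => norm_nonneg (κ w)), ← ENNReal.toReal_mul]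
      exact ENNReal.toReal_mono
        (ENNReal.mul_ne_top ENNReal.ofReal_ne_top (Lp.memLp F).eLpNorm_lt_top.ne)
        (conv_core_Lp hκ hκi F).2.2

lemma coeFn_convL (hκ : Measurable κ) (hκi : Integrable κ) (F : L2C) :
    convL κ hκ hκi F =ᵐ[volume] fun z => ∫ w, κ (w - z) * F w :=
  (conv_core_Lp hκ hκi F).2.1.coeFn_toLp

lemma norm_convL_le (hκ : Measurable κ) (hκi : Integrable κ) :
    ‖convL κ hκ hκi‖ ≤ ∫ w, ‖κ w‖ :=
  LinearMap.mkContinuous_norm_le _ (integral_nonneg fun w => norm_nonneg (κ w)) _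

lemma convL_sub {κ' : ℂ → ℂ} (hκ : Measurable κ) (hκi : Integrable κ) (hκ' : Measurable κ')
    (hκi' : Integrable κ') : convL κ hκ hκi - convL κ' hκ' hκi' =
      convL (κ - κ') (hκ.sub hκ') (hκi.sub hκi') := by
  ext1 F
  refine Lp.ext ?_
  rw [_root_.sub_apply]
  filter_upwards [Lp.coeFn_sub (convL κ hκ hκi F) (convL κ' hκ' hκi' F), coeFn_convL hκ hκi F,
    coeFn_convL hκ' hκi' F, coeFn_convL (hκ.sub hκ') (hκi.sub hκi') F, (conv_core_Lp hκ hκi F).1,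
    (conv_core_Lp hκ' hκi' F).1] with z h1 h2 h3 h4 h5 h6
  rw [h1, Pi.sub_apply, h2, h3, h4, ← integral_sub h5 h6]
  simp only [Pi.sub_apply, sub_mul]

end Convolution

/-! ### Truncated Cauchy and Beurling transforms -/

section Truncation

lemma locallyIntegrable_inv : LocallyIntegrable (fun w : ℂ => w⁻¹) volume := by
  refine locallyIntegrable_of_norm_le_rpow (C := 1) (α := 1) (by simp) (by simp)
    (Eventually.of_forall fun w => ?_) measurable_inv.aestronglyMeasurable
  rw [norm_inv, Real.rpow_neg_one, one_mul]

/-- The kernel of the Cauchy transform, cut off at distance `R`. -/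
def cauchyKer (R : ℝ) : ℂ → ℂ := (Metric.ball 0 R).indicator fun w => -(1 / (Real.pi : ℂ)) * w⁻¹

lemma measurable_cauchyKer (R : ℝ) : Measurable (cauchyKer R) :=
  (measurable_inv.const_mul _).indicator measurableSet_ball

lemma integrable_cauchyKer (R : ℝ) : Integrable (cauchyKer R) := by
  rw [cauchyKer, integrable_indicator_iff measurableSet_ball]
  refine Integrable.const_mul ?_ _
  exact (locallyIntegrable_inv.integrableOn_isCompact (isCompact_closedBall 0 R)).mono_set
    Metric.ball_subset_closedBall

/-- The truncation of the Cauchy kernel to distances larger than `δ`. -/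
def cutCauchyKer (R δ : ℝ) : ℂ → ℂ := {w : ℂ | δ < ‖w‖}.indicator (cauchyKer R)

lemma measurableSet_lt_norm (δ : ℝ) : MeasurableSet {w : ℂ | δ < ‖w‖} :=
  measurableSet_lt measurable_const measurable_norm

lemma measurable_cutCauchyKer (R δ : ℝ) : Measurable (cutCauchyKer R δ) :=
  (measurable_cauchyKer R).indicator (measurableSet_lt_norm δ)

lemma integrable_cutCauchyKer (R δ : ℝ) : Integrable (cutCauchyKer R δ) :=
  (integrable_cauchyKer R).indicator (measurableSet_lt_norm δ)

/-- The Cauchy transform, cut off at distance `R`. -/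
def cauchyL (R : ℝ) : L2C →L[ℂ] L2C :=
  convL (cauchyKer R) (measurable_cauchyKer R) (integrable_cauchyKer R)

/-- The truncated Cauchy transform. -/
def cutCauchyL (R δ : ℝ) : L2C →L[ℂ] L2C :=
  convL (cutCauchyKer R δ) (measurable_cutCauchyKer R δ) (integrable_cutCauchyKer R δ)

/-- The convergence holds in operator norm, since the truncated kernels converge in L¹. -/
lemma tendsto_cutCauchyL (R : ℝ) : Tendsto (cutCauchyL R) (𝓝[>] 0) (𝓝 (cauchyL R)) := by
  rw [tendsto_iff_norm_sub_tendsto_zero]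
  have hb : ∀ δ, ‖cutCauchyL R δ - cauchyL R‖ ≤ ∫ w, ‖(cutCauchyKer R δ - cauchyKer R) w‖ :=
    fun δ => by
      rw [cutCauchyL, cauchyL, convL_sub]
      exact norm_convL_le _ _
  refine squeeze_zero (fun _ => norm_nonneg _) hb ?_
  suffices h : Tendsto (fun δ => ∫ w, ‖(cutCauchyKer R δ - cauchyKer R) w‖) (𝓝[>] 0)
      (𝓝 (∫ _ : ℂ, (0 : ℝ))) by simpa using h
  refine tendsto_integral_filter_of_dominated_convergence (l := 𝓝[>] (0 : ℝ))
    (fun w => ‖cauchyKer R w‖) ?_ ?_ (integrable_cauchyKer R).norm ?_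
  · exact Eventually.of_forall fun δ =>
      ((measurable_cutCauchyKer R δ).sub (measurable_cauchyKer R)).norm.aestronglyMeasurable
  · refine Eventually.of_forall fun δ => Eventually.of_forall fun w => ?_
    rw [norm_norm, Pi.sub_apply, cutCauchyKer]
    by_cases hw : w ∈ {w : ℂ | δ < ‖w‖}
    · simp [Set.indicator_of_mem hw]
    · simp [Set.indicator_of_notMem hw]
  · filter_upwards [compl_mem_ae_iff.2 (measure_singleton (0 : ℂ))] with w hw
    have hw : w ≠ 0 := hw
    refine tendsto_const_nhds.congr' ?_
    have : ∀ᶠ δ in 𝓝[>] (0 : ℝ), δ < ‖w‖ :=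
      (eventually_lt_nhds (norm_pos_iff.2 hw)).filter_mono nhdsWithin_le_nhds
    filter_upwards [this] with δ hδ
    rw [Pi.sub_apply, cutCauchyKer, Set.indicator_of_mem (by simpa using hδ), sub_self, norm_zero]

lemma measurable_discFun (z : ℂ) (δ : ℝ) : Measurable (discFun z δ) :=
  measurable_const.indicator Metric.isClosed_closedBall.measurableSet

/-! ### Disc averages and the truncated Beurling transform. -/

/-- The kernel of the disc average. -/
def avgKer (δ : ℝ) (w : ℂ) : ℂ := (Real.pi : ℂ)⁻¹ * discFun 0 δ w

lemma measurable_avgKer (δ : ℝ) : Measurable (avgKer δ) := (measurable_discFun 0 δ).const_mul _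

lemma integrable_avgKer (δ : ℝ) : Integrable (avgKer δ) := by
  refine Integrable.const_mul ?_ _
  rw [discFun, integrable_indicator_iff Metric.isClosed_closedBall.measurableSet]
  exact integrableOn_const measure_closedBall_lt_top.ne

/-- The average over discs of radius `δ`. -/
def avgL (δ : ℝ) : L2C →L[ℂ] L2C := convL (avgKer δ) (measurable_avgKer δ) (integrable_avgKer δ)

lemma integral_avgKer_mul (δ : ℝ) (f : ℂ → ℂ) (z : ℂ) (hδ : 0 < δ) :
    ∫ w, avgKer δ (w - z) * f w = ⨍ w in Metric.closedBall z δ, f w := by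
  rw [setAverage_eq, measureReal_def, Complex.volume_closedBall]
  simp only [ENNReal.toReal_mul, ENNReal.toReal_pow, ENNReal.toReal_ofReal hδ.le]
  rw [← integral_smul, ← integral_indicator Metric.isClosed_closedBall.measurableSet]
  refine integral_congr_ae (Eventually.of_forall fun w => ?_)
  by_cases hw : w ∈ Metric.closedBall z δ
  · have hw' : w - z ∈ Metric.closedBall 0 δ := by simpa [dist_eq_norm] using hw
    simp only [avgKer, discFun, Set.indicator_of_mem hw, Set.indicator_of_mem hw']
    simp [NNReal.coe_real_pi]
  · have hw' : w - z ∉ Metric.closedBall 0 δ := by simpa [dist_eq_norm] using hw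
    simp only [avgKer, discFun, Set.indicator_of_notMem hw, Set.indicator_of_notMem hw']
    simp

/-- The averaging kernel is a probability density. -/
lemma norm_avgL_le {δ : ℝ} (hδ : 0 < δ) : ‖avgL δ‖ ≤ 1 := by
  refine (norm_convL_le _ _).trans ?_
  have e : ∀ w, ‖avgKer δ w‖ =
      (Metric.closedBall (0 : ℂ) δ).indicator (fun _ => (Real.pi * δ ^ 2)⁻¹) w := by
    intro w
    by_cases hw : w ∈ Metric.closedBall (0 : ℂ) δ
    · simp only [avgKer, discFun, Set.indicator_of_mem hw]
      rw [norm_mul, norm_inv, norm_inv, Complex.norm_real, Complex.norm_real,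
        Real.norm_of_nonneg Real.pi_pos.le, Real.norm_of_nonneg (by positivity), mul_inv]
    · simp only [avgKer, discFun, Set.indicator_of_notMem hw, mul_zero, norm_zero]
  simp_rw [e]
  rw [integral_indicator Metric.isClosed_closedBall.measurableSet, setIntegral_const,
    measureReal_def, Complex.volume_closedBall]
  simp only [ENNReal.toReal_mul, ENNReal.toReal_pow, ENNReal.toReal_ofReal hδ.le]
  have hpi := Real.pi_pos
  simp [NNReal.coe_real_pi]
  field_simp
  exact le_refl _

lemma norm_average_sub_le {g : ℂ → ℂ} {C : NNReal} (hg : LipschitzWith C g) (z : ℂ) {δ : ℝ}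
    (hδ : 0 < δ) : ‖(⨍ w in Metric.closedBall z δ, g w) - g z‖ ≤ C * δ := by
  have hvol : (volume (Metric.closedBall z δ)).toReal ≠ 0 := by
    have hpi := Real.pi_pos
    rw [Complex.volume_closedBall]
    simp only [ENNReal.toReal_mul, ENNReal.toReal_pow, ENNReal.toReal_ofReal hδ.le]
    simp [NNReal.coe_real_pi]
    exact hδ.ne'
  have h1 : (⨍ w in Metric.closedBall z δ, g w) - g z =
      ⨍ w in Metric.closedBall z δ, (g w - g z) := by
    have hgi : IntegrableOn g (Metric.closedBall z δ) :=
      hg.continuous.continuousOn.integrableOn_compact (isCompact_closedBall z δ)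
    rw [setAverage_eq, setAverage_eq, integral_sub hgi
      (integrableOn_const measure_closedBall_lt_top.ne), smul_sub, setIntegral_const,
      smul_smul, measureReal_def, inv_mul_cancel₀ hvol, one_smul]
  rw [h1, setAverage_eq, norm_smul, norm_inv, measureReal_def, Real.norm_of_nonneg
    ENNReal.toReal_nonneg, inv_mul_le_iff₀ (lt_of_le_of_ne ENNReal.toReal_nonneg hvol.symm)]
  have := norm_setIntegral_le_of_norm_le_const (μ := (volume : Measure ℂ))
    (s := Metric.closedBall z δ) (f := fun w => g w - g z) (C := C * δ)
    measure_closedBall_lt_top fun w hw => by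
      have h2 := hg.dist_le_mul w z
      rw [dist_eq_norm] at h2
      exact h2.trans (mul_le_mul_of_nonneg_left hw C.2)
  rwa [mul_comm] at this

/-- The averages are contractions, so it suffices to treat smooth compactly supported functions, for
which convergence is uniform on a fixed compact set. -/
lemma tendsto_avgL (F : L2C) : Tendsto (fun δ => avgL δ F) (𝓝[>] 0) (𝓝 F) := by
  have hdense : F ∈ closure {f : L2C | Tendsto (fun δ => avgL δ f) (𝓝[>] 0) (𝓝 f)} := by
    refine closure_mono ?_ (Lp.dense_hasCompactSupport_contDiff (F := ℂ) (E := ℂ) (p := 2)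
      (μ := volume) (by norm_num) F)
    rintro f ⟨g, hfg, hgc, hgd⟩
    obtain ⟨C, hC⟩ := hgd.lipschitzWith_of_hasCompactSupport hgc (by simp)
    rw [Set.mem_ofPred_eq, tendsto_iff_norm_sub_tendsto_zero]
    -- For δ < 1 the averages of `g` are supported here.
    set K := Metric.cthickening 1 (tsupport g) with hK
    have hKc : IsCompact K := hgc.isCompact.cthickening
    have hb : ∀ᶠ δ in 𝓝[>] (0 : ℝ), ‖avgL δ f - f‖ ≤
        (C * δ) * (volume K ^ (1 / 2 : ℝ)).toReal := by
      have h1 : ∀ᶠ δ in 𝓝[>] (0 : ℝ), δ < 1 :=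
        (eventually_lt_nhds one_pos).filter_mono nhdsWithin_le_nhds
      filter_upwards [self_mem_nhdsWithin, h1] with δ hδ hδ1
      have hδ : 0 < δ := hδ
      have hpt : ∀ᵐ z, ‖(avgL δ f - f) z‖ ≤ ‖K.indicator (fun _ => C * δ) z‖ := by
        filter_upwards [Lp.coeFn_sub (avgL δ f) f, coeFn_convL (measurable_avgKer δ)
          (integrable_avgKer δ) f, hfg] with z h2 h3 h4
        have h5 : avgL δ f z = ⨍ w in Metric.closedBall z δ, g w := by
          rw [avgL, h3, integral_avgKer_mul δ _ z hδ, setAverage_eq, setAverage_eq]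
          congr 1
          exact integral_congr_ae (ae_restrict_of_ae hfg)
        rw [h2, Pi.sub_apply, h5, h4]
        by_cases hz : z ∈ K
        · rw [Set.indicator_of_mem hz, Real.norm_of_nonneg (by positivity)]
          exact norm_average_sub_le hC z hδ
        · have h6 : ∀ w ∈ Metric.closedBall z δ, g w = 0 := by
            intro w hw
            refine image_eq_zero_of_notMem_tsupport fun h7 => hz ?_
            refine Metric.mem_cthickening_of_dist_le z w 1 _ h7 ?_
            rw [dist_comm]
            exact (Metric.mem_closedBall.1 hw).trans hδ1.le
          rw [setAverage_eq, setIntegral_congr_fun Metric.isClosed_closedBall.measurableSet h6,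
            h6 z (Metric.mem_closedBall_self hδ.le)]
          simp
      have h2 := eLpNorm_mono_ae (p := 2) hpt
      rw [Lp.norm_def]
      refine (ENNReal.toReal_mono ?_ (h2.trans (eLpNorm_indicator_const_le _ _))).trans_eq ?_
      · exact ENNReal.mul_ne_top enorm_ne_top
          (ENNReal.rpow_ne_top_of_nonneg (by norm_num) hKc.measure_ne_top)
      · rw [ENNReal.toReal_mul, toReal_enorm, Real.norm_of_nonneg (by positivity)]
        norm_num
    refine squeeze_zero' (Eventually.of_forall fun _ => norm_nonneg _) hb ?_
    have : Tendsto (fun δ : ℝ => (C * δ) * (volume K ^ (1 / 2 : ℝ)).toReal) (𝓝 0) (𝓝 (C * 0 *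
        (volume K ^ (1 / 2 : ℝ)).toReal)) := (tendsto_id.const_mul _).mul_const _
    simpa using this.mono_left nhdsWithin_le_nhds
  rw [Metric.mem_closure_iff] at hdense
  rw [Metric.tendsto_nhds]
  intro ε hε
  obtain ⟨f, hf, hFf⟩ := hdense (ε / 3) (by positivity)
  filter_upwards [Metric.tendsto_nhds.1 hf (ε / 3) (by positivity), self_mem_nhdsWithin] with δ h1 hδ
  have h2 : dist (avgL δ F) (avgL δ f) ≤ dist F f := by
    rw [dist_eq_norm, dist_eq_norm, ← map_sub]
    exact ((avgL δ).le_of_opNorm_le (norm_avgL_le hδ) _).trans_eq (one_mul _)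
  calc dist (avgL δ F) F ≤ dist (avgL δ F) (avgL δ f) + dist (avgL δ f) f + dist f F :=
        dist_triangle4 _ _ _ _
    _ < ε / 3 + ε / 3 + ε / 3 := by
        rw [dist_comm f F]
        gcongr
        exact h2.trans_lt hFf
    _ = ε := by ring

/-- The truncated Beurling transform. -/
def cutBeurlingL (δ : ℝ) : L2C →L[ℂ] L2C := avgL δ ∘L beurlingL

/-- The convergence is only asserted for each fixed `F`; together with the uniform bound
`norm_cutBeurlingL_le` it is enough for compositions. -/
lemma tendsto_cutBeurlingL (F : L2C) :
    Tendsto (fun δ => cutBeurlingL δ F) (𝓝[>] 0) (𝓝 (beurlingL F)) := tendsto_avgL _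

lemma norm_cutBeurlingL_le {δ : ℝ} (hδ : 0 < δ) : ‖cutBeurlingL δ‖ ≤ ‖beurlingL‖ := by
  refine (ContinuousLinearMap.opNorm_comp_le _ _).trans ?_
  exact mul_le_of_le_one_left (norm_nonneg _) (norm_avgL_le hδ)

lemma coeFn_cutBeurlingL {δ : ℝ} (hδ : 0 < δ) (F : L2C) : cutBeurlingL δ F =ᵐ[volume] fun z =>
    -(1 / (Real.pi : ℂ)) * ∫ w in {w : ℂ | δ < ‖w - z‖}, F w / (w - z) ^ 2 := by
  filter_upwards [coeFn_convL (measurable_avgKer δ) (integrable_avgKer δ) (beurlingL F)] with z hz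
  rw [truncated_beurling_eq F z hδ, ← integral_avgKer_mul δ _ z hδ, ← hz]
  rfl

end Truncation

/-! ### Neumann series in a Banach space -/

section Neumann

variable {X H : Type*} [NormedAddCommGroup X] [NormedSpace ℝ X] [NormedAddCommGroup H]
  [NormedSpace ℝ H] [CompleteSpace H]

/-- The terms of the Neumann series of `u + M x (Q u) = M x c`. -/
def neumannTerm (M : X →L[ℝ] H →L[ℝ] H) (Q : H →L[ℝ] H) (c : H) (x : X) : ℕ → H
  | 0 => M x c
  | j + 1 => -M x (Q (neumannTerm M Q c x j))

/-- The solution of `u + M x (Q u) = M x c`. -/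
def neumannSol (M : X →L[ℝ] H →L[ℝ] H) (Q : H →L[ℝ] H) (c : H) (x : X) : H :=
  Ring.inverse (1 + (M x).comp Q) (M x c)

variable (M : X →L[ℝ] H →L[ℝ] H) (Q : H →L[ℝ] H) (c : H)

lemma analyticAt_neumannSol : AnalyticAt ℝ (neumannSol M Q c) 0 := by
  have h1 : AnalyticAt ℝ (fun x => 1 + (M x).comp Q) 0 :=
    analyticAt_const.add ((((ContinuousLinearMap.compL ℝ H H H).flip Q).comp M).analyticAt 0)
  have h2 : AnalyticAt ℝ (Ring.inverse : (H →L[ℝ] H) → (H →L[ℝ] H)) (1 + (M 0).comp Q) := by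
    have := analyticAt_inverse (𝕜 := ℝ) (1 : (H →L[ℝ] H)ˣ)
    simpa using this
  have h3 : AnalyticAt ℝ (fun x => Ring.inverse (1 + (M x).comp Q)) 0 :=
    AnalyticAt.fun_comp (g := Ring.inverse) (f := fun x => 1 + (M x).comp Q) h2 h1
  have h4 : AnalyticAt ℝ (fun x => M x c) 0 := (M.flip c).analyticAt 0
  exact AnalyticAt.comp₂ (h := fun p : (H →L[ℝ] H) × H => p.1 p.2)
    ((ContinuousLinearMap.id ℝ (H →L[ℝ] H)).analyticAt_bilinear _) h3 h4

lemma eventually_isUnit : ∀ᶠ x in 𝓝 (0 : X), IsUnit (1 + (M x).comp Q) := by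
  have h1 : Continuous fun x => 1 + (M x).comp Q :=
    continuous_const.add (((ContinuousLinearMap.compL ℝ H H H).flip Q).comp M).continuous
  exact h1.continuousAt.eventually_mem (Units.isOpen.mem_nhds (by simp))

lemma eq_neumannSol_iff {x : X} (hx : IsUnit (1 + (M x).comp Q)) (u : H) :
    u + M x (Q u) = M x c ↔ u = neumannSol M Q c x := by
  have h1 := Ring.inverse_mul_cancel _ hx
  have h2 := Ring.mul_inverse_cancel _ hx
  have h3 : ∀ u, u + M x (Q u) = (1 + (M x).comp Q) u := fun u => rfl
  rw [h3, neumannSol]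
  constructor
  · intro h
    rw [← h]
    exact (congrArg (fun L : H →L[ℝ] H => L u) h1).symm
  · rintro rfl
    exact congrArg (fun L : H →L[ℝ] H => L (M x c)) h2

lemma neumannTerm_smul (x : X) (s : ℝ) (n : ℕ) :
    neumannTerm M Q c (s • x) n = s ^ (n + 1) • neumannTerm M Q c x n := by
  induction n with
  | zero => simp [neumannTerm]
  | succ n ih =>
    simp only [neumannTerm, ih, map_smul, _root_.smul_apply, smul_neg, smul_smul]
    rw [pow_succ' s (n + 1), mul_comm]

lemma hasSum_neumannTerm {x : X} (hx : ‖(M x).comp Q‖ < 1) :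
    HasSum (neumannTerm M Q c x) (neumannSol M Q c x) := by
  have h1 : ‖-(M x).comp Q‖ < 1 := by rwa [norm_neg]
  have h2 := (hasSum_geom_series_inverse (-(M x).comp Q) h1)
  rw [sub_neg_eq_add] at h2
  have h3 := h2.mapL (ContinuousLinearMap.apply ℝ H (M x c))
  have e : ∀ n, (ContinuousLinearMap.apply ℝ H (M x c)) ((-(M x).comp Q) ^ n) =
      neumannTerm M Q c x n := by
    intro n
    induction n with
    | zero => simp [neumannTerm]
    | succ n ih =>
      rw [neumannTerm, ← ih, pow_succ']
      rfl
  simp_rw [e] at h3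
  exact h3

/-- On the line s ↦ s • x the solution has two power series, the restricted Taylor series and the
Neumann series, whose n-th term is homogeneous of degree n + 1; power series in one real variable
are unique. -/
lemma iteratedFDeriv_neumannSol (n : ℕ) (x : X) :
    (((n + 1).factorial : ℝ)⁻¹) • iteratedFDeriv ℝ (n + 1) (neumannSol M Q c) 0 (fun _ => x) =
      neumannTerm M Q c x n := by
  obtain ⟨p, r, hp⟩ := analyticAt_neumannSol M Q c
  have h1 := hp.factorial_smul x (n + 1)
  rw [← h1, ← Nat.cast_smul_eq_nsmul ℝ, smul_smul, inv_mul_cancel₀ (by positivity), one_smul]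
  let a : ℕ → H := fun n => p n fun _ => x
  -- The Neumann series has no constant term: `neumannTerm` with index n is the coefficient of
  -- degree n + 1.
  let b : ℕ → H := fun n => Nat.casesOn n 0 (neumannTerm M Q c x)
  let pa : FormalMultilinearSeries ℝ ℝ H := fun n => ContinuousMultilinearMap.mkPiRing ℝ (Fin n) (a n)
  let pb : FormalMultilinearSeries ℝ ℝ H := fun n => ContinuousMultilinearMap.mkPiRing ℝ (Fin n) (b n)
  have hl : Tendsto (fun s : ℝ => s • x) (𝓝 0) (𝓝 0) := by
    have : Continuous fun s : ℝ => s • x := by fun_prop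
    simpa using this.tendsto 0
  have ha : HasFPowerSeriesAt (fun s : ℝ => neumannSol M Q c (s • x)) pa 0 := by
    rw [hasFPowerSeriesAt_iff]
    filter_upwards [hl.eventually (Metric.eball_mem_nhds 0 hp.r_pos)] with s hs
    have h2 := hp.hasSum hs
    simp only [zero_add] at h2 ⊢
    have e : ∀ n, (p n fun _ => s • x) = s ^ n • pa.coeff n := by
      intro n
      have := (p n).map_smul_univ (fun _ => s) (fun _ => x)
      simpa [pa, a, FormalMultilinearSeries.coeff] using this
    simpa only [e] using h2
  have hb : HasFPowerSeriesAt (fun s : ℝ => neumannSol M Q c (s • x)) pb 0 := by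
    rw [hasFPowerSeriesAt_iff]
    have h3 : ∀ᶠ y in 𝓝 (0 : X), ‖(M y).comp Q‖ < 1 := by
      have h4 : Continuous fun y => ‖(M y).comp Q‖ :=
        (((ContinuousLinearMap.compL ℝ H H H).flip Q).comp M).continuous.norm
      exact h4.continuousAt.eventually_lt continuousAt_const (by simp)
    filter_upwards [hl.eventually h3] with s hs
    have h2 : HasSum (fun n => neumannTerm M Q c (s • x) n) _ := hasSum_neumannTerm M Q c hs
    simp only [neumannTerm_smul] at h2
    rw [zero_add, ← hasSum_nat_add_iff' 1]
    simpa [pb, b, FormalMultilinearSeries.coeff] using h2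
  have := congrArg (fun q : FormalMultilinearSeries ℝ ℝ H => q.coeff (n + 1))
    (ha.eq_formalMultilinearSeries hb)
  simpa [pa, pb, FormalMultilinearSeries.coeff, a, b] using this

end Neumann

/-! ### Extension by zero, multiplication operators, exponentials -/

section Operators

open scoped ENNReal

variable {E : Type*} [NormedAddCommGroup E] [NormedSpace ℝ E]

/-- Extension by zero, from `L^p(s)` to `L^p(ℂ)`. -/
def extendLp (p : ℝ≥0∞) [Fact (1 ≤ p)] {s : Set ℂ} (hs : MeasurableSet s) :
    Lp E p (volume.restrict s) →L[ℝ] Lp E p (volume : Measure ℂ) :=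
  LinearMap.mkContinuous
    { toFun := fun f => ((memLp_indicator_iff_restrict hs).2 (Lp.memLp f)).toLp
      map_add' := fun f g => by
        rw [← MemLp.toLp_add]
        refine MemLp.toLp_congr _ _ ?_
        filter_upwards [(ae_restrict_iff' hs).1 (Lp.coeFn_add f g)] with z hz
        by_cases h : z ∈ s
        · simp only [Pi.add_apply, Set.indicator_of_mem h, hz h]
        · simp only [Pi.add_apply, Set.indicator_of_notMem h, add_zero]
      map_smul' := fun c f => by
        rw [RingHom.id_apply, ← MemLp.toLp_const_smul]
        refine MemLp.toLp_congr _ _ ?_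
        filter_upwards [(ae_restrict_iff' hs).1 (Lp.coeFn_smul c f)] with z hz
        by_cases h : z ∈ s
        · simp only [Pi.smul_apply, Set.indicator_of_mem h, hz h]
        · simp only [Pi.smul_apply, Set.indicator_of_notMem h, smul_zero] }
    1 fun f => by
      change ‖((memLp_indicator_iff_restrict hs).2 (Lp.memLp f)).toLp‖ ≤ _
      rw [Lp.norm_toLp, Lp.norm_def, eLpNorm_indicator_eq_eLpNorm_restrict hs, one_mul]

lemma coeFn_extendLp {p : ℝ≥0∞} [Fact (1 ≤ p)] {s : Set ℂ} (hs : MeasurableSet s)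
    (f : Lp E p (volume.restrict s)) : extendLp p hs f =ᵐ[volume] s.indicator f :=
  ((memLp_indicator_iff_restrict hs).2 (Lp.memLp f)).coeFn_toLp

/-- Bounded functions on the plane. -/
abbrev LinfC : Type := Lp ℂ ⊤ (volume : Measure ℂ)

/-- Multiplication of an `L²` function by a bounded function. -/
def mulB : LinfC →L[ℝ] L2C →L[ℝ] L2C := (ContinuousLinearMap.mul ℝ ℂ).holderL volume ⊤ 2 2

lemma coeFn_mulB (a : LinfC) (F : L2C) : mulB a F =ᵐ[volume] fun z => a z * F z :=
  (ContinuousLinearMap.mul ℝ ℂ).coeFn_holder a F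

/-- Complex conjugation on `L²`. -/
def conjL : L2C →L[ℝ] L2C := (Complex.conjCLE : ℂ →L[ℝ] ℂ).compLpL 2 volume

lemma coeFn_conjL (F : L2C) : conjL F =ᵐ[volume] fun z => conj (F z) :=
  ContinuousLinearMap.coeFn_compLpL _ F

lemma norm_conjL_le : ‖conjL‖ ≤ 1 :=
  (ContinuousLinearMap.norm_compLpL_le _).trans (by simp)

lemma eK_eq (k z : ℂ) : eK k z = Complex.exp (Complex.I * ((2 * (k * z).re : ℝ) : ℂ)) := by
  rw [eK, ← map_mul, Complex.add_conj]

lemma norm_eK (k z : ℂ) : ‖eK k z‖ = 1 := by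
  rw [eK_eq, mul_comm, Complex.norm_exp_ofReal_mul_I]

lemma conj_eK (k z : ℂ) : conj (eK k z) = eK (-k) z := by
  rw [eK_eq, eK_eq, ← Complex.exp_conj, map_mul, Complex.conj_I, Complex.conj_ofReal]
  congr 1
  simp
  ring

lemma eK_add (k k' z : ℂ) : eK (k + k') z = eK k z * eK k' z := by
  rw [eK, eK, eK, ← Complex.exp_add, map_add]
  congr 1
  ring

lemma norm_eK_sub_le (k k' z : ℂ) : ‖eK k z - eK k' z‖ ≤ 2 * ‖k - k'‖ * ‖z‖ := by
  have h : eK k z - eK k' z = eK k' z * (eK (k - k') z - 1) := by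
    rw [mul_sub, ← eK_add, add_sub_cancel, mul_one]
  rw [h, norm_mul, norm_eK, one_mul, eK_eq]
  refine (Real.norm_exp_I_mul_ofReal_sub_one_le).trans ?_
  rw [Real.norm_eq_abs, abs_mul, abs_two, mul_assoc, ← norm_mul]
  exact mul_le_mul_of_nonneg_left (Complex.abs_re_le_norm _) zero_le_two

lemma continuous_eK (k : ℂ) : Continuous (eK k) := by
  unfold eK
  fun_prop

lemma memLp_eK (R : ℝ) (k : ℂ) : MemLp ((Metric.ball (0 : ℂ) R).indicator (eK k)) ⊤ volume :=
  (memLp_top_of_bound (continuous_eK k).aestronglyMeasurable 1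
    (Eventually.of_forall fun z => (norm_eK k z).le)).indicator measurableSet_ball

/-- The exponential `e_k`, restricted to the ball of radius `R`. -/
def eLp (R : ℝ) (k : ℂ) : LinfC := (memLp_eK R k).toLp

lemma coeFn_eLp (R : ℝ) (k : ℂ) :
    eLp R k =ᵐ[volume] (Metric.ball (0 : ℂ) R).indicator (eK k) := (memLp_eK R k).coeFn_toLp

lemma LinfC.norm_le_of_ae {f : LinfC} {C : ℝ} (hC : 0 ≤ C) (h : ∀ᵐ z, ‖f z‖ ≤ C) : ‖f‖ ≤ C := by
  rw [Lp.norm_def, eLpNorm_exponent_top]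
  exact ENNReal.toReal_le_of_le_ofReal hC (eLpNormEssSup_le_of_ae_bound h)

lemma norm_eLp_le (R : ℝ) (k : ℂ) : ‖eLp R k‖ ≤ 1 := by
  refine LinfC.norm_le_of_ae zero_le_one ?_
  filter_upwards [coeFn_eLp R k] with z hz
  rw [hz]
  exact (norm_indicator_le_norm_self _ _).trans (norm_eK k z).le

/-- Continuity in the sup norm relies on the restriction to a ball, because |e_k - e_{k'}| is only
bounded by 2|k - k'||z|. -/
lemma continuous_eLp (R : ℝ) : Continuous (eLp R) := by
  refine (LipschitzWith.of_dist_le_mul (K := (2 * |R|).toNNReal) fun k k' => ?_).continuous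
  rw [dist_eq_norm, dist_eq_norm, Real.coe_toNNReal _ (by positivity)]
  refine LinfC.norm_le_of_ae (by positivity) ?_
  filter_upwards [Lp.coeFn_sub (eLp R k) (eLp R k'), coeFn_eLp R k, coeFn_eLp R k'] with z h1 h2 h3
  rw [h1, Pi.sub_apply, h2, h3]
  by_cases hz : z ∈ Metric.ball (0 : ℂ) R
  · rw [Set.indicator_of_mem hz, Set.indicator_of_mem hz]
    refine (norm_eK_sub_le k k' z).trans ?_
    have : ‖z‖ ≤ |R| := (mem_ball_zero_iff.1 hz).le.trans (le_abs_self R)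
    nlinarith [norm_nonneg (k - k')]
  · rw [Set.indicator_of_notMem hz, Set.indicator_of_notMem hz, sub_zero, norm_zero]
    positivity

/-- The indicator function of the ball of radius `R`. -/
def oneL (R : ℝ) : L2C :=
  (memLp_indicator_const 2 (measurableSet_ball (x := (0 : ℂ)) (ε := R)) (1 : ℂ)
    (Or.inr measure_ball_lt_top.ne)).toLp

lemma coeFn_oneL (R : ℝ) : oneL R =ᵐ[volume] (Metric.ball (0 : ℂ) R).indicator fun _ => 1 :=
  MemLp.coeFn_toLp _

end Operators

/-! ### The Beltrami equation in `L²(Ω)` -/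

section Beltrami

variable {Ω Ω₀ : Set ℂ} {R : ℝ}

/-- The bounded function on the plane defined by a coefficient. -/
def coeffL (hΩ₀ : MeasurableSet Ω₀) : Coefficients Ω₀ →L[ℝ] LinfC :=
  (extendLp ⊤ hΩ₀).comp (Complex.ofRealCLM.compLpL ⊤ (volume.restrict Ω₀))

lemma coeFn_coeffL (hΩ₀ : MeasurableSet Ω₀) (μ : Coefficients Ω₀) :
    coeffL hΩ₀ μ =ᵐ[volume] fun z => ((extendCoeff μ z : ℝ) : ℂ) := by
  filter_upwards [coeFn_extendLp hΩ₀ (Complex.ofRealCLM.compLpL ⊤ (volume.restrict Ω₀) μ),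
    (ae_restrict_iff' hΩ₀).1 (ContinuousLinearMap.coeFn_compLpL (p := ⊤)
      (μ := volume.restrict Ω₀) Complex.ofRealCLM μ)] with z h1 h2
  refine h1.trans ?_
  by_cases hz : z ∈ Ω₀
  · rw [Set.indicator_of_mem hz, h2 hz, extendCoeff, Set.indicator_of_mem hz]
    rfl
  · rw [Set.indicator_of_notMem hz, extendCoeff, Set.indicator_of_notMem hz, Complex.ofReal_zero]

/-- Restriction to `Ω`. -/
def restrictΩ (Ω : Set ℂ) : L2C →L[ℝ] Lp ℂ 2 (volume.restrict Ω) :=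
  LpToLpRestrictCLM ℂ ℂ ℝ volume 2 Ω

/-- Multiplication by a coefficient, on `L²(Ω)`. -/
def mulCoeff (hΩ : MeasurableSet Ω) (hΩ₀ : MeasurableSet Ω₀) :
    Coefficients Ω₀ →L[ℝ] Lp ℂ 2 (volume.restrict Ω) →L[ℝ] Lp ℂ 2 (volume.restrict Ω) :=
  (ContinuousLinearMap.compL ℝ (Lp ℂ 2 (volume.restrict Ω)) L2C (Lp ℂ 2 (volume.restrict Ω))
    (restrictΩ Ω)).comp (((ContinuousLinearMap.compL ℝ (Lp ℂ 2 (volume.restrict Ω)) L2C L2C).flip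
      (extendLp 2 hΩ)).comp (mulB.comp (coeffL hΩ₀)))

lemma coeFn_mulCoeff (hΩ : MeasurableSet Ω) (hΩ₀ : MeasurableSet Ω₀) (μ : Coefficients Ω₀)
    (F : Lp ℂ 2 (volume.restrict Ω)) : mulCoeff hΩ hΩ₀ μ F =ᵐ[volume.restrict Ω] fun z =>
      ((extendCoeff μ z : ℝ) : ℂ) * F z := by
  have h1 : mulCoeff hΩ hΩ₀ μ F = restrictΩ Ω (mulB (coeffL hΩ₀ μ) (extendLp 2 hΩ F)) := rfl
  rw [h1]
  filter_upwards [LpToLpRestrictCLM_coeFn ℝ Ω (mulB (coeffL hΩ₀ μ) (extendLp 2 hΩ F)),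
    ae_restrict_of_ae (coeFn_mulB (coeffL hΩ₀ μ) (extendLp 2 hΩ F)),
    ae_restrict_of_ae (coeFn_coeffL hΩ₀ μ), ae_restrict_of_ae (coeFn_extendLp hΩ F),
    ae_restrict_mem hΩ] with z h2 h3 h4 h5 h6
  rw [restrictΩ, h2, h3, h4, h5, Set.indicator_of_mem h6]

/-- `i k P + S`. -/
def stepOp (P S : L2C →L[ℂ] L2C) (k : ℂ) : L2C →L[ℂ] L2C := (Complex.I * k) • P + S

lemma coeFn_stepOp (P S : L2C →L[ℂ] L2C) (k : ℂ) (F : L2C) :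
    stepOp P S k F =ᵐ[volume] fun z => Complex.I * k * P F z + S F z := by
  have h : stepOp P S k F = (Complex.I * k) • P F + S F := rfl
  rw [h]
  filter_upwards [Lp.coeFn_add ((Complex.I * k) • P F) (S F), Lp.coeFn_smul (Complex.I * k) (P F)]
    with z h1 h2
  rw [h1, Pi.add_apply, h2, Pi.smul_apply, smul_eq_mul]

/-- Two points of the ball of radius R/2 differ by less than R, so the cut-off that makes the Cauchy
kernel integrable is invisible on `Ω`. -/
lemma cauchyP_ae_eq (hR : Ω ⊆ Metric.ball 0 (R / 2)) {f : ℂ → ℂ} {F : L2C} (hf : f =ᵐ[volume] F)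
    (hsupp : ∀ z ∉ Ω, f z = 0) : ∀ᵐ z, z ∈ Ω → cauchyP f z = cauchyL R F z := by
  filter_upwards [coeFn_convL (measurable_cauchyKer R) (integrable_cauchyKer R) F] with z h1 hz
  rw [cauchyL, h1, cauchyP, ← integral_const_mul]
  refine integral_congr_ae ?_
  filter_upwards [hf] with w hw
  rw [← hw]
  by_cases hwΩ : w ∈ Ω
  · have : w - z ∈ Metric.ball (0 : ℂ) R := by
      rw [mem_ball_zero_iff]
      have h2 := mem_ball_zero_iff.1 (hR hz)
      have h3 := mem_ball_zero_iff.1 (hR hwΩ)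
      exact (norm_sub_le _ _).trans_lt (by linarith)
    rw [cauchyKer, Set.indicator_of_mem this]
    ring
  · rw [hsupp w hwΩ]
    simp

/-- The operator `A` on functions supported in `Ω`. -/
lemma opA_ae_eq (hR : Ω ⊆ Metric.ball 0 (R / 2)) (hsub : Ω₀ ⊆ Ω) (μ : Coefficients Ω₀) (k : ℂ)
    {f : ℂ → ℂ} {F : L2C} (hf : f =ᵐ[volume] F) (hsupp : ∀ z ∉ Ω, f z = 0) :
    opA (extendCoeff μ) k f =ᵐ[volume] fun z =>
      -((extendCoeff μ z : ℝ) : ℂ) * (eK k z * stepOp (cauchyL R) beurlingL k F z) := by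
  filter_upwards [cauchyP_ae_eq hR hf hsupp, beurlingS_ae_eq F hf,
    coeFn_stepOp (cauchyL R) beurlingL k F] with z h1 h2 h3
  rw [opA, h2, h3, alphaCoeff, nuCoeff]
  by_cases hz : z ∈ Ω₀
  · rw [h1 (hsub hz)]
    simp only [map_mul, map_neg, Complex.conj_I, Complex.conj_conj, conj_eK, neg_neg,
      Complex.conj_ofReal]
    ring
  · have : extendCoeff μ z = 0 := Set.indicator_of_notMem hz _
    simp [this]

/-- The operator `Q_k` with `A ρ = μ Q_k` on `L²(Ω)`. -/
def beltramiOp (hΩ : MeasurableSet Ω) (R : ℝ) (k : ℂ) :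
    Lp ℂ 2 (volume.restrict Ω) →L[ℝ] Lp ℂ 2 (volume.restrict Ω) :=
  -(restrictΩ Ω).comp ((mulB (eLp R k)).comp
    (((stepOp (cauchyL R) beurlingL k).restrictScalars ℝ).comp (conjL.comp (extendLp 2 hΩ))))

/-- The function `-i k e_k`, so that `-conj α = μ c_k`. -/
def beltramiRhs (Ω : Set ℂ) (R : ℝ) (k : ℂ) : Lp ℂ 2 (volume.restrict Ω) :=
  restrictΩ Ω (mulB (eLp R k) ((-Complex.I * k) • oneL R))

lemma extendConj_ae (hΩ : MeasurableSet Ω) (u : Lp ℂ 2 (volume.restrict Ω)) :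
    (fun w => conj (Ω.indicator u w)) =ᵐ[volume] conjL (extendLp 2 hΩ u) := by
  filter_upwards [coeFn_conjL (extendLp 2 hΩ u), coeFn_extendLp hΩ u] with z h1 h2
  rw [h1, h2]

/-- The coefficient μ factors out of both terms of A. The remaining operator is only real-linear,
because of the conjugation ρ. -/
lemma opA_conj_ae_eq (hΩ : MeasurableSet Ω) (hR : Ω ⊆ Metric.ball 0 (R / 2)) (hR0 : 0 < R)
    (hΩ₀ : MeasurableSet Ω₀) (hsub : Ω₀ ⊆ Ω) (μ : Coefficients Ω₀) (k : ℂ)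
    (u : Lp ℂ 2 (volume.restrict Ω)) :
    opA (extendCoeff μ) k (fun w => conj (Ω.indicator u w)) =ᵐ[volume.restrict Ω]
      mulCoeff hΩ hΩ₀ μ (beltramiOp hΩ R k u) := by
  set F := conjL (extendLp 2 hΩ u) with hF
  have hQ : beltramiOp hΩ R k u =
      -restrictΩ Ω (mulB (eLp R k) (stepOp (cauchyL R) beurlingL k F)) := rfl
  filter_upwards [ae_restrict_of_ae (opA_ae_eq hR hsub μ k (extendConj_ae hΩ u) (fun z hz => by
    simp [Set.indicator_of_notMem hz])), coeFn_mulCoeff hΩ hΩ₀ μ (beltramiOp hΩ R k u),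
    Lp.coeFn_neg (restrictΩ Ω (mulB (eLp R k) (stepOp (cauchyL R) beurlingL k F))),
    LpToLpRestrictCLM_coeFn ℝ Ω (mulB (eLp R k) (stepOp (cauchyL R) beurlingL k F)),
    ae_restrict_of_ae (coeFn_mulB (eLp R k) (stepOp (cauchyL R) beurlingL k F)),
    ae_restrict_of_ae (coeFn_eLp R k), ae_restrict_mem hΩ] with z h1 h2 h3 h4 h5 h6 h7
  have hz : z ∈ Metric.ball (0 : ℂ) R := Metric.ball_subset_ball (by linarith) (hR h7)
  rw [h1, h2, hQ, h3, Pi.neg_apply, restrictΩ, h4, h5, h6, Set.indicator_of_mem hz]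
  ring

lemma neg_conj_alphaCoeff_ae (hΩ : MeasurableSet Ω) (hR : Ω ⊆ Metric.ball 0 (R / 2)) (hR0 : 0 < R)
    (hΩ₀ : MeasurableSet Ω₀) (μ : Coefficients Ω₀) (k : ℂ) :
    (fun z => -conj (alphaCoeff (extendCoeff μ) k z)) =ᵐ[volume.restrict Ω]
      mulCoeff hΩ hΩ₀ μ (beltramiRhs Ω R k) := by
  filter_upwards [coeFn_mulCoeff hΩ hΩ₀ μ (beltramiRhs Ω R k),
    LpToLpRestrictCLM_coeFn ℝ Ω (mulB (eLp R k) ((-Complex.I * k) • oneL R)),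
    ae_restrict_of_ae (coeFn_mulB (eLp R k) ((-Complex.I * k) • oneL R)),
    ae_restrict_of_ae (coeFn_eLp R k), ae_restrict_of_ae (Lp.coeFn_smul (-Complex.I * k) (oneL R)),
    ae_restrict_of_ae (coeFn_oneL R), ae_restrict_mem hΩ] with z h2 h4 h5 h6 h8 h9 h7
  have hz : z ∈ Metric.ball (0 : ℂ) R := Metric.ball_subset_ball (by linarith) (hR h7)
  rw [h2, beltramiRhs, restrictΩ, h4, h5, h6, h8, Pi.smul_apply, h9, Set.indicator_of_mem hz,
    Set.indicator_of_mem hz, alphaCoeff]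
  simp only [map_mul, map_neg, Complex.conj_I, Complex.conj_conj, conj_eK, neg_neg,
    Complex.conj_ofReal, smul_eq_mul]
  ring

lemma isBeltramiSolution_iff (hΩ : MeasurableSet Ω) (hR : Ω ⊆ Metric.ball 0 (R / 2)) (hR0 : 0 < R)
    (hΩ₀ : MeasurableSet Ω₀) (hsub : Ω₀ ⊆ Ω) (μ : Coefficients Ω₀) (k : ℂ)
    (u : Lp ℂ 2 (volume.restrict Ω)) :
    IsBeltramiSolution Ω (extendCoeff μ) k u ↔
      u + mulCoeff hΩ hΩ₀ μ (beltramiOp hΩ R k u) = mulCoeff hΩ hΩ₀ μ (beltramiRhs Ω R k) := by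
  have h1 := opA_conj_ae_eq hΩ hR hR0 hΩ₀ hsub μ k u
  have h2 := neg_conj_alphaCoeff_ae hΩ hR hR0 hΩ₀ μ k
  have h3 := Lp.coeFn_add u (mulCoeff hΩ hΩ₀ μ (beltramiOp hΩ R k u))
  rw [Lp.ext_iff, IsBeltramiSolution]
  constructor
  · intro h
    filter_upwards [h, h1, h2, h3] with z h h1 h2 h3
    rw [h3, ← h2, Pi.add_apply, ← h1, h]
  · intro h
    filter_upwards [h, h1, h2, h3] with z h h1 h2 h3
    rw [h3, ← h2, Pi.add_apply, ← h1] at h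
    exact h

lemma solutionMap_eventuallyEq (hΩ : MeasurableSet Ω) (hR : Ω ⊆ Metric.ball 0 (R / 2))
    (hR0 : 0 < R) (hΩ₀ : MeasurableSet Ω₀) (hsub : Ω₀ ⊆ Ω) (k : ℂ) :
    ∀ᶠ μ : Coefficients Ω₀ in 𝓝 0, (∃! u, IsBeltramiSolution Ω (extendCoeff μ) k u) ∧
      solutionMap Ω Ω₀ k μ =
        neumannSol (mulCoeff hΩ hΩ₀) (beltramiOp hΩ R k) (beltramiRhs Ω R k) μ := by
  filter_upwards [eventually_isUnit (mulCoeff hΩ hΩ₀) (beltramiOp hΩ R k)] with μ hμ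
  have h : ∀ u, IsBeltramiSolution Ω (extendCoeff μ) k u ↔
      u = neumannSol (mulCoeff hΩ hΩ₀) (beltramiOp hΩ R k) (beltramiRhs Ω R k) μ := fun u =>
    (isBeltramiSolution_iff hΩ hR hR0 hΩ₀ hsub μ k u).trans (eq_neumannSol_iff _ _ _ hμ u)
  have hex : ∃! u, IsBeltramiSolution Ω (extendCoeff μ) k u :=
    ⟨_, (h _).2 rfl, fun u hu => (h u).1 hu⟩
  refine ⟨hex, ?_⟩
  rw [solutionMap, dif_pos hex]
  exact (h _).1 hex.exists.choose_spec

lemma contDiffAt_solutionMap (hΩ : MeasurableSet Ω) (hR : Ω ⊆ Metric.ball 0 (R / 2))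
    (hR0 : 0 < R) (hΩ₀ : MeasurableSet Ω₀) (hsub : Ω₀ ⊆ Ω) (k : ℂ) :
    ContDiffAt ℝ ∞ (solutionMap Ω Ω₀ k) 0 := by
  have h := (analyticAt_neumannSol (mulCoeff hΩ hΩ₀) (beltramiOp hΩ R k)
    (beltramiRhs Ω R k)).contDiffAt (n := ∞)
  refine h.congr_of_eventuallyEq ?_
  filter_upwards [solutionMap_eventuallyEq hΩ hR hR0 hΩ₀ hsub k] with μ hμ using hμ.2

/-- Derivatives at 0 depend only on the germ, so the arbitrary values of `solutionMap` where unique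
solvability fails do not matter. -/
lemma frechetTerm_eq (hΩ : MeasurableSet Ω) (hR : Ω ⊆ Metric.ball 0 (R / 2))
    (hR0 : 0 < R) (hΩ₀ : MeasurableSet Ω₀) (hsub : Ω₀ ⊆ Ω) (k : ℂ) (n : ℕ)
    (μ : Coefficients Ω₀) : frechetTerm Ω Ω₀ (n + 1) k μ =
      neumannTerm (mulCoeff hΩ hΩ₀) (beltramiOp hΩ R k) (beltramiRhs Ω R k) μ n := by
  rw [← iteratedFDeriv_neumannSol, frechetTerm]
  have h : solutionMap Ω Ω₀ k =ᶠ[𝓝 0]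
      neumannSol (mulCoeff hΩ hΩ₀) (beltramiOp hΩ R k) (beltramiRhs Ω R k) := by
    filter_upwards [solutionMap_eventuallyEq hΩ hR hR0 hΩ₀ hsub k] with μ hμ using hμ.2
  rw [(h.iteratedFDeriv ℝ (n + 1)).eq_of_nhds]

lemma neumannU_eq_zero (μ : Coefficients Ω₀) (k : ℂ) (n : ℕ) {z : ℂ}
    (hz : z ∉ Ω₀) : neumannU (extendCoeff μ) k n z = 0 := by
  have : extendCoeff μ z = 0 := Set.indicator_of_notMem hz _
  cases n <;> simp [neumannU, opA, alphaCoeff, nuCoeff, this]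

/-- Links the abstract Neumann terms to the iterates defined by pointwise integrals and principal
values. -/
lemma neumannTerm_ae_eq (hΩ : MeasurableSet Ω) (hR : Ω ⊆ Metric.ball 0 (R / 2))
    (hR0 : 0 < R) (hΩ₀ : MeasurableSet Ω₀) (hsub : Ω₀ ⊆ Ω) (k : ℂ) (n : ℕ)
    (μ : Coefficients Ω₀) :
    (neumannTerm (mulCoeff hΩ hΩ₀) (beltramiOp hΩ R k) (beltramiRhs Ω R k) μ n :
      Lp ℂ 2 (volume.restrict Ω)) =ᵐ[volume.restrict Ω] neumannU (extendCoeff μ) k n := by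
  induction n with
  | zero => exact (neg_conj_alphaCoeff_ae hΩ hR hR0 hΩ₀ μ k).symm
  | succ n ih =>
    set u := neumannTerm (mulCoeff hΩ hΩ₀) (beltramiOp hΩ R k) (beltramiRhs Ω R k) μ n with hu
    have hcongr : (fun w => conj (neumannU (extendCoeff μ) k n w)) =ᵐ[volume]
        conjL (extendLp 2 hΩ u) := by
      refine EventuallyEq.trans ?_ (extendConj_ae hΩ u)
      filter_upwards [(ae_restrict_iff' hΩ).1 ih] with z hz
      by_cases h : z ∈ Ω
      · rw [Set.indicator_of_mem h, hz h]
      · rw [Set.indicator_of_notMem h, neumannU_eq_zero μ k n fun h' => h (hsub h')]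
    -- The two functions to which A is applied agree only almost everywhere; both are compared with
    -- the same class in L².
    have h1 := opA_ae_eq hR hsub μ k hcongr (fun z hz => by
      rw [neumannU_eq_zero μ k n fun h' => hz (hsub h'), map_zero])
    have h2 := opA_ae_eq hR hsub μ k (extendConj_ae hΩ u) (fun z hz => by
      simp [Set.indicator_of_notMem hz])
    have h3 := opA_conj_ae_eq hΩ hR hR0 hΩ₀ hsub μ k u
    have h4 := Lp.coeFn_neg (mulCoeff hΩ hΩ₀ μ (beltramiOp hΩ R k u))
    filter_upwards [ae_restrict_of_ae h1, ae_restrict_of_ae h2, h3, h4] with z h1 h2 h3 h4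
    rw [neumannTerm, h4, Pi.neg_apply, ← h3]
    change _ = -opA (extendCoeff μ) k (fun w => conj (neumannU (extendCoeff μ) k n w)) z
    rw [h1, h2]

end Beltrami

/-! ### Chains of singular integral operators -/

section Chain

/-- Multiplication of an `L²` function by a bounded function, as a complex bilinear map. -/
def mulC : LinfC →L[ℂ] L2C →L[ℂ] L2C := (ContinuousLinearMap.mul ℂ ℂ).holderL volume ⊤ 2 2

lemma coeFn_mulC (a : LinfC) (F : L2C) : mulC a F =ᵐ[volume] fun z => a z * F z :=
  (ContinuousLinearMap.mul ℂ ℂ).coeFn_holder a F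

lemma norm_mulC_apply_le (a : LinfC) (F : L2C) : ‖mulC a F‖ ≤ ‖a‖ * ‖F‖ := by
  refine (mulC a).le_of_opNorm_le ?_ F
  refine (mulC.le_of_opNorm_le ((ContinuousLinearMap.norm_holderL_le _).trans
    (ContinuousLinearMap.opNorm_mul_le ℂ ℂ)) a).trans_eq (one_mul _)

/-- Complex conjugation of bounded functions. -/
def conjInf : LinfC →L[ℝ] LinfC := (Complex.conjCLE : ℂ →L[ℝ] ℂ).compLpL ⊤ volume

lemma coeFn_conjInf (F : LinfC) : conjInf F =ᵐ[volume] fun z => conj (F z) :=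
  ContinuousLinearMap.coeFn_compLpL _ F

lemma norm_conjInf_apply_le (F : LinfC) : ‖conjInf F‖ ≤ ‖F‖ :=
  (conjInf.le_of_opNorm_le ((ContinuousLinearMap.norm_compLpL_le _).trans (by simp)) F).trans_eq
    (one_mul _)

lemma norm_conjL_apply_le (F : L2C) : ‖conjL F‖ ≤ ‖F‖ :=
  (conjL.le_of_opNorm_le norm_conjL_le F).trans_eq (one_mul _)

lemma conjInf_smul (c : ℂ) (F : LinfC) : conjInf (c • F) = conj c • conjInf F := by
  refine Lp.ext ?_
  filter_upwards [coeFn_conjInf (c • F), Lp.coeFn_smul c F, Lp.coeFn_smul (conj c) (conjInf F),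
    coeFn_conjInf F] with z h1 h2 h3 h4
  rw [h1, h2, h3, Pi.smul_apply, Pi.smul_apply, h4, smul_eq_mul, smul_eq_mul, map_mul]

lemma conjL_smul (c : ℂ) (F : L2C) : conjL (c • F) = conj c • conjL F := by
  refine Lp.ext ?_
  filter_upwards [coeFn_conjL (c • F), Lp.coeFn_smul c F, Lp.coeFn_smul (conj c) (conjL F),
    coeFn_conjL F] with z h1 h2 h3 h4
  rw [h1, h2, h3, Pi.smul_apply, Pi.smul_apply, h4, smul_eq_mul, smul_eq_mul, map_mul]

/-- The conjugate `B ↦ conj (M (conj B))` of a multilinear map. -/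
def conjMultilinear {n : ℕ} (M : MultilinearMap ℂ (fun _ : Fin n => LinfC) L2C) :
    MultilinearMap ℂ (fun _ : Fin n => LinfC) L2C where
  toFun B := conjL (M fun i => conjInf (B i))
  map_update_add' B i x y := by
    have h : ∀ x : LinfC, (fun j => conjInf (Function.update B i x j)) =
        Function.update (fun j => conjInf (B j)) i (conjInf x) := fun x => by
      funext j
      exact Function.apply_update (fun _ => conjInf) B i x j
    rw [h, h, h, map_add, M.map_update_add, map_add]
  map_update_smul' B i c x := by
    have h : ∀ x : LinfC, (fun j => conjInf (Function.update B i x j)) =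
        Function.update (fun j => conjInf (B j)) i (conjInf x) := fun x => by
      funext j
      exact Function.apply_update (fun _ => conjInf) B i x j
    rw [h, h, conjInf_smul, M.map_update_smul, conjL_smul, Complex.conj_conj]

/-- The functions `V₀ = b₀ e_{-k} (-i conj k)`, `V_{m+1}(b) = b₀ e_{-k} conj((i k P + S) V_m(conj b'))`,
where `b'` is the tail of the sequence `b`. -/
def chain (P S : L2C →L[ℂ] L2C) (R : ℝ) (k : ℂ) :
    (m : ℕ) → MultilinearMap ℂ (fun _ : Fin (m + 1) => LinfC) L2C
  | 0 => LinearMap.uncurryLeft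
      { toFun := fun b => MultilinearMap.constOfIsEmpty ℂ (fun _ : Fin 0 => LinfC)
          (mulC b (mulC (eLp R (-k)) ((-Complex.I * conj k) • oneL R)))
        map_add' := fun b b' => by ext1; simp
        map_smul' := fun c b => by ext1; simp }
  | m + 1 => LinearMap.uncurryLeft
      { toFun := fun b => ((mulC b).comp (mulC (eLp R (-k)))).toLinearMap.compMultilinearMap
          (conjMultilinear ((stepOp P S k).toLinearMap.compMultilinearMap (chain P S R k m)))
        map_add' := fun b b' => by ext1; simp
        map_smul' := fun c b => by ext1; simp }

variable (P S : L2C →L[ℂ] L2C) (R : ℝ) (k : ℂ)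

lemma chain_zero (B : Fin 1 → LinfC) :
    chain P S R k 0 B = mulC (B 0) (mulC (eLp R (-k)) ((-Complex.I * conj k) • oneL R)) := rfl

lemma chain_succ {m : ℕ} (B : Fin (m + 2) → LinfC) :
    chain P S R k (m + 1) B = mulC (B 0) (mulC (eLp R (-k))
      (conjL (stepOp P S k (chain P S R k m fun i => conjInf (B i.succ))))) := rfl

lemma norm_stepOp_le : ‖stepOp P S k‖ ≤ (‖P‖ + ‖S‖ + 1) * (1 + ‖k‖) := by
  refine (norm_add_le _ _).trans ?_
  rw [norm_smul, norm_mul, Complex.norm_I, one_mul]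
  nlinarith [norm_nonneg P, norm_nonneg S, norm_nonneg k, mul_nonneg (norm_nonneg k) (norm_nonneg S)]

/-- The initial function contributes one factor of order |k| and each of the m steps one factor 1 +
|k|, whence the growth of order n = m + 1. -/
lemma norm_chain_le {m : ℕ} (B : Fin (m + 1) → LinfC) : ‖chain P S R k m B‖ ≤
    (∏ i, ‖B i‖) * ‖oneL R‖ * ((‖P‖ + ‖S‖ + 1) * (1 + ‖k‖)) ^ (m + 1) := by
  induction m with
  | zero =>
    rw [chain_zero, Fin.prod_univ_one, mul_assoc]
    refine (norm_mulC_apply_le _ _).trans (mul_le_mul_of_nonneg_left ?_ (norm_nonneg _))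
    refine (norm_mulC_apply_le _ _).trans
      ((mul_le_of_le_one_left (norm_nonneg _) (norm_eLp_le R (-k))).trans ?_)
    rw [norm_smul, norm_mul, norm_neg, Complex.norm_I, one_mul, Complex.norm_conj, mul_comm,
      zero_add, pow_one]
    refine mul_le_mul_of_nonneg_left ?_ (norm_nonneg _)
    nlinarith [norm_nonneg P, norm_nonneg S, norm_nonneg k,
      mul_nonneg (add_nonneg (norm_nonneg P) (norm_nonneg S)) (norm_nonneg k)]
  | succ m ih =>
    rw [chain_succ, Fin.prod_univ_succ, mul_assoc, mul_assoc]
    refine (norm_mulC_apply_le _ _).trans (mul_le_mul_of_nonneg_left ?_ (norm_nonneg _))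
    refine (norm_mulC_apply_le _ _).trans
      ((mul_le_of_le_one_left (norm_nonneg _) (norm_eLp_le R (-k))).trans ?_)
    refine (norm_conjL_apply_le _).trans (((stepOp P S k).le_opNorm _).trans ?_)
    refine (mul_le_mul (norm_stepOp_le P S k) (ih fun i => conjInf (B i.succ)) (norm_nonneg _)
      (by positivity)).trans ?_
    have h : ∏ i : Fin (m + 1), ‖conjInf (B i.succ)‖ ≤ ∏ i : Fin (m + 1), ‖B i.succ‖ :=
      Finset.prod_le_prod (fun _ _ => norm_nonneg _) fun _ _ => norm_conjInf_apply_le _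
    calc _ = (∏ i : Fin (m + 1), ‖conjInf (B i.succ)‖) *
          (‖oneL R‖ * ((‖P‖ + ‖S‖ + 1) * (1 + ‖k‖)) ^ (m + 1 + 1)) := by ring
      _ ≤ _ := mul_le_mul_of_nonneg_right h (by positivity)

lemma continuous_chain {m : ℕ} (B : Fin (m + 1) → LinfC) :
    Continuous fun k => chain P S R k m B := by
  have he : Continuous fun k => mulC (eLp R (-k)) :=
    mulC.continuous.comp ((continuous_eLp R).comp continuous_neg)
  induction m with
  | zero =>
    simp only [chain_zero]
    refine (mulC (B 0)).continuous.comp (he.clm_apply ?_)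
    exact (continuous_const.mul Complex.continuous_conj).smul continuous_const
  | succ m ih =>
    simp only [chain_succ]
    refine (mulC (B 0)).continuous.comp (he.clm_apply (conjL.continuous.comp ?_))
    refine Continuous.clm_apply ?_ (ih _)
    exact ((continuous_const.mul continuous_id).smul continuous_const).add continuous_const

lemma norm_cutCauchyL_le (δ : ℝ) : ‖cutCauchyL R δ‖ ≤ ∫ w, ‖cauchyKer R w‖ := by
  refine (norm_convL_le _ _).trans (integral_mono (integrable_cutCauchyKer R δ).norm
    (integrable_cauchyKer R).norm fun w => ?_)
  exact norm_indicator_le_norm_self _ _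

/-- By induction. For S the argument also moves with δ: the change of argument is absorbed by the
uniform norm bound, and strong convergence is applied to the fixed limit. -/
lemma tendsto_chain {m : ℕ} (B : Fin (m + 1) → LinfC) :
    Tendsto (fun δ => chain (cutCauchyL R δ) (cutBeurlingL δ) R k m B) (𝓝[>] 0)
      (𝓝 (chain (cauchyL R) beurlingL R k m B)) := by
  induction m with
  | zero => exact tendsto_const_nhds
  | succ m ih =>
    simp only [chain_succ]
    refine ((mulC (B 0)).continuous.tendsto _).comp (((mulC (eLp R (-k))).continuous.tendsto _).comp
      ((conjL.continuous.tendsto _).comp ?_))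
    set V := fun δ => chain (cutCauchyL R δ) (cutBeurlingL δ) R k m fun i => conjInf (B i.succ)
    have hV : Tendsto V (𝓝[>] 0) (𝓝 _) := ih fun i => conjInf (B i.succ)
    set W := chain (cauchyL R) beurlingL R k m fun i => conjInf (B i.succ)
    have h1 : Tendsto (fun δ => cutCauchyL R δ (V δ)) (𝓝[>] 0) (𝓝 (cauchyL R W)) :=
      (isBoundedBilinearMap_apply.continuous.tendsto (cauchyL R, W)).comp
        ((tendsto_cutCauchyL R).prodMk_nhds hV)
    have h2 : Tendsto (fun δ => cutBeurlingL δ (V δ - W)) (𝓝[>] 0) (𝓝 0) := by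
      have h0 : Tendsto (fun δ => ‖beurlingL‖ * ‖V δ - W‖) (𝓝[>] 0) (𝓝 0) := by
        have := (tendsto_iff_norm_sub_tendsto_zero.1 hV).const_mul ‖beurlingL‖
        rwa [mul_zero] at this
      refine squeeze_zero_norm' ?_ h0
      filter_upwards [self_mem_nhdsWithin] with δ hδ
      exact (cutBeurlingL δ).le_of_opNorm_le (norm_cutBeurlingL_le hδ) _
    have h3 : Tendsto (fun δ => cutBeurlingL δ (V δ)) (𝓝[>] 0) (𝓝 (beurlingL W)) := by
      have := h2.add (tendsto_cutBeurlingL W)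
      rw [zero_add] at this
      refine this.congr fun δ => ?_
      rw [map_sub, sub_add_cancel]
    exact (h1.const_smul (Complex.I * k)).add h3

end Chain
/-! ### The Born terms as chains -/

section Born

variable {Ω Ω₀ : Set ℂ} {R : ℝ} {z₀ : ℂ}

/-- The kernel of the evaluation of a Cauchy transform at `z₀`, for functions on `Ω₀`. -/
def evalKer (Ω₀ : Set ℂ) (z₀ w : ℂ) : ℂ := Ω₀.indicator (fun w => -(1 / (Real.pi : ℂ)) * (w - z₀)⁻¹) w

lemma measurable_evalKer (hΩ₀ : MeasurableSet Ω₀) (z₀ : ℂ) : Measurable (evalKer Ω₀ z₀) :=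
  Measurable.indicator (by fun_prop) hΩ₀

/-- The point z₀ has positive distance from `Ω₀`, so the Cauchy kernel at z₀ is bounded there and
evaluation at z₀ is a bounded functional on L². -/
lemma exists_norm_evalKer_le (hz : z₀ ∉ closure Ω₀) : ∃ C, 0 < C ∧ ∀ w, ‖evalKer Ω₀ z₀ w‖ ≤ C := by
  obtain ⟨ε, hε, h⟩ := Metric.isOpen_iff.1 isClosed_closure.isOpen_compl z₀ hz
  refine ⟨Real.pi⁻¹ * ε⁻¹, by positivity, fun w => ?_⟩
  by_cases hw : w ∈ Ω₀
  · rw [evalKer, Set.indicator_of_mem hw, norm_mul, norm_inv]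
    have h1 : ε ≤ ‖w - z₀‖ := by
      by_contra hlt
      exact h (by rwa [Metric.mem_ball, dist_eq_norm, ← not_le]) (subset_closure hw)
    have h2 : ‖-(1 / (Real.pi : ℂ))‖ = Real.pi⁻¹ := by simp [abs_of_pos Real.pi_pos]
    rw [h2]
    gcongr
  · rw [evalKer, Set.indicator_of_notMem hw, norm_zero]
    positivity

lemma memLp_evalKer (hΩ₀ : MeasurableSet Ω₀) (hb : Bornology.IsBounded Ω₀) (hz : z₀ ∉ closure Ω₀) :
    MemLp (fun w => conj (evalKer Ω₀ z₀ w)) 2 volume := by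
  obtain ⟨C, -, hC⟩ := exists_norm_evalKer_le hz
  have h1 : evalKer Ω₀ z₀ = Ω₀.indicator (evalKer Ω₀ z₀) := by
    rw [Set.indicator_eq_self.2]
    intro w hw
    by_contra h
    exact hw (Set.indicator_of_notMem h _)
  have : Fact (volume Ω₀ < ⊤) := ⟨hb.measure_lt_top⟩
  refine MemLp.conj ?_
  rw [h1, memLp_indicator_iff_restrict hΩ₀]
  exact MemLp.of_bound (measurable_evalKer hΩ₀ z₀).aestronglyMeasurable C (Eventually.of_forall hC)

/-- The evaluation of the Cauchy transform at `z₀`. -/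
def evalL (hΩ₀ : MeasurableSet Ω₀) (hb : Bornology.IsBounded Ω₀) (hz : z₀ ∉ closure Ω₀) :
    L2C →L[ℂ] ℂ :=
  innerSL ℂ (memLp_evalKer hΩ₀ hb hz).toLp

lemma evalL_apply (hΩ₀ : MeasurableSet Ω₀) (hb : Bornology.IsBounded Ω₀) (hz : z₀ ∉ closure Ω₀)
    (F : L2C) : evalL hΩ₀ hb hz F = ∫ w, evalKer Ω₀ z₀ w * F w := by
  change inner ℂ _ F = _
  conv_lhs => rw [← Lp.toLp_coeFn F (Lp.memLp F), L2C.inner_toLp]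
  simp only [Complex.conj_conj]

/-- The chain is normalised as V = -ρu. This absorbs the sign and the conjugation in ω = -Pρu, so
that the Born term is P applied to V. -/
lemma chain_ae_eq_neumannU (hR : Ω ⊆ Metric.ball 0 (R / 2))
    (hR0 : 0 < R) (hΩ₀ : MeasurableSet Ω₀) (hsub : Ω₀ ⊆ Ω) (k : ℂ) (m : ℕ) (μ : Coefficients Ω₀) :
    chain (cauchyL R) beurlingL R k m (fun _ => coeffL hΩ₀ μ) =ᵐ[volume]
      fun z => -conj (neumannU (extendCoeff μ) k m z) := by
  have hball : ∀ z, z ∈ Ω₀ → z ∈ Metric.ball (0 : ℂ) R := fun z hz =>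
    Metric.ball_subset_ball (by linarith) (hR (hsub hz))
  have hμ0 : ∀ z, z ∉ Ω₀ → extendCoeff μ z = 0 := fun z hz => Set.indicator_of_notMem hz _
  -- Here μ is real. The chain conjugates its inner arguments, which is why it is complex
  -- multilinear in general coefficients.
  have hstar : conjInf (coeffL hΩ₀ μ) = coeffL hΩ₀ μ := by
    refine Lp.ext ?_
    filter_upwards [coeFn_conjInf (coeffL hΩ₀ μ), coeFn_coeffL hΩ₀ μ] with z h1 h2
    rw [h1, h2]
    exact Complex.conj_ofReal _
  induction m with
  | zero =>
    rw [chain_zero]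
    filter_upwards [coeFn_mulC (coeffL hΩ₀ μ) (mulC (eLp R (-k)) ((-Complex.I * conj k) • oneL R)),
      coeFn_mulC (eLp R (-k)) ((-Complex.I * conj k) • oneL R), coeFn_coeffL hΩ₀ μ,
      coeFn_eLp R (-k), coeFn_oneL R, Lp.coeFn_smul (-Complex.I * conj k) (oneL R)]
      with z h1 h2 h3 h4 h5 h6
    rw [h1, h2, h3, h4, h6, Pi.smul_apply, h5]
    by_cases hz : z ∈ Ω₀
    · rw [Set.indicator_of_mem (hball z hz), Set.indicator_of_mem (hball z hz)]
      simp only [neumannU, alphaCoeff, map_neg, Complex.conj_conj, smul_eq_mul]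
      ring
    · simp [hμ0 z hz, neumannU, alphaCoeff]
  | succ m ih =>
    rw [chain_succ]
    simp only [hstar]
    set V := chain (cauchyL R) beurlingL R k m fun _ => coeffL hΩ₀ μ
    have hV : (fun w => conj (neumannU (extendCoeff μ) k m w)) =ᵐ[volume] (-V : L2C) := by
      filter_upwards [ih, Lp.coeFn_neg V] with z h1 h2
      rw [h2, Pi.neg_apply, h1, neg_neg]
    have h0 := opA_ae_eq hR hsub μ k hV (fun z hz => by
      rw [neumannU_eq_zero μ k m fun h' => hz (hsub h'), map_zero])
    rw [map_neg] at h0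
    filter_upwards [coeFn_mulC (coeffL hΩ₀ μ) (mulC (eLp R (-k))
        (conjL (stepOp (cauchyL R) beurlingL k V))),
      coeFn_mulC (eLp R (-k)) (conjL (stepOp (cauchyL R) beurlingL k V)), coeFn_coeffL hΩ₀ μ,
      coeFn_eLp R (-k), h0, coeFn_conjL (stepOp (cauchyL R) beurlingL k V),
      Lp.coeFn_neg (stepOp (cauchyL R) beurlingL k V)]
      with z h1 h2 h3 h4 h5 h6 h7
    rw [h1, h2, h3, h4, h6]
    change _ = -conj (-opA (extendCoeff μ) k (fun w => conj (neumannU (extendCoeff μ) k m w)) z)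
    rw [h5, h7, Pi.neg_apply]
    by_cases hz : z ∈ Ω₀
    · rw [Set.indicator_of_mem (hball z hz)]
      simp only [map_neg, map_mul, conj_eK, Complex.conj_ofReal]
      ring
    · simp [hμ0 z hz]

lemma bornTerm_eq (hΩ : MeasurableSet Ω) (hR : Ω ⊆ Metric.ball 0 (R / 2))
    (hR0 : 0 < R) (hΩ₀ : MeasurableSet Ω₀) (hsub : Ω₀ ⊆ Ω) (hb : Bornology.IsBounded Ω₀)
    (hz : z₀ ∉ closure Ω₀) (k : ℂ) (m : ℕ) (μ : Coefficients Ω₀) :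
    bornTerm Ω Ω₀ (m + 1) μ z₀ k =
      evalL hΩ₀ hb hz (chain (cauchyL R) beurlingL R k m fun _ => coeffL hΩ₀ μ) := by
  rw [bornTerm, frechetTerm_eq hΩ hR hR0 hΩ₀ hsub, cauchyP, evalL_apply, ← integral_const_mul,
    ← integral_neg]
  refine integral_congr_ae ?_
  filter_upwards [chain_ae_eq_neumannU hR hR0 hΩ₀ hsub k m μ,
    (ae_restrict_iff' hΩ).1 (neumannTerm_ae_eq hΩ hR hR0 hΩ₀ hsub k m μ)] with w h1 h2
  rw [h1]
  by_cases hw : w ∈ Ω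
  · rw [Set.indicator_of_mem hw, h2 hw]
    by_cases hw' : w ∈ Ω₀
    · rw [evalKer, Set.indicator_of_mem hw']
      ring
    · simp [neumannU_eq_zero μ k m hw']
  · have hw' : w ∉ Ω₀ := fun h => hw (hsub h)
    simp [Set.indicator_of_notMem hw, neumannU_eq_zero μ k m hw']

lemma continuous_bornTerm (hΩ : MeasurableSet Ω) (hR : Ω ⊆ Metric.ball 0 (R / 2))
    (hR0 : 0 < R) (hΩ₀ : MeasurableSet Ω₀) (hsub : Ω₀ ⊆ Ω) (hb : Bornology.IsBounded Ω₀)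
    (hz : z₀ ∉ closure Ω₀) (m : ℕ) (μ : Coefficients Ω₀) :
    Continuous fun k => bornTerm Ω Ω₀ (m + 1) μ z₀ k := by
  simp only [bornTerm_eq hΩ hR hR0 hΩ₀ hsub hb hz]
  exact (evalL hΩ₀ hb hz).continuous.comp (continuous_chain _ _ R _)

lemma exists_norm_bornTerm_le (hΩ : MeasurableSet Ω) (hR : Ω ⊆ Metric.ball 0 (R / 2))
    (hR0 : 0 < R) (hΩ₀ : MeasurableSet Ω₀) (hsub : Ω₀ ⊆ Ω) (hb : Bornology.IsBounded Ω₀)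
    (hz : z₀ ∉ closure Ω₀) (m : ℕ) (μ : Coefficients Ω₀) :
    ∃ C : ℝ, ∀ k : ℂ, ‖bornTerm Ω Ω₀ (m + 1) μ z₀ k‖ ≤ C * (1 + ‖k‖) ^ (m + 1) := by
  refine ⟨‖evalL hΩ₀ hb hz‖ * ((∏ _i : Fin (m + 1), ‖coeffL hΩ₀ μ‖) * ‖oneL R‖ *
    (‖cauchyL R‖ + ‖beurlingL‖ + 1) ^ (m + 1)), fun k => ?_⟩
  rw [bornTerm_eq hΩ hR hR0 hΩ₀ hsub hb hz]
  refine ((evalL hΩ₀ hb hz).le_opNorm _).trans ?_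
  rw [mul_assoc]
  refine mul_le_mul_of_nonneg_left ?_ (norm_nonneg _)
  refine (norm_chain_le _ _ R k _).trans_eq ?_
  rw [mul_pow]
  ring

end Born

/-! ### The kernels of the truncated chains -/

section ChainKernel

/-- The kernel of the truncated operator `i k P + S`. -/
def stepKer (δ : ℝ) (k w : ℂ) : ℂ :=
  {w : ℂ | δ < ‖w‖}.indicator (fun w => -(1 / (Real.pi : ℂ)) * (Complex.I * k * w⁻¹ + (w ^ 2)⁻¹)) w

lemma measurable_stepKer (δ : ℝ) (k : ℂ) : Measurable (stepKer δ k) :=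
  Measurable.indicator (by fun_prop) (measurableSet_lt_norm δ)

lemma norm_stepKer_le {δ : ℝ} (hδ : 0 < δ) (k w : ℂ) :
    ‖stepKer δ k w‖ ≤ (δ⁻¹ + δ⁻¹ ^ 2) * (1 + ‖k‖) := by
  by_cases hw : w ∈ {w : ℂ | δ < ‖w‖}
  · rw [stepKer, Set.indicator_of_mem hw]
    have hw' : δ < ‖w‖ := hw
    have h1 : ‖w‖⁻¹ ≤ δ⁻¹ := inv_anti₀ hδ hw'.le
    have hpi : ‖-(1 / (Real.pi : ℂ))‖ ≤ 1 := by
      rw [norm_neg, norm_div, norm_one, Complex.norm_real, Real.norm_of_nonneg Real.pi_pos.le]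
      exact (div_le_one Real.pi_pos).2 (by linarith [Real.two_le_pi])
    rw [norm_mul]
    refine (mul_le_of_le_one_left (norm_nonneg _) hpi).trans ((norm_add_le _ _).trans ?_)
    rw [norm_mul, norm_mul, Complex.norm_I, one_mul, norm_inv, norm_inv, norm_pow, ← inv_pow]
    have h2 : ‖w‖⁻¹ ^ 2 ≤ δ⁻¹ ^ 2 := pow_le_pow_left₀ (by positivity) h1 2
    have h3 : ‖k‖ * ‖w‖⁻¹ ≤ ‖k‖ * δ⁻¹ := mul_le_mul_of_nonneg_left h1 (norm_nonneg _)
    have : 0 ≤ δ⁻¹ ^ 2 * ‖k‖ := by positivity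
    nlinarith [inv_pos.2 hδ]
  · rw [stepKer, Set.indicator_of_notMem hw, norm_zero]
    positivity

variable {m : ℕ}

/-- The factor of the kernel at the `i`-th link. -/
def linkFactor (δ τ φ : ℝ) (z : Fin (m + 1) → ℂ) (i : Fin m) : ℂ :=
  {z : Fin (m + 1) → ℂ | δ < ‖z i.castSucc - z i.succ‖}.indicator (fun z =>
    -(1 / (Real.pi : ℂ)) * (Complex.I * τ * angularFactor i φ * (linkDifference z i)⁻¹ +
      (linkDifference z i ^ 2)⁻¹)) z

/-- The kernel of a truncated chain. -/
def chainKernel (m : ℕ) (δ τ φ : ℝ) (z : Fin (m + 1) → ℂ) : ℂ :=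
  Complex.exp (Complex.I * τ * phase m φ z) * (Complex.I * τ * angularFactor m φ) *
    ∏ i : Fin m, linkFactor δ τ φ z i

/-- Each step of the chain conjugates the kernel of the tail; conjugation advances the alternating
signs by one index, up to the sign compensated by conj(i) = -i. -/
lemma conj_angularFactor (i : ℕ) (φ : ℝ) : conj (angularFactor i φ) = -angularFactor (i + 1) φ := by
  simp only [angularFactor, map_mul, map_pow, map_neg, map_one, ← Complex.exp_conj, Complex.conj_I,
    Complex.conj_ofReal]
  rw [pow_succ (-1 : ℂ) (i + 1)]
  ring_nf

lemma linkDifference_tail (z : Fin (m + 2) → ℂ) (i : Fin m) :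
    linkDifference z i.succ = conj (linkDifference (fun j => z j.succ) i) := by
  simp only [linkDifference, Fin.val_succ, Nat.even_add_one, Fin.castSucc_succ]
  split_ifs <;> simp

lemma linkFactor_succ (δ τ φ : ℝ) (z : Fin (m + 2) → ℂ) (i : Fin m) :
    linkFactor δ τ φ z i.succ = conj (linkFactor δ τ φ (fun j => z j.succ) i) := by
  simp only [linkFactor, Set.indicator_apply, Set.mem_ofPred_eq, Fin.castSucc_succ]
  split_ifs
  · simp only [map_mul, map_neg, map_add, map_inv₀, map_pow, conj_angularFactor, Complex.conj_I,
      Complex.conj_ofReal, linkDifference_tail, Fin.val_succ, map_div₀, map_one]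
    ring
  · simp

lemma linkFactor_zero (δ τ φ : ℝ) (z : Fin (m + 2) → ℂ) :
    linkFactor δ τ φ z 0 =
      conj (stepKer δ (τ * Complex.exp (Complex.I * φ)) (z 1 - z 0)) := by
  simp only [linkFactor, stepKer, Set.indicator_apply, Set.mem_ofPred_eq, Fin.castSucc_zero,
    Fin.succ_zero_eq_one, norm_sub_rev (z 1)]
  split_ifs
  · have h : conj (Complex.exp (Complex.I * φ)) = -angularFactor 0 φ := by
      simp [angularFactor, ← Complex.exp_conj]
    simp only [map_mul, map_neg, map_add, map_inv₀, map_pow, h, Complex.conj_I,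
      Complex.conj_ofReal, linkDifference, Fin.val_zero, Even.zero, if_true, map_div₀, map_one,
      Fin.castSucc_zero, Fin.succ_zero_eq_one]
    ring
  · simp

lemma phase_succ (φ : ℝ) (z : Fin (m + 2) → ℂ) : phase (m + 1) φ z =
    -(2 * (Complex.exp (Complex.I * φ) * z 0).re) - phase m φ fun j => z j.succ := by
  simp only [phase, Fin.sum_univ_succ (n := m + 1), Fin.val_zero, Fin.val_succ]
  have : ∑ x : Fin (m + 1), (-1 : ℂ) ^ ((x : ℕ) + 1 + 1) * z x.succ =
      -∑ x : Fin (m + 1), (-1 : ℂ) ^ ((x : ℕ) + 1) * z x.succ := by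
    rw [← Finset.sum_neg_distrib]
    refine Finset.sum_congr rfl fun x _ => ?_
    rw [pow_succ]
    ring
  rw [this]
  simp only [mul_add, mul_neg, Complex.add_re, Complex.neg_re, zero_add, pow_one, neg_mul, one_mul]
  ring

lemma eK_neg_eq (τ φ : ℝ) (z : ℂ) : eK (-(τ * Complex.exp (Complex.I * φ))) z =
    Complex.exp (Complex.I * τ * ((-(2 * (Complex.exp (Complex.I * φ) * z).re) : ℝ) : ℂ)) := by
  rw [eK_eq]
  congr 1
  have : (-(↑τ * Complex.exp (Complex.I * ↑φ)) * z).re =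
      -(τ * (Complex.exp (Complex.I * φ) * z).re) := by
    rw [neg_mul, Complex.neg_re, mul_assoc, Complex.re_ofReal_mul]
  rw [this]
  push_cast
  ring

lemma chainKernel_zero (δ τ φ : ℝ) (z : Fin 1 → ℂ) : chainKernel 0 δ τ φ z =
    eK (-(τ * Complex.exp (Complex.I * φ))) (z 0) *
      (-Complex.I * conj (τ * Complex.exp (Complex.I * φ))) := by
  have h : conj (Complex.exp (Complex.I * φ)) = -angularFactor 0 φ := by
    simp [angularFactor, ← Complex.exp_conj]
  have h2 : phase 0 φ z = -(2 * (Complex.exp (Complex.I * φ) * z 0).re) := by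
    simp [phase]
    ring
  rw [chainKernel, eK_neg_eq, map_mul, h, h2, Complex.conj_ofReal, Fin.prod_univ_zero, mul_one]
  ring

/-- The counterpart of `chain_succ` for kernels: the alternating phase, angular factors and
conjugated differences are what the recursion V ↦ e_{-k} conj((ikP + S)V) produces. -/
lemma chainKernel_succ (δ τ φ : ℝ) (z : Fin (m + 2) → ℂ) : chainKernel (m + 1) δ τ φ z =
    eK (-(τ * Complex.exp (Complex.I * φ))) (z 0) *
      conj (stepKer δ (τ * Complex.exp (Complex.I * φ)) (z 1 - z 0) *
        chainKernel m δ τ φ fun j => z j.succ) := by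
  have h : Complex.exp (Complex.I * τ * phase (m + 1) φ z) =
      eK (-(τ * Complex.exp (Complex.I * φ))) (z 0) *
        conj (Complex.exp (Complex.I * τ * phase m φ fun j => z j.succ)) := by
    rw [eK_neg_eq, ← Complex.exp_conj, ← Complex.exp_add, phase_succ]
    congr 1
    simp only [map_mul, Complex.conj_I, Complex.conj_ofReal]
    push_cast
    ring
  rw [chainKernel, h, Fin.prod_univ_succ, linkFactor_zero, chainKernel, map_mul, map_mul, map_mul,
    map_prod]
  simp only [linkFactor_succ, map_mul, conj_angularFactor, Complex.conj_I, Complex.conj_ofReal]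
  ring

lemma norm_exp_I_mul_mul (τ s : ℝ) : ‖Complex.exp (Complex.I * τ * s)‖ = 1 := by
  have h : Complex.I * τ * s = ((τ * s : ℝ) : ℂ) * Complex.I := by
    push_cast
    ring
  rw [h, Complex.norm_exp_ofReal_mul_I]

lemma norm_chainKernel_le {δ : ℝ} (hδ : 0 < δ) (τ φ : ℝ) (z : Fin (m + 1) → ℂ) :
    ‖chainKernel m δ τ φ z‖ ≤ (δ⁻¹ + δ⁻¹ ^ 2) ^ m * (1 + |τ|) ^ (m + 1) := by
  have hk : ‖(τ : ℂ) * Complex.exp (Complex.I * φ)‖ = |τ| := by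
    rw [norm_mul, mul_comm Complex.I, Complex.norm_exp_ofReal_mul_I, mul_one, Complex.norm_real,
      Real.norm_eq_abs]
  induction m with
  | zero =>
    rw [chainKernel_zero, norm_mul, norm_eK, norm_mul, norm_neg, Complex.norm_I, Complex.norm_conj,
      hk]
    simp
  | succ m ih =>
    rw [chainKernel_succ, norm_mul, norm_eK, one_mul, Complex.norm_conj, norm_mul]
    refine (mul_le_mul (norm_stepKer_le hδ _ _) (ih _) (norm_nonneg _) (by positivity)).trans_eq ?_
    rw [hk]
    ring

lemma continuous_phase : Continuous fun p : ℝ × (Fin (m + 1) → ℂ) => phase m p.1 p.2 := by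
  unfold phase
  fun_prop

lemma continuous_angularFactor (i : ℕ) : Continuous (angularFactor i) := by
  unfold angularFactor
  fun_prop

lemma continuous_linkDifference (i : Fin m) :
    Continuous fun z : Fin (m + 1) → ℂ => linkDifference z i := by
  unfold linkDifference
  split_ifs <;> fun_prop

lemma measurable_chainKernel (δ : ℝ) :
    Measurable fun p : ℝ × ℝ × (Fin (m + 1) → ℂ) => chainKernel m δ p.1 p.2.1 p.2.2 := by
  have h1 : Measurable fun p : ℝ × ℝ × (Fin (m + 1) → ℂ) => phase m p.2.1 p.2.2 :=
    (continuous_phase.comp continuous_snd).measurable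
  have h2 : ∀ i, Measurable fun p : ℝ × ℝ × (Fin (m + 1) → ℂ) => angularFactor i p.2.1 := fun i =>
    ((continuous_angularFactor i).comp (continuous_fst.comp continuous_snd)).measurable
  have h3 : ∀ i : Fin m, Measurable fun p : ℝ × ℝ × (Fin (m + 1) → ℂ) =>
      linkDifference p.2.2 i := fun i =>
    ((continuous_linkDifference i).comp (continuous_snd.comp continuous_snd)).measurable
  have h4 : Measurable fun p : ℝ × ℝ × (Fin (m + 1) → ℂ) => Complex.I * (p.1 : ℂ) := by fun_prop
  unfold chainKernel
  refine ((Complex.measurable_exp.comp (h4.mul (Complex.measurable_ofReal.comp h1))).mul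
    (h4.mul (h2 m))).mul (Finset.measurable_fun_prod _ fun i _ => ?_)
  have h5 : MeasurableSet {p : ℝ × ℝ × (Fin (m + 1) → ℂ) |
      δ < ‖p.2.2 i.castSucc - p.2.2 i.succ‖} := measurableSet_lt measurable_const (by fun_prop)
  exact Measurable.indicator (f := fun p : ℝ × ℝ × (Fin (m + 1) → ℂ) =>
    -(1 / (Real.pi : ℂ)) * (Complex.I * p.1 * angularFactor i p.2.1 * (linkDifference p.2.2 i)⁻¹ +
      (linkDifference p.2.2 i ^ 2)⁻¹)) (((((h4.mul (h2 i)).mul (h3 i).inv)).add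
        ((h3 i).pow_const 2).inv).const_mul _) h5

lemma integral_pi_succ {f : (Fin (m + 2) → ℂ) → ℂ} (hf : Integrable f) :
    ∫ z, f z = ∫ x, ∫ z' : Fin (m + 1) → ℂ, f (Fin.cons x z') := by
  have h := (volume_preserving_piFinSuccAbove (fun _ : Fin (m + 2) => ℂ) 0).symm
  have h1 : ∀ p : ℂ × (Fin (m + 1) → ℂ),
      (MeasurableEquiv.piFinSuccAbove (fun _ : Fin (m + 2) => ℂ) 0).symm p =
        Fin.cons p.1 p.2 := fun p => by
    rw [MeasurableEquiv.piFinSuccAbove_symm_apply]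
    exact Fin.insertNth_zero' p.1 p.2
  rw [← h.integral_comp' f]
  have h2 := h.integrable_comp_of_integrable hf
  simp only [Function.comp_def, h1] at h2 ⊢
  exact integral_prod _ h2

lemma integrable_chainKernel {δ : ℝ} (hδ : 0 < δ) (τ φ : ℝ) {b : Fin (m + 1) → ℂ → ℂ}
    (hb : ∀ i, Integrable (b i)) {G : ℂ → ℂ} (hG : Measurable G) {C : ℝ} (hGC : ∀ w, ‖G w‖ ≤ C) :
    Integrable fun z : Fin (m + 1) → ℂ => G (z 0) * ((∏ i, b i (z i)) * chainKernel m δ τ φ z) := by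
  have h1 : Integrable fun z : Fin (m + 1) → ℂ => ∏ i, b i (z i) := Integrable.fintype_prod hb
  have h2 : Measurable fun z : Fin (m + 1) → ℂ => chainKernel m δ τ φ z :=
    (measurable_chainKernel δ).comp (g := fun p : ℝ × ℝ × (Fin (m + 1) → ℂ) =>
      chainKernel m δ p.1 p.2.1 p.2.2) (f := fun z : Fin (m + 1) → ℂ => (τ, φ, z))
      (measurable_const.prodMk (measurable_const.prodMk measurable_id))
  have h3 : Integrable fun z : Fin (m + 1) → ℂ => (∏ i, b i (z i)) * chainKernel m δ τ φ z :=
    h1.mul_bdd h2.aestronglyMeasurable (Eventually.of_forall (norm_chainKernel_le hδ τ φ))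
  have h4 : Measurable fun z : Fin (m + 1) → ℂ => G (z 0) := hG.comp (measurable_pi_apply 0)
  exact h3.bdd_mul h4.aestronglyMeasurable (Eventually.of_forall fun z => hGC (z 0))

/-- Replaces the L² operators by one absolutely convergent integral, in which the truncated kernels
of P and S are added before integration. -/
lemma chain_trunc_succ_ae {R δ : ℝ} (hδ : 0 < δ) (k : ℂ) {B : Fin (m + 2) → LinfC} {b : ℂ → ℂ}
    (hb : B 0 =ᵐ[volume] b) (hbR : ∀ z ∉ Metric.ball (0 : ℂ) (R / 2), b z = 0) (hR0 : 0 < R)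
    {V : L2C} (hV : ∀ᵐ w, w ∉ Metric.ball (0 : ℂ) (R / 2) → V w = 0)
    (hVi : Integrable V) :
    mulC (B 0) (mulC (eLp R (-k)) (conjL (stepOp (cutCauchyL R δ) (cutBeurlingL δ) k V)))
      =ᵐ[volume] fun z => b z * (eK (-k) z * conj (∫ w, stepKer δ k (w - z) * V w)) := by
  set F := stepOp (cutCauchyL R δ) (cutBeurlingL δ) k V
  filter_upwards [coeFn_mulC (B 0) (mulC (eLp R (-k)) (conjL F)), coeFn_mulC (eLp R (-k)) (conjL F),
    hb, coeFn_eLp R (-k), coeFn_conjL F, coeFn_stepOp (cutCauchyL R δ) (cutBeurlingL δ) k V,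
    coeFn_convL (measurable_cutCauchyKer R δ) (integrable_cutCauchyKer R δ) V,
    coeFn_cutBeurlingL hδ V] with z h1 h2 h3 h4 h5 h6 h7 h8
  rw [h1, h2, h3, h4, h5]
  by_cases hz : z ∈ Metric.ball (0 : ℂ) (R / 2)
  swap
  · rw [hbR z hz, zero_mul, zero_mul]
  rw [Set.indicator_of_mem (Metric.ball_subset_ball (by linarith) hz), h6, cutCauchyL, h7, h8]
  have hm : MeasurableSet {w : ℂ | δ < ‖w - z‖} := measurableSet_lt measurable_const (by fun_prop)
  rw [← integral_const_mul (Complex.I * k), ← integral_const_mul (-(1 / (Real.pi : ℂ))),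
    ← integral_indicator hm, ← integral_add ?_ ?_]
  · congr 3
    refine integral_congr_ae ?_
    filter_upwards [hV] with w hw
    by_cases hwR : w ∈ Metric.ball (0 : ℂ) (R / 2)
    swap
    · simp [hw hwR, Set.indicator]
    -- Both points lie in the ball of radius R/2, so the outer cut-off of the Cauchy kernel is
    -- inactive.
    have hball : w - z ∈ Metric.ball (0 : ℂ) R := by
      rw [Metric.mem_ball, dist_zero_right] at *
      exact (norm_sub_le w z).trans_lt (by linarith)
    by_cases hd : δ < ‖w - z‖
    · rw [cutCauchyKer, Set.indicator_of_mem (show w - z ∈ {w : ℂ | δ < ‖w‖} from hd), cauchyKer,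
        Set.indicator_of_mem hball, Set.indicator_of_mem (show w ∈ {w : ℂ | δ < ‖w - z‖} from hd),
        stepKer, Set.indicator_of_mem (show w - z ∈ {w : ℂ | δ < ‖w‖} from hd)]
      ring
    · rw [cutCauchyKer, Set.indicator_of_notMem (show w - z ∉ {w : ℂ | δ < ‖w‖} from hd),
        Set.indicator_of_notMem (show w ∉ {w : ℂ | δ < ‖w - z‖} from hd),
        stepKer, Set.indicator_of_notMem (show w - z ∉ {w : ℂ | δ < ‖w‖} from hd)]
      ring
  · refine Integrable.const_mul ?_ _
    have : ∀ w, ‖cutCauchyKer R δ (w - z)‖ ≤ Real.pi⁻¹ * δ⁻¹ := fun w => by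
      rw [cutCauchyKer, cauchyKer]
      by_cases hd : δ < ‖w - z‖
      · rw [Set.indicator_of_mem (show w - z ∈ {w : ℂ | δ < ‖w‖} from hd)]
        refine (norm_indicator_le_norm_self _ _).trans ?_
        rw [norm_mul, norm_inv, norm_neg, norm_div, norm_one, Complex.norm_real,
          Real.norm_of_nonneg Real.pi_pos.le, one_div]
        exact mul_le_mul_of_nonneg_left (inv_anti₀ hδ hd.le) (by positivity)
      · rw [Set.indicator_of_notMem (show w - z ∉ {w : ℂ | δ < ‖w‖} from hd), norm_zero]
        positivity
    exact hVi.bdd_mul ((measurable_cutCauchyKer R δ).comp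
      (measurable_id.sub_const z)).aestronglyMeasurable (Eventually.of_forall this)
  · rw [integrable_indicator_iff hm]
    refine Integrable.const_mul ?_ _
    change IntegrableOn _ _ _
    rw [← integrable_indicator_iff hm]
    have h9 : (fun w => cutKernel z δ w * V w) =
        fun w => -({w : ℂ | δ < ‖w - z‖}.indicator (fun w => V w / (w - z) ^ 2) w) := by
      funext w
      simp only [cutKernel, Set.indicator_apply]
      split_ifs
      · ring
      · simp
    have h10 : Integrable fun w => cutKernel z δ w * V w :=
      (memLp_cutKernel z hδ).integrable_mul (Lp.memLp V)
    rw [h9] at h10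
    simpa using h10.neg

lemma chain_ae_eq_zero (P S : L2C →L[ℂ] L2C) (R : ℝ) (k : ℂ) {B : Fin (m + 1) → LinfC} {b : ℂ → ℂ}
    (hb : B 0 =ᵐ[volume] b) (hbR : ∀ z ∉ Metric.ball (0 : ℂ) (R / 2), b z = 0) :
    ∀ᵐ w, w ∉ Metric.ball (0 : ℂ) (R / 2) → chain P S R k m B w = 0 := by
  obtain ⟨F, hF⟩ : ∃ F, chain P S R k m B = mulC (B 0) F := by
    cases m with
    | zero => exact ⟨_, chain_zero P S R k B⟩
    | succ m => exact ⟨_, chain_succ P S R k B⟩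
  rw [hF]
  filter_upwards [coeFn_mulC (B 0) F, hb] with w h1 h2 hw
  rw [h1, h2, hbR w hw, zero_mul]

lemma L2C.integrable_of_ae_eq_zero {V : L2C} {s : ℝ}
    (hV : ∀ᵐ w, w ∉ Metric.ball (0 : ℂ) s → V w = 0) : Integrable V := by
  have h1 : V =ᵐ[volume] (Metric.ball (0 : ℂ) s).indicator V := by
    filter_upwards [hV] with w hw
    by_cases h : w ∈ Metric.ball (0 : ℂ) s
    · rw [Set.indicator_of_mem h]
    · rw [Set.indicator_of_notMem h, hw h]
  refine Integrable.congr ?_ h1.symm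
  rw [integrable_indicator_iff measurableSet_ball]
  have : Fact (volume (Metric.ball (0 : ℂ) s) < ⊤) := ⟨measure_ball_lt_top⟩
  exact ((Lp.memLp V).restrict _).integrable (by norm_num)

/-- The bounded test function `G` is left general for the induction: the inner integral of a longer
chain is a shorter chain tested against the kernel of the next step. -/
lemma integral_chainKernel {R δ : ℝ} (hδ : 0 < δ) (hR0 : 0 < R) (τ φ : ℝ) {B : Fin (m + 1) → LinfC}
    {b : Fin (m + 1) → ℂ → ℂ} (hb : ∀ i, B i =ᵐ[volume] b i) (hbi : ∀ i, Integrable (b i))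
    (hbR : ∀ i, ∀ z ∉ Metric.ball (0 : ℂ) (R / 2), b i z = 0) {G : ℂ → ℂ} (hG : Measurable G)
    {C : ℝ} (hGC : ∀ w, ‖G w‖ ≤ C) :
    ∫ z : Fin (m + 1) → ℂ, G (z 0) * ((∏ i, b i (z i)) * chainKernel m δ τ φ z) =
      ∫ w, G w * chain (cutCauchyL R δ) (cutBeurlingL δ) R (τ * Complex.exp (Complex.I * φ)) m B w := by
  set k : ℂ := τ * Complex.exp (Complex.I * φ) with hk
  induction m generalizing G C with
  | zero =>
    rw [← (volume_preserving_funUnique (Fin 1) ℂ).integral_comp'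
      (g := fun w => G w * chain (cutCauchyL R δ) (cutBeurlingL δ) R k 0 B w)]
    refine integral_congr_ae ?_
    have h1 : ∀ᵐ w, chain (cutCauchyL R δ) (cutBeurlingL δ) R k 0 B w =
        b 0 w * (eK (-k) w * (-Complex.I * conj k)) := by
      rw [chain_zero]
      filter_upwards [coeFn_mulC (B 0) (mulC (eLp R (-k)) ((-Complex.I * conj k) • oneL R)),
        coeFn_mulC (eLp R (-k)) ((-Complex.I * conj k) • oneL R), hb 0,
        coeFn_eLp R (-k), coeFn_oneL R, Lp.coeFn_smul (-Complex.I * conj k) (oneL R)]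
        with z h1 h2 h3 h4 h5 h6
      rw [h1, h2, h3, h4, h6, Pi.smul_apply, h5]
      by_cases hz : z ∈ Metric.ball (0 : ℂ) (R / 2)
      · have hz' := Metric.ball_subset_ball (show R / 2 ≤ R by linarith) hz
        rw [Set.indicator_of_mem hz', Set.indicator_of_mem hz', smul_eq_mul, mul_one]
      · simp [hbR 0 z hz]
    filter_upwards [(volume_preserving_funUnique (Fin 1) ℂ).quasiMeasurePreserving.ae h1] with z hz
    have hz0 : MeasurableEquiv.funUnique (Fin 1) ℂ z = z 0 := rfl
    rw [hz0] at hz ⊢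
    rw [hz, chainKernel_zero, Fin.prod_univ_one]
  | succ m ih =>
    set V := chain (cutCauchyL R δ) (cutBeurlingL δ) R k m fun i => conjInf (B i.succ) with hV
    have hb' : ∀ i : Fin (m + 1), conjInf (B i.succ) =ᵐ[volume] fun z => conj (b i.succ z) :=
      fun i => by
        filter_upwards [coeFn_conjInf (B i.succ), hb i.succ] with z h1 h2
        rw [h1, h2]
    have hbR' : ∀ i : Fin (m + 1), ∀ z ∉ Metric.ball (0 : ℂ) (R / 2), conj (b i.succ z) = 0 :=
      fun i z hz => by rw [hbR i.succ z hz, map_zero]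
    have hbi' : ∀ i : Fin (m + 1), Integrable fun z => conj (b i.succ z) := fun i =>
      Complex.conjCLE.toContinuousLinearMap.integrable_comp (hbi i.succ)
    have h0 := chain_ae_eq_zero (m := m) (B := fun i => conjInf (B i.succ)) (cutCauchyL R δ) (cutBeurlingL δ) R k (hb' 0) (hbR' 0)
    have h1 := chain_trunc_succ_ae (m := m) hδ k (hb 0) (hbR 0) hR0 h0
      (L2C.integrable_of_ae_eq_zero h0)
    rw [integral_pi_succ (integrable_chainKernel hδ τ φ hbi hG hGC)]
    refine integral_congr_ae ?_
    rw [chain_succ]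
    filter_upwards [h1] with x hx
    -- The induction hypothesis is applied to the tail with the step kernel based at the outer
    -- variable as test function.
    rw [hx, ← ih hb' hbi' hbR' (G := fun w => stepKer δ k (w - x))
      ((measurable_stepKer δ k).comp (measurable_id.sub_const x))
      (fun w => norm_stepKer_le hδ k (w - x)), ← integral_conj, ← mul_assoc, ← mul_assoc,
      ← integral_const_mul]
    refine integral_congr_ae (Eventually.of_forall fun z' => ?_)
    simp only [Fin.prod_univ_succ, chainKernel_succ, Fin.cons_zero, Fin.cons_succ, map_mul,
      map_prod, Complex.conj_conj, ← hk]
    have : (Fin.cons x z' : Fin (m + 2) → ℂ) 1 = z' 0 := rfl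
    rw [this]
    ring

end ChainKernel

/-! ### Construction of distributions -/

section Construction

variable {E : Type*} [NormedAddCommGroup E] [NormedSpace ℝ E]

open TestFunction in
/-- The distribution defined by a linear functional that is bounded, on test functions supported
in a given compact set, by finitely many derivatives. -/
def distributionOfBound (L : 𝓓((⊤ : Opens E), ℂ) → ℂ) (hadd : ∀ f g, L (f + g) = L f + L g)
    (hsmul : ∀ (c : ℂ) f, L (c • f) = c • L f)
    (hb : ∀ K : Set E, IsCompact K → ∃ (N : ℕ) (C : ℝ), 0 ≤ C ∧ ∀ (ψ : 𝓓((⊤ : Opens E), ℂ)) (M : ℝ),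
      tsupport ψ ⊆ K → (∀ i ≤ N, ∀ x, ‖iteratedFDeriv ℝ i ψ x‖ ≤ M) → ‖L ψ‖ ≤ C * M) :
    ComplexDistribution E :=
  TestFunction.mkCLM ℂ L hadd hsmul fun K hK => by
    have hbK := hb K K.isCompact
    refine (ContDiffMapSupportedIn.mkCLMtoNormedSpace (𝕜 := ℂ) (L ∘ ofSupportedIn hK)
      (fun f g => hadd (ofSupportedIn hK f) (ofSupportedIn hK g))
      (fun c f => hsmul c (ofSupportedIn hK f)) ?_).continuous
    obtain ⟨N, C, hC, h⟩ := hbK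
    refine ⟨Finset.range (N + 1), C, hC, fun f => h (ofSupportedIn hK f) _ f.tsupport_subset
      fun i hi x => ?_⟩
    refine (ContDiffMapSupportedIn.norm_iteratedFDeriv_apply_le_seminorm_top ℂ (f := f)).trans ?_
    exact Seminorm.le_finset_sup_apply (p := fun i => ContDiffMapSupportedIn.seminorm ℂ E ℂ _ K i)
      (Finset.mem_range.2 (Nat.lt_succ_of_le hi))

lemma iteratedDeriv_fst_eq {F : Type*} [NormedAddCommGroup F] [NormedSpace ℝ F] {ψ : ℝ × F → ℂ}
    (hψ : ContDiff ℝ ∞ ψ) (p : ℕ) (s : ℝ) (y : F) :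
    iteratedDeriv p (fun t => ψ (t, y)) s = iteratedFDeriv ℝ p ψ (s, y) fun _ => (1, 0) := by
  have h1 : (fun t => ψ (t, y)) = (fun q => ψ (q + (0, y))) ∘ ContinuousLinearMap.inl ℝ ℝ F := by
    funext t
    simp
  have h2 : ContDiff ℝ ∞ fun q => ψ (q + (0, y)) := hψ.comp (contDiff_id.add contDiff_const)
  rw [iteratedDeriv_eq_iteratedFDeriv, h1,
    ContinuousLinearMap.iteratedFDeriv_comp_right _ h2 s (mod_cast le_top)]
  simp [iteratedFDeriv_comp_add_right]

lemma norm_iteratedDeriv_fst_le {F : Type*} [NormedAddCommGroup F] [NormedSpace ℝ F]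
    {ψ : ℝ × F → ℂ} (hψ : ContDiff ℝ ∞ ψ) (p : ℕ) (s : ℝ) (y : F) :
    ‖iteratedDeriv p (fun t => ψ (t, y)) s‖ ≤ ‖iteratedFDeriv ℝ p ψ (s, y)‖ := by
  rw [iteratedDeriv_fst_eq hψ]
  refine (ContinuousMultilinearMap.le_opNorm _ _).trans_eq ?_
  simp [Prod.norm_def]

end Construction

/-! ### The Fourier transform in one variable -/

section Fourier

open scoped FourierTransform

/-- The Fourier transform, with the normalization `∫ e^{-itτ} f(t) dt`. -/
def ft (f : ℝ → ℂ) (τ : ℝ) : ℂ := ∫ t : ℝ, Complex.exp (-Complex.I * t * τ) * f t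

variable {f : ℝ → ℂ}

lemma ft_eq_fourier (f : ℝ → ℂ) (τ : ℝ) : ft f τ = 𝓕 f (τ / (2 * Real.pi)) := by
  rw [ft, Real.fourier_real_eq_integral_exp_smul]
  refine integral_congr_ae (Eventually.of_forall fun t => ?_)
  simp only [smul_eq_mul]
  congr 2
  have := Real.pi_ne_zero
  push_cast
  field_simp

lemma integrable_iteratedDeriv (hf : ContDiff ℝ ∞ f) (hc : HasCompactSupport f) (p : ℕ) :
    Integrable (iteratedDeriv p f) := by
  refine (hf.continuous_iteratedDeriv p (mod_cast le_top)).integrable_of_hasCompactSupport ?_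
  have h := hc.iteratedFDeriv (𝕜 := ℝ) p
  refine h.comp_left (g := fun L : ContinuousMultilinearMap ℝ (fun _ : Fin p => ℝ) ℂ =>
    L fun _ => 1) rfl

lemma ft_iteratedDeriv (hf : ContDiff ℝ ∞ f) (hc : HasCompactSupport f) (p : ℕ) (τ : ℝ) :
    ft (iteratedDeriv p f) τ = (Complex.I * τ) ^ p * ft f τ := by
  rw [ft_eq_fourier, ft_eq_fourier, Real.fourier_iteratedDeriv (N := ⊤) hf
    (fun n _ => integrable_iteratedDeriv hf hc n) le_top]
  simp only [smul_eq_mul]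
  congr 2
  have := Real.pi_ne_zero
  push_cast
  field_simp

lemma norm_exp_neg_I_mul (t τ : ℝ) : ‖Complex.exp (-Complex.I * t * τ)‖ = 1 := by
  have h : -Complex.I * t * τ = ((-(t * τ) : ℝ) : ℂ) * Complex.I := by
    push_cast
    ring
  rw [h, Complex.norm_exp_ofReal_mul_I]

lemma norm_ft_le {a M : ℝ} (ha : 0 ≤ a) (hs : ∀ t, a < |t| → f t = 0) (hM : ∀ t, ‖f t‖ ≤ M) (τ : ℝ) :
    ‖ft f τ‖ ≤ 2 * a * M := by
  have h : ft f τ = ∫ t in Set.Icc (-a) a, Complex.exp (-Complex.I * t * τ) * f t := by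
    rw [ft, setIntegral_eq_integral_of_forall_compl_eq_zero]
    intro t ht
    rw [hs t, mul_zero]
    by_contra hlt
    exact ht (abs_le.1 (not_lt.1 hlt))
  rw [h]
  refine (norm_setIntegral_le_of_norm_le_const measure_Icc_lt_top (C := M) fun t _ => ?_).trans_eq ?_
  · rw [norm_mul, norm_exp_neg_I_mul, one_mul]
    exact hM t
  · rw [Real.volume_real_Icc_of_le (by linarith)]
    ring

/-- The bound is explicit in the radius of the support and the size of the derivatives, because
continuity of distributions needs it uniformly over test functions. The power of two comes from (1 +
x)^N ≤ 2^(N-1) (1 + x^N). -/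
lemma norm_ft_mul_pow_le (hf : ContDiff ℝ ∞ f) (hc : HasCompactSupport f) {a M : ℝ} (ha : 0 ≤ a)
    (hs : ∀ t, a < |t| → f t = 0) (N : ℕ) (hM : ∀ i ≤ N, ∀ t, ‖iteratedDeriv i f t‖ ≤ M) (τ : ℝ) :
    ‖ft f τ‖ * (1 + |τ|) ^ N ≤ 2 ^ (N - 1) * (4 * a) * M := by
  have hs' : ∀ t, a < |t| → iteratedDeriv N f t = 0 := by
    intro t ht
    have h1 : f =ᶠ[𝓝 t] fun _ => 0 := by
      filter_upwards [(isOpen_lt continuous_const continuous_abs).mem_nhds ht] with s hs1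
      exact hs s hs1
    rw [h1.iteratedDeriv_eq]
    simp [iteratedDeriv_fun_const_zero]
  have h0 := norm_ft_le ha hs (fun t => by simpa using hM 0 (Nat.zero_le _) t) τ
  have hN := norm_ft_le ha hs' (hM N le_rfl) τ
  rw [ft_iteratedDeriv hf hc, norm_mul, norm_pow, norm_mul, Complex.norm_I, one_mul,
    Complex.norm_real, Real.norm_eq_abs] at hN
  have h2 : (1 + |τ|) ^ N ≤ 2 ^ (N - 1) * (1 ^ N + |τ| ^ N) :=
    add_pow_le zero_le_one (abs_nonneg τ) N
  calc ‖ft f τ‖ * (1 + |τ|) ^ N ≤ ‖ft f τ‖ * (2 ^ (N - 1) * (1 ^ N + |τ| ^ N)) := by gcongr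
    _ = 2 ^ (N - 1) * (‖ft f τ‖ + |τ| ^ N * ‖ft f τ‖) := by rw [one_pow]; ring
    _ ≤ 2 ^ (N - 1) * (2 * a * M + 2 * a * M) := by gcongr
    _ = _ := by ring

lemma exists_support_bound (hc : HasCompactSupport f) : ∃ a, 0 ≤ a ∧ ∀ t, a < |t| → f t = 0 := by
  obtain ⟨a, ha⟩ := hc.isCompact.isBounded.subset_closedBall 0
  refine ⟨max a 0, le_max_right _ _, fun t ht => image_eq_zero_of_notMem_tsupport fun h => ?_⟩
  have := ha h
  rw [mem_closedBall_zero_iff, Real.norm_eq_abs] at this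
  exact absurd (this.trans (le_max_left a 0)) (not_le.2 ht)

lemma exists_norm_ft_le (hf : ContDiff ℝ ∞ f) (hc : HasCompactSupport f) (N : ℕ) :
    ∃ C, ∀ τ, ‖ft f τ‖ * (1 + |τ|) ^ N ≤ C := by
  obtain ⟨a, ha, hs⟩ := exists_support_bound hc
  have h : ∀ i, ∃ M, ∀ t, ‖iteratedDeriv i f t‖ ≤ M := fun i => by
    have h := hc.iteratedFDeriv (𝕜 := ℝ) i
    refine (hf.continuous_iteratedDeriv i (mod_cast le_top)).bounded_above_of_compact_support ?_
    exact h.comp_left (g := fun L : ContinuousMultilinearMap ℝ (fun _ : Fin i => ℝ) ℂ =>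
      L fun _ => 1) rfl
  choose M hM using h
  refine ⟨_, norm_ft_mul_pow_le hf hc ha hs N (M := ∑ i ∈ Finset.range (N + 1), M i)
    fun i hi t => (hM i t).trans ?_⟩
  exact Finset.single_le_sum (f := M) (fun j _ => (norm_nonneg _).trans (hM j 0))
    (Finset.mem_range.2 (Nat.lt_succ_of_le hi))

lemma continuous_ft (hf : Continuous f) (hc : HasCompactSupport f) : Continuous (ft f) := by
  have h : ft f = fun τ => 𝓕 f (τ / (2 * Real.pi)) := funext fun τ => ft_eq_fourier f τ
  rw [h]
  have h1 : Continuous (𝓕 f) := VectorFourier.fourierIntegral_continuous Real.continuous_fourierChar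
    (by fun_prop) (hf.integrable_of_hasCompactSupport hc)
  exact h1.comp (by fun_prop)

lemma inv_pow_two_le (τ : ℝ) : ((1 + |τ|) ^ 2)⁻¹ ≤ (1 + τ ^ 2)⁻¹ := by
  refine inv_anti₀ (by positivity) ?_
  nlinarith [abs_nonneg τ, sq_abs τ]

/-- Two spare powers of decay are traded for an integrable function of τ. -/
lemma norm_mul_pow_le_of_pow {x C τ : ℝ} {N : ℕ} (h : x * (1 + |τ|) ^ (N + 2) ≤ C) (hC : 0 ≤ C) :
    x * (1 + |τ|) ^ N ≤ C * (1 + τ ^ 2)⁻¹ := by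
  have h1 : 0 < 1 + |τ| := by positivity
  calc x * (1 + |τ|) ^ N = x * (1 + |τ|) ^ (N + 2) * ((1 + |τ|) ^ 2)⁻¹ := by
        rw [pow_add]
        field_simp
    _ ≤ C * ((1 + |τ|) ^ 2)⁻¹ := mul_le_mul_of_nonneg_right h (by positivity)
    _ ≤ C * (1 + τ ^ 2)⁻¹ := mul_le_mul_of_nonneg_left (inv_pow_two_le τ) hC

lemma integrable_pow_mul_ft (hf : ContDiff ℝ ∞ f) (hc : HasCompactSupport f) (p : ℕ) (s : ℝ) :
    Integrable fun τ : ℝ => (Complex.I * τ) ^ p * ft f τ * Complex.exp (Complex.I * τ * s) := by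
  obtain ⟨C, hC⟩ := exists_norm_ft_le hf hc (p + 2)
  have hC0 : 0 ≤ C := (by positivity : 0 ≤ ‖ft f 0‖ * (1 + |(0 : ℝ)|) ^ (p + 2)).trans (hC 0)
  refine (integrable_inv_one_add_sq.const_mul C).mono' ?_ (Eventually.of_forall fun τ => ?_)
  · have := continuous_ft hf.continuous hc
    exact Continuous.aestronglyMeasurable (by fun_prop)
  · rw [norm_mul, norm_exp_I_mul_mul, mul_one, norm_mul, norm_pow, norm_mul, Complex.norm_I, one_mul,
      Complex.norm_real, Real.norm_eq_abs, mul_comm]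
    refine le_trans ?_ (norm_mul_pow_le_of_pow (hC τ) hC0)
    gcongr
    linarith

/-- Fourier inversion, for the derivatives of a test function. -/
lemma integral_pow_mul_ft (hf : ContDiff ℝ ∞ f) (hc : HasCompactSupport f) (p : ℕ) (s : ℝ) :
    ∫ τ : ℝ, (Complex.I * τ) ^ p * ft f τ * Complex.exp (Complex.I * τ * s) =
      2 * Real.pi * iteratedDeriv p f s := by
  have hpi := Real.pi_pos
  have h1 : ∀ τ : ℝ, (Complex.I * τ) ^ p * ft f τ * Complex.exp (Complex.I * τ * s) =
      (fun ξ : ℝ => Complex.exp (((2 * Real.pi * inner ℝ ξ s : ℝ) : ℂ) * Complex.I) •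
        𝓕 (iteratedDeriv p f) ξ) (τ / (2 * Real.pi)) := fun τ => by
    rw [← ft_iteratedDeriv hf hc, ft_eq_fourier, mul_comm]
    simp only [smul_eq_mul]
    congr 2
    have : inner ℝ (τ / (2 * Real.pi)) s = s * (τ / (2 * Real.pi)) := rfl
    rw [this]
    have := Real.pi_ne_zero
    push_cast
    field_simp
  have hd := hf.continuous_iteratedDeriv p (mod_cast le_top)
  -- Pointwise inversion requires the transform to be integrable; this is the case s = 0 of the
  -- integrability just shown, up to rescaling.
  have hint : Integrable (𝓕 (iteratedDeriv p f)) := by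
    have h2 := integrable_pow_mul_ft hf hc p 0
    have h3 : (fun τ : ℝ => (Complex.I * τ) ^ p * ft f τ * Complex.exp (Complex.I * τ * (0 : ℝ))) =
        fun τ => 𝓕 (iteratedDeriv p f) (τ / (2 * Real.pi)) := by
      funext τ
      rw [← ft_eq_fourier, ft_iteratedDeriv hf hc]
      simp
    rw [h3] at h2
    exact (integrable_comp_div_iff _ (by positivity)).1 h2
  rw [integral_congr_ae (Eventually.of_forall h1)]
  refine (Measure.integral_comp_div (fun ξ : ℝ =>
    Complex.exp (((2 * Real.pi * inner ℝ ξ s : ℝ) : ℂ) * Complex.I) • 𝓕 (iteratedDeriv p f) ξ)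
    (2 * Real.pi)).trans ?_
  rw [← Real.fourierInv_eq',
    hd.fourierInv_fourier_eq (integrable_iteratedDeriv hf hc p) hint, abs_of_pos (by positivity)]
  simp

end Fourier

/-! ### Pairing with partial Fourier transforms -/

section FourierPairing

/-- The pairing of the inverse partial Fourier transform of `w` with a test function. -/
def fourierPairing (w : ℝ × ℝ → ℂ) (ψ : ℝ × ℝ → ℂ) : ℂ :=
  ∫ φ : ℝ, ∫ τ : ℝ, w (τ, φ) * ft (fun t => ψ (t, φ)) τ

variable {ψ : ℝ × ℝ → ℂ}

lemma hasCompactSupport_slice {F : Type*} [NormedAddCommGroup F] {ψ : ℝ × F → ℂ}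
    (hc : HasCompactSupport ψ) (y : F) : HasCompactSupport fun t => ψ (t, y) := by
  refine HasCompactSupport.intro (hc.isCompact.image continuous_fst) fun t ht => ?_
  by_contra h
  exact ht ⟨(t, y), subset_tsupport _ h, rfl⟩

lemma contDiff_slice {F : Type*} [NormedAddCommGroup F] [NormedSpace ℝ F] {ψ : ℝ × F → ℂ}
    (hψ : ContDiff ℝ ∞ ψ) (y : F) : ContDiff ℝ ∞ fun t => ψ (t, y) :=
  hψ.comp (contDiff_id.prodMk contDiff_const)

lemma exists_norm_ft_slice_le {K : Set (ℝ × ℝ)} (hK : IsCompact K) (N : ℕ) :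
    ∃ a C : ℝ, 0 ≤ C ∧ ∀ ψ : ℝ × ℝ → ℂ, ContDiff ℝ ∞ ψ → HasCompactSupport ψ → tsupport ψ ⊆ K →
      ∀ M, (∀ i ≤ N, ∀ x, ‖iteratedFDeriv ℝ i ψ x‖ ≤ M) → ∀ τ φ : ℝ,
        ‖ft (fun t => ψ (t, φ)) τ‖ * (1 + |τ|) ^ N ≤
          (Set.Icc (-a) a).indicator (fun _ => C * M) φ := by
  obtain ⟨a, ha⟩ := hK.isBounded.subset_closedBall 0
  refine ⟨a, 2 ^ (N - 1) * (4 * max a 0), by positivity, fun ψ hψ hc hs M hM τ φ => ?_⟩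
  have hz : ∀ t φ, a < max |t| |φ| → ψ (t, φ) = 0 := fun t φ h => by
    refine image_eq_zero_of_notMem_tsupport fun h' => ?_
    have := ha (hs h')
    rw [mem_closedBall_zero_iff, Prod.norm_def, Real.norm_eq_abs, Real.norm_eq_abs] at this
    exact absurd this (not_le.2 h)
  by_cases hφ : φ ∈ Set.Icc (-a) a
  · rw [Set.indicator_of_mem hφ]
    exact norm_ft_mul_pow_le (contDiff_slice hψ φ) (hasCompactSupport_slice hc φ)
      (le_max_right a 0) (fun t ht => hz t φ
        (((le_max_left a 0).trans_lt ht).trans_le (le_max_left _ _))) N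
      (fun i hi t => (norm_iteratedDeriv_fst_le hψ i t φ).trans (hM i hi _)) τ
  · rw [Set.indicator_of_notMem hφ]
    have : (fun t => ψ (t, φ)) = fun _ => 0 := by
      funext t
      refine hz t φ (lt_of_lt_of_le ?_ (le_max_right _ _))
      rw [← not_le, abs_le]
      exact hφ
    rw [this]
    simp [ft]

lemma continuous_ft_slice (hψ : Continuous ψ) (hc : HasCompactSupport ψ) :
    Continuous fun p : ℝ × ℝ => ft (fun t => ψ (t, p.2)) p.1 := by
  have hK := hc.isCompact.image continuous_fst
  have h : (fun p : ℝ × ℝ => ft (fun t => ψ (t, p.2)) p.1) = fun p =>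
      ∫ t in Prod.fst '' tsupport ψ, Complex.exp (-Complex.I * t * p.1) * ψ (t, p.2) := by
    funext p
    rw [ft, setIntegral_eq_integral_of_forall_compl_eq_zero]
    intro t ht
    rw [image_eq_zero_of_notMem_tsupport fun h => ht ⟨(t, p.2), h, rfl⟩, mul_zero]
  rw [h]
  refine continuous_parametric_integral_of_continuous ?_ hK
  unfold Function.uncurry
  fun_prop

/-- A single dominating function for all test functions supported in `K` gives integrability,
continuity of the distribution, and dominated convergence as δ → 0. Its arguments are in the order
of integration (φ, τ). -/
lemma exists_dominator {K : Set (ℝ × ℝ)} (hK : IsCompact K) (n : ℕ) :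
    ∃ D : ℝ × ℝ → ℝ, Integrable D ∧ (∀ p, 0 ≤ D p) ∧
      ∀ ψ : ℝ × ℝ → ℂ, ContDiff ℝ ∞ ψ → HasCompactSupport ψ → tsupport ψ ⊆ K →
      ∀ M, (∀ i ≤ n + 2, ∀ x, ‖iteratedFDeriv ℝ i ψ x‖ ≤ M) → ∀ τ φ : ℝ,
        (1 + |τ|) ^ n * ‖ft (fun t => ψ (t, φ)) τ‖ ≤ M * D (φ, τ) := by
  obtain ⟨a, C, hC, h⟩ := exists_norm_ft_slice_le hK (n + 2)
  have h1 : Integrable ((Set.Icc (-a) a).indicator fun _ => C) := by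
    rw [integrable_indicator_iff measurableSet_Icc]
    exact integrableOn_const measure_Icc_lt_top.ne
  refine ⟨fun p => (Set.Icc (-a) a).indicator (fun _ => C) p.1 * (1 + p.2 ^ 2)⁻¹,
    h1.mul_prod integrable_inv_one_add_sq, ?_, ?_⟩
  · exact fun p => mul_nonneg (Set.indicator_nonneg (fun _ _ => hC) _) (by positivity)
  · intro ψ hψ hc hs M hM τ φ
    have hM0 : 0 ≤ M := (norm_nonneg _).trans (hM 0 (Nat.zero_le _) 0)
    have h2 := h ψ hψ hc hs M hM τ φ
    rw [mul_comm]
    refine (norm_mul_pow_le_of_pow h2 (Set.indicator_nonneg (fun _ _ => by positivity) _)).trans_eq ?_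
    simp only
    by_cases hφ : φ ∈ Set.Icc (-a) a
    · rw [Set.indicator_of_mem hφ, Set.indicator_of_mem hφ]
      ring
    · rw [Set.indicator_of_notMem hφ, Set.indicator_of_notMem hφ]
      ring

variable {w : ℝ × ℝ → ℂ} {C : ℝ} {n : ℕ}

lemma exists_bound_iteratedFDeriv {E : Type*} [NormedAddCommGroup E] [NormedSpace ℝ E]
    {ψ : E → ℂ} (hψ : ContDiff ℝ ∞ ψ) (hc : HasCompactSupport ψ) (n : ℕ) :
    ∃ M, ∀ i ≤ n, ∀ x, ‖iteratedFDeriv ℝ i ψ x‖ ≤ M := by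
  have h : ∀ i : ℕ, ∃ M, ∀ x, ‖iteratedFDeriv ℝ i ψ x‖ ≤ M := fun i =>
    (hψ.continuous_iteratedFDeriv (m := i) (mod_cast le_top)).bounded_above_of_compact_support
      (hc.iteratedFDeriv i)
  choose M hM using h
  refine ⟨∑ i ∈ Finset.range (n + 1), M i, fun i hi x => (hM i x).trans ?_⟩
  exact Finset.single_le_sum (f := M) (fun j _ => (norm_nonneg _).trans (hM j 0))
    (Finset.mem_range.2 (Nat.lt_succ_of_le hi))

lemma integrable_fourierPairing (hw : Continuous w)
    (hwC : ∀ τ φ, ‖w (τ, φ)‖ ≤ C * (1 + |τ|) ^ n) (hψ : ContDiff ℝ ∞ ψ) (hc : HasCompactSupport ψ) :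
    Integrable fun p : ℝ × ℝ => w (p.2, p.1) * ft (fun t => ψ (t, p.1)) p.2 := by
  obtain ⟨D, hD, hD0, h⟩ := exists_dominator hc.isCompact n
  obtain ⟨M, hM⟩ := exists_bound_iteratedFDeriv hψ hc (n + 2)
  have hC : 0 ≤ C := by simpa using (norm_nonneg _).trans (hwC 0 0)
  refine (hD.const_mul (C * M)).mono' ?_ (Eventually.of_forall fun p => ?_)
  · refine Continuous.aestronglyMeasurable ?_
    exact (hw.comp continuous_swap).mul
      ((continuous_ft_slice hψ.continuous hc).comp continuous_swap)
  · rw [norm_mul]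
    calc _ ≤ C * (1 + |p.2|) ^ n * ‖ft (fun t => ψ (t, p.1)) p.2‖ := by
          gcongr
          exact hwC _ _
      _ = C * ((1 + |p.2|) ^ n * ‖ft (fun t => ψ (t, p.1)) p.2‖) := by ring
      _ ≤ C * (M * D (p.1, p.2)) := by
          exact mul_le_mul_of_nonneg_left (h ψ hψ hc subset_rfl M hM _ _) hC
      _ = _ := by ring

lemma fourierPairing_eq (hw : Continuous w)
    (hwC : ∀ τ φ, ‖w (τ, φ)‖ ≤ C * (1 + |τ|) ^ n) (hψ : ContDiff ℝ ∞ ψ) (hc : HasCompactSupport ψ) :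
    fourierPairing w ψ = ∫ p : ℝ × ℝ, w (p.2, p.1) * ft (fun t => ψ (t, p.1)) p.2 :=
  (integral_prod _ (integrable_fourierPairing hw hwC hψ hc)).symm

lemma exists_norm_fourierPairing_le (hw : Continuous w)
    (hwC : ∀ τ φ, ‖w (τ, φ)‖ ≤ C * (1 + |τ|) ^ n) {K : Set (ℝ × ℝ)} (hK : IsCompact K) :
    ∃ C', 0 ≤ C' ∧ ∀ ψ : ℝ × ℝ → ℂ, ContDiff ℝ ∞ ψ → HasCompactSupport ψ → tsupport ψ ⊆ K →
      ∀ M, (∀ i ≤ n + 2, ∀ x, ‖iteratedFDeriv ℝ i ψ x‖ ≤ M) → ‖fourierPairing w ψ‖ ≤ C' * M := by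
  obtain ⟨D, hD, hD0, h⟩ := exists_dominator hK n
  have hC : 0 ≤ C := by simpa using (norm_nonneg _).trans (hwC 0 0)
  refine ⟨C * ∫ p, D p, mul_nonneg hC (integral_nonneg hD0), fun ψ hψ hc hs M hM => ?_⟩
  rw [fourierPairing_eq hw hwC hψ hc]
  refine (norm_integral_le_of_norm_le (hD.const_mul (C * M)) (Eventually.of_forall fun p => ?_)).trans_eq ?_
  · rw [norm_mul]
    calc _ ≤ C * (1 + |p.2|) ^ n * ‖ft (fun t => ψ (t, p.1)) p.2‖ := by
          gcongr
          exact hwC _ _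
      _ = C * ((1 + |p.2|) ^ n * ‖ft (fun t => ψ (t, p.1)) p.2‖) := by ring
      _ ≤ C * (M * D (p.1, p.2)) := by
          exact mul_le_mul_of_nonneg_left (h ψ hψ hc hs M hM _ _) hC
      _ = _ := by ring
  · rw [integral_const_mul]
    ring

lemma tendsto_fourierPairing {wδ : ℝ → ℝ × ℝ → ℂ} (hw : Continuous w)
    (hwC : ∀ τ φ, ‖w (τ, φ)‖ ≤ C * (1 + |τ|) ^ n) (hwδ : ∀ δ > 0, Continuous (wδ δ))
    (hwδC : ∀ δ > 0, ∀ τ φ, ‖wδ δ (τ, φ)‖ ≤ C * (1 + |τ|) ^ n)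
    (hlim : ∀ p, Tendsto (fun δ => wδ δ p) (𝓝[>] 0) (𝓝 (w p)))
    (hψ : ContDiff ℝ ∞ ψ) (hc : HasCompactSupport ψ) :
    Tendsto (fun δ => fourierPairing (wδ δ) ψ) (𝓝[>] 0) (𝓝 (fourierPairing w ψ)) := by
  obtain ⟨D, hD, hD0, h⟩ := exists_dominator hc.isCompact n
  obtain ⟨M, hM⟩ := exists_bound_iteratedFDeriv hψ hc (n + 2)
  have hC : 0 ≤ C := by simpa using (norm_nonneg _).trans (hwC 0 0)
  rw [fourierPairing_eq hw hwC hψ hc]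
  have h1 : ∀ᶠ δ in 𝓝[>] (0 : ℝ), ∫ p : ℝ × ℝ, wδ δ (p.2, p.1) * ft (fun t => ψ (t, p.1)) p.2 =
      fourierPairing (wδ δ) ψ := by
    filter_upwards [self_mem_nhdsWithin] with δ hδ
    exact (fourierPairing_eq (hwδ δ hδ) (hwδC δ hδ) hψ hc).symm
  refine Tendsto.congr' h1 ?_
  refine tendsto_integral_filter_of_dominated_convergence (fun p => C * M * D p) ?_ ?_
    (hD.const_mul _) ?_
  · filter_upwards [self_mem_nhdsWithin] with δ hδ
    exact (integrable_fourierPairing (hwδ δ hδ) (hwδC δ hδ) hψ hc).aestronglyMeasurable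
  · filter_upwards [self_mem_nhdsWithin] with δ hδ
    refine Eventually.of_forall fun p => ?_
    rw [norm_mul]
    calc _ ≤ C * (1 + |p.2|) ^ n * ‖ft (fun t => ψ (t, p.1)) p.2‖ := by
          gcongr
          exact hwδC δ hδ _ _
      _ = C * ((1 + |p.2|) ^ n * ‖ft (fun t => ψ (t, p.1)) p.2‖) := by ring
      _ ≤ C * (M * D (p.1, p.2)) := by
          exact mul_le_mul_of_nonneg_left (h ψ hψ hc subset_rfl M hM _ _) hC
      _ = _ := by ring
  · exact Eventually.of_forall fun p => (hlim _).mul_const _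

lemma ft_add {f g : ℝ → ℂ} (hf : Integrable f) (hg : Integrable g) (τ : ℝ) :
    ft (fun t => f t + g t) τ = ft f τ + ft g τ := by
  have h : ∀ {f : ℝ → ℂ}, Integrable f →
      Integrable fun t : ℝ => Complex.exp (-Complex.I * t * τ) * f t := fun hf =>
    hf.bdd_mul (c := 1) (by fun_prop) (Eventually.of_forall fun t => (norm_exp_neg_I_mul t τ).le)
  rw [ft, ft, ft, ← integral_add (h hf) (h hg)]
  simp only [mul_add]

lemma ft_const_mul (c : ℂ) (f : ℝ → ℂ) (τ : ℝ) : ft (fun t => c * f t) τ = c * ft f τ := by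
  rw [ft, ft, ← integral_const_mul]
  congr 1
  funext t
  ring

/-- The partial Fourier transform of a function of polynomial growth, as a distribution. -/
def fourierDistribution (w : ℝ × ℝ → ℂ) (hw : Continuous w) {C : ℝ} {n : ℕ}
    (hwC : ∀ τ φ, ‖w (τ, φ)‖ ≤ C * (1 + |τ|) ^ n) : ComplexDistribution (ℝ × ℝ) :=
  distributionOfBound (fun ψ => fourierPairing w ψ)
    (fun f g => by
      have hfg := fourierPairing_eq hw hwC (f + g).contDiff (f + g).hasCompactSupport
      have hf := fourierPairing_eq hw hwC f.contDiff f.hasCompactSupport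
      have hg := fourierPairing_eq hw hwC g.contDiff g.hasCompactSupport
      rw [hfg, hf, hg, ← integral_add (integrable_fourierPairing hw hwC f.contDiff
        f.hasCompactSupport) (integrable_fourierPairing hw hwC g.contDiff g.hasCompactSupport)]
      refine integral_congr_ae (Eventually.of_forall fun p => ?_)
      have hi : ∀ f : 𝓓((⊤ : Opens (ℝ × ℝ)), ℂ), Integrable fun t => f (t, p.1) := fun f =>
        (contDiff_slice f.contDiff p.1).continuous.integrable_of_hasCompactSupport
          (hasCompactSupport_slice f.hasCompactSupport p.1)
      simp only [← mul_add, ← ft_add (hi f) (hi g)]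
      rfl)
    (fun c f => by
      simp only [fourierPairing, smul_eq_mul, ← integral_const_mul]
      refine integral_congr_ae (Eventually.of_forall fun φ => integral_congr_ae
        (Eventually.of_forall fun τ => ?_))
      have : ft (fun t => (c • f) (t, φ)) τ = c * ft (fun t => f (t, φ)) τ := ft_const_mul c _ τ
      simp only [this]
      ring)
    (fun K hK => by
      obtain ⟨C', hC', h⟩ := exists_norm_fourierPairing_le hw hwC hK
      exact ⟨n + 2, C', hC', fun ψ M hs hM => h ψ ψ.contDiff ψ.hasCompactSupport hs M hM⟩)

lemma fourierPairing_shift (h : ℝ) (hw : ∀ τ φ, w (τ, φ + h) = w (τ, φ)) (ψ : ℝ × ℝ → ℂ) :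
    fourierPairing w (fun p => ψ (p + (0, h))) = fourierPairing w ψ := by
  rw [fourierPairing, fourierPairing, ← integral_add_right_eq_self
    (fun φ : ℝ => ∫ τ : ℝ, w (τ, φ) * ft (fun t => ψ (t, φ)) τ) h]
  simp only [Prod.mk_add_mk, add_zero, hw]

end FourierPairing

/-! ### The operator `T` -/

section BornOperator

variable {Ω₀ : Set ℂ} {R δ : ℝ} {z₀ : ℂ} {m : ℕ}

/-- The set where the truncated kernel lives. -/
def farSet (m : ℕ) (δ : ℝ) : Set (Fin (m + 1) → ℂ) := {z | ∀ i : Fin m, δ < ‖z i.castSucc - z i.succ‖}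

lemma measurableSet_farSet : MeasurableSet (farSet m δ) := by
  have : farSet m δ = ⋂ i : Fin m, {z | δ < ‖z i.castSucc - z i.succ‖} := by
    ext z
    simp [farSet]
  rw [this]
  exact MeasurableSet.iInter fun i => measurableSet_lt measurable_const (by fun_prop)

lemma chainKernel_of_notMem {z : Fin (m + 1) → ℂ} (hz : z ∉ farSet m δ) (τ φ : ℝ) :
    chainKernel m δ τ φ z = 0 := by
  obtain ⟨i, hi⟩ : ∃ i : Fin m, ¬ δ < ‖z i.castSucc - z i.succ‖ := by
    by_contra! h
    exact hz h
  rw [chainKernel, Finset.prod_eq_zero (Finset.mem_univ i) (Set.indicator_of_notMem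
    (show z ∉ {z : Fin (m + 1) → ℂ | δ < ‖z i.castSucc - z i.succ‖} from hi) _), mul_zero]

/-- The coefficient of `(iτ)^p e^{iτΨ}` in the kernel of a chain. -/
def chainCoeff (A : Finset (Fin m)) (φ : ℝ) (z : Fin (m + 1) → ℂ) : ℂ :=
  (-(1 / (Real.pi : ℂ))) ^ m * (angularFactor m φ * ∏ i ∈ Aᶜ, angularFactor (i : ℕ) φ) /
    ∏ i : Fin m, linkDifference z i ^ (if i ∈ A then 2 else 1)

lemma kernelCoeff_eq (A : Finset (Fin m)) (φ : ℝ) (z : Fin (m + 1) → ℂ) :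
    kernelCoeff m z₀ A φ z =
      2 * Real.pi * (-(1 / (Real.pi : ℂ)) * (z 0 - z₀)⁻¹) * chainCoeff A φ z := by
  rw [kernelCoeff, chainCoeff, pow_succ, div_eq_mul_inv, mul_inv, div_eq_mul_inv _ (∏ i, _)]
  ring

/-- Expansion of the product of the link factors: `A` collects the links at which the term from S is
chosen. Every other link gives a factor iτ, and so does the start of the chain. -/
lemma chainKernel_of_mem {z : Fin (m + 1) → ℂ} (hz : z ∈ farSet m δ) (τ φ : ℝ) :
    chainKernel m δ τ φ z = ∑ A : Finset (Fin m), chainCoeff A φ z *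
      ((Complex.I * τ) ^ (m + 1 - A.card) * Complex.exp (Complex.I * τ * phase m φ z)) := by
  -- The summand from S is put first, so that the subset chosen in `Finset.prod_add` is `A` itself.
  have h1 : ∀ i : Fin m, linkFactor δ τ φ z i = -(1 / (Real.pi : ℂ)) *
      ((linkDifference z i ^ 2)⁻¹ + Complex.I * τ * angularFactor i φ * (linkDifference z i)⁻¹) :=
    fun i => by
      rw [linkFactor, Set.indicator_of_mem 
        (show z ∈ {z : Fin (m + 1) → ℂ | δ < ‖z i.castSucc - z i.succ‖} from hz i),
        add_comm (Complex.I * _ * _ * _)]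
  rw [chainKernel, Finset.prod_congr rfl fun i _ => h1 i, Finset.prod_mul_distrib,
    Finset.prod_const, Finset.card_univ, Fintype.card_fin, Finset.prod_add, Finset.powerset_univ,
    Finset.mul_sum, Finset.mul_sum]
  refine Finset.sum_congr rfl fun A _ => ?_
  have h2 : m + 1 - A.card = Aᶜ.card + 1 := by
    have := Finset.card_add_card_compl A
    rw [Fintype.card_fin] at this
    omega
  have h3 : ∏ i : Fin m, linkDifference z i ^ (if i ∈ A then 2 else 1) =
      (∏ i ∈ A, linkDifference z i ^ 2) * ∏ i ∈ Aᶜ, linkDifference z i := by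
    rw [← Finset.prod_mul_prod_compl A]
    congr 1
    · exact Finset.prod_congr rfl fun i hi => by rw [if_pos hi]
    · exact Finset.prod_congr rfl fun i hi => by rw [if_neg (Finset.mem_compl.1 hi), pow_one]
  rw [chainCoeff, h3, h2, ← Finset.compl_eq_univ_sdiff, Finset.prod_mul_distrib,
    Finset.prod_mul_distrib, Finset.prod_const, Finset.prod_inv_distrib, Finset.prod_inv_distrib,
    div_eq_mul_inv _ (_ * _), mul_inv, pow_succ (Complex.I * (τ : ℂ))]
  ring

/-- The pairing of a chain with the Cauchy kernel at `z₀`, as a function of `k = τ e^{iφ}`. -/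
def chainSymbol (L : L2C →L[ℂ] ℂ) (P S : L2C →L[ℂ] L2C) (R : ℝ) (B : Fin (m + 1) → LinfC)
    (p : ℝ × ℝ) : ℂ := L (chain P S R (p.1 * Complex.exp (Complex.I * p.2)) m B)

lemma continuous_chainSymbol (L : L2C →L[ℂ] ℂ) (P S : L2C →L[ℂ] L2C) (R : ℝ)
    (B : Fin (m + 1) → LinfC) : Continuous (chainSymbol L P S R B) := by
  refine L.continuous.comp ((continuous_chain P S R B).comp ?_)
  fun_prop

/-- The operators enter only through a bound `c` for their norms, so that one constant serves for
all truncations. -/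
lemma norm_chainSymbol_le (L : L2C →L[ℂ] ℂ) {P S : L2C →L[ℂ] L2C} {c : ℝ} (hc : ‖P‖ + ‖S‖ ≤ c) (R : ℝ)
    (B : Fin (m + 1) → LinfC) (τ φ : ℝ) : ‖chainSymbol L P S R B (τ, φ)‖ ≤
      ‖L‖ * ((∏ i, ‖B i‖) * ‖oneL R‖ * (c + 1) ^ (m + 1)) * (1 + |τ|) ^ (m + 1) := by
  have hk : ‖(τ : ℂ) * Complex.exp (Complex.I * φ)‖ = |τ| := by
    rw [norm_mul, mul_comm Complex.I, Complex.norm_exp_ofReal_mul_I, mul_one, Complex.norm_real,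
      Real.norm_eq_abs]
  refine (L.le_opNorm _).trans ?_
  rw [mul_assoc]
  refine mul_le_mul_of_nonneg_left ((norm_chain_le P S R _ B).trans ?_) (norm_nonneg _)
  rw [hk, mul_pow, ← mul_assoc]
  gcongr

lemma norm_cauchyL_le (R : ℝ) : ‖cauchyL R‖ ≤ ∫ w, ‖cauchyKer R w‖ := norm_convL_le _ _

lemma integrable_indicator_Linf (hΩ₀ : MeasurableSet Ω₀) (hb : Bornology.IsBounded Ω₀)
    (μ : Lp ℂ ⊤ (volume.restrict Ω₀)) : Integrable (Ω₀.indicator μ) := by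
  rw [integrable_indicator_iff hΩ₀]
  have : Fact (volume Ω₀ < ⊤) := ⟨hb.measure_lt_top⟩
  exact (Lp.memLp μ).integrable le_top

/-- At positive δ the integrals over τ and z may be exchanged; then Fourier inversion in τ turns
(iτ)^p e^{iτΨ} into 2π times the p-th derivative in t at Ψ. The factor 2π is the one in the kernel.
-/
lemma truncatedPairing_eq_fourierPairing (hΩ₀ : MeasurableSet Ω₀) (hb : Bornology.IsBounded Ω₀)
    (hz : z₀ ∉ closure Ω₀) (hR0 : 0 < R) (hR : Ω₀ ⊆ Metric.ball 0 (R / 2)) (hδ : 0 < δ)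
    (μ : Fin (m + 1) → Lp ℂ ⊤ (volume.restrict Ω₀)) {ψ : ℝ × ℝ → ℂ} (hψ : ContDiff ℝ ∞ ψ)
    (hc : HasCompactSupport ψ) :
    truncatedPairing m z₀ (fun t φ z => ψ (t, φ) * ∏ i, Ω₀.indicator (μ i) (z i)) δ =
      fourierPairing (chainSymbol (evalL hΩ₀ hb hz) (cutCauchyL R δ) (cutBeurlingL δ) R
        fun i => extendLp ⊤ hΩ₀ (μ i)) ψ := by
  rw [truncatedPairing, fourierPairing]
  congr 1
  funext φ
  have hf := contDiff_slice hψ φ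
  have hfc := hasCompactSupport_slice hc φ
  set f : ℝ → ℂ := fun t => ψ (t, φ) with hf_def
  obtain ⟨C, -, hC⟩ := exists_norm_evalKer_le hz
  have hbi : ∀ i, Integrable (Ω₀.indicator (μ i)) := fun i => integrable_indicator_Linf hΩ₀ hb (μ i)
  have hbR : ∀ i, ∀ z ∉ Metric.ball (0 : ℂ) (R / 2), Ω₀.indicator (μ i) z = 0 := fun i z hz =>
    Set.indicator_of_notMem (fun h => hz (hR h)) _
  have h1 : ∀ τ : ℝ, chainSymbol (evalL hΩ₀ hb hz) (cutCauchyL R δ) (cutBeurlingL δ) R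
      (fun i => extendLp ⊤ hΩ₀ (μ i)) (τ, φ) * ft f τ = ∫ z : Fin (m + 1) → ℂ,
        evalKer Ω₀ z₀ (z 0) * ((∏ i, Ω₀.indicator (μ i) (z i)) * chainKernel m δ τ φ z) * ft f τ :=
    fun τ => by
      rw [integral_mul_const, chainSymbol, evalL_apply,
        integral_chainKernel hδ hR0 τ φ (fun i => coeFn_extendLp hΩ₀ (μ i)) hbi hbR
          (measurable_evalKer hΩ₀ z₀) hC]
  simp only [h1]
  rw [integral_integral_swap]
  · change ∫ z in farSet m δ, _ = _
    rw [← integral_indicator measurableSet_farSet]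
    congr 1
    funext z
    by_cases hzf : z ∈ farSet m δ
    swap
    · rw [Set.indicator_of_notMem hzf]
      simp [chainKernel_of_notMem hzf]
    rw [Set.indicator_of_mem hzf]
    -- The evaluation kernel is cut off to `Ω₀` but the coefficient of the kernel is not; outside
    -- `Ω₀` the product of the coefficients makes both sides vanish.
    by_cases hz0 : z 0 ∈ Ω₀
    swap
    · have : ∏ i, Ω₀.indicator (μ i) (z i) = 0 :=
        Finset.prod_eq_zero (Finset.mem_univ 0) (Set.indicator_of_notMem hz0 _)
      simp only [this, mul_zero, zero_mul, integral_zero]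
      refine Finset.sum_eq_zero fun A _ => ?_
      simp [iteratedDeriv_fun_const_zero]
    have h2 : ∀ τ : ℝ, evalKer Ω₀ z₀ (z 0) * ((∏ i, Ω₀.indicator (μ i) (z i)) *
        chainKernel m δ τ φ z) * ft f τ = ∑ A : Finset (Fin m), evalKer Ω₀ z₀ (z 0) *
          (∏ i, Ω₀.indicator (μ i) (z i)) * chainCoeff A φ z * ((Complex.I * τ) ^ (m + 1 - A.card) *
            ft f τ * Complex.exp (Complex.I * τ * phase m φ z)) := fun τ => by
      rw [chainKernel_of_mem hzf, Finset.mul_sum, Finset.mul_sum, Finset.sum_mul]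
      exact Finset.sum_congr rfl fun A _ => by ring
    simp only [h2]
    rw [integral_finsetSum _ fun A _ => (integrable_pow_mul_ft hf hfc _ _).const_mul _]
    refine Finset.sum_congr rfl fun A _ => ?_
    rw [integral_const_mul, integral_pow_mul_ft hf hfc, kernelCoeff_eq, evalKer,
      Set.indicator_of_mem hz0]
    have h3 : iteratedDeriv (m + 1 - A.card) (fun t => ψ (t, φ) * ∏ i, Ω₀.indicator (μ i) (z i))
        (phase m φ z) = iteratedDeriv (m + 1 - A.card) f (phase m φ z) *
          ∏ i, Ω₀.indicator (μ i) (z i) := by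
      simp only [mul_comm _ (∏ i, Ω₀.indicator (μ i) (z i))]
      exact iteratedDeriv_const_mul_field _ f
    rw [h3]
    ring
  -- The chain kernel grows like (1 + |τ|)^(m+1), and two more powers make the integral over τ
  -- converge.
  · obtain ⟨C', hC'⟩ := exists_norm_ft_le hf hfc (m + 1 + 2)
    have hC0 : 0 ≤ C' := (by positivity : 0 ≤ ‖ft f 0‖ * (1 + |(0 : ℝ)|) ^ (m + 1 + 2)).trans (hC' 0)
    have hp : Integrable fun z : Fin (m + 1) → ℂ => ∏ i, Ω₀.indicator (μ i) (z i) :=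
      Integrable.fintype_prod hbi
    refine (((integrable_inv_one_add_sq.const_mul C').mul_prod hp.norm).const_mul
      (C * (δ⁻¹ + δ⁻¹ ^ 2) ^ m)).mono' ?_ (Eventually.of_forall fun p => ?_)
    · have m1 : Measurable fun p : ℝ × (Fin (m + 1) → ℂ) => evalKer Ω₀ z₀ (p.2 0) :=
        (measurable_evalKer hΩ₀ z₀).comp ((measurable_pi_apply 0).comp measurable_snd)
      have m2 : Measurable fun p : ℝ × (Fin (m + 1) → ℂ) => chainKernel m δ p.1 φ p.2 :=
        (measurable_chainKernel δ).comp (g := fun p : ℝ × ℝ × (Fin (m + 1) → ℂ) =>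
          chainKernel m δ p.1 p.2.1 p.2.2) (f := fun p : ℝ × (Fin (m + 1) → ℂ) => (p.1, φ, p.2))
          (measurable_fst.prodMk (measurable_const.prodMk measurable_snd))
      have m3 : Measurable fun p : ℝ × (Fin (m + 1) → ℂ) => ft f p.1 :=
        (continuous_ft hf.continuous hfc).measurable.comp measurable_fst
      exact (m1.aestronglyMeasurable.mul (hp.aestronglyMeasurable.comp_snd.mul
        m2.aestronglyMeasurable)).mul m3.aestronglyMeasurable
    · simp only [Function.uncurry, norm_mul]
      calc _ ≤ C * (‖∏ i, Ω₀.indicator (μ i) (p.2 i)‖ * ((δ⁻¹ + δ⁻¹ ^ 2) ^ m *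
            (1 + |p.1|) ^ (m + 1))) * ‖ft f p.1‖ := by
            gcongr
            · exact (norm_nonneg _).trans (hC 0)
            · exact hC _
            · exact norm_chainKernel_le hδ _ _ _
        _ = C * (δ⁻¹ + δ⁻¹ ^ 2) ^ m * ((‖ft f p.1‖ * (1 + |p.1|) ^ (m + 1)) *
            ‖∏ i, Ω₀.indicator (μ i) (p.2 i)‖) := by ring
        _ ≤ _ := by
            refine mul_le_mul_of_nonneg_left (mul_le_mul_of_nonneg_right
              (norm_mul_pow_le_of_pow (hC' p.1) hC0) (norm_nonneg _)) ?_
            have : 0 ≤ C := (norm_nonneg _).trans (hC 0)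
            positivity

lemma extendLp_smul (hΩ₀ : MeasurableSet Ω₀) (c : ℂ) (μ : Lp ℂ ⊤ (volume.restrict Ω₀)) :
    extendLp ⊤ hΩ₀ (c • μ) = c • extendLp ⊤ hΩ₀ μ := by
  refine Lp.ext ?_
  filter_upwards [coeFn_extendLp hΩ₀ (c • μ), coeFn_extendLp hΩ₀ μ,
    Lp.coeFn_smul c (extendLp ⊤ hΩ₀ μ), (ae_restrict_iff' hΩ₀).1 (Lp.coeFn_smul c μ)]
    with z h1 h2 h3 h4
  rw [h1, h3, Pi.smul_apply, h2]
  by_cases hz : z ∈ Ω₀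
  · rw [Set.indicator_of_mem hz, Set.indicator_of_mem hz, h4 hz, Pi.smul_apply]
  · rw [Set.indicator_of_notMem hz, Set.indicator_of_notMem hz, smul_zero]

/-- The symbol of the operator `T`. -/
def bornSymbol (hΩ₀ : MeasurableSet Ω₀) (hb : Bornology.IsBounded Ω₀) (hz : z₀ ∉ closure Ω₀) (R : ℝ)
    (μ : Fin (m + 1) → Lp ℂ ⊤ (volume.restrict Ω₀)) : ℝ × ℝ → ℂ :=
  chainSymbol (evalL hΩ₀ hb hz) (cauchyL R) beurlingL R fun i => extendLp ⊤ hΩ₀ (μ i)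

lemma continuous_bornSymbol (hΩ₀ : MeasurableSet Ω₀) (hb : Bornology.IsBounded Ω₀)
    (hz : z₀ ∉ closure Ω₀) (R : ℝ) (μ : Fin (m + 1) → Lp ℂ ⊤ (volume.restrict Ω₀)) :
    Continuous (bornSymbol hΩ₀ hb hz R μ) := continuous_chainSymbol _ _ _ _ _

lemma bornSymbol_le (hΩ₀ : MeasurableSet Ω₀) (hb : Bornology.IsBounded Ω₀) (hz : z₀ ∉ closure Ω₀)
    (R : ℝ) (μ : Fin (m + 1) → Lp ℂ ⊤ (volume.restrict Ω₀)) (τ φ : ℝ) :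
    ‖bornSymbol hΩ₀ hb hz R μ (τ, φ)‖ ≤ ‖evalL hΩ₀ hb hz‖ * ((∏ i, ‖extendLp ⊤ hΩ₀ (μ i)‖) *
      ‖oneL R‖ * ((∫ w, ‖cauchyKer R w‖) + ‖beurlingL‖ + 1) ^ (m + 1)) * (1 + |τ|) ^ (m + 1) :=
  norm_chainSymbol_le _ (add_le_add_left (norm_cauchyL_le R) _) R _ τ φ

/-- The operator `T_n^{z₀}`. -/
def bornOperator (hΩ₀ : MeasurableSet Ω₀) (hb : Bornology.IsBounded Ω₀) (hz : z₀ ∉ closure Ω₀) (R : ℝ) :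
    MultilinearMap ℂ (fun _ : Fin (m + 1) => Lp ℂ ⊤ (volume.restrict Ω₀))
      (ComplexDistribution (ℝ × ℝ)) where
  toFun μ := fourierDistribution (bornSymbol hΩ₀ hb hz R μ) (continuous_bornSymbol hΩ₀ hb hz R _)
    (bornSymbol_le hΩ₀ hb hz R μ)
  map_update_add' μ i x y := by
    have h : ∀ x, (fun j => extendLp ⊤ hΩ₀ (Function.update μ i x j)) =
        Function.update (fun j => extendLp ⊤ hΩ₀ (μ j)) i (extendLp ⊤ hΩ₀ x) := fun x => by
      funext j
      exact Function.apply_update (fun _ => extendLp ⊤ hΩ₀) μ i x j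
    ext ψ
    have hp : ∀ ν : Fin (m + 1) → Lp ℂ ⊤ (volume.restrict Ω₀), _ := fun ν => fourierPairing_eq
      (continuous_bornSymbol hΩ₀ hb hz R _) (bornSymbol_le hΩ₀ hb hz R ν) ψ.contDiff ψ.hasCompactSupport
    have hi : ∀ ν : Fin (m + 1) → Lp ℂ ⊤ (volume.restrict Ω₀), _ := fun ν => integrable_fourierPairing
      (continuous_bornSymbol hΩ₀ hb hz R _) (bornSymbol_le hΩ₀ hb hz R ν) ψ.contDiff ψ.hasCompactSupport
    change fourierPairing _ ψ = fourierPairing _ ψ + fourierPairing _ ψ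
    rw [hp, hp, hp, ← integral_add (hi _) (hi _)]
    congr 1
    funext p
    rw [← add_mul]
    simp only [bornSymbol, chainSymbol, h, map_add, MultilinearMap.map_update_add]
  map_update_smul' μ i c x := by
    have h : ∀ x, (fun j => extendLp ⊤ hΩ₀ (Function.update μ i x j)) =
        Function.update (fun j => extendLp ⊤ hΩ₀ (μ j)) i (extendLp ⊤ hΩ₀ x) := fun x => by
      funext j
      exact Function.apply_update (fun _ => extendLp ⊤ hΩ₀) μ i x j
    ext ψ
    change fourierPairing _ ψ = c * fourierPairing _ ψ
    simp only [fourierPairing, bornSymbol, chainSymbol, h, extendLp_smul,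
      MultilinearMap.map_update_smul, map_smul, smul_eq_mul, ← integral_const_mul, mul_assoc]

lemma bornOperator_apply (hΩ₀ : MeasurableSet Ω₀) (hb : Bornology.IsBounded Ω₀)
    (hz : z₀ ∉ closure Ω₀) (R : ℝ) (μ : Fin (m + 1) → Lp ℂ ⊤ (volume.restrict Ω₀))
    (ψ : 𝓓((⊤ : Opens (ℝ × ℝ)), ℂ)) :
    bornOperator hΩ₀ hb hz R μ ψ = fourierPairing (bornSymbol hΩ₀ hb hz R μ) ψ := rfl

/-- Truncated pairings are Fourier pairings of truncated symbols. These converge pointwise, with a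
polynomial bound independent of δ, so dominated convergence applies. -/
lemma isBornOperator_bornOperator (hΩ₀ : MeasurableSet Ω₀) (hb : Bornology.IsBounded Ω₀)
    (hz : z₀ ∉ closure Ω₀) (hR0 : 0 < R) (hR : Ω₀ ⊆ Metric.ball 0 (R / 2)) :
    IsBornOperator m z₀ Ω₀ (bornOperator hΩ₀ hb hz R) := by
  intro μ ψ
  rw [bornOperator_apply]
  set c := ‖evalL hΩ₀ hb hz‖ * ((∏ i, ‖extendLp ⊤ hΩ₀ (μ i)‖) *
      ‖oneL R‖ * ((∫ w, ‖cauchyKer R w‖) + ‖beurlingL‖ + 1) ^ (m + 1))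
  have h := tendsto_fourierPairing (C := c) (n := m + 1) (w := bornSymbol hΩ₀ hb hz R μ) (wδ := fun δ =>
      chainSymbol (evalL hΩ₀ hb hz) (cutCauchyL R δ) (cutBeurlingL δ) R fun i => extendLp ⊤ hΩ₀ (μ i))
    (continuous_chainSymbol _ _ _ _ _) (bornSymbol_le hΩ₀ hb hz R μ)
    (fun δ _ => continuous_chainSymbol _ _ _ _ _)
    (fun δ hδ => norm_chainSymbol_le _ (add_le_add (norm_cutCauchyL_le R δ)
      (norm_cutBeurlingL_le hδ)) R _)
    (fun p => ((evalL hΩ₀ hb hz).continuous.tendsto _).comp (tendsto_chain R _ _))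
    ψ.contDiff ψ.hasCompactSupport
  refine h.congr' ?_
  filter_upwards [self_mem_nhdsWithin] with δ hδ
  exact (truncatedPairing_eq_fourierPairing hΩ₀ hb hz hR0 hR hδ μ ψ.contDiff
    ψ.hasCompactSupport).symm

lemma isPeriodic_bornOperator (hΩ₀ : MeasurableSet Ω₀) (hb : Bornology.IsBounded Ω₀)
    (hz : z₀ ∉ closure Ω₀) (R : ℝ) (μ : Fin (m + 1) → Lp ℂ ⊤ (volume.restrict Ω₀)) :
    IsPeriodicDistribution (bornOperator hΩ₀ hb hz R μ) (0, 2 * Real.pi) := by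
  intro ψ
  refine fourierPairing_shift (2 * Real.pi) (fun τ φ => ?_) ψ
  have : Complex.exp (Complex.I * ((φ + 2 * Real.pi : ℝ) : ℂ)) = Complex.exp (Complex.I * φ) := by
    push_cast
    rw [mul_add, mul_comm Complex.I (2 * Real.pi), Complex.exp_add, Complex.exp_two_pi_mul_I, mul_one]
  rw [bornSymbol, chainSymbol, chainSymbol, this]

lemma integral_bornTerm_eq {Ω : Set ℂ} (hΩ : MeasurableSet Ω) (hR : Ω ⊆ Metric.ball 0 (R / 2))
    (hR0 : 0 < R) (hΩ₀ : MeasurableSet Ω₀) (hsub : Ω₀ ⊆ Ω) (hb : Bornology.IsBounded Ω₀)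
    (hz : z₀ ∉ closure Ω₀) (μ : Coefficients Ω₀) (ψ : 𝓓((⊤ : Opens (ℝ × ℝ)), ℂ)) :
    ∫ φ : ℝ, ∫ τ : ℝ, bornTerm Ω Ω₀ (m + 1) μ z₀ (τ * Complex.exp (Complex.I * φ)) *
        ∫ t : ℝ, Complex.exp (-Complex.I * t * τ) * ψ (t, φ) =
      bornOperator hΩ₀ hb hz R (fun _ : Fin (m + 1) => Complex.ofRealCLM.compLp μ) ψ := by
  simp only [bornTerm_eq hΩ hR hR0 hΩ₀ hsub hb hz]
  rfl

end BornOperator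

/-! ### Singular weights in the coordinates `z_1 - z_0, z_2 - z_1, …` -/

section Weights

variable {m : ℕ} {δ : ℝ}

/-- The space of points `(φ, w)`, where `w` stands for `z_1 - z₀` and the differences `z_{j+1} - z_j`. -/
abbrev LinkSpace (m : ℕ) : Type := ℝ × (Fin (m + 1) → ℂ)

instance : (volume : Measure (LinkSpace m)).IsAddHaarMeasure :=
  Measure.prod.instIsAddHaarMeasure (volume : Measure ℝ) (volume : Measure (Fin (m + 1) → ℂ))

/-- Conjugation, at every second link. -/
def linkConj (i : Fin m) : ℂ →L[ℝ] ℂ :=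
  if Even (i : ℕ) then (Complex.conjCLE : ℂ →L[ℝ] ℂ) else ContinuousLinearMap.id ℝ ℂ

lemma norm_linkConj (i : Fin m) (w : ℂ) : ‖linkConj i w‖ = ‖w‖ := by
  unfold linkConj
  split_ifs <;> simp

/-- The factor at a link: `w^{-2}` for links in `A`, a regularization of `w^{-1}` for the other
links in `B`, a truncation of `w^{-1}` for the remaining ones. -/
def linkWeight (A B : Finset (Fin m)) (δ : ℝ) (i : Fin m) (w : ℂ) : ℂ :=
  if i ∈ A then {w : ℂ | δ < ‖w‖}.indicator (fun w => (linkConj i w ^ 2)⁻¹) w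
  else if i ∈ B then linkConj i (regInv δ w)
  else {w : ℂ | δ < ‖w‖}.indicator (fun w => (linkConj i w)⁻¹) w

lemma measurable_linkWeight (A B : Finset (Fin m)) (hδ : 0 < δ) (i : Fin m) :
    Measurable (linkWeight A B δ i) := by
  have hc : Measurable (linkConj i) := (linkConj i).measurable
  unfold linkWeight
  split_ifs
  · exact (hc.pow_const 2).inv.indicator (measurableSet_lt_norm δ)
  · exact hc.comp (lipschitzWith_regInv hδ).continuous.measurable
  · exact hc.inv.indicator (measurableSet_lt_norm δ)

lemma norm_linkWeight_le (A B : Finset (Fin m)) (hδ : 0 < δ) (i : Fin m) (w : ℂ) :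
    ‖linkWeight A B δ i w‖ ≤ δ⁻¹ + δ⁻¹ ^ 2 := by
  have h0 : 0 < δ⁻¹ := inv_pos.2 hδ
  unfold linkWeight
  simp only [Set.indicator_apply, Set.mem_ofPred_eq]
  split_ifs with h1 h2 h2 h2
  · rw [norm_inv, norm_pow, norm_linkConj, ← inv_pow]
    have : ‖w‖⁻¹ ^ 2 ≤ δ⁻¹ ^ 2 := pow_le_pow_left₀ (by positivity) (inv_anti₀ hδ h2.le) 2
    linarith
  · rw [norm_zero]
    positivity
  · rw [norm_linkConj]
    have := norm_regInv_le_inv hδ w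
    nlinarith
  · rw [norm_inv, norm_linkConj]
    have := inv_anti₀ hδ h2.le
    nlinarith
  · rw [norm_zero]
    positivity

/-- Once no factor of exponent two is left, the weights are dominated independently of δ by a
locally integrable function. -/
lemma norm_linkWeight_empty_le (B : Finset (Fin m)) (hδ : 0 < δ) (i : Fin m) (w : ℂ) :
    ‖linkWeight ∅ B δ i w‖ ≤ ‖w‖⁻¹ := by
  unfold linkWeight
  simp only [Set.indicator_apply, Set.mem_ofPred_eq, Finset.notMem_empty, if_false]
  split_ifs
  · rw [norm_linkConj]
    exact norm_regInv_le hδ w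
  · rw [norm_inv, norm_linkConj]
  · rw [norm_zero]
    positivity

lemma tendsto_linkWeight_empty (B : Finset (Fin m)) (i : Fin m) (w : ℂ) :
    Tendsto (fun δ => linkWeight ∅ B δ i w) (𝓝[>] 0) (𝓝 (linkConj i w)⁻¹) := by
  unfold linkWeight
  simp only [Finset.notMem_empty, if_false]
  split_ifs
  · have h : (linkConj i w)⁻¹ = linkConj i w⁻¹ := by
      unfold linkConj
      split_ifs <;> simp
    rw [h]
    exact ((linkConj i).continuous.tendsto _).comp (tendsto_regInv w)
  · rcases eq_or_ne w 0 with rfl | hw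
    · simp [Set.indicator_apply]
    · refine tendsto_const_nhds.congr' ?_
      have : ∀ᶠ δ in 𝓝[>] (0 : ℝ), δ < ‖w‖ :=
        (eventually_lt_nhds (norm_pos_iff.2 hw)).filter_mono nhdsWithin_le_nhds
      filter_upwards [this] with δ hδ
      rw [Set.indicator_of_mem (show w ∈ {w : ℂ | δ < ‖w‖} from hδ)]

/-- The product of the factors at all links, and of the Cauchy kernel in the first variable. -/
def weight (A B : Finset (Fin m)) (δ : ℝ) (y : LinkSpace m) : ℂ :=
  (y.2 0)⁻¹ * ∏ i : Fin m, linkWeight A B δ i (y.2 i.succ)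

lemma measurable_weight (A B : Finset (Fin m)) (hδ : 0 < δ) : Measurable (weight A B δ) := by
  refine (Measurable.inv (by fun_prop)).mul (Finset.measurable_fun_prod _ fun i _ => ?_)
  exact (measurable_linkWeight A B hδ i).comp (by fun_prop)

/-- On a compact set the function agrees with a product of integrable functions of separate
variables. -/
lemma locallyIntegrable_prod {f : Fin (m + 1) → ℂ → ℂ}
    (hf : ∀ i, LocallyIntegrable (f i) volume) :
    LocallyIntegrable (fun y : LinkSpace m => ∏ i, f i (y.2 i)) volume := by
  rw [locallyIntegrable_iff]
  intro K hK
  obtain ⟨r, hr⟩ := hK.isBounded.subset_closedBall 0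
  have h1 : ∀ i, Integrable ((Metric.closedBall (0 : ℂ) r).indicator (f i)) := fun i => by
    rw [integrable_indicator_iff measurableSet_closedBall]
    exact (hf i).integrableOn_isCompact (isCompact_closedBall 0 r)
  have h2 : Integrable ((Set.Icc (-r) r).indicator fun _ : ℝ => (1 : ℂ)) := by
    rw [integrable_indicator_iff measurableSet_Icc]
    exact integrableOn_const measure_Icc_lt_top.ne
  have h3 := h2.mul_prod (Integrable.fintype_prod (μ := fun _ => (volume : Measure ℂ)) h1)
  refine h3.integrableOn.congr_fun (fun y hy => ?_) hK.measurableSet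
  have hy' := hr hy
  rw [mem_closedBall_zero_iff, Prod.norm_def, max_le_iff] at hy'
  have h4 : y.1 ∈ Set.Icc (-r) r := abs_le.1 hy'.1
  simp only [Set.indicator_of_mem h4, one_mul]
  refine Finset.prod_congr rfl fun i _ => ?_
  rw [Set.indicator_of_mem]
  rw [mem_closedBall_zero_iff]
  exact (norm_le_pi_norm y.2 i).trans hy'.2

lemma locallyIntegrable_prod_inv :
    LocallyIntegrable (fun y : LinkSpace m => ∏ i, (y.2 i)⁻¹) volume :=
  locallyIntegrable_prod fun _ => locallyIntegrable_inv

lemma locallyIntegrable_inv_fst :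
    LocallyIntegrable (fun y : LinkSpace m => (y.2 0)⁻¹) volume := by
  have h := locallyIntegrable_prod (m := m) (f := Fin.cons (fun w => w⁻¹) fun _ _ => 1) (fun i => by
    refine Fin.cases ?_ (fun j => ?_) i
    · exact locallyIntegrable_inv
    · exact locallyIntegrable_const 1)
  refine h.congr (Eventually.of_forall fun y => ?_)
  simp [Fin.prod_univ_succ]

lemma norm_weight_empty_le (B : Finset (Fin m)) (hδ : 0 < δ) (y : LinkSpace m) :
    ‖weight ∅ B δ y‖ ≤ ‖∏ i, (y.2 i)⁻¹‖ := by
  rw [weight, norm_mul, Fin.prod_univ_succ, norm_mul, norm_prod, norm_prod]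
  refine mul_le_mul_of_nonneg_left (Finset.prod_le_prod (fun _ _ => norm_nonneg _) fun i _ => ?_)
    (norm_nonneg _)
  rw [norm_inv]
  exact norm_linkWeight_empty_le B hδ i _

lemma locallyIntegrable_weight (A B : Finset (Fin m)) (hδ : 0 < δ) :
    LocallyIntegrable (weight A B δ) volume := by
  refine (locallyIntegrable_inv_fst.smul ((δ⁻¹ + δ⁻¹ ^ 2) ^ m)).mono
    (measurable_weight A B hδ).aestronglyMeasurable (Eventually.of_forall fun y => ?_)
  have hp : 0 ≤ δ⁻¹ + δ⁻¹ ^ 2 := by positivity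
  rw [weight, norm_mul, Pi.smul_apply, norm_smul, Real.norm_of_nonneg (by positivity), mul_comm,
    norm_prod]
  refine mul_le_mul_of_nonneg_right ?_ (norm_nonneg _)
  refine (Finset.prod_le_prod (fun _ _ => norm_nonneg _) fun i _ =>
    norm_linkWeight_le A B hδ i _).trans_eq ?_
  simp

/-! ### Removing an exponent two by integration by parts. -/

/-- The translation of the `i`-th difference. -/
def linkDir (i : Fin m) (v : ℂ) : LinkSpace m := (0, Pi.single i.succ v)

lemma norm_linkDir (i : Fin m) (v : ℂ) : ‖linkDir i v‖ = ‖v‖ := by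
  simp [linkDir, Prod.norm_def, Pi.norm_single]

/-- The imaginary unit or its opposite. -/
def linkUnit (i : Fin m) : ℂ := if Even (i : ℕ) then Complex.I else -Complex.I

lemma norm_linkUnit (i : Fin m) : ‖linkUnit i‖ = 1 := by
  unfold linkUnit
  split_ifs <;> simp

/-- The operator `∂` or `∂bar` in the `i`-th difference. -/
def linkDeriv (i : Fin m) (g : LinkSpace m → ℂ) (y : LinkSpace m) : ℂ :=
  (1 / 2) * (fderiv ℝ g y (linkDir i 1) + linkUnit i * fderiv ℝ g y (linkDir i Complex.I))

/-- The unit is chosen to absorb the conjugation: at every link the operator acts on the conjugated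
kernel as ∂ acts on `regInv`. -/
lemma linkConj_dz (i : Fin m) (f : ℂ → ℂ) (w : ℂ) : (1 / 2) * (linkConj i (fderiv ℝ f w 1) +
    linkUnit i * linkConj i (fderiv ℝ f w Complex.I)) = linkConj i (dz f w) := by
  unfold linkConj linkUnit dz
  split_ifs
  · simp only [ContinuousLinearEquiv.coe_coe, Complex.conjCLE_apply, map_div₀, map_sub, map_mul,
      Complex.conj_I, map_ofNat]
    ring
  · simp
    ring

lemma ae_norm_link_ne (i : Fin m) (δ : ℝ) : ∀ᵐ y : LinkSpace m, ‖y.2 i.succ‖ ≠ δ := by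
  have h : ∀ᵐ w : ℂ, ‖w‖ ≠ δ := by simpa using ae_norm_sub_ne 0 δ
  have h1 : ∀ᵐ z : Fin (m + 1) → ℂ, ‖z i.succ‖ ≠ δ :=
    (Measure.quasiMeasurePreserving_eval (fun _ => (volume : Measure ℂ)) i.succ).ae h
  exact Measure.quasiMeasurePreserving_snd.ae h1

/-- Integration by parts at one link. -/
lemma integral_weight_mul_eq {A B : Finset (Fin m)} {a : Fin m} (ha : a ∉ A) (hδ : 0 < δ)
    {g : LinkSpace m → ℂ} (hg : ContDiff ℝ ∞ g) (hgc : HasCompactSupport g) :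
    ∫ y, weight (insert a A) B δ y * g y = ∫ y, weight A (insert a B) δ y * linkDeriv a g y := by
  -- All factors except the one at link `a`; they do not change when only that difference moves.
  set G : LinkSpace m → ℂ := fun y =>
    (y.2 0)⁻¹ * ∏ i ∈ Finset.univ.erase a, linkWeight A B δ i (y.2 i.succ) with hG
  set r : LinkSpace m → ℂ := fun y => linkConj a (regInv δ (y.2 a.succ)) with hr
  have hprod : ∀ f : Fin m → ℂ, ∏ i, f i = f a * ∏ i ∈ Finset.univ.erase a, f i := fun f =>
    (Finset.mul_prod_erase _ _ (Finset.mem_univ a)).symm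
  have hw1 : ∀ y, weight (insert a A) B δ y =
      G y * {w : ℂ | δ < ‖w‖}.indicator (fun w => (linkConj a w ^ 2)⁻¹) (y.2 a.succ) := fun y => by
    have h2 : ∏ i ∈ Finset.univ.erase a, linkWeight (insert a A) B δ i (y.2 i.succ) =
        ∏ i ∈ Finset.univ.erase a, linkWeight A B δ i (y.2 i.succ) :=
      Finset.prod_congr rfl fun i hi => by
        simp [linkWeight, Finset.mem_insert, Finset.ne_of_mem_erase hi]
    rw [weight, hprod, h2]
    simp only [hG, linkWeight, Finset.mem_insert_self, if_true]
    ring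
  have hw2 : ∀ y, weight A (insert a B) δ y = G y * r y := fun y => by
    have h2 : ∏ i ∈ Finset.univ.erase a, linkWeight A (insert a B) δ i (y.2 i.succ) =
        ∏ i ∈ Finset.univ.erase a, linkWeight A B δ i (y.2 i.succ) :=
      Finset.prod_congr rfl fun i hi => by
        simp [linkWeight, Finset.mem_insert, Finset.ne_of_mem_erase hi]
    rw [weight, hprod, h2]
    simp only [hG, hr, linkWeight, ha, if_false, Finset.mem_insert_self, if_true]
    ring
  have hGm : Measurable G := by
    refine (Measurable.inv (by fun_prop)).mul (Finset.measurable_fun_prod _ fun i _ => ?_)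
    exact (measurable_linkWeight A B hδ i).comp (by fun_prop)
  have hGl : LocallyIntegrable G volume := by
    refine (locallyIntegrable_inv_fst.smul
      ((δ⁻¹ + δ⁻¹ ^ 2) ^ (Finset.univ.erase a).card)).mono hGm.aestronglyMeasurable
      (Eventually.of_forall fun y => ?_)
    rw [hG, norm_mul, Pi.smul_apply, norm_smul, Real.norm_of_nonneg (by positivity), mul_comm,
      norm_prod]
    refine mul_le_mul_of_nonneg_right ?_ (norm_nonneg _)
    refine (Finset.prod_le_prod (fun _ _ => norm_nonneg _) fun i _ =>
      norm_linkWeight_le A B hδ i _).trans_eq ?_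
    simp
  have hGv : ∀ v y (s : ℝ), G (y + s • linkDir a v) = G y := fun v y s => by
    simp only [hG, linkDir, Prod.snd_add, Prod.smul_snd, Pi.add_apply, Pi.smul_apply]
    congr 1
    · rw [Pi.single_eq_of_ne (Fin.succ_ne_zero a).symm, smul_zero, add_zero]
    · refine Finset.prod_congr rfl fun i hi => ?_
      rw [Pi.single_eq_of_ne (fun h => Finset.ne_of_mem_erase hi (Fin.succ_injective _ h)),
        smul_zero, add_zero]
  obtain ⟨Cg, hCg⟩ := hg.lipschitzWith_of_hasCompactSupport hgc (by simp)
  obtain ⟨Mg, hMg⟩ := hg.continuous.bounded_above_of_compact_support hgc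
  have hrc : Continuous r := (linkConj a).continuous.comp
    ((lipschitzWith_regInv hδ).continuous.comp (by fun_prop))
  have hrb : ∀ y, ‖r y‖ ≤ δ⁻¹ := fun y => by
    rw [hr, norm_linkConj]
    exact norm_regInv_le_inv hδ _
  have hline : ∀ y v (s : ℝ), (y + s • linkDir a v).2 a.succ = y.2 a.succ + s • v := fun y v s => by
    simp [linkDir]
  set h' : ℂ → LinkSpace m → ℂ := fun v y =>
    linkConj a (fderiv ℝ (regInv δ) (y.2 a.succ) v) * g y + r y * fderiv ℝ g y (linkDir a v) with hh'
  have key : ∀ v : ℂ, ∫ y, G y * h' v y = 0 := fun v => by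
    refine integral_invariant_mul_lineDeriv_eq_zero (μ := volume) (h := fun y => r y * g y) hGl (hGv v)
      hgc.mul_left (hrc.mul hg.continuous) (C := (Real.toNNReal (δ ^ 2)⁻¹ : ℝ) * ‖v‖ * Mg +
        δ⁻¹ * (Cg * ‖linkDir a v‖)) ?_ ?_
    · intro y s
      have e : r (y + s • linkDir a v) * g (y + s • linkDir a v) - r y * g y =
          (r (y + s • linkDir a v) - r y) * g (y + s • linkDir a v) +
            r y * (g (y + s • linkDir a v) - g y) := by ring
      have h1 : ‖r (y + s • linkDir a v) - r y‖ ≤ (Real.toNNReal (δ ^ 2)⁻¹ : ℝ) * ‖v‖ * |s| := by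
        simp only [hr]
        rw [← map_sub, norm_linkConj, hline]
        exact (lipschitzWith_regInv hδ).norm_sub_line_le (y.2 a.succ) v s
      rw [e]
      refine (norm_add_le _ _).trans ?_
      rw [norm_mul, norm_mul]
      calc _ ≤ (Real.toNNReal (δ ^ 2)⁻¹ : ℝ) * ‖v‖ * |s| * Mg +
            δ⁻¹ * (Cg * ‖linkDir a v‖ * |s|) := by
            gcongr
            · exact hMg _
            · exact hrb y
            · exact hCg.norm_sub_line_le y _ s
        _ = _ := by ring
    · filter_upwards [ae_norm_link_ne a δ] with y hy
      have hd : DifferentiableAt ℝ (regInv δ) (y.2 a.succ) := by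
        rcases lt_or_gt_of_ne hy with h | h
        · exact (hasFDerivAt_regInv_of_lt h).differentiableAt
        · exact (hasFDerivAt_regInv_of_gt hδ h).differentiableAt
      have hg1 : HasLineDerivAt ℝ g (fderiv ℝ g y (linkDir a v)) y (linkDir a v) :=
        ((hg.differentiable (by simp)) y).hasFDerivAt.hasLineDerivAt _
      have hr1 : HasLineDerivAt ℝ r (linkConj a (fderiv ℝ (regInv δ) (y.2 a.succ) v)) y
          (linkDir a v) := by
        have h2 : HasDerivAt (fun s : ℝ => regInv δ (y.2 a.succ + s • v))
            (fderiv ℝ (regInv δ) (y.2 a.succ) v) 0 := hd.hasFDerivAt.hasLineDerivAt v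
        have h3 := (linkConj a).hasFDerivAt.comp_hasDerivAt (0 : ℝ) h2
        refine h3.congr_of_eventuallyEq (Eventually.of_forall fun s => ?_)
        simp only [hr, hline, Function.comp]
      have h4 := HasDerivAt.mul (𝔸 := ℂ) hr1 hg1
      simp only [zero_smul, add_zero] at h4
      exact h4
  have hi : ∀ v : ℂ, Integrable fun y => G y * h' v y := fun v => by
    have e : (fun y => G y * h' v y) = fun y => G y * (linkConj a (fderiv ℝ (regInv δ)
        (y.2 a.succ) v) * g y) + G y * (r y * fderiv ℝ g y (linkDir a v)) := by
      funext y
      simp only [hh']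
      ring
    have hfg : Continuous fun y => fderiv ℝ g y (linkDir a v) :=
      (hg.continuous_fderiv (by simp)).clm_apply continuous_const
    have hfgc : HasCompactSupport fun y => fderiv ℝ g y (linkDir a v) :=
      (hgc.fderiv (𝕜 := ℝ)).comp_left (g := fun L : LinkSpace m →L[ℝ] ℂ => L (linkDir a v)) rfl
    rw [e]
    refine Integrable.add ?_ ?_
    · have h1 : Integrable fun y => G y * g y := by
        simpa [mul_comm] using hGl.integrable_smul_left_of_hasCompactSupport hg.continuous hgc
      have h2 : Measurable fun y : LinkSpace m => linkConj a (fderiv ℝ (regInv δ) (y.2 a.succ) v) :=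
        (linkConj a).measurable.comp ((measurable_fderiv_apply_const ℝ (regInv δ) v).comp
          (by fun_prop))
      have h3 := h1.bdd_mul (c := (Real.toNNReal (δ ^ 2)⁻¹ : ℝ) * ‖v‖) h2.aestronglyMeasurable
        (Eventually.of_forall fun y => by
          rw [norm_linkConj]
          exact (lipschitzWith_regInv hδ).norm_fderiv_apply_le _ v)
      refine h3.congr (Eventually.of_forall fun y => ?_)
      simp only
      ring
    · have := hGl.integrable_smul_left_of_hasCompactSupport (hrc.mul hfg) hfgc.mul_left
      refine this.congr (Eventually.of_forall fun y => ?_)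
      simp only [Pi.mul_apply, smul_eq_mul]
      ring
  -- The real directions 1 and i are combined into the complex derivative. Applied to the
  -- regularised kernel it yields minus the truncated w⁻², with nothing on the circle |w| = δ.
  have hsum : ∫ y, G y * ((1 / 2) * (h' 1 y + linkUnit a * h' Complex.I y)) = 0 := by
    have e : (fun y => G y * ((1 / 2) * (h' 1 y + linkUnit a * h' Complex.I y))) =
        fun y => (1 / 2) * (G y * h' 1 y) + (1 / 2 * linkUnit a) * (G y * h' Complex.I y) := by
      funext y
      ring
    rw [e, integral_add ((hi 1).const_mul _) ((hi Complex.I).const_mul _), integral_const_mul,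
      integral_const_mul, key, key, mul_zero, mul_zero, add_zero]
  have hpt : ∀ᵐ y, G y * ((1 / 2) * (h' 1 y + linkUnit a * h' Complex.I y)) =
      weight A (insert a B) δ y * linkDeriv a g y - weight (insert a A) B δ y * g y := by
    filter_upwards [ae_norm_link_ne a δ] with y hy
    have e1 : (1 / 2) * (h' 1 y + linkUnit a * h' Complex.I y) =
        linkConj a (dz (regInv δ) (y.2 a.succ)) * g y + r y * linkDeriv a g y := by
      rw [← linkConj_dz, linkDeriv]
      simp only [hh']
      ring
    rw [e1, hw1, hw2]
    rcases lt_or_gt_of_ne hy with h | h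
    · rw [dz_regInv_of_lt h, map_zero,
        Set.indicator_of_notMem (show y.2 a.succ ∉ {w : ℂ | δ < ‖w‖} from not_lt.2 h.le)]
      ring
    · rw [dz_regInv_of_gt hδ h, Set.indicator_of_mem (show y.2 a.succ ∈ {w : ℂ | δ < ‖w‖} from h)]
      have : linkConj a (-(y.2 a.succ ^ 2)⁻¹) = -(linkConj a (y.2 a.succ) ^ 2)⁻¹ := by
        unfold linkConj
        split_ifs <;> simp
      rw [this]
      ring
  rw [integral_congr_ae hpt, integral_sub, sub_eq_zero] at hsum
  · exact hsum.symm
  · have hD : Continuous (linkDeriv a g) := by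
      have hfg : ∀ v, Continuous fun y => fderiv ℝ g y (linkDir a v) := fun v =>
        (hg.continuous_fderiv (by simp)).clm_apply continuous_const
      exact continuous_const.mul ((hfg 1).add (continuous_const.mul (hfg Complex.I)))
    have hDc : HasCompactSupport (linkDeriv a g) :=
      (hgc.fderiv (𝕜 := ℝ)).comp_left (g := fun L : LinkSpace m →L[ℝ] ℂ =>
        (1 / 2) * (L (linkDir a 1) + linkUnit a * L (linkDir a Complex.I))) (by simp)
    simpa [mul_comm] using (locallyIntegrable_weight A (insert a B)
      hδ).integrable_smul_left_of_hasCompactSupport hD hDc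
  · simpa [mul_comm] using (locallyIntegrable_weight (insert a A) B
      hδ).integrable_smul_left_of_hasCompactSupport hg.continuous hgc

end Weights

/-! ### Bounds for iterated derivatives -/

section DerivativeBounds

variable {E F : Type*} [NormedAddCommGroup E] [NormedSpace ℝ E] [NormedAddCommGroup F]
  [NormedSpace ℝ F]

lemma ContDiff.dirDeriv {f : E → ℂ} (hf : ContDiff ℝ ∞ f) (v : E) :
    ContDiff ℝ ∞ fun x => fderiv ℝ f x v :=
  (hf.fderiv_right (by simp)).clm_apply contDiff_const

lemma tsupport_dirDeriv_subset (f : E → ℂ) (v : E) :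
    tsupport (fun x => fderiv ℝ f x v) ⊆ tsupport f :=
  closure_minimal (fun x hx => support_fderiv_subset ℝ (fun h => hx (by
    change fderiv ℝ f x v = 0
    rw [h]
    rfl))) (isClosed_tsupport f)

lemma norm_iteratedFDeriv_dirDeriv_le {f : E → ℂ} (hf : ContDiff ℝ ∞ f) (v : E) (i : ℕ) (x : E) :
    ‖iteratedFDeriv ℝ i (fun x => fderiv ℝ f x v) x‖ ≤ ‖v‖ * ‖iteratedFDeriv ℝ (i + 1) f x‖ := by
  have h := (ContinuousLinearMap.apply ℝ ℂ v).norm_iteratedFDeriv_comp_left (N := ∞) (n := i)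
    (f := fderiv ℝ f) (x := x) (hf.fderiv_right (by simp)).contDiffAt (mod_cast le_top)
  rw [norm_iteratedFDeriv_fderiv] at h
  refine h.trans (mul_le_mul_of_nonneg_right ?_ (norm_nonneg _))
  refine ContinuousLinearMap.opNorm_le_bound _ (norm_nonneg _) fun L => ?_
  rw [mul_comm]
  exact L.le_opNorm v

/-- The iterated derivative in a fixed direction. -/
def iterDirDeriv (v : E) : ℕ → (E → ℂ) → E → ℂ
  | 0, f => f
  | p + 1, f => fun x => fderiv ℝ (iterDirDeriv v p f) x v

lemma contDiff_iterDirDeriv {f : E → ℂ} (hf : ContDiff ℝ ∞ f) (v : E) (p : ℕ) :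
    ContDiff ℝ ∞ (iterDirDeriv v p f) := by
  induction p with
  | zero => exact hf
  | succ p ih => exact ih.dirDeriv v

lemma tsupport_iterDirDeriv_subset (f : E → ℂ) (v : E) (p : ℕ) :
    tsupport (iterDirDeriv v p f) ⊆ tsupport f := by
  induction p with
  | zero => exact subset_rfl
  | succ p ih => exact (tsupport_dirDeriv_subset _ v).trans ih

lemma norm_iteratedFDeriv_iterDirDeriv_le {f : E → ℂ} (hf : ContDiff ℝ ∞ f) {v : E} (hv : ‖v‖ ≤ 1)
    (p i : ℕ) (x : E) :
    ‖iteratedFDeriv ℝ i (iterDirDeriv v p f) x‖ ≤ ‖iteratedFDeriv ℝ (i + p) f x‖ := by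
  induction p generalizing i with
  | zero => exact le_rfl
  | succ p ih =>
    refine (norm_iteratedFDeriv_dirDeriv_le (contDiff_iterDirDeriv hf v p) v i x).trans ?_
    refine (mul_le_of_le_one_left (norm_nonneg _) hv).trans ((ih (i + 1)).trans_eq ?_)
    rw [add_right_comm, add_assoc]

lemma iteratedDeriv_eq_iterDirDeriv {f : ℝ × F → ℂ} (hf : ContDiff ℝ ∞ f) (p : ℕ) (s : ℝ) (y : F) :
    iteratedDeriv p (fun t => f (t, y)) s = iterDirDeriv (1, 0) p f (s, y) := by
  induction p generalizing s with
  | zero => rfl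
  | succ p ih =>
    rw [iteratedDeriv_succ, funext fun s => ih s]
    have h1 : HasFDerivAt (iterDirDeriv (1, 0) p f) (fderiv ℝ (iterDirDeriv (1, 0) p f) (s, y))
        (s, y) := ((contDiff_iterDirDeriv hf _ p).differentiable (by simp) _).hasFDerivAt
    exact (h1.comp_hasDerivAt s ((hasDerivAt_id s).prodMk (hasDerivAt_const s y))).deriv

lemma exists_bound_iteratedFDeriv_on {g : E → F} (hg : ContDiff ℝ ∞ g) {K : Set E}
    (hK : IsCompact K) (n : ℕ) :
    ∃ D : ℝ, 1 ≤ D ∧ ∀ i ≤ n, ∀ y ∈ K, ‖iteratedFDeriv ℝ i g y‖ ≤ D := by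
  have h1 : ∀ i, ∃ D, ∀ y ∈ K, ‖iteratedFDeriv ℝ i g y‖ ≤ D := fun i =>
    hK.exists_bound_of_continuousOn (hg.continuous_iteratedFDeriv (mod_cast le_top)).continuousOn
  choose D hD using h1
  refine ⟨1 + ∑ i ∈ Finset.range (n + 1), |D i|,
    le_add_of_nonneg_right (Finset.sum_nonneg fun _ _ => abs_nonneg _), fun i hi y hy => ?_⟩
  have h2 : |D i| ≤ ∑ i ∈ Finset.range (n + 1), |D i| :=
    Finset.single_le_sum (f := fun i => |D i|) (fun _ _ => abs_nonneg _)
      (Finset.mem_range.2 (Nat.lt_succ_of_le hi))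
  have h3 := (hD i y hy).trans (le_abs_self _)
  linarith

/-- Bounds for derivatives of `c * (f ∘ P)` in terms of those of `f`. -/
lemma exists_norm_iteratedFDeriv_mul_comp_le {P : E → F} (hP : ContDiff ℝ ∞ P) {c : E → ℂ}
    (hc : ContDiff ℝ ∞ c) {K : Set E} (hK : IsCompact K) (n : ℕ) :
    ∃ C : ℝ, 0 ≤ C ∧ ∀ f : F → ℂ, ContDiff ℝ ∞ f → ∀ M : ℝ,
      (∀ i ≤ n, ∀ x, ‖iteratedFDeriv ℝ i f x‖ ≤ M) →
      ∀ i ≤ n, ∀ y ∈ K, ‖iteratedFDeriv ℝ i (fun y => c y * f (P y)) y‖ ≤ C * M := by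
  obtain ⟨D, hD1, hD⟩ := exists_bound_iteratedFDeriv_on hP hK n
  obtain ⟨D', hD1', hD'⟩ := exists_bound_iteratedFDeriv_on hc hK n
  -- Faà di Bruno's formula gives n! Dⁿ for the composition, and the binomial coefficients in
  -- Leibniz' formula sum to at most 2ⁿ.
  refine ⟨2 ^ n * (D' * (n.factorial * D ^ n)), by positivity, fun f hf M hM i hi y hy => ?_⟩
  have hM0 : 0 ≤ M := (norm_nonneg _).trans (hM 0 (Nat.zero_le _) (P y))
  have h1 : ∀ j ≤ n, ‖iteratedFDeriv ℝ j (f ∘ P) y‖ ≤ n.factorial * M * D ^ n := fun j hj => by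
    refine (norm_iteratedFDeriv_comp_le hf hP (mod_cast le_top) y (C := M) (D := D)
      (fun l hl => hM l (hl.trans hj) _) fun l h1 h2 => ?_).trans ?_
    · exact (hD l (h2.trans hj) y hy).trans (le_self_pow₀ hD1 (by omega))
    · gcongr
  refine (norm_iteratedFDeriv_mul_le hc (hf.comp hP) y (n := i) (mod_cast le_top)).trans ?_
  calc ∑ j ∈ Finset.range (i + 1), (i.choose j : ℝ) * ‖iteratedFDeriv ℝ j c y‖ *
        ‖iteratedFDeriv ℝ (i - j) (f ∘ P) y‖
      ≤ ∑ j ∈ Finset.range (i + 1), (i.choose j : ℝ) * D' * (n.factorial * M * D ^ n) := by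
        refine Finset.sum_le_sum fun j hj => ?_
        have hj' := Finset.mem_range_succ_iff.1 hj
        gcongr
        · exact hD' j (hj'.trans hi) y hy
        · exact h1 _ ((Nat.sub_le _ _).trans hi)
    _ = 2 ^ i * (D' * (n.factorial * D ^ n)) * M := by
        rw [← Finset.sum_mul, ← Finset.sum_mul, ← Nat.cast_sum, Nat.sum_range_choose]
        push_cast
        ring
    _ ≤ _ := by
        gcongr
        norm_num

end DerivativeBounds

/-! ### Principal values of integrals with singular weights -/

section PrincipalValue

variable {m : ℕ} {δ : ℝ}

lemma contDiff_linkDeriv {g : LinkSpace m → ℂ} (hg : ContDiff ℝ ∞ g) (a : Fin m) :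
    ContDiff ℝ ∞ (linkDeriv a g) :=
  contDiff_const.mul ((hg.dirDeriv _).add (contDiff_const.mul (hg.dirDeriv _)))

lemma tsupport_linkDeriv_subset (g : LinkSpace m → ℂ) (a : Fin m) :
    tsupport (linkDeriv a g) ⊆ tsupport g :=
  closure_minimal (fun x hx => support_fderiv_subset ℝ (fun h => hx (by simp [linkDeriv, h])))
    (isClosed_tsupport g)

/-- The factor 1/2 makes this a combination of norm at most one, so repeated integrations by parts
do not accumulate constants. -/
lemma norm_iteratedFDeriv_linkDeriv_le {g : LinkSpace m → ℂ} (hg : ContDiff ℝ ∞ g) (a : Fin m)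
    (i : ℕ) (y : LinkSpace m) :
    ‖iteratedFDeriv ℝ i (linkDeriv a g) y‖ ≤ ‖iteratedFDeriv ℝ (i + 1) g y‖ := by
  have hL (L : LinkSpace m →L[ℝ] ℂ) :
      ‖(1 / 2 : ℂ) * (L (linkDir a 1) + linkUnit a * L (linkDir a Complex.I))‖ ≤ 1 * ‖L‖ := by
    have h1 := L.le_opNorm (linkDir a 1)
    have h2 := L.le_opNorm (linkDir a Complex.I)
    rw [norm_linkDir, norm_one, mul_one] at h1
    rw [norm_linkDir, Complex.norm_I, mul_one] at h2
    have h3 := norm_add_le (L (linkDir a 1)) (linkUnit a * L (linkDir a Complex.I))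
    rw [norm_mul, norm_linkUnit, one_mul] at h3
    rw [norm_mul]
    norm_num
    linarith
  let T : (LinkSpace m →L[ℝ] ℂ) →L[ℝ] ℂ := LinearMap.mkContinuous
    { toFun := fun L => (1 / 2) * (L (linkDir a 1) + linkUnit a * L (linkDir a Complex.I))
      map_add' := fun L L' => by
        simp only [add_apply]
        ring
      map_smul' := fun c L => by
        simp only [smul_apply, RingHom.id_apply, Complex.real_smul]
        ring } 1 hL
  have hT : ‖T‖ ≤ 1 := LinearMap.mkContinuous_norm_le _ zero_le_one _
  have h := T.norm_iteratedFDeriv_comp_left (N := ∞) (n := i)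
    (f := fderiv ℝ g) (x := y) (hg.fderiv_right (by simp)).contDiffAt (mod_cast le_top)
  rw [norm_iteratedFDeriv_fderiv] at h
  exact h.trans (mul_le_of_le_one_left (norm_nonneg _) hT)

/-- The weights of exponent two are removed by integration by parts. -/
lemma exists_integral_weight_eq (A : Finset (Fin m)) (B : Finset (Fin m)) {g : LinkSpace m → ℂ}
    (hg : ContDiff ℝ ∞ g) (hgc : HasCompactSupport g) :
    ∃ g' : LinkSpace m → ℂ, ContDiff ℝ ∞ g' ∧ tsupport g' ⊆ tsupport g ∧
      (∀ M : ℝ, (∀ i ≤ A.card, ∀ y, ‖iteratedFDeriv ℝ i g y‖ ≤ M) → ∀ y, ‖g' y‖ ≤ M) ∧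
      ∀ δ, 0 < δ → ∫ y, weight A B δ y * g y = ∫ y, weight ∅ (A ∪ B) δ y * g' y := by
  induction A using Finset.induction_on generalizing B g with
  | empty =>
    refine ⟨g, hg, subset_rfl, fun M hM y => ?_, fun δ _ => by rw [Finset.empty_union]⟩
    simpa using hM 0 le_rfl y
  | insert a A ha ih =>
    have hc1 : HasCompactSupport (linkDeriv a g) :=
      hgc.of_isClosed_subset (isClosed_tsupport _) (tsupport_linkDeriv_subset g a)
    -- The link `a` passes from `A` to `B`: its kernel is now regularised instead of truncated.
    -- Hence the induction runs over all `B`.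
    obtain ⟨g', h1, h2, h3, h4⟩ := ih (insert a B) (contDiff_linkDeriv hg a) hc1
    refine ⟨g', h1, h2.trans (tsupport_linkDeriv_subset g a), fun M hM => h3 M fun i hi y => ?_,
      fun δ hδ => ?_⟩
    · refine (norm_iteratedFDeriv_linkDeriv_le hg a i y).trans (hM _ ?_ y)
      rw [Finset.card_insert_of_notMem ha]
      omega
    · rw [integral_weight_mul_eq ha hδ hg hgc, h4 δ hδ, Finset.insert_union, Finset.union_insert]

lemma exists_norm_integral_weight_le (A : Finset (Fin m)) {K : Set (LinkSpace m)}
    (hK : IsCompact K) :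
    ∃ C : ℝ, 0 ≤ C ∧ ∀ g : LinkSpace m → ℂ, ContDiff ℝ ∞ g → tsupport g ⊆ K → ∀ M : ℝ,
      (∀ i ≤ A.card, ∀ y, ‖iteratedFDeriv ℝ i g y‖ ≤ M) → ∀ δ, 0 < δ →
      ‖∫ y, weight A ∅ δ y * g y‖ ≤ C * M := by
  refine ⟨∫ y in K, ‖∏ i, (y.2 i)⁻¹‖, integral_nonneg fun _ => norm_nonneg _,
    fun g hg hgK M hM δ hδ => ?_⟩
  have hgc : HasCompactSupport g := hK.of_isClosed_subset (isClosed_tsupport _) hgK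
  obtain ⟨g', h1, h2, h3, h4⟩ := exists_integral_weight_eq A ∅ hg hgc
  have hI : IntegrableOn (fun y : LinkSpace m => ∏ i, (y.2 i)⁻¹) K :=
    locallyIntegrable_prod_inv.integrableOn_isCompact hK
  rw [h4 δ hδ, ← setIntegral_eq_integral_of_forall_compl_eq_zero (s := K), ← integral_mul_const]
  · refine norm_integral_le_of_norm_le (hI.norm.mul_const M) (Eventually.of_forall fun y => ?_)
    rw [norm_mul]
    exact mul_le_mul (norm_weight_empty_le _ hδ y) (h3 M hM y) (norm_nonneg _) (norm_nonneg _)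
  · intro y hy
    rw [image_eq_zero_of_notMem_tsupport fun h => hy (hgK (h2 h)), mul_zero]

/-- After the integrations by parts the remaining amplitude does not depend on δ, and the weights
converge under a locally integrable bound. -/
lemma exists_tendsto_integral_weight (A : Finset (Fin m)) {g : LinkSpace m → ℂ}
    (hg : ContDiff ℝ ∞ g) (hgc : HasCompactSupport g) :
    ∃ I : ℂ, Tendsto (fun δ => ∫ y, weight A ∅ δ y * g y) (𝓝[>] 0) (𝓝 I) := by
  obtain ⟨g', h1, h2, -, h4⟩ := exists_integral_weight_eq A ∅ hg hgc
  have hc' : HasCompactSupport g' := hgc.of_isClosed_subset (isClosed_tsupport _) h2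
  refine ⟨∫ y, (y.2 0)⁻¹ * (∏ i : Fin m, (linkConj i (y.2 i.succ))⁻¹) * g' y,
    Tendsto.congr' (f₁ := fun δ => ∫ y, weight ∅ (A ∪ ∅) δ y * g' y) ?_ ?_⟩
  · filter_upwards [self_mem_nhdsWithin] with δ hδ using (h4 δ hδ).symm
  · have hI := (locallyIntegrable_prod_inv (m := m)).integrable_smul_left_of_hasCompactSupport
      h1.continuous hc'
    refine tendsto_integral_filter_of_dominated_convergence _ ?_ ?_ hI.norm ?_
    · filter_upwards [self_mem_nhdsWithin] with δ hδ
      exact ((measurable_weight _ _ hδ).mul h1.continuous.measurable).aestronglyMeasurable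
    · filter_upwards [self_mem_nhdsWithin] with δ hδ
      refine Eventually.of_forall fun y => ?_
      rw [norm_mul, norm_smul, mul_comm]
      exact mul_le_mul_of_nonneg_left (norm_weight_empty_le _ hδ y) (norm_nonneg _)
    · refine Eventually.of_forall fun y => Tendsto.mul_const _ (Tendsto.const_mul _ ?_)
      exact tendsto_finsetProd _ fun i _ => tendsto_linkWeight_empty _ i _

end PrincipalValue

/-! ### The kernel -/

section Kernel

variable {m : ℕ} {δ : ℝ} {z₀ : ℂ}

/-- The partial sums of `w`. -/
def linkSum (m : ℕ) : (Fin (m + 1) → ℂ) →L[ℝ] (Fin (m + 1) → ℂ) :=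
  ContinuousLinearMap.pi fun i => ∑ j ∈ Finset.Iic i, ContinuousLinearMap.proj (R := ℝ) j

lemma linkSum_apply (w : Fin (m + 1) → ℂ) (i : Fin (m + 1)) :
    linkSum m w i = ∑ j ∈ Finset.Iic i, w j := by
  simp [linkSum]

lemma linkSum_zero (w : Fin (m + 1) → ℂ) : linkSum m w 0 = w 0 := by
  rw [linkSum_apply]
  have : Finset.Iic (0 : Fin (m + 1)) = {0} := by
    ext j
    simp
  rw [this, Finset.sum_singleton]

lemma linkSum_succ_sub (w : Fin (m + 1) → ℂ) (i : Fin m) :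
    linkSum m w i.succ - linkSum m w i.castSucc = w i.succ := by
  rw [linkSum_apply, linkSum_apply]
  have : Finset.Iic i.succ = insert i.succ (Finset.Iic i.castSucc) := by
    ext j
    simp only [Finset.mem_Iic, Finset.mem_insert, Fin.le_def, Fin.ext_iff, Fin.val_succ,
      Fin.val_castSucc]
    omega
  rw [this, Finset.sum_insert (by simp [Fin.le_def]), add_sub_cancel_right]

/-- The consecutive differences of `z`. -/
def linkDiff (z : Fin (m + 1) → ℂ) : Fin (m + 1) → ℂ :=
  Fin.cons (z 0) fun i : Fin m => z i.succ - z i.castSucc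

lemma continuous_linkDiff : Continuous (linkDiff (m := m)) := by
  refine continuous_pi fun i => Fin.cases ?_ (fun i => ?_) i
  · exact continuous_apply 0
  · exact (continuous_apply i.succ).sub (continuous_apply i.castSucc)

lemma linkDiff_linkSum (w : Fin (m + 1) → ℂ) : linkDiff (linkSum m w) = w := by
  funext i
  refine Fin.cases ?_ (fun i => ?_) i
  · exact linkSum_zero w
  · exact linkSum_succ_sub w i

lemma isClosedEmbedding_linkSum : IsClosedEmbedding (linkSum m) :=
  Function.LeftInverse.isClosedEmbedding linkDiff_linkSum continuous_linkDiff (linkSum m).continuous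

lemma surjective_linkSum : Function.Surjective (linkSum m) :=
  LinearMap.surjective_of_injective (f := (linkSum m : (Fin (m + 1) → ℂ) →ₗ[ℝ] _))
    isClosedEmbedding_linkSum.injective

/-- The Jacobian of the change of variables. -/
def linkJacobian (m : ℕ) : ℝ :=
  |LinearMap.det (linkSum m : (Fin (m + 1) → ℂ) →ₗ[ℝ] (Fin (m + 1) → ℂ))|

lemma linkJacobian_nonneg : 0 ≤ linkJacobian m := abs_nonneg _

/-- The point with the coordinates `y`. -/
def linkPoint (z₀ : ℂ) (y : LinkSpace m) : Fin (m + 1) → ℂ := fun i => z₀ + linkSum m y.2 i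

/-- An affine change of variables; `φ` is a placeholder that `linkPoint` ignores. -/
lemma integral_eq_linkPoint (H : (Fin (m + 1) → ℂ) → ℂ) (φ : ℝ) :
    ∫ z, H z = linkJacobian m * ∫ w, H (linkPoint z₀ (φ, w)) := by
  have hdet : LinearMap.det (linkSum m : (Fin (m + 1) → ℂ) →ₗ[ℝ] (Fin (m + 1) → ℂ)) ≠ 0 := by
    have h1 := LinearEquiv.ofInjectiveEndo
      (linkSum m : (Fin (m + 1) → ℂ) →ₗ[ℝ] _) isClosedEmbedding_linkSum.injective
    have h2 : IsUnit (linkSum m : (Fin (m + 1) → ℂ) →ₗ[ℝ] (Fin (m + 1) → ℂ)) :=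
      (LinearMap.isUnit_iff_ker_eq_bot _).2
        (LinearMap.ker_eq_bot.2 isClosedEmbedding_linkSum.injective)
    exact (h2.map (LinearMap.det)).ne_zero
  have h1 := Measure.map_linearMap_addHaar_eq_smul_addHaar
    (volume : Measure (Fin (m + 1) → ℂ)) hdet
  have h2 : ∫ z, H (fun i => z₀ + z i) ∂(Measure.map (linkSum m) volume) =
      ∫ w, H (linkPoint z₀ (φ, w)) :=
    isClosedEmbedding_linkSum.measurableEmbedding.integral_map _
  have h3 : ∫ z : Fin (m + 1) → ℂ, H (fun i => z₀ + z i) = ∫ z, H z :=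
    integral_add_left_eq_self H fun _ => z₀
  rw [← h2]
  have h4 : Measure.map (linkSum m) volume = ENNReal.ofReal |(LinearMap.det
      (linkSum m : (Fin (m + 1) → ℂ) →ₗ[ℝ] (Fin (m + 1) → ℂ)))⁻¹| •
      (volume : Measure (Fin (m + 1) → ℂ)) := h1
  rw [h4, integral_smul_measure, h3, ENNReal.toReal_ofReal (abs_nonneg _), Complex.real_smul,
    linkJacobian, abs_inv, ← mul_assoc, ← Complex.ofReal_mul, mul_inv_cancel₀ (abs_ne_zero.2 hdet),
    Complex.ofReal_one, one_mul]

/-- The point on the graph of the phase with the coordinates `y`. -/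
def graphPoint (z₀ : ℂ) (y : LinkSpace m) : KernelSpace m :=
  (phase m y.1 (linkPoint z₀ y), y.1, linkPoint z₀ y)

lemma contDiff_linkPoint : ContDiff ℝ ∞ (linkPoint (m := m) z₀) :=
  contDiff_const.add ((linkSum m).contDiff.comp contDiff_snd)

lemma contDiff_graphPoint : ContDiff ℝ ∞ (graphPoint (m := m) z₀) :=
  (contDiff_phaseFn.comp (contDiff_fst.prodMk contDiff_linkPoint)).prodMk
    (contDiff_fst.prodMk contDiff_linkPoint)

/-- Forgetting t and taking differences inverts the parametrisation. Closedness makes preimages of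
compact sets compact, so amplitudes have compact support, and makes the complement of the graph
open. -/
lemma isClosedEmbedding_graphPoint : IsClosedEmbedding (graphPoint (m := m) z₀) := by
  refine Function.LeftInverse.isClosedEmbedding
    (f := fun x : KernelSpace m => (x.2.1, linkDiff fun i => x.2.2 i - z₀)) (fun y => ?_)
    ?_ contDiff_graphPoint.continuous
  · refine Prod.ext rfl ?_
    simp only [graphPoint, linkPoint, add_sub_cancel_left]
    exact linkDiff_linkSum _
  · exact (continuous_fst.comp continuous_snd).prodMk (continuous_linkDiff.comp (by fun_prop))

lemma linkPoint_zero (y : LinkSpace m) : linkPoint z₀ y 0 - z₀ = y.2 0 := by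
  rw [linkPoint, linkSum_zero, add_sub_cancel_left]

lemma linkPoint_succ_sub (y : LinkSpace m) (i : Fin m) :
    linkPoint z₀ y i.succ - linkPoint z₀ y i.castSucc = y.2 i.succ := by
  rw [linkPoint, linkPoint, add_sub_add_left_eq_sub, linkSum_succ_sub]

/-- The smooth factor of the coefficients of the kernel. -/
def angularCoeff (A : Finset (Fin m)) (φ : ℝ) : ℂ :=
  2 * (Real.pi : ℂ) * (-(1 / (Real.pi : ℂ))) ^ (m + 1) *
    (angularFactor m φ * ∏ i ∈ Aᶜ, angularFactor (i : ℕ) φ)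

lemma contDiff_angularFactor (i : ℕ) : ContDiff ℝ ∞ (angularFactor i) :=
  contDiff_const.mul
    (contDiff_const.mul (contDiff_const.mul Complex.ofRealCLM.contDiff)).cexp

lemma contDiff_angularCoeff (A : Finset (Fin m)) : ContDiff ℝ ∞ (angularCoeff A) :=
  contDiff_const.mul ((contDiff_angularFactor m).mul
    (contDiff_prod fun i _ => contDiff_angularFactor (i : ℕ)))

/-- In the difference coordinates the truncation of the kernel is the product of the truncations at
the links. -/
lemma indicator_kernelCoeff (A : Finset (Fin m)) (y : LinkSpace m) (v : ℂ) :
    (farSet m δ).indicator (fun z => kernelCoeff m z₀ A y.1 z * v) (linkPoint z₀ y) =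
      weight A ∅ δ y * (angularCoeff A y.1 * v) := by
  have hd : ∀ i : Fin m, linkDifference (linkPoint z₀ y) i = linkConj i (y.2 i.succ) := fun i => by
    rw [linkDifference, linkPoint_succ_sub, linkConj]
    split_ifs <;> simp
  by_cases h : linkPoint z₀ y ∈ farSet m δ
  · have hi : ∀ i : Fin m, y.2 i.succ ∈ {w : ℂ | δ < ‖w‖} := fun i => by
      have := h i
      rwa [norm_sub_rev, linkPoint_succ_sub] at this
    have hw : ∀ i : Fin m, linkWeight A ∅ δ i (y.2 i.succ) =
        (linkDifference (linkPoint z₀ y) i ^ (if i ∈ A then 2 else 1))⁻¹ := fun i => by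
      rw [linkWeight, Set.indicator_of_mem (hi i), Set.indicator_of_mem (hi i), hd]
      split_ifs <;> simp_all
    rw [Set.indicator_of_mem h, weight, Finset.prod_congr rfl fun i _ => hw i, kernelCoeff,
      linkPoint_zero, angularCoeff, Finset.prod_inv_distrib, div_eq_mul_inv, mul_inv]
    ring
  · obtain ⟨i, hi⟩ : ∃ i : Fin m, ¬ δ < ‖y.2 i.succ‖ := by
      by_contra! h'
      refine h fun i => ?_
      rw [norm_sub_rev, linkPoint_succ_sub]
      exact h' i
    have hi' : y.2 i.succ ∉ {w : ℂ | δ < ‖w‖} := hi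
    have hw : linkWeight A ∅ δ i (y.2 i.succ) = 0 := by
      rw [linkWeight, Set.indicator_of_notMem hi', Set.indicator_of_notMem hi']
      simp
    rw [Set.indicator_of_notMem h, weight, Finset.prod_eq_zero (Finset.mem_univ i) hw, mul_zero,
      zero_mul]

/-- The amplitude with which the weight `A` is integrated. -/
def amplitude (z₀ : ℂ) (A : Finset (Fin m)) (ψ : KernelSpace m → ℂ) (y : LinkSpace m) : ℂ :=
  angularCoeff A y.1 * iterDirDeriv (1, 0) (m + 1 - A.card) ψ (graphPoint z₀ y)

variable {ψ : KernelSpace m → ℂ}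

lemma contDiff_amplitude (hψ : ContDiff ℝ ∞ ψ) (A : Finset (Fin m)) :
    ContDiff ℝ ∞ (amplitude z₀ A ψ) :=
  ((contDiff_angularCoeff A).comp contDiff_fst).mul
    ((contDiff_iterDirDeriv hψ _ _).comp contDiff_graphPoint)

lemma tsupport_amplitude_subset (A : Finset (Fin m)) (ψ : KernelSpace m → ℂ) :
    tsupport (amplitude z₀ A ψ) ⊆ graphPoint z₀ ⁻¹' tsupport ψ :=
  (tsupport_mul_subset_right (f := fun y : LinkSpace m => angularCoeff A y.1)
    (g := fun y => iterDirDeriv (1, 0) (m + 1 - A.card) ψ (graphPoint z₀ y))).trans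
    ((tsupport_comp_subset_preimage _ contDiff_graphPoint.continuous).trans
      (Set.preimage_mono (tsupport_iterDirDeriv_subset _ _ _)))

lemma isCompact_preimage_graphPoint {K : Set (KernelSpace m)} (hK : IsCompact K) :
    IsCompact (graphPoint z₀ ⁻¹' K) := isClosedEmbedding_graphPoint.isCompact_preimage hK

lemma hasCompactSupport_amplitude (hc : HasCompactSupport ψ) (A : Finset (Fin m)) :
    HasCompactSupport (amplitude z₀ A ψ) :=
  (isCompact_preimage_graphPoint hc.isCompact).of_isClosed_subset (isClosed_tsupport _)
    (tsupport_amplitude_subset A ψ)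

lemma integrable_weight_mul (A B : Finset (Fin m)) (hδ : 0 < δ) {g : LinkSpace m → ℂ}
    (hg : Continuous g) (hgc : HasCompactSupport g) :
    Integrable fun y => weight A B δ y * g y := by
  simpa [mul_comm] using
    (locallyIntegrable_weight A B hδ).integrable_smul_left_of_hasCompactSupport hg hgc

/-- The truncated pairing in the coordinates `z_1 - z_0, z_2 - z_1, …`. -/
lemma truncatedPairing_eq (hψ : ContDiff ℝ ∞ ψ) (hc : HasCompactSupport ψ) (hδ : 0 < δ) :
    truncatedPairing m z₀ (fun t φ z => ψ (t, φ, z)) δ =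
      linkJacobian m * ∑ A : Finset (Fin m), ∫ y, weight A ∅ δ y * amplitude z₀ A ψ y := by
  have hI : ∀ A : Finset (Fin m), Integrable fun y => weight A ∅ δ y * amplitude z₀ A ψ y :=
    fun A => integrable_weight_mul A ∅ hδ (contDiff_amplitude hψ A).continuous
      (hasCompactSupport_amplitude hc A)
  rw [← integral_finsetSum _ fun A _ => hI A, Measure.volume_eq_prod,
    integral_prod _ (integrable_finsetSum _ fun A _ => hI A), ← integral_const_mul, truncatedPairing]
  congr 1
  funext φ
  change ∫ z in farSet m δ, _ = _
  rw [← integral_indicator measurableSet_farSet, integral_eq_linkPoint (z₀ := z₀) _ φ]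
  congr 2
  funext w
  have h : (farSet m δ).indicator (fun z => ∑ A : Finset (Fin m), kernelCoeff m z₀ A φ z *
      iteratedDeriv (m + 1 - A.card) (fun t => ψ (t, φ, z)) (phase m φ z)) (linkPoint z₀ (φ, w)) =
      ∑ A : Finset (Fin m), (farSet m δ).indicator (fun z => kernelCoeff m z₀ A φ z *
        iterDirDeriv (1, 0) (m + 1 - A.card) ψ (graphPoint z₀ (φ, w))) (linkPoint z₀ (φ, w)) := by
    by_cases h : linkPoint z₀ (φ, w) ∈ farSet m δ
    · simp only [Set.indicator_of_mem h, iteratedDeriv_eq_iterDirDeriv hψ, graphPoint]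
    · simp only [Set.indicator_of_notMem h, Finset.sum_const_zero]
  rw [h]
  exact Finset.sum_congr rfl fun A _ => indicator_kernelCoeff A (φ, w) _

lemma exists_tendsto_truncatedPairing (hψ : ContDiff ℝ ∞ ψ) (hc : HasCompactSupport ψ) :
    ∃ I, Tendsto (truncatedPairing m z₀ fun t φ z => ψ (t, φ, z)) (𝓝[>] 0) (𝓝 I) := by
  choose I hI using fun A : Finset (Fin m) => exists_tendsto_integral_weight A
    (contDiff_amplitude (z₀ := z₀) hψ A) (hasCompactSupport_amplitude hc A)
  refine ⟨linkJacobian m * ∑ A, I A,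
    ((tendsto_finsetSum _ fun A _ => hI A).const_mul (linkJacobian m : ℂ)).congr' ?_⟩
  filter_upwards [self_mem_nhdsWithin] with δ hδ using (truncatedPairing_eq hψ hc hδ).symm

lemma exists_norm_truncatedPairing_le (z₀ : ℂ) {K : Set (KernelSpace m)} (hK : IsCompact K) :
    ∃ (N : ℕ) (C : ℝ), 0 ≤ C ∧ ∀ ψ : KernelSpace m → ℂ, ContDiff ℝ ∞ ψ → tsupport ψ ⊆ K → ∀ M,
      (∀ i ≤ N, ∀ x, ‖iteratedFDeriv ℝ i ψ x‖ ≤ M) → ∀ δ, 0 < δ →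
      ‖truncatedPairing m z₀ (fun t φ z => ψ (t, φ, z)) δ‖ ≤ C * M := by
  have hK' := isCompact_preimage_graphPoint (z₀ := z₀) hK
  choose C hC0 hC using fun A : Finset (Fin m) => exists_norm_integral_weight_le A hK'
  choose D hD0 hD using fun A : Finset (Fin m) => exists_norm_iteratedFDeriv_mul_comp_le
    (contDiff_graphPoint (m := m) (z₀ := z₀))
    ((contDiff_angularCoeff A).comp (contDiff_fst (E := ℝ) (F := Fin (m + 1) → ℂ))) hK' A.card
  -- The amplitude takes m + 1 - |A| derivatives in t, and the integrations by parts at most |A|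
  -- more; 2m + 1 is more than enough.
  refine ⟨2 * m + 1, linkJacobian m * ∑ A, C A * D A, mul_nonneg linkJacobian_nonneg
    (Finset.sum_nonneg fun A _ => mul_nonneg (hC0 A) (hD0 A)), fun ψ hψ hψK M hM δ hδ => ?_⟩
  have hc : HasCompactSupport ψ := hK.of_isClosed_subset (isClosed_tsupport _) hψK
  rw [truncatedPairing_eq hψ hc hδ, norm_mul, Complex.norm_real,
    Real.norm_of_nonneg linkJacobian_nonneg, mul_assoc, Finset.sum_mul]
  refine mul_le_mul_of_nonneg_left ((norm_sum_le _ _).trans (Finset.sum_le_sum fun A _ => ?_))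
    linkJacobian_nonneg
  have hsub : tsupport (amplitude z₀ A ψ) ⊆ graphPoint z₀ ⁻¹' K :=
    (tsupport_amplitude_subset A ψ).trans (Set.preimage_mono hψK)
  rw [mul_assoc]
  refine hC A _ (contDiff_amplitude hψ A) hsub (D A * M) (fun i hi y => ?_) δ hδ
  have hA := Finset.card_le_univ A
  rw [Fintype.card_fin] at hA
  by_cases hy : y ∈ graphPoint z₀ ⁻¹' K
  · refine hD A _ (contDiff_iterDirDeriv hψ (1, 0) (m + 1 - A.card)) M (fun j hj x => ?_) i hi y hy
    exact (norm_iteratedFDeriv_iterDirDeriv_le hψ (by simp [Prod.norm_def]) _ j x).trans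
      (hM _ (by omega) x)
  · rw [image_eq_zero_of_notMem_tsupport fun h =>
      hy (hsub (tsupport_iteratedFDeriv_subset (𝕜 := ℝ) i h)), norm_zero]
    have hM0 : 0 ≤ M := (norm_nonneg _).trans (hM 0 (Nat.zero_le _) 0)
    exact mul_nonneg (hD0 A) hM0

lemma iterDirDeriv_add {E : Type*} [NormedAddCommGroup E] [NormedSpace ℝ E] {f g : E → ℂ}
    (hf : ContDiff ℝ ∞ f) (hg : ContDiff ℝ ∞ g) (v : E) (p : ℕ) :
    iterDirDeriv v p (f + g) = iterDirDeriv v p f + iterDirDeriv v p g := by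
  induction p with
  | zero => rfl
  | succ p ih =>
    funext x
    simp only [iterDirDeriv, ih, Pi.add_apply]
    rw [fderiv_add ((contDiff_iterDirDeriv hf v p).differentiable (by simp) x)
      ((contDiff_iterDirDeriv hg v p).differentiable (by simp) x)]
    rfl

lemma iterDirDeriv_const_smul {E : Type*} [NormedAddCommGroup E] [NormedSpace ℝ E] {f : E → ℂ}
    (hf : ContDiff ℝ ∞ f) (c : ℂ) (v : E) (p : ℕ) :
    iterDirDeriv v p (c • f) = c • iterDirDeriv v p f := by
  induction p with
  | zero => rfl
  | succ p ih =>
    funext x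
    simp only [iterDirDeriv, ih, Pi.smul_apply]
    rw [fderiv_const_smul ((contDiff_iterDirDeriv hf v p).differentiable (by simp) x)]
    rfl

/-! ### The principal value as a distribution. -/

/-- The distribution `K`. -/
def bornKernelFun (m : ℕ) (z₀ : ℂ) (ψ : 𝓓((⊤ : Opens (KernelSpace m)), ℂ)) : ℂ :=
  limUnder (𝓝[>] 0) (truncatedPairing m z₀ fun t φ z => ψ (t, φ, z))

lemma tendsto_bornKernelFun (ψ : 𝓓((⊤ : Opens (KernelSpace m)), ℂ)) :
    Tendsto (truncatedPairing m z₀ fun t φ z => ψ (t, φ, z)) (𝓝[>] 0)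
      (𝓝 (bornKernelFun m z₀ ψ)) :=
  tendsto_nhds_limUnder (exists_tendsto_truncatedPairing ψ.contDiff ψ.hasCompactSupport)

lemma bornKernelFun_add (f g : 𝓓((⊤ : Opens (KernelSpace m)), ℂ)) :
    bornKernelFun m z₀ (f + g) = bornKernelFun m z₀ f + bornKernelFun m z₀ g := by
  refine tendsto_nhds_unique (tendsto_bornKernelFun (f + g))
    (((tendsto_bornKernelFun f).add (tendsto_bornKernelFun g)).congr' ?_)
  filter_upwards [self_mem_nhdsWithin] with δ hδ
  rw [truncatedPairing_eq f.contDiff f.hasCompactSupport hδ,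
    truncatedPairing_eq g.contDiff g.hasCompactSupport hδ,
    truncatedPairing_eq (f + g).contDiff (f + g).hasCompactSupport hδ, ← mul_add,
    ← Finset.sum_add_distrib]
  congr 1
  refine Finset.sum_congr rfl fun A _ => ?_
  rw [← integral_add
    (integrable_weight_mul A ∅ hδ (contDiff_amplitude f.contDiff A).continuous
      (hasCompactSupport_amplitude f.hasCompactSupport A))
    (integrable_weight_mul A ∅ hδ (contDiff_amplitude g.contDiff A).continuous
      (hasCompactSupport_amplitude g.hasCompactSupport A))]
  congr 1
  funext y
  have h : ((f + g : 𝓓((⊤ : Opens (KernelSpace m)), ℂ)) : KernelSpace m → ℂ) = f + g := rfl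
  rw [amplitude, amplitude, amplitude, h, iterDirDeriv_add f.contDiff g.contDiff, Pi.add_apply]
  ring

lemma bornKernelFun_smul (c : ℂ) (f : 𝓓((⊤ : Opens (KernelSpace m)), ℂ)) :
    bornKernelFun m z₀ (c • f) = c • bornKernelFun m z₀ f := by
  refine tendsto_nhds_unique (tendsto_bornKernelFun (c • f))
    (((tendsto_bornKernelFun f).const_smul c).congr' ?_)
  filter_upwards [self_mem_nhdsWithin] with δ hδ
  rw [truncatedPairing_eq f.contDiff f.hasCompactSupport hδ,
    truncatedPairing_eq (c • f).contDiff (c • f).hasCompactSupport hδ, smul_eq_mul, mul_left_comm,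
    Finset.mul_sum]
  congr 1
  refine Finset.sum_congr rfl fun A _ => ?_
  rw [← integral_const_mul]
  congr 1
  funext y
  have h : ((c • f : 𝓓((⊤ : Opens (KernelSpace m)), ℂ)) : KernelSpace m → ℂ) = c • ⇑f := rfl
  rw [amplitude, amplitude, h, iterDirDeriv_const_smul f.contDiff, Pi.smul_apply, smul_eq_mul]
  ring

/-- The distribution `K_n^{z₀}`. -/
def bornKernel (m : ℕ) (z₀ : ℂ) : ComplexDistribution (KernelSpace m) :=
  distributionOfBound (bornKernelFun m z₀) bornKernelFun_add bornKernelFun_smul fun K hK => by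
    obtain ⟨N, C, hC0, hC⟩ := exists_norm_truncatedPairing_le z₀ hK
    refine ⟨N, C, hC0, fun ψ M hψ hM => le_of_tendsto (tendsto_bornKernelFun ψ).norm ?_⟩
    filter_upwards [self_mem_nhdsWithin] with δ hδ using hC ψ ψ.contDiff hψ M hM δ hδ

lemma isBornKernel_bornKernel (m : ℕ) (z₀ : ℂ) : IsBornKernel m z₀ (bornKernel m z₀) :=
  tendsto_bornKernelFun

lemma phase_add_two_pi (φ : ℝ) (z : Fin (m + 1) → ℂ) :
    phase m (φ + 2 * Real.pi) z = phase m φ z := by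
  have h : Complex.exp (Complex.I * ((φ + 2 * Real.pi : ℝ) : ℂ)) = Complex.exp (Complex.I * φ) := by
    push_cast
    rw [mul_comm, add_mul, Complex.exp_add, Complex.exp_two_pi_mul_I, mul_one, mul_comm]
  rw [phase, phase, h]

lemma angularFactor_add_two_pi (i : ℕ) (φ : ℝ) :
    angularFactor i (φ + 2 * Real.pi) = angularFactor i φ := by
  rw [angularFactor, angularFactor]
  congr 1
  rcases neg_one_pow_eq_or ℂ (i + 1) with h | h
  · rw [h]
    push_cast
    rw [one_mul, one_mul, mul_add, Complex.exp_add, mul_comm _ (2 * (Real.pi : ℂ)),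
      Complex.exp_two_pi_mul_I, mul_one]
  · rw [h]
    push_cast
    rw [neg_one_mul, neg_one_mul, neg_add, mul_add, Complex.exp_add, mul_neg _ (2 * (Real.pi : ℂ)),
      mul_comm _ (2 * (Real.pi : ℂ)), Complex.exp_neg (2 * _ * _), Complex.exp_two_pi_mul_I, inv_one,
      mul_one]

/-- Phase and coefficients are 2π-periodic and the integral over φ is translation invariant, so the
claim already holds before the limit. -/
lemma isPeriodic_bornKernel (m : ℕ) (z₀ : ℂ) :
    IsPeriodicDistribution (bornKernel m z₀) (0, 2 * Real.pi, 0) := by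
  intro ψ
  refine tendsto_nhds_unique (isBornKernel_bornKernel m z₀ _)
    ((isBornKernel_bornKernel m z₀ ψ).congr fun δ => ?_)
  rw [truncatedPairing, truncatedPairing, ← integral_add_right_eq_self _ (2 * Real.pi)]
  congr 1
  funext φ
  congr 1
  funext z
  refine Finset.sum_congr rfl fun A _ => ?_
  have h1 : ∀ t, shiftTest (0, 2 * Real.pi, 0) ψ (t, φ, z) = ψ (t, φ + 2 * Real.pi, z) := fun t => by
    change ψ ((t, φ, z) + (0, 2 * Real.pi, 0)) = _
    simp
  simp only [h1, phase_add_two_pi, kernelCoeff, angularFactor_add_two_pi]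

end Kernel

/-! ### Families of functions, and their slices -/

section Slices

variable {D E : Type*} [NormedAddCommGroup D] [NormedSpace ℝ D] [NormedAddCommGroup E]
  [NormedSpace ℝ E] {h : D × E → ℂ}

lemma ContDiff.slice (hh : ContDiff ℝ ∞ h) (η : D) : ContDiff ℝ ∞ fun y => h (η, y) :=
  hh.comp (contDiff_const.prodMk contDiff_id)

lemma tsupport_slice_subset (h : D × E → ℂ) (η : D) :
    tsupport (fun y => h (η, y)) ⊆ {y | (η, y) ∈ tsupport h} :=
  tsupport_comp_subset_preimage h (f := fun y : E => (η, y)) (by fun_prop)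

lemma tsupport_slice_subset_image (h : D × E → ℂ) (η : D) :
    tsupport (fun y => h (η, y)) ⊆ Prod.snd '' tsupport h :=
  fun _ hy => ⟨_, tsupport_slice_subset h η hy, rfl⟩

lemma HasCompactSupport.slice (hc : HasCompactSupport h) (η : D) :
    HasCompactSupport fun y => h (η, y) :=
  (hc.isCompact.image continuous_snd).of_isClosed_subset (isClosed_tsupport _)
    (tsupport_slice_subset_image h η)

lemma fderiv_slice (hh : ContDiff ℝ ∞ h) (η : D) (y a : E) :
    fderiv ℝ (fun y => h (η, y)) y a = fderiv ℝ h (η, y) (0, a) := by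
  have h1 : HasFDerivAt h (fderiv ℝ h (η, y)) (η, y) :=
    (hh.differentiable (by simp) _).hasFDerivAt
  have h2 : HasFDerivAt (fun y : E => (η, y)) ((0 : E →L[ℝ] D).prod (ContinuousLinearMap.id ℝ E)) y :=
    (hasFDerivAt_const η y).prodMk (hasFDerivAt_id y)
  exact congrArg (fun L : E →L[ℝ] ℂ => L a) (h1.comp y h2).fderiv |>.trans (by simp)

lemma norm_iteratedFDeriv_slice_le (hh : ContDiff ℝ ∞ h) (η : D) (i : ℕ) (y : E) :
    ‖iteratedFDeriv ℝ i (fun y => h (η, y)) y‖ ≤ ‖iteratedFDeriv ℝ i h (η, y)‖ := by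
  have h1 : (fun y => h (η, y)) = (fun q => h (q + (η, 0))) ∘ ContinuousLinearMap.inr ℝ D E := by
    funext y
    simp
  have h2 : ContDiff ℝ ∞ fun q : D × E => h (q + (η, 0)) :=
    hh.comp (contDiff_id.add contDiff_const)
  rw [h1, (ContinuousLinearMap.inr ℝ D E).iteratedFDeriv_comp_right h2 y (mod_cast le_top),
    iteratedFDeriv_comp_add_right]
  refine (ContinuousMultilinearMap.norm_compContinuousLinearMap_le _ _).trans ?_
  have h3 : (ContinuousLinearMap.inr ℝ D E) y + (η, 0) = (η, y) := by simp
  rw [h3]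
  refine mul_le_of_le_one_right (norm_nonneg _) (Finset.prod_le_one (fun _ _ => norm_nonneg _)
    fun _ _ => ContinuousLinearMap.opNorm_le_bound _ zero_le_one fun v => ?_)
  simp [Prod.norm_def]

lemma norm_iteratedFDeriv_eq_zero {f : E → ℂ} {x : E} (hx : x ∉ tsupport f) (i : ℕ) :
    ‖iteratedFDeriv ℝ i f x‖ = 0 :=
  norm_eq_zero.2 (image_eq_zero_of_notMem_tsupport fun h =>
    hx (tsupport_iteratedFDeriv_subset (𝕜 := ℝ) i h))

/-- Off the support of `f` the quotient is locally zero, whatever the denominator does there. -/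
lemma contDiff_div_of_ne_zero {F : Type*} [NormedAddCommGroup F] [NormedSpace ℝ F] {f d : F → ℂ}
    (hf : ContDiff ℝ ∞ f) (hd : ContDiff ℝ ∞ d) (h0 : ∀ x ∈ tsupport f, d x ≠ 0) :
    ContDiff ℝ ∞ fun x => f x / d x := by
  simp only [div_eq_mul_inv]
  refine contDiff_iff_contDiffAt.2 fun x => ?_
  by_cases hx : x ∈ tsupport f
  · exact hf.contDiffAt.mul (hd.contDiffAt.inv (h0 x hx))
  · refine contDiffAt_const (c := (0 : ℂ)) |>.congr_of_eventuallyEq ?_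
    filter_upwards [(isClosed_tsupport f).isOpen_compl.mem_nhds hx] with y hy
    rw [image_eq_zero_of_notMem_tsupport hy, zero_mul]

lemma tsupport_div_subset {F : Type*} [TopologicalSpace F] (f d : F → ℂ) :
    tsupport (fun x => f x / d x) ⊆ tsupport f := by
  simp only [div_eq_mul_inv]
  exact tsupport_mul_subset_left

lemma iteratedDeriv_cexp_real (c : ℂ) (n : ℕ) :
    iteratedDeriv n (fun x : ℝ => Complex.exp (c * x)) = fun x : ℝ => c ^ n * Complex.exp (c * x) := by
  induction n with
  | zero => simp
  | succ n ih =>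
    rw [iteratedDeriv_succ, ih]
    funext x
    have h1 : HasDerivAt (fun x : ℝ => c * (x : ℂ)) c x := by
      simpa using (Complex.ofRealCLM.hasDerivAt (x := x)).const_mul c
    have h2 := (h1.cexp.const_mul (c ^ n)).deriv
    rw [h2]
    ring

end Slices

/-! ### Oscillatory integrals with singular weights -/

section Oscillatory

variable {m : ℕ} {z₀ : ℂ} {r δ s : ℝ}

/-- Pairs of a covector and a point. -/
abbrev PhaseSpace (m : ℕ) : Type := (KernelSpace m →L[ℝ] ℝ) × LinkSpace m

/-- The value of the covector at a point of the graph. -/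
def graphPhase (z₀ : ℂ) (q : PhaseSpace m) : ℝ := q.1 (graphPoint z₀ q.2)

lemma contDiff_graphPhase : ContDiff ℝ ∞ (graphPhase (m := m) z₀) :=
  contDiff_fst.clm_apply (contDiff_graphPoint.comp contDiff_snd)

/-- The derivative of `graphPhase` in the direction `a`. -/
def graphSlope (z₀ : ℂ) (a : LinkSpace m) (q : PhaseSpace m) : ℝ :=
  q.1 (fderiv ℝ (graphPoint z₀) q.2 a)

lemma contDiff_graphSlope (a : LinkSpace m) : ContDiff ℝ ∞ (graphSlope z₀ a) :=
  contDiff_fst.clm_apply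
    (((contDiff_graphPoint.fderiv_right (by simp)).comp contDiff_snd).clm_apply contDiff_const)

/-- The oscillating factor. -/
def graphWave (z₀ : ℂ) (s : ℝ) (q : PhaseSpace m) : ℂ :=
  Complex.exp (-Complex.I * s * (graphPhase z₀ q : ℝ))

lemma contDiff_graphWave (s : ℝ) : ContDiff ℝ ∞ (graphWave (m := m) z₀ s) :=
  (contDiff_const.mul (Complex.ofRealCLM.contDiff.comp contDiff_graphPhase)).cexp

lemma norm_neg_I_mul_pow (hs : 0 ≤ s) (i : ℕ) : ‖(-Complex.I * s) ^ i‖ = s ^ i := by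
  rw [norm_pow, norm_mul, norm_neg, Complex.norm_I, one_mul, Complex.norm_real,
    Real.norm_of_nonneg hs]

lemma norm_iteratedFDeriv_cexp_le (hs : 1 ≤ s) {i n : ℕ} (hi : i ≤ n) (x : ℝ) :
    ‖iteratedFDeriv ℝ i (fun x : ℝ => Complex.exp (-Complex.I * s * x)) x‖ ≤ s ^ n := by
  rw [norm_iteratedFDeriv_eq_norm_iteratedDeriv, iteratedDeriv_cexp_real, norm_mul,
    norm_neg_I_mul_pow (zero_le_one.trans hs)]
  have h : -Complex.I * s * x = ((-(s * x) : ℝ) : ℂ) * Complex.I := by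
    push_cast
    ring
  rw [h, Complex.norm_exp_ofReal_mul_I, mul_one]
  exact pow_le_pow_right₀ hs hi

/-- A polynomial bound for oscillatory integrals, uniform in the truncation. -/
lemma exists_norm_oscillatory_le_pow (z₀ : ℂ) (A : Finset (Fin m)) {h : PhaseSpace m → ℂ}
    (hh : ContDiff ℝ ∞ h) (hc : HasCompactSupport h) :
    ∃ C : ℝ, 0 ≤ C ∧ ∀ δ, 0 < δ → ∀ s, 1 ≤ s → ∀ η,
      ‖∫ y, weight A ∅ δ y * (h (η, y) * graphWave z₀ s (η, y))‖ ≤ C * s ^ A.card := by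
  obtain ⟨C, hC0, hC⟩ :=
    exists_norm_integral_weight_le A (hc.isCompact.image (continuous_snd (X := _ →L[ℝ] ℝ)))
  obtain ⟨D, hD0, hD⟩ := exists_norm_iteratedFDeriv_mul_comp_le
    (contDiff_graphPhase (m := m) (z₀ := z₀)) hh hc.isCompact A.card
  refine ⟨C * D, mul_nonneg hC0 hD0, fun δ hδ s hs η => ?_⟩
  have hs0 : 0 ≤ s := zero_le_one.trans hs
  have hho : ContDiff ℝ ∞ fun q => h q * graphWave z₀ s q := hh.mul (contDiff_graphWave s)
  have hsub : tsupport (fun q => h q * graphWave z₀ s q) ⊆ tsupport h := tsupport_mul_subset_left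
  rw [mul_assoc]
  refine hC (fun y => h (η, y) * graphWave z₀ s (η, y)) (hho.slice η) ?_ _ (fun i hi y => ?_) δ hδ
  · exact (tsupport_slice_subset_image _ η).trans (Set.image_mono hsub)
  · refine (norm_iteratedFDeriv_slice_le hho η i y).trans ?_
    by_cases hy : (η, y) ∈ tsupport h
    · exact hD _ (contDiff_const.mul Complex.ofRealCLM.contDiff).cexp _
        (fun j hj x => norm_iteratedFDeriv_cexp_le hs hj x) i hi _ hy
    · rw [norm_iteratedFDeriv_eq_zero (fun h' => hy (hsub h')) i]
      positivity

/-! ### Regular and singular factors; repeated integration by parts. -/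

/-- The inverse of the factors of the weight at the links outside `J`. -/
def linkPoly (A J : Finset (Fin m)) (y : LinkSpace m) : ℂ :=
  y.2 0 * ∏ i ∈ Jᶜ, linkConj i (y.2 i.succ) ^ (if i ∈ A then 2 else 1)

lemma contDiff_linkPoly (A J : Finset (Fin m)) : ContDiff ℝ ∞ (linkPoly A J) := by
  have h : ∀ i : Fin (m + 1), ContDiff ℝ ∞ fun y : LinkSpace m => y.2 i := fun i =>
    (contDiff_apply ℝ ℂ i).comp contDiff_snd
  exact (h 0).mul (contDiff_prod fun i _ => ((linkConj i).contDiff.comp (h i.succ)).pow _)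

lemma linkConj_ne_zero {w : ℂ} (i : Fin m) (hw : w ≠ 0) : linkConj i w ≠ 0 := by
  rwa [← norm_ne_zero_iff, norm_linkConj, norm_ne_zero_iff]

lemma linkPoly_ne_zero {A J : Finset (Fin m)} {y : LinkSpace m} (h0 : y.2 0 ≠ 0)
    (h : ∀ i ∉ J, y.2 i.succ ≠ 0) : linkPoly A J y ≠ 0 :=
  mul_ne_zero h0 (Finset.prod_ne_zero_iff.2 fun i hi =>
    pow_ne_zero _ (linkConj_ne_zero i (h i (Finset.mem_compl.1 hi))))

/-- The factors of the weight at the links in `J`. -/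
def partialWeight (A J : Finset (Fin m)) (δ : ℝ) (y : LinkSpace m) : ℂ :=
  ∏ i ∈ J, linkWeight A ∅ δ i (y.2 i.succ)

/-- Where the links outside `J` exceed δ their truncations are inactive, so multiplication by the
polynomial cancels exactly these factors and leaves the singular ones. -/
lemma weight_mul_linkPoly (A : Finset (Fin m)) {J : Finset (Fin m)} {y : LinkSpace m}
    (hδ : 0 < δ) (h0 : y.2 0 ≠ 0) (h : ∀ i ∉ J, δ < ‖y.2 i.succ‖) :
    weight A ∅ δ y * linkPoly A J y = partialWeight A J δ y := by
  have h1 : ∏ i ∈ Jᶜ, linkWeight A ∅ δ i (y.2 i.succ) =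
      (∏ i ∈ Jᶜ, linkConj i (y.2 i.succ) ^ (if i ∈ A then 2 else 1))⁻¹ := by
    rw [← Finset.prod_inv_distrib]
    refine Finset.prod_congr rfl fun i hi => ?_
    have hi' : y.2 i.succ ∈ {w : ℂ | δ < ‖w‖} := h i (Finset.mem_compl.1 hi)
    rw [linkWeight, Set.indicator_of_mem hi', Set.indicator_of_mem hi']
    split_ifs <;> simp_all
  have h2 : ∏ i ∈ Jᶜ, linkConj i (y.2 i.succ) ^ (if i ∈ A then 2 else 1) ≠ 0 :=
    Finset.prod_ne_zero_iff.2 fun i hi => pow_ne_zero _ (linkConj_ne_zero i (norm_pos_iff.1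
      (hδ.trans (h i (Finset.mem_compl.1 hi)))))
  rw [weight, linkPoly, partialWeight, ← Finset.prod_compl_mul_prod J, h1]
  field_simp

lemma locallyIntegrable_partialWeight (A J : Finset (Fin m)) (hδ : 0 < δ) :
    LocallyIntegrable (partialWeight A J δ) volume := by
  refine (locallyIntegrable_const ((δ⁻¹ + δ⁻¹ ^ 2) ^ J.card)).mono ?_
    (Eventually.of_forall fun y => ?_)
  · exact (Finset.measurable_fun_prod _ fun i _ =>
      (measurable_linkWeight A ∅ hδ i).comp (by fun_prop)).aestronglyMeasurable
  · rw [partialWeight, norm_prod, Real.norm_of_nonneg (by positivity)]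
    refine (Finset.prod_le_prod (fun _ _ => norm_nonneg _) fun i _ =>
      norm_linkWeight_le A ∅ hδ i _).trans_eq ?_
    simp

/-- The families on which integration by parts in the direction `a` is possible. -/
structure IsAdmissible (z₀ : ℂ) (J : Finset (Fin m)) (a : LinkSpace m) (r : ℝ)
    (h : PhaseSpace m → ℂ) : Prop where
  contDiff : ContDiff ℝ ∞ h
  hasCompactSupport : HasCompactSupport h
  slope : ∀ q ∈ tsupport h, graphSlope z₀ a q ≠ 0
  base : ∀ q ∈ tsupport h, q.2.2 0 ≠ 0
  link : ∀ q ∈ tsupport h, ∀ i ∉ J, r ≤ ‖q.2.2 i.succ‖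

variable {A J : Finset (Fin m)} {a : LinkSpace m} {h : PhaseSpace m → ℂ}

/-- The quotient of the family by the slope and by the regular factors of the weight. -/
def reducedFamily (z₀ : ℂ) (A J : Finset (Fin m)) (a : LinkSpace m) (h : PhaseSpace m → ℂ)
    (q : PhaseSpace m) : ℂ := h q / (graphSlope z₀ a q * linkPoly A J q.2)

/-- The effect on the family of one integration by parts. -/
def partsFamily (z₀ : ℂ) (A J : Finset (Fin m)) (a : LinkSpace m) (h : PhaseSpace m → ℂ)
    (q : PhaseSpace m) : ℂ :=
  linkPoly A J q.2 * fderiv ℝ (reducedFamily z₀ A J a h) q (0, a)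

namespace IsAdmissible

lemma linkPoly_ne_zero (hr : 0 < r) (hh : IsAdmissible z₀ J a r h) (A : Finset (Fin m))
    {q : PhaseSpace m} (hq : q ∈ tsupport h) : linkPoly A J q.2 ≠ 0 :=
  _root_.linkPoly_ne_zero (hh.base q hq) fun i hi =>
    norm_pos_iff.1 (hr.trans_le (hh.link q hq i hi))

lemma contDiff_reducedFamily (hr : 0 < r) (hh : IsAdmissible z₀ J a r h) (A : Finset (Fin m)) :
    ContDiff ℝ ∞ (reducedFamily z₀ A J a h) :=
  contDiff_div_of_ne_zero hh.contDiff
    ((Complex.ofRealCLM.contDiff.comp (contDiff_graphSlope a)).mul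
      ((contDiff_linkPoly A J).comp contDiff_snd))
    fun q hq => mul_ne_zero (Complex.ofReal_ne_zero.2 (hh.slope q hq))
      (hh.linkPoly_ne_zero hr A hq)

lemma tsupport_fderiv_subset : tsupport (fun q => fderiv ℝ (reducedFamily z₀ A J a h) q (0, a)) ⊆
    tsupport h := (tsupport_dirDeriv_subset _ _).trans (tsupport_div_subset _ _)

lemma tsupport_partsFamily_subset : tsupport (partsFamily z₀ A J a h) ⊆ tsupport h :=
  (tsupport_mul_subset_right (f := fun q : PhaseSpace m => linkPoly A J q.2)).trans
    tsupport_fderiv_subset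

lemma parts (hr : 0 < r) (hh : IsAdmissible z₀ J a r h) (A : Finset (Fin m)) :
    IsAdmissible z₀ J a r (partsFamily z₀ A J a h) where
  contDiff := ((contDiff_linkPoly A J).comp contDiff_snd).mul
    ((hh.contDiff_reducedFamily hr A).dirDeriv _)
  hasCompactSupport := hh.hasCompactSupport.of_isClosed_subset (isClosed_tsupport _)
    tsupport_partsFamily_subset
  slope q hq := hh.slope q (tsupport_partsFamily_subset hq)
  base q hq := hh.base q (tsupport_partsFamily_subset hq)
  link q hq := hh.link q (tsupport_partsFamily_subset hq)

/-- One integration by parts. -/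
lemma integral_eq (hr : 0 < r) (hh : IsAdmissible z₀ J a r h) (A : Finset (Fin m))
    (ha : ∀ i ∈ J, a.2 i.succ = 0) (hδ : 0 < δ) (hδr : δ < r) (s : ℝ)
    (η : KernelSpace m →L[ℝ] ℝ) :
    Complex.I * s * ∫ y, weight A ∅ δ y * (h (η, y) * graphWave z₀ s (η, y)) =
      ∫ y, weight A ∅ δ y * (partsFamily z₀ A J a h (η, y) * graphWave z₀ s (η, y)) := by
  -- The division by the slope is chosen so that the derivative falling on the oscillating factor
  -- reproduces -is times the original integrand; the division by the regular factors leaves a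
  -- weight that is invariant along `a`.
  set k := reducedFamily z₀ A J a h with hk
  have hkd : ContDiff ℝ ∞ k := hh.contDiff_reducedFamily hr A
  have hkc : HasCompactSupport k := hh.hasCompactSupport.of_isClosed_subset (isClosed_tsupport _)
    (tsupport_div_subset _ _)
  have hqd : ContDiff ℝ ∞ fun q => k q * graphWave z₀ s q := hkd.mul (contDiff_graphWave s)
  have hqc : HasCompactSupport fun q => k q * graphWave z₀ s q := hkc.mul_right
  set g : LinkSpace m → ℂ := fun y => k (η, y) * graphWave z₀ s (η, y) with hg
  have hgd : ContDiff ℝ ∞ g := hqd.slice η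
  have hgc : HasCompactSupport g := hqc.slice η
  obtain ⟨Cg, hCg⟩ := hgd.lipschitzWith_of_hasCompactSupport hgc (by simp)
  have hinv : ∀ y (t : ℝ), partialWeight A J δ (y + t • a) = partialWeight A J δ y := fun y t => by
    refine Finset.prod_congr rfl fun i hi => ?_
    simp [ha i hi]
  have hzero := integral_invariant_mul_lineDeriv_eq_zero (μ := (volume : Measure (LinkSpace m)))
    (locallyIntegrable_partialWeight A J hδ) hinv hgc hgd.continuous
    (C := Cg * ‖a‖) (fun y t => hCg.norm_sub_line_le y a t) (h' := fun y => fderiv ℝ g y a)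
    (Eventually.of_forall fun y => ((hgd.differentiable (by simp)) y).hasFDerivAt.hasLineDerivAt a)
  have hder : ∀ y, fderiv ℝ g y a = fderiv ℝ k (η, y) (0, a) * graphWave z₀ s (η, y) -
      Complex.I * s * (graphSlope z₀ a (η, y) * (k (η, y) * graphWave z₀ s (η, y))) := fun y => by
    have h1 : HasFDerivAt (fun y => k (η, y)) (fderiv ℝ (fun y => k (η, y)) y) y :=
      ((hkd.slice η).differentiable (by simp) y).hasFDerivAt
    have h2 : HasFDerivAt (fun y => graphPhase z₀ (η, y))
        (η.comp (fderiv ℝ (graphPoint z₀) y)) y :=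
      η.hasFDerivAt.comp y ((contDiff_graphPoint.differentiable (by simp)) y).hasFDerivAt
    have h3 : HasFDerivAt (fun y => graphWave z₀ s (η, y)) _ y :=
      ((Complex.ofRealCLM.hasFDerivAt.comp y h2).const_mul (-Complex.I * s)).cexp
    have h4 := (h1.mul h3).fderiv
    have h5 := congrArg (fun L : LinkSpace m →L[ℝ] ℂ => L a) h4
    refine h5.trans ?_
    simp only [add_apply, smul_apply, ContinuousLinearMap.comp_apply, smul_eq_mul,
      Complex.ofRealCLM_apply, Function.comp, fderiv_slice hkd]
    simp only [graphWave, graphSlope]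
    ring
  have hpt : ∀ y, partialWeight A J δ y * fderiv ℝ g y a =
      weight A ∅ δ y * (partsFamily z₀ A J a h (η, y) * graphWave z₀ s (η, y)) -
        Complex.I * s * (weight A ∅ δ y * (h (η, y) * graphWave z₀ s (η, y))) := fun y => by
    rw [hder y]
    by_cases hy : (η, y) ∈ tsupport h
    · rw [← weight_mul_linkPoly A hδ (hh.base _ hy)
        fun i hi => hδr.trans_le (hh.link _ hy i hi)]
      have h1 : graphSlope z₀ a (η, y) * linkPoly A J y * k (η, y) = h (η, y) :=
        mul_div_cancel₀ _ (mul_ne_zero (Complex.ofReal_ne_zero.2 (hh.slope _ hy))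
          (hh.linkPoly_ne_zero hr A hy))
      rw [← h1, partsFamily]
      ring
    · have h1 : k (η, y) = 0 := by
        rw [hk, reducedFamily, image_eq_zero_of_notMem_tsupport hy, zero_div]
      have h2 : fderiv ℝ k (η, y) (0, a) = 0 :=
        image_eq_zero_of_notMem_tsupport (f := fun q => fderiv ℝ k q (0, a))
          fun h' => hy (tsupport_fderiv_subset h')
      rw [partsFamily, ← hk, h2, h1, image_eq_zero_of_notMem_tsupport hy]
      simp
  have hint : ∀ f : PhaseSpace m → ℂ, ContDiff ℝ ∞ f → HasCompactSupport f →
      Integrable fun y => weight A ∅ δ y * (f (η, y) * graphWave z₀ s (η, y)) := fun f hf hfc =>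
    integrable_weight_mul A ∅ hδ (g := fun y => f (η, y) * graphWave z₀ s (η, y))
      ((hf.mul (contDiff_graphWave s)).slice η).continuous
      (HasCompactSupport.slice (h := fun q => f q * graphWave z₀ s q) hfc.mul_right η)
  have hp := hh.parts hr A
  rw [integral_congr_ae (Eventually.of_forall hpt), integral_sub
    (hint _ hp.contDiff hp.hasCompactSupport)
    ((hint _ hh.contDiff hh.hasCompactSupport).const_mul _), integral_const_mul, sub_eq_zero] at hzero
  exact hzero.symm

/-- Rapid decay of oscillatory integrals, uniformly in the truncation. -/
lemma exists_norm_oscillatory_le (hr : 0 < r) (hh : IsAdmissible z₀ J a r h) (A : Finset (Fin m))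
    (ha : ∀ i ∈ J, a.2 i.succ = 0) (N : ℕ) :
    ∃ C : ℝ, 0 ≤ C ∧ ∀ δ, 0 < δ → δ < r → ∀ s, 1 ≤ s → ∀ η,
      ‖∫ y, weight A ∅ δ y * (h (η, y) * graphWave z₀ s (η, y))‖ ≤ C * s⁻¹ ^ N := by
  have key : ∀ n, ∀ h, IsAdmissible z₀ J a r h → ∃ h', IsAdmissible z₀ J a r h' ∧
      ∀ δ, 0 < δ → δ < r → ∀ s : ℝ, 1 ≤ s → ∀ η,
      ‖∫ y, weight A ∅ δ y * (h (η, y) * graphWave z₀ s (η, y))‖ =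
        s⁻¹ ^ n * ‖∫ y, weight A ∅ δ y * (h' (η, y) * graphWave z₀ s (η, y))‖ := by
    intro n
    induction n with
    | zero => exact fun h hh => ⟨h, hh, fun _ _ _ _ _ _ => by simp⟩
    | succ n ih =>
      intro h hh
      obtain ⟨h', h1, h2⟩ := ih _ (hh.parts hr A)
      refine ⟨h', h1, fun δ hδ hδr s hs η => ?_⟩
      have hs0 : 0 < s := zero_lt_one.trans_le hs
      have h3 := congrArg norm (hh.integral_eq hr A ha hδ hδr s η)
      rw [norm_mul, norm_mul, Complex.norm_I, one_mul, Complex.norm_real,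
        Real.norm_of_nonneg hs0.le, h2 δ hδ hδr s hs η] at h3
      rw [pow_succ', mul_assoc, ← h3, inv_mul_cancel_left₀ hs0.ne']
  -- The uniform bound loses s^|A|, so |A| additional integrations by parts are made.
  obtain ⟨h', h1, h2⟩ := key (N + A.card) h hh
  obtain ⟨C, hC0, hC⟩ := exists_norm_oscillatory_le_pow z₀ A h1.contDiff h1.hasCompactSupport
  refine ⟨C, hC0, fun δ hδ hδr s hs η => ?_⟩
  have hs0 : 0 < s := zero_lt_one.trans_le hs
  rw [h2 δ hδ hδr s hs η]
  refine (mul_le_mul_of_nonneg_left (hC δ hδ s hs η) (by positivity)).trans_eq ?_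
  rw [pow_add, mul_comm, mul_assoc, mul_comm (s⁻¹ ^ N), ← mul_assoc (s ^ A.card), ← mul_pow,
    mul_inv_cancel₀ hs0.ne', one_pow, one_mul]

end IsAdmissible

end Oscillatory

/-! ### The wave front set of the kernel -/

section WaveFrontSet

variable {m : ℕ} {z₀ : ℂ}

/-- Leibniz' rule in t. Every derivative on the exponential gives a factor -iξ(1, 0), which is of
order s for ξ = s • η. -/
lemma iterDirDeriv_modulate {F : Type*} [NormedAddCommGroup F] [NormedSpace ℝ F]
    (χ : 𝓓((⊤ : Opens (ℝ × F)), ℂ)) (ξ : ℝ × F →L[ℝ] ℝ) (p : ℕ) (x : ℝ × F) :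
    iterDirDeriv (1, 0) p (modulate χ ξ) x = ∑ l ∈ Finset.range (p + 1),
      (p.choose l * (-Complex.I * (ξ (1, 0) : ℝ)) ^ l * iterDirDeriv (1, 0) (p - l) χ x) *
        Complex.exp (-Complex.I * (ξ x : ℝ)) := by
  obtain ⟨t, y⟩ := x
  have hχ : ContDiff ℝ ∞ fun t => χ (t, y) := contDiff_slice χ.contDiff y
  have hξ : ∀ t, ξ (t, y) = t * ξ (1, 0) + ξ (0, y) := fun t => by
    have : ((t, y) : ℝ × F) = t • (1, 0) + (0, y) := by simp
    rw [this, map_add, map_smul, smul_eq_mul]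
  have h1 : (fun t => modulate χ ξ (t, y)) = fun t : ℝ =>
      Complex.exp (-Complex.I * (ξ (1, 0) : ℝ) * t) *
        (Complex.exp (-Complex.I * (ξ (0, y) : ℝ)) * χ (t, y)) := by
    funext t
    change χ (t, y) * Complex.exp (-Complex.I * (ξ (t, y) : ℝ)) = _
    rw [hξ t, ← mul_assoc, ← Complex.exp_add, mul_comm]
    congr 2
    push_cast
    ring
  have hexp : ContDiff ℝ ∞ fun t : ℝ => Complex.exp (-Complex.I * (ξ (1, 0) : ℝ) * t) :=
    (contDiff_const.mul Complex.ofRealCLM.contDiff).cexp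
  have hn : ∀ n : ℕ, (n : WithTop ℕ∞) ≤ ∞ := fun n => mod_cast le_top
  rw [← iteratedDeriv_eq_iterDirDeriv (modulate χ ξ).contDiff, h1,
    iteratedDeriv_fun_mul (hexp.of_le (hn p)).contDiffAt
      ((contDiff_const.mul hχ).of_le (hn p)).contDiffAt]
  refine Finset.sum_congr rfl fun l _ => ?_
  rw [iteratedDeriv_cexp_real, iteratedDeriv_const_mul_field,
    iteratedDeriv_eq_iterDirDeriv χ.contDiff, hξ t]
  have : -Complex.I * ((t * ξ (1, 0) + ξ (0, y) : ℝ) : ℂ) =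
      -Complex.I * (ξ (1, 0) : ℝ) * t + -Complex.I * (ξ (0, y) : ℝ) := by
    push_cast
    ring
  rw [this, Complex.exp_add]
  ring

/-- The coefficient of the `l`-th power of the frequency in the amplitudes of modulations. -/
def modulationFamily (z₀ : ℂ) (A : Finset (Fin m)) (l : ℕ) (χ : KernelSpace m → ℂ)
    (b : (KernelSpace m →L[ℝ] ℝ) → ℝ) (q : PhaseSpace m) : ℂ :=
  b q.1 * (((m + 1 - A.card).choose l * (-Complex.I * (q.1 (1, 0) : ℝ)) ^ l *
    angularCoeff A q.2.1) * iterDirDeriv (1, 0) (m + 1 - A.card - l) χ (graphPoint z₀ q.2))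

lemma contDiff_modulationFamily (A : Finset (Fin m)) (l : ℕ) {χ : KernelSpace m → ℂ}
    (hχ : ContDiff ℝ ∞ χ) {b : (KernelSpace m →L[ℝ] ℝ) → ℝ} (hb : ContDiff ℝ ∞ b) :
    ContDiff ℝ ∞ (modulationFamily z₀ A l χ b) := by
  refine (Complex.ofRealCLM.contDiff.comp (hb.comp contDiff_fst)).mul
    ((ContDiff.mul ?_ ?_).mul ?_)
  · exact contDiff_const.mul ((contDiff_const.mul
      (Complex.ofRealCLM.contDiff.comp (contDiff_fst.clm_apply contDiff_const))).pow l)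
  · exact (contDiff_angularCoeff A).comp (contDiff_fst.comp contDiff_snd)
  · exact (contDiff_iterDirDeriv hχ _ _).comp (contDiff_graphPoint.comp contDiff_snd)

lemma tsupport_modulationFamily_subset (A : Finset (Fin m)) (l : ℕ) (χ : KernelSpace m → ℂ)
    (b : (KernelSpace m →L[ℝ] ℝ) → ℝ) :
    tsupport (modulationFamily z₀ A l χ b) ⊆ tsupport b ×ˢ (graphPoint z₀ ⁻¹' tsupport χ) := by
  refine closure_minimal (fun q hq => ⟨subset_tsupport _ fun h => hq ?_,
    tsupport_iterDirDeriv_subset χ (1, 0) (m + 1 - A.card - l) (subset_tsupport _ fun h => hq ?_)⟩)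
    ((isClosed_tsupport b).prod ((isClosed_tsupport χ).preimage contDiff_graphPoint.continuous))
  · rw [modulationFamily, h, Complex.ofReal_zero, zero_mul]
  · rw [modulationFamily, h, mul_zero, mul_zero]

/-- Separates the powers of s from families independent of s, so that decay of oscillatory integrals
applies to each. The cut-off `b` makes these compactly supported in the covector as well, hence the
estimates uniform in η. -/
lemma amplitude_modulate (A : Finset (Fin m)) (χ : 𝓓((⊤ : Opens (KernelSpace m)), ℂ))
    (b : (KernelSpace m →L[ℝ] ℝ) → ℝ) (η : KernelSpace m →L[ℝ] ℝ) (s : ℝ) (y : LinkSpace m) :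
    b η * amplitude z₀ A (modulate χ (s • η)) y = ∑ l ∈ Finset.range (m + 1 - A.card + 1),
      (s : ℂ) ^ l * (modulationFamily z₀ A l χ b (η, y) * graphWave z₀ s (η, y)) := by
  rw [amplitude, iterDirDeriv_modulate, Finset.mul_sum, Finset.mul_sum]
  refine Finset.sum_congr rfl fun l _ => ?_
  simp only [modulationFamily, graphWave, graphPhase, smul_apply, smul_eq_mul, Complex.ofReal_mul]
  have e1 : -Complex.I * ((s : ℂ) * (η (1, 0) : ℝ)) = s * (-Complex.I * (η (1, 0) : ℝ)) := by ring
  have e2 : -Complex.I * ((s : ℂ) * (η (graphPoint z₀ y) : ℝ)) =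
      -Complex.I * s * (η (graphPoint z₀ y) : ℝ) := by ring
  rw [e1, e2, mul_pow (s : ℂ)]
  ring

variable {J : Finset (Fin m)} {a : LinkSpace m} {r : ℝ}

/-- Rapid decay of the pairings with modulated cut-off functions. -/
lemma exists_norm_bornKernel_modulate_le (hr : 0 < r) (ha : ∀ i ∈ J, a.2 i.succ = 0)
    (χ : 𝓓((⊤ : Opens (KernelSpace m)), ℂ)) {b : (KernelSpace m →L[ℝ] ℝ) → ℝ}
    (hb : ContDiff ℝ ∞ b) (hbc : HasCompactSupport b)
    (h : ∀ q ∈ tsupport b ×ˢ (graphPoint z₀ ⁻¹' tsupport χ), graphSlope z₀ a q ≠ 0 ∧ q.2.2 0 ≠ 0 ∧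
      ∀ i ∉ J, r ≤ ‖q.2.2 i.succ‖) (N : ℕ) :
    ∃ C : ℝ, ∀ η, ∀ s : ℝ, 1 ≤ s → ‖b η * bornKernel m z₀ (modulate χ (s • η))‖ ≤ C * s⁻¹ ^ N := by
  have hadm : ∀ A l, IsAdmissible z₀ J a r (modulationFamily z₀ A l χ b) := fun A l => by
    have hsub := tsupport_modulationFamily_subset (z₀ := z₀) A l χ b
    exact
      { contDiff := contDiff_modulationFamily A l χ.contDiff hb
        hasCompactSupport := (hbc.isCompact.prod
          (isCompact_preimage_graphPoint χ.hasCompactSupport.isCompact)).of_isClosed_subset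
            (isClosed_tsupport _) hsub
        slope := fun q hq => (h q (hsub hq)).1
        base := fun q hq => (h q (hsub hq)).2.1
        link := fun q hq => (h q (hsub hq)).2.2 }
  -- The extra m + 1 powers of decay compensate the factors s^l with l ≤ m + 1.
  choose C hC0 hC using fun A l => (hadm A l).exists_norm_oscillatory_le hr A ha (N + (m + 1))
  refine ⟨linkJacobian m * ∑ A, ∑ l ∈ Finset.range (m + 1 - A.card + 1), C A l, fun η s hs => ?_⟩
  have hs0 : 0 < s := zero_lt_one.trans_le hs
  refine le_of_tendsto ((isBornKernel_bornKernel m z₀ (modulate χ (s • η))).const_mul (b η : ℂ)).norm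
    ?_
  have hev : ∀ᶠ δ : ℝ in 𝓝[>] 0, δ < r := (eventually_lt_nhds hr).filter_mono nhdsWithin_le_nhds
  filter_upwards [self_mem_nhdsWithin, hev] with δ hδ hδr
  have hδ : 0 < δ := hδ
  have hint : ∀ A l, Integrable fun y => weight A ∅ δ y *
      (modulationFamily z₀ A l χ b (η, y) * graphWave z₀ s (η, y)) := fun A l =>
    integrable_weight_mul A ∅ hδ
      (g := fun y => modulationFamily z₀ A l χ b (η, y) * graphWave z₀ s (η, y))
      (((hadm A l).contDiff.mul (contDiff_graphWave s)).slice η).continuous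
      (HasCompactSupport.slice (h := fun q => modulationFamily z₀ A l χ b q * graphWave z₀ s q)
        (hadm A l).hasCompactSupport.mul_right η)
  have hA : ∀ A : Finset (Fin m), ‖b η * ∫ y, weight A ∅ δ y *
      amplitude z₀ A (modulate χ (s • η)) y‖ ≤
      (∑ l ∈ Finset.range (m + 1 - A.card + 1), C A l) * s⁻¹ ^ N := fun A => by
    have e : (fun y => (b η : ℂ) * (weight A ∅ δ y * amplitude z₀ A (modulate χ (s • η)) y)) =
        fun y => ∑ l ∈ Finset.range (m + 1 - A.card + 1), (s : ℂ) ^ l * (weight A ∅ δ y *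
          (modulationFamily z₀ A l χ b (η, y) * graphWave z₀ s (η, y))) := by
      funext y
      rw [mul_left_comm, amplitude_modulate, Finset.mul_sum]
      exact Finset.sum_congr rfl fun l _ => mul_left_comm _ _ _
    rw [← integral_const_mul, e, integral_finsetSum _ fun l _ => (hint A l).const_mul _,
      Finset.sum_mul]
    refine (norm_sum_le _ _).trans (Finset.sum_le_sum fun l hl => ?_)
    have hl' : l ≤ m + 1 := (Finset.mem_range_succ_iff.1 hl).trans (Nat.sub_le _ _)
    rw [integral_const_mul, norm_mul, norm_pow, Complex.norm_real, Real.norm_of_nonneg hs0.le]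
    calc s ^ l * _ ≤ s ^ (m + 1) * (C A l * s⁻¹ ^ (N + (m + 1))) :=
          mul_le_mul (pow_le_pow_right₀ hs hl') (hC A l δ hδ hδr s hs η) (norm_nonneg _)
            (by positivity)
      _ = C A l * s⁻¹ ^ N := by
          rw [pow_add s⁻¹, mul_left_comm, mul_left_comm (s ^ (m + 1)), ← mul_pow,
            mul_inv_cancel₀ hs0.ne', one_pow, mul_one]
  rw [truncatedPairing_eq (modulate χ (s • η)).contDiff (modulate χ (s • η)).hasCompactSupport hδ,
    mul_left_comm, norm_mul, Complex.norm_real, Real.norm_of_nonneg linkJacobian_nonneg,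
    Finset.mul_sum, mul_assoc, Finset.sum_mul]
  exact mul_le_mul_of_nonneg_left ((norm_sum_le _ _).trans (Finset.sum_le_sum fun A _ => hA A))
    linkJacobian_nonneg

/-- A cut-off function supported near a given point. -/
lemma exists_testFunction {E : Type*} [NormedAddCommGroup E] [NormedSpace ℝ E]
    [FiniteDimensional ℝ E] {x : E} {s : Set E} (hs : s ∈ 𝓝 x) :
    ∃ χ : 𝓓((⊤ : Opens E), ℂ), χ x ≠ 0 ∧ tsupport χ ⊆ s := by
  obtain ⟨f, h1, h2, h3, -, h5⟩ := exists_contDiff_tsupport_subset (n := ⊤) hs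
  refine ⟨⟨fun y => f y, Complex.ofRealCLM.contDiff.comp h3, h2.comp_left Complex.ofReal_zero,
    fun _ _ => trivial⟩, ?_, ?_⟩
  · change ((f x : ℝ) : ℂ) ≠ 0
    rw [h5]
    simp
  · refine (closure_mono fun y hy => ?_).trans h1
    intro h
    refine hy ?_
    change ((f y : ℝ) : ℂ) = 0
    rw [h, Complex.ofReal_zero]

lemma tsupport_modulate_subset {E : Type*} [NormedAddCommGroup E] [NormedSpace ℝ E]
    (χ : 𝓓((⊤ : Opens E), ℂ)) (η : E →L[ℝ] ℝ) : tsupport (modulate χ η) ⊆ tsupport χ :=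
  tsupport_mul_subset_left (f := χ)

/-- The kernel vanishes off the graph of the phase. -/
lemma microlocallySmoothAt_of_notMem_range {x : KernelSpace m}
    (hx : x ∉ Set.range (graphPoint (m := m) z₀)) (ξ : KernelSpace m →L[ℝ] ℝ) :
    MicrolocallySmoothAt (bornKernel m z₀) x ξ := by
  obtain ⟨χ, h1, h2⟩ := exists_testFunction
    ((isClosedEmbedding_graphPoint (m := m) (z₀ := z₀)).isClosed_range.isOpen_compl.mem_nhds hx)
  refine ⟨χ, h1, Set.univ, univ_mem, fun N => ⟨0, fun η _ s _ => ?_⟩⟩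
  have h0 : bornKernel m z₀ (modulate χ (s • η)) = 0 := by
    refine tendsto_nhds_unique (isBornKernel_bornKernel m z₀ _)
      (tendsto_const_nhds.congr' (f₁ := fun _ => (0 : ℂ)) ?_)
    filter_upwards [self_mem_nhdsWithin] with δ hδ
    have hA : ∀ (A : Finset (Fin m)) y, amplitude z₀ A (modulate χ (s • η)) y = 0 := fun A y =>
      image_eq_zero_of_notMem_tsupport fun hy =>
        h2 (tsupport_modulate_subset χ _ (tsupport_amplitude_subset A _ hy)) ⟨y, rfl⟩
    rw [truncatedPairing_eq (modulate χ (s • η)).contDiff (modulate χ (s • η)).hasCompactSupport hδ]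
    simp [hA]
  rw [h0, norm_zero, zero_mul]

lemma linkSum_linkDiff (z : Fin (m + 1) → ℂ) : linkSum m (linkDiff z) = z := by
  obtain ⟨w, rfl⟩ := surjective_linkSum z
  rw [linkDiff_linkSum]

/-- In the difference coordinates a vector `v` becomes (v.1, `linkDiff` v.2), and its image is the
tangent vector of the graph over `v`; this ties the slope to the conormal condition. -/
lemma fderiv_graphPoint_apply (y : LinkSpace m) (v : ℝ × (Fin (m + 1) → ℂ)) :
    fderiv ℝ (graphPoint z₀) y (v.1, linkDiff v.2) =
      (fderiv ℝ (phaseFn m) (y.1, linkPoint z₀ y) v, v) := by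
  have h1 : HasFDerivAt (fun y : LinkSpace m => (y.1, linkPoint z₀ y))
      ((ContinuousLinearMap.fst ℝ ℝ (Fin (m + 1) → ℂ)).prod
        ((linkSum m).comp (ContinuousLinearMap.snd ℝ ℝ (Fin (m + 1) → ℂ)))) y := by
    refine hasFDerivAt_fst.prodMk ?_
    exact (((linkSum m).hasFDerivAt.comp y hasFDerivAt_snd).const_add fun _ => z₀)
  have h2 : HasFDerivAt (phaseFn m) (fderiv ℝ (phaseFn m) (y.1, linkPoint z₀ y))
      (y.1, linkPoint z₀ y) := (contDiff_phaseFn.differentiable (by simp) _).hasFDerivAt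
  have h3 := ((h2.comp y h1).prodMk h1).fderiv
  refine (congrArg (fun L : LinkSpace m →L[ℝ] KernelSpace m => L (v.1, linkDiff v.2)) h3).trans ?_
  have h4 : ((ContinuousLinearMap.fst ℝ ℝ (Fin (m + 1) → ℂ)).prod
      ((linkSum m).comp (ContinuousLinearMap.snd ℝ ℝ (Fin (m + 1) → ℂ)))) (v.1, linkDiff v.2) = v :=
    Prod.ext rfl (linkSum_linkDiff v.2)
  exact Prod.ext (congrArg (fderiv ℝ (phaseFn m) (y.1, linkPoint z₀ y)) h4) h4

/-- The nonvanishing conditions for integration by parts are open in covector and point jointly, so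
they hold on a product of neighbourhoods, on which the cut-offs are supported. -/
lemma microlocallySmoothAt_graphPoint {y : LinkSpace m} (h0 : y.2 0 ≠ 0)
    (hJ : ∀ i, i ∈ J ↔ y.2 i.succ = 0) (ha : ∀ i ∈ J, a.2 i.succ = 0)
    {ξ : KernelSpace m →L[ℝ] ℝ} (hξ : graphSlope z₀ a (ξ, y) ≠ 0) :
    MicrolocallySmoothAt (bornKernel m z₀) (graphPoint z₀ y) ξ := by
  obtain ⟨r, hr, hlink⟩ : ∃ r : ℝ, 0 < r ∧ ∀ i ∉ J, r < ‖y.2 i.succ‖ := by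
    have h1 : ∀ i : Fin m, ∀ᶠ r : ℝ in 𝓝[>] 0, i ∉ J → r < ‖y.2 i.succ‖ := fun i => by
      by_cases hi : i ∈ J
      · exact Eventually.of_forall fun r h => absurd hi h
      · have h2 : 0 < ‖y.2 i.succ‖ := norm_pos_iff.2 fun h => hi ((hJ i).2 h)
        exact ((eventually_lt_nhds h2).filter_mono nhdsWithin_le_nhds).mono fun r hr _ => hr
    obtain ⟨r, hr1, hr2⟩ := ((eventually_all.2 h1).and self_mem_nhdsWithin).exists
    exact ⟨r, hr2, hr1⟩
  have hcont : ∀ i : Fin (m + 1), Continuous fun q : PhaseSpace m => q.2.2 i := fun i => by fun_prop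
  have hU : ∀ᶠ q in 𝓝 ((ξ, y) : PhaseSpace m), graphSlope z₀ a q ≠ 0 ∧ q.2.2 0 ≠ 0 ∧
      ∀ i ∉ J, r ≤ ‖q.2.2 i.succ‖ := by
    refine ((contDiff_graphSlope a).continuous.continuousAt.eventually_ne hξ).and
      (((hcont 0).continuousAt.eventually_ne h0).and ?_)
    refine eventually_all.2 fun i => ?_
    by_cases hi : i ∈ J
    · exact Eventually.of_forall fun q h => absurd hi h
    · have h2 : ∀ᶠ q in 𝓝 ((ξ, y) : PhaseSpace m), r < ‖q.2.2 i.succ‖ :=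
        (hcont i.succ).norm.continuousAt.eventually_const_lt (hlink i hi)
      exact h2.mono fun q hq _ => hq.le
  rw [nhds_prod_eq] at hU
  obtain ⟨V, hV, U, hUy, hVU⟩ := Filter.mem_prod_iff.1 hU
  -- Since the parametrisation is an embedding, a cut-off in the ambient space can localise the
  -- parameter.
  obtain ⟨O, hO, hOU⟩ : ∃ O ∈ 𝓝 (graphPoint z₀ y), graphPoint z₀ ⁻¹' O ⊆ U := by
    rwa [isClosedEmbedding_graphPoint.isInducing.nhds_eq_comap, Filter.mem_comap] at hUy
  obtain ⟨χ, hχ1, hχ2⟩ := exists_testFunction hO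
  obtain ⟨b, hb1, hb2, hb3, -, hb5⟩ := exists_contDiff_tsupport_subset (n := ⊤) hV
  -- On this neighbourhood of ξ the auxiliary factor `b` can be divided out at the cost of a factor
  -- 2.
  refine ⟨χ, hχ1, {η | 1 / 2 < b η}, ?_, fun N => ?_⟩
  · exact hb3.continuous.continuousAt.eventually_const_lt (by rw [hb5]; norm_num)
  · obtain ⟨C, hC⟩ := exists_norm_bornKernel_modulate_le (z₀ := z₀) hr ha χ hb3 hb2
      (fun q hq => hVU ⟨hb1 hq.1, hOU (hχ2 hq.2)⟩) N
    refine ⟨2 * C, fun η hη s hs => ?_⟩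
    have h1 := hC η s hs
    have hη : 1 / 2 < b η := hη
    rw [norm_mul, Complex.norm_real, Real.norm_of_nonneg (by linarith)] at h1
    have h2 := mul_le_mul_of_nonneg_right hη.le
      (norm_nonneg (bornKernel m z₀ (modulate χ (s • η))))
    linarith

lemma waveFrontSet_bornKernel_subset (m : ℕ) (z₀ : ℂ) :
    {p ∈ waveFrontSet (bornKernel m z₀) | p.1.2.2 0 ≠ z₀} ⊆
      ⋃ J : Finset (Fin m), conormalBundle (LJ m J) := by
  rintro ⟨x, ξ⟩ ⟨⟨hξ, hsing⟩, hx0⟩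
  by_contra hnot
  refine hsing ?_
  by_cases hx : x ∈ Set.range (graphPoint (m := m) z₀)
  · obtain ⟨y, rfl⟩ := hx
    classical
    -- All links that vanish at the point are taken: the remaining factors of the kernel are then
    -- smooth nearby.
    set J : Finset (Fin m) := Finset.univ.filter fun i => y.2 i.succ = 0 with hJ
    have hmem : ∀ i, i ∈ J ↔ y.2 i.succ = 0 := fun i => by simp [hJ]
    have hL : graphPoint z₀ y ∈ LJ m J := ⟨sub_self _, fun i hi => by
      change linkPoint z₀ y i.castSucc - linkPoint z₀ y i.succ = 0
      rw [← neg_sub, linkPoint_succ_sub, (hmem i).1 hi, neg_zero]⟩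
    -- If ξ annihilated all tangent vectors of `L_n^J`, the point would lie in its conormal bundle.
    obtain ⟨v, hv, hvξ⟩ : ∃ v ∈ coincidenceSpace J,
        ξ (fderiv ℝ (phaseFn m) (graphPoint z₀ y).2 v, v) ≠ 0 := by
      by_contra! h
      exact hnot (Set.mem_iUnion.2 ⟨J, mem_conormalBundle_LJ.2 ⟨hL, hξ, h⟩⟩)
    refine microlocallySmoothAt_graphPoint (a := (v.1, linkDiff v.2)) ?_ hmem (fun i hi => ?_) ?_
    · rw [← linkPoint_zero (z₀ := z₀)]
      exact sub_ne_zero.2 hx0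
    · change v.2 i.succ - v.2 i.castSucc = 0
      rw [← neg_sub, mem_coincidenceSpace.1 hv i hi, neg_zero]
    · rw [graphSlope, fderiv_graphPoint_apply]
      exact hvξ
  · exact microlocallySmoothAt_of_notMem_range hx ξ

end WaveFrontSet

end

theorem theorem4p2 (Ω Ω₀ : Set ℂ) (hΩ : IsOpen Ω) (hΩb : Bornology.IsBounded Ω)
    (hΩ₀m : MeasurableSet Ω₀) (hΩ₀ : closure Ω₀ ⊆ Ω) (z₀ : ℂ) (hz₀ : z₀ ∈ frontier Ω) (m : ℕ) :
    -- the Fréchet derivatives of `U_k` at `0` make sense, and give the Neumann series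
    (∀ k : ℂ,
      (∀ᶠ μ : Coefficients Ω₀ in 𝓝 0, ∃! u, IsBeltramiSolution Ω (extendCoeff μ) k u) ∧
      ContDiffAt ℝ ∞ (solutionMap Ω Ω₀ k) 0 ∧
      ∀ μ : Coefficients Ω₀,
        frechetTerm Ω Ω₀ (m + 1) k μ =ᵐ[volume.restrict Ω] neumannU (extendCoeff μ) k m) ∧
    -- `k ↦ ω_n(z₀, k)` is continuous with polynomial growth
    (∀ μ : Coefficients Ω₀,
      Continuous (fun k : ℂ => bornTerm Ω Ω₀ (m + 1) μ z₀ k) ∧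
      ∃ C : ℝ, ∀ k : ℂ, ‖bornTerm Ω Ω₀ (m + 1) μ z₀ k‖ ≤ C * (1 + ‖k‖) ^ (m + 1)) ∧
    -- the operator `T_n`, and the partial Fourier transform of the Born term
    (∃ T : MultilinearMap ℂ (fun _ : Fin (m + 1) => Lp ℂ ⊤ (volume.restrict Ω₀))
        (ComplexDistribution (ℝ × ℝ)),
      IsBornOperator m z₀ Ω₀ T ∧
      (∀ μ, IsPeriodicDistribution (T μ) (0, 2 * Real.pi)) ∧
      ∀ (μ : Coefficients Ω₀) (ψ : 𝓓((⊤ : Opens (ℝ × ℝ)), ℂ)),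
        ∫ φ : ℝ, ∫ τ : ℝ, bornTerm Ω Ω₀ (m + 1) μ z₀ (τ * Complex.exp (Complex.I * φ)) *
            ∫ t : ℝ, Complex.exp (-Complex.I * t * τ) * ψ (t, φ)
          = T (fun _ => Complex.ofRealCLM.compLp μ) ψ) ∧
    -- the Schwartz kernel `K_n` and its wave front set
    (∃ K : ComplexDistribution (KernelSpace m),
      IsBornKernel m z₀ K ∧
      IsPeriodicDistribution K (0, 2 * Real.pi, 0) ∧
      {p ∈ waveFrontSet K | p.1.2.2 0 ≠ z₀} ⊆
        ⋃ J : Finset (Fin m), conormalBundle (LJ m J)) ∧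
    -- the geometry of the `2^{n-1}` conormal bundles
    (∀ J : Finset (Fin m), IsSmoothSubmanifold (LJ m J) (1 + 2 * J.card)) ∧
    (∀ J : Finset (Fin m), IsLagrangian (conormalBundle (LJ m J))) ∧
    (Set.range fun J : Finset (Fin m) => conormalBundle (LJ m J)).ncard = 2 ^ m ∧
    (∀ J J' : Finset (Fin m),
      IntersectCleanly (conormalBundle (LJ m J)) (conormalBundle (LJ m J'))) := by
  -- The factor 1/2 ensures that differences of points of Ω stay within the cut-off radius of the
  -- Cauchy kernel.
  obtain ⟨R, hR0, hR⟩ : ∃ R : ℝ, 0 < R ∧ Ω ⊆ Metric.ball 0 (R / 2) := by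
    obtain ⟨ρ, hρ⟩ := hΩb.subset_ball 0
    refine ⟨2 * max ρ 1, by positivity, hρ.trans (Metric.ball_subset_ball ?_)⟩
    rw [mul_div_cancel_left₀ _ two_ne_zero]
    exact le_max_left _ _
  have hsub : Ω₀ ⊆ Ω := subset_closure.trans hΩ₀
  have hΩ₀b : Bornology.IsBounded Ω₀ := hΩb.subset hsub
  -- A boundary point of the open set Ω is not in Ω, which contains the closure of Ω₀.
  have hz : z₀ ∉ closure Ω₀ := fun h => by
    rw [hΩ.frontier_eq] at hz₀
    exact hz₀.2 (hΩ₀ h)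
  have hΩm := hΩ.measurableSet
  refine ⟨fun k => ⟨?_, contDiffAt_solutionMap hΩm hR hR0 hΩ₀m hsub k, fun μ => ?_⟩,
    fun μ => ⟨continuous_bornTerm hΩm hR hR0 hΩ₀m hsub hΩ₀b hz m μ,
      exists_norm_bornTerm_le hΩm hR hR0 hΩ₀m hsub hΩ₀b hz m μ⟩,
    ⟨bornOperator hΩ₀m hΩ₀b hz R, isBornOperator_bornOperator hΩ₀m hΩ₀b hz hR0 (hsub.trans hR),
      isPeriodic_bornOperator hΩ₀m hΩ₀b hz R,
      integral_bornTerm_eq hΩm hR hR0 hΩ₀m hsub hΩ₀b hz⟩,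
    ⟨bornKernel m z₀, isBornKernel_bornKernel m z₀, isPeriodic_bornKernel m z₀,
      waveFrontSet_bornKernel_subset m z₀⟩,
    isSmoothSubmanifold_LJ, isLagrangian_conormalBundle_LJ, ncard_range_conormalBundle_LJ,
    intersectCleanly_conormalBundle_LJ⟩
  · exact (solutionMap_eventuallyEq hΩm hR hR0 hΩ₀m hsub k).mono fun μ h => h.1
  · rw [frechetTerm_eq hΩm hR hR0 hΩ₀m hsub k m μ]
    exact neumannTerm_ae_eq hΩm hR hR0 hΩ₀m hsub k m μ
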